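/- Let $G$ be a finite simple graph with a plane embedding and a distinguished outer edge $v_1v_2$, where $v_1,v_2$ are named so that $v_2$ follows $v_1$ in clockwise order along the outer face (that is, the outer face lies to the left of the edge directed from $v_1$ to $v_2$). Then the following four conditions are equivalent. (C1) $G$ is a maximal L-graph and admits an L-representation with base edge $v_1v_2$ that induces the given embedding. (C2) $G = H\setminus S_n$ as plane graphs with the same $v_1,v_2$, for some maximally planar graph $H$ with a plane embedding and some Schnyder realizer $(S_1,S_2,S_n)$ of $H$ with outer vertices $v_1,v_2,v_n$ in clockwise order. (C3) $G$ admits an edge labeling with base edge $v_1v_2$. (C4) $G$ admits a 2-canonical order with base edge $v_1v_2$. **Definitions.** *L-representation.* An L-shape is the union of a vertical segment and a horizontal segment, both of positive length, whose common point (the bend) is the bottom end of the vertical and the left end of the horizontal segment; its endpoints are the top end of the former and the right end of the latter, and its interior is the L-shape without its two endpoints. An L-representation of $G$ is a family of L-shapes $L_v$, $v\in V(G)$, with pairwise disjoint interiors, such that no point lies on three of them and, for $u\neq v$, $L_u\cap L_v\ne\emptyset$ if and only if $uv\in E(G)$. An edge $v_1v_2$ of $G$ is a base edge of it if the horizontal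 leg of $L_{v_1}$ is topmost and the vertical leg of $L_{v_2}$ is rightmost. The induced embedding has, at each vertex $v$, the clockwise order of the contact points around $L_v$. $G$ is an L-graph if it has an L-representation, and a maximal L-graph if moreover it is not a proper subgraph of an L-graph on the same vertex set. *Schnyder realizer.* $H$ is maximally planar if it is planar and adding any edge destroys planarity. Let $H$ be embedded with outer face a triangle, with vertices $v_1,v_2,v_n$ in clockwise order. A Schnyder realizer is an orientation and coloring of the inner edges with colors $1$ (red), $2$ (blue), $n$ (green), with color classes $S_1,S_2,S_n$, such that: (i) around each inner vertex there are, in clockwise order, exactly one outgoing red edge, a possibly empty set of incoming green edges, exactly one outgoing blue edge, a possibly empty set of incoming red edges, exactly one outgoing green edge, a possibly empty set of incoming blue edges; (ii) all inner edges at $v_1$, $v_2$, $v_n$ are incoming there and colored red, blue, green, respectively. $H\setminus S_n$ is the plane graph $(V(H)\setminus\{v_n\},E(H)\setminus S_n)$, also without the edges at $v_n$, with the inherited embedding. *Edge labeling with base edge $v_1v_2$.* An orientation and coloring of the edges other than $v_1v_2$ with colors red and blue such that: (i) around each vertex other than $v_1,v_2$ there are, in clockwise order, exactly one outgoing red edge,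 exactly one outgoing blue edge, a possibly empty set of incoming red edges, a possibly empty set of incoming blue edges; (ii) all non-base edges at $v_1$ are incoming there and red, and all non-base edges at $v_2$ are incoming there and blue; (iii) reversing all red edges gives an acyclic directed graph. *2-canonical order with base edge $v_1v_2$.* An order $(v_1,v_2,\dots,v_n)$ of all vertices of $G$, with $G_i=G[v_1,\dots,v_i]$, such that: (i) for each $i\ge 3$, $G_i$ is biconnected and its outer face is bounded by a cycle $C_i$ containing $v_1v_2$; (ii) for each $i\ge 4$, $v_i$ lies in the outer face of $G_{i-1}$ and its neighbors in $G_{i-1}$ lie on the path $C_{i-1}\setminus v_1v_2$ (these are the canonical orders); and (iii) for each $i\ge 3$, $v_i$ has degree exactly two in $G_i$. -/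

import Mathlib

universe u v

/-! ### Plane embeddings of finite graphs, as rotation systems -/

/-- A rotation system of a graph: `rot` sends a dart `u → w` to the next dart in clockwise order
around its tail `u`. The orbits of `rot` are exactly the sets of darts with a common tail. -/
structure RotationSystem {V : Type u} (G : SimpleGraph V) where
  rot : Equiv.Perm G.Dart
  sameCycle_iff : ∀ d e : G.Dart, rot.SameCycle d e ↔ d.fst = e.fst

namespace RotationSystem

variable {V : Type u} {G : SimpleGraph V}

/-- Reversal of darts, as a permutation. -/
def flip (G : SimpleGraph V) : Equiv.Perm G.Dart :=
  ⟨SimpleGraph.Dart.symm, SimpleGraph.Dart.symm, SimpleGraph.Dart.symm_symm,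
    SimpleGraph.Dart.symm_symm⟩

/-- The face permutation: `d = (u → w)` is sent to the dart that follows `w → u` in clockwise
order around `w`. Its orbits are the faces, each one walked along with the face on the left. -/
def facePerm (R : RotationSystem G) : Equiv.Perm G.Dart :=
  (flip G).trans R.rot

/-- The faces incident with at least one edge. -/
def Face (R : RotationSystem G) : Type u :=
  Quotient (Equiv.Perm.SameCycle.setoid R.facePerm)

/-- The dart `e` lies on the boundary of the face to the left of the dart `d`. -/
def OnLeftFace (R : RotationSystem G) (d e : G.Dart) : Prop :=
  R.facePerm.SameCycle d e

/-- The rotation system has genus zero, i.e. it is the rotation system of a drawing in the plane.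
This is Euler's formula summed over the connected components; each isolated vertex
is a component with a single face, which carries no dart and is counted separately. -/
def IsPlanar (R : RotationSystem G) : Prop :=
  Nat.card V + Nat.card R.Face + Nat.card {x : V // ∀ y, ¬ G.Adj x y} =
    Nat.card G.edgeSet + 2 * Nat.card G.ConnectedComponent

/-- `e` is the first dart of the set `P` that is met when turning clockwise around the tail of `d`,
starting immediately after `d` (a full turn back to `d` itself is allowed). -/
def IsFirstClockwise (R : RotationSystem G) (P : Set G.Dart) (d e : G.Dart) : Prop :=
  e ∈ P ∧ ∃ k : ℕ, 1 ≤ k ∧ (R.rot ^ k) d = e ∧ ∀ j : ℕ, 1 ≤ j → j < k → (R.rot ^ j) d ∉ P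

/-- `R'` is the rotation system that the graph `K` inherits from `R` as a subgraph of `G`, the
inclusion being `f`. -/
def IsInherited {W : Type v} {K : SimpleGraph W} (f : K →g G) (R' : RotationSystem K)
    (R : RotationSystem G) : Prop :=
  ∀ d : K.Dart, R.IsFirstClockwise (Set.range f.mapDart) (f.mapDart d) (f.mapDart (R'.rot d))

/-- Turning once clockwise around the tail of `d`, starting with `d`, one meets only darts of `P 0`,
then only darts of `P 1`, and so on (the blocks may be empty). -/
def IsClockwisePattern (R : RotationSystem G) {m : ℕ} (d : G.Dart) (P : Fin m → Set G.Dart) :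
    Prop :=
  ∃ κ : ℕ → Fin m, Monotone κ ∧
    ∀ i : ℕ, i < (G.neighborSet d.fst).ncard → (R.rot ^ i) d ∈ P (κ i)

end RotationSystem

section Graphs

variable {V : Type u} {G : SimpleGraph V}

/-- A planar graph, i.e. one that has a plane embedding. -/
def IsPlanarGraph (G : SimpleGraph V) : Prop :=
  ∃ R : RotationSystem G, R.IsPlanar

/-- A maximally planar graph: planar, and adding any edges destroys planarity. -/
def IsMaximallyPlanar (G : SimpleGraph V) : Prop :=
  IsPlanarGraph G ∧ ∀ G' : SimpleGraph V, G < G' → ¬ IsPlanarGraph G'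

/-- Connected, and without cut vertices (used for graphs with at least three vertices). -/
def IsBiconnected (G : SimpleGraph V) : Prop :=
  G.Connected ∧ ∀ x : V, (G.induce {x}ᶜ).Connected

/-- An orientation and colouring of the edges in `E` with colours in `C`: `S c` is the set of
directed edges of colour `c`. -/
def IsColoredOrientation {C : Type} (E : Set (Sym2 V)) (S : C → Set G.Dart) : Prop :=
  (∀ c, ∀ d ∈ S c, d.edge ∈ E) ∧ ∀ e ∈ E, ∃! p : C × G.Dart, p.2.edge = e ∧ p.2 ∈ S p.1

/-- The darts which, at their tail, are incoming edges of the set `S` of directed edges. -/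
def incoming (S : Set G.Dart) : Set G.Dart :=
  {d | d.symm ∈ S}

/-! ### Schnyder realizers -/

/-- The outer face of the plane graph is a triangle with vertices `v₁, v₂, vₙ` in clockwise order,
that is, the face to the left of `v₁ → v₂` is bounded by `v₁ → v₂ → vₙ → v₁`. -/
def HasOuterTriangle (R : RotationSystem G) (v₁ v₂ vₙ : V) : Prop :=
  ∃ (h₁₂ : G.Adj v₁ v₂) (h₂ₙ : G.Adj v₂ vₙ) (hₙ₁ : G.Adj vₙ v₁),
    R.facePerm ⟨(v₁, v₂), h₁₂⟩ = ⟨(v₂, vₙ), h₂ₙ⟩ ∧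
    R.facePerm ⟨(v₂, vₙ), h₂ₙ⟩ = ⟨(vₙ, v₁), hₙ₁⟩ ∧
    R.facePerm ⟨(vₙ, v₁), hₙ₁⟩ = ⟨(v₁, v₂), h₁₂⟩

/-- The edges that are not on the outer triangle `v₁, v₂, vₙ`. -/
def innerEdges (G : SimpleGraph V) (v₁ v₂ vₙ : V) : Set (Sym2 V) :=
  G.edgeSet \ {s(v₁, v₂), s(v₂, vₙ), s(vₙ, v₁)}

/-- `(S 0, S 1, S 2)` is a Schnyder realizer of the plane graph `(G, R)` with outer vertices
`v₁, v₂, vₙ` in clockwise order. The colours `0, 1, 2` are red, blue and green; they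
belong to `v₁`, `v₂` and `vₙ`, respectively. -/
structure IsSchnyderRealizer (R : RotationSystem G) (v₁ v₂ vₙ : V) (S : Fin 3 → Set G.Dart) :
    Prop where
  maximallyPlanar : IsMaximallyPlanar G
  planar : R.IsPlanar
  outer : HasOuterTriangle R v₁ v₂ vₙ
  orientation : IsColoredOrientation (innerEdges G v₁ v₂ vₙ) S
  outgoing : ∀ x : V, x ≠ v₁ → x ≠ v₂ → x ≠ vₙ → ∀ c, ∃! d : G.Dart, d.fst = x ∧ d ∈ S c
  clockwise : ∀ x : V, x ≠ v₁ → x ≠ v₂ → x ≠ vₙ → ∃ d ∈ S 0, d.fst = x ∧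
    R.IsClockwisePattern d
      ![S 0, incoming (S 2), S 1, incoming (S 0), S 2, incoming (S 1)]
  at₁ : ∀ d : G.Dart, d.edge ∈ innerEdges G v₁ v₂ vₙ → d.snd = v₁ → d ∈ S 0
  at₂ : ∀ d : G.Dart, d.edge ∈ innerEdges G v₁ v₂ vₙ → d.snd = v₂ → d ∈ S 1
  atₙ : ∀ d : G.Dart, d.edge ∈ innerEdges G v₁ v₂ vₙ → d.snd = vₙ → d ∈ S 2

/-- `G = H ∖ Sₙ` as plane graphs with the same base edge `v₁v₂`, for a maximally planar plane
graph `H` with a Schnyder realizer `(S₁, S₂, Sₙ)`. The vertices of `H` are the vertices `some x`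
with `x` in `G`, and the deleted outer vertex `vₙ`, which is `none`. -/
def IsSchnyderMinusGreen (R : RotationSystem G) (v₁ v₂ : V) : Prop :=
  ∃ (H : SimpleGraph (Option V)) (RH : RotationSystem H) (S : Fin 3 → Set H.Dart),
    IsSchnyderRealizer RH (some v₁) (some v₂) none S ∧
    (∀ x y : V, G.Adj x y ↔ H.Adj (some x) (some y) ∧ ∀ d ∈ S 2, d.edge ≠ s(some x, some y)) ∧
    ∃ f : G →g H, (∀ x, f x = some x) ∧ R.IsInherited f RH

/-! ### Edge labelings -/

/-- `(S 0, S 1)` is an edge labeling of the plane graph `(G, R)` with base edge `v₁v₂`; the colours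
`0` and `1` are red and blue. -/
structure IsEdgeLabeling (R : RotationSystem G) (v₁ v₂ : V) (S : Fin 2 → Set G.Dart) : Prop where
  orientation : IsColoredOrientation (G.edgeSet \ {s(v₁, v₂)}) S
  outgoing : ∀ x : V, x ≠ v₁ → x ≠ v₂ → ∀ c, ∃! d : G.Dart, d.fst = x ∧ d ∈ S c
  clockwise : ∀ x : V, x ≠ v₁ → x ≠ v₂ → ∃ d ∈ S 0, d.fst = x ∧
    R.IsClockwisePattern d ![S 0, S 1, incoming (S 0), incoming (S 1)]
  at₁ : ∀ d : G.Dart, d.edge ≠ s(v₁, v₂) → d.snd = v₁ → d ∈ S 0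
  at₂ : ∀ d : G.Dart, d.edge ≠ s(v₁, v₂) → d.snd = v₂ → d ∈ S 1
  /-- Reversing all red edges gives an acyclic directed graph. -/
  acyclic : ∀ x : V, ¬ Relation.TransGen (fun y z : V =>
    ∃ d : G.Dart, (d ∈ S 0 ∧ d.fst = z ∧ d.snd = y) ∨ (d ∈ S 1 ∧ d.fst = y ∧ d.snd = z)) x x

/-! ### Canonical orders -/

/-- The boundary of the face to the left of `d = (v₁ → v₂)` is a cycle `C`, and `q` is the
path `C ∖ v₁v₂`. -/
def IsOuterPath (R : RotationSystem G) (d : G.Dart) (q : G.Walk d.snd d.fst) : Prop :=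
  (SimpleGraph.Walk.cons d.adj q).IsCycle ∧
    ∀ e : G.Dart, e ∈ (SimpleGraph.Walk.cons d.adj q).darts ↔ R.OnLeftFace d e

/-- The inclusion of an induced subgraph. -/
def inclusionHom (G : SimpleGraph V) (A : Set V) : G.induce A →g G :=
  (SimpleGraph.Embedding.induce A).toHom

/-- Let `R'` be the inherited rotation system of the subgraph induced on `A`, and let `x ∉ A`.
Every edge joining `x` to a vertex of `A` leaves that vertex into the face of `R'` to the left
of `d`; if there is such an edge, this says that `x` lies in that face. -/
def LiesInLeftFace (R : RotationSystem G) {A : Set V} (R' : RotationSystem (G.induce A))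
    (d : (G.induce A).Dart) (x : V) : Prop :=
  ∀ c : G.Dart, c.fst ∈ A → c.snd = x → ∃ e : (G.induce A).Dart, R'.OnLeftFace d e ∧
    R.IsFirstClockwise (Set.range (inclusionHom G A).mapDart) c ((inclusionHom G A).mapDart e)

/-- The first `i` vertices of a vertex order. -/
def firstVertices (ord : V ≃ Fin (Nat.card V)) (i : ℕ) : Set V :=
  {x | (ord x : ℕ) < i}

/-- `ord` (numbering the vertices from `0` on) is a canonical order of the plane graph `(G, R)` with
base edge `v₁v₂`, where the outer face of the plane graph is to the left of `v₁ → v₂`. The outer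
face of each `G_i` is then also the one to the left of `v₁ → v₂`. -/
structure IsCanonicalOrder (R : RotationSystem G) (v₁ v₂ : V) (ord : V ≃ Fin (Nat.card V)) :
    Prop where
  first : (ord v₁ : ℕ) = 0
  second : (ord v₂ : ℕ) = 1
  /-- `G_i` is biconnected, and its outer face is bounded by a cycle containing `v₁v₂`. -/
  biconnected : ∀ i : ℕ, 3 ≤ i → i ≤ Nat.card V →
    IsBiconnected (G.induce (firstVertices ord i)) ∧
    ∃ (R' : RotationSystem (G.induce (firstVertices ord i)))
      (d : (G.induce (firstVertices ord i)).Dart)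
      (q : (G.induce (firstVertices ord i)).Walk d.snd d.fst),
      R'.IsInherited (inclusionHom G _) R ∧ (d.fst : V) = v₁ ∧ (d.snd : V) = v₂ ∧
      IsOuterPath R' d q
  /-- The `(i+1)`-st vertex `x` lies in the outer face of `G_i`, and its neighbours in `G_i` lie on
  the path `C_i ∖ v₁v₂`. -/
  attach : ∀ i : ℕ, 3 ≤ i → ∀ x : V, (ord x : ℕ) = i →
    ∃ (R' : RotationSystem (G.induce (firstVertices ord i)))
      (d : (G.induce (firstVertices ord i)).Dart)
      (q : (G.induce (firstVertices ord i)).Walk d.snd d.fst),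
      R'.IsInherited (inclusionHom G _) R ∧ (d.fst : V) = v₁ ∧ (d.snd : V) = v₂ ∧
      IsOuterPath R' d q ∧ LiesInLeftFace R R' d x ∧
      ∀ y : firstVertices ord i, G.Adj x y → y ∈ q.support

/-- A 2-canonical order: a canonical order in which every vertex after the first two has exactly two
neighbours among its predecessors. -/
def IsTwoCanonicalOrder (R : RotationSystem G) (v₁ v₂ : V) (ord : V ≃ Fin (Nat.card V)) : Prop :=
  IsCanonicalOrder R v₁ v₂ ord ∧
    ∀ x : V, 2 ≤ (ord x : ℕ) → {y : V | G.Adj x y ∧ ord y < ord x}.ncard = 2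

end Graphs

/-! ### L-representations -/

/-- An axis-aligned L-shape in the rotation with the bend at the lower left: a vertical leg
going up from the bend `(x, y)` to the top endpoint `(x, top)`, and a horizontal leg going right
from the bend to the right endpoint `(right, y)`. -/
structure LShape where
  x : ℝ
  y : ℝ
  top : ℝ
  right : ℝ
  y_lt_top : y < top
  x_lt_right : x < right

namespace LShape

/-- The points of an L-shape. -/
def points (L : LShape) : Set (ℝ × ℝ) :=
  {p | (p.1 = L.x ∧ L.y ≤ p.2 ∧ p.2 ≤ L.top) ∨ (p.2 = L.y ∧ L.x ≤ p.1 ∧ p.1 ≤ L.right)}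

/-- The interior of an L-shape (as a curve): all its points except the two endpoints. -/
def interior (L : LShape) : Set (ℝ × ℝ) :=
  L.points \ {(L.x, L.top), (L.right, L.y)}

end LShape

section Representations

variable {V : Type u}

/-- The L-shapes `L x` form an L-representation of `G`: they are interior disjoint, two of them touch
if and only if the corresponding vertices are adjacent, and no point lies on three of them. -/
structure IsLRepresentation (G : SimpleGraph V) (L : V → LShape) : Prop where
  interior_disjoint : ∀ x y : V, x ≠ y → Disjoint (L x).interior (L y).interior
  touch : ∀ x y : V, x ≠ y → (G.Adj x y ↔ ((L x).points ∩ (L y).points).Nonempty)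
  no_triple : ∀ x y z : V, x ≠ y → y ≠ z → x ≠ z →
    (L x).points ∩ (L y).points ∩ (L z).points = ∅

/-- A graph that admits an L-representation. -/
def IsLGraph (G : SimpleGraph V) : Prop :=
  ∃ L : V → LShape, IsLRepresentation G L

/-- An L-graph that is not a proper subgraph of another L-graph on the same vertices. -/
def IsMaximalLGraph (G : SimpleGraph V) : Prop :=
  IsLGraph G ∧ ∀ G' : SimpleGraph V, G < G' → ¬ IsLGraph G'

/-- `v₁` has the topmost horizontal leg and `v₂` has the rightmost vertical leg. -/
def HasBaseEdge (L : V → LShape) (v₁ v₂ : V) : Prop :=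
  (∀ x, (L x).y ≤ (L v₁).y) ∧ ∀ x, (L x).x ≤ (L v₂).x

/-- The numbers `a`, `b`, `c` are distinct and in this cyclic order. -/
def CyclicLT (a b c : ℝ) : Prop :=
  (a < b ∧ b < c) ∨ (b < c ∧ c < a) ∨ (c < a ∧ a < b)

/-- The plane embedding defined by the L-representation is `R`, i.e. for every vertex the clockwise
order of its incident edges in `R` is the clockwise order of the contact points around its L-shape.
All contact points on an L-shape are on its lower-left side or at an endpoint. Walking clockwise
around the L-shape, from the right endpoint along the lower side of the horizontal leg to the bend
and then along the left side of the vertical leg to the top endpoint, `p.2 - p.1` increases. So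
no contact point `q` lies strictly between the contact point `p` of an edge and the contact point
`r` of the clockwise next edge, in the cyclic order given by `p.2 - p.1`. -/
def DefinesEmbedding {G : SimpleGraph V} (L : V → LShape) (R : RotationSystem G) : Prop :=
  ∀ d e : G.Dart, e.fst = d.fst → ∀ p q r : ℝ × ℝ,
    p ∈ (L d.fst).points ∩ (L d.snd).points →
    q ∈ (L e.fst).points ∩ (L e.snd).points →
    r ∈ (L (R.rot d).fst).points ∩ (L (R.rot d).snd).points →
    ¬ CyclicLT (p.2 - p.1) (q.2 - q.1) (r.2 - r.1)

end Representations

/-!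
All four conditions describe one structure. Call the vertices other than `v₁` and `v₂` inner, write
`red x` and `blue x` for the heads of the two outgoing edges of an inner vertex `x`, and direct the
edges from `red x` to `x`, from `x` to `blue x` and from `v₁` to `v₂` (`Up`). Then every face has a
single apex `w`: its boundary consists of the edges of `w` to `red w` and `blue w` and of a
path of `Up` edges from `red w` to `blue w`, the facial path of `w`. The outer face has the apex
`none`, and its facial path goes from `v₁` to `v₂` and is closed by the base edge. This is
`RotationSystem.FacialPaths`. The conditions are proved in the cycle L-representation, edge
labeling, Schnyder realizer, 2-canonical order, L-representation.

*From an L-representation to an edge labeling.* An L-representation can be put into general position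
without losing a contact (`IsLRepresentation.exists_isGeneric`), after which the legs can be
extended until every end of an L-shape except three touches another leg (`IsGeneric.exists_isSpread`,
`IsSpread.exists_isFull`). Hence the maximal L-graphs on `n ≥ 2` vertices are exactly the L-graphs
with `2 n - 3` edges (`isMaximalLGraph_iff`). By this count, each end of an L-shape of an inner
vertex represents one edge. The edges at top ends become red and those at right ends become
blue (`IsLRepresentation.exists_isEdgeLabeling`): going clockwise around an L-shape, one finds the
classes of edges in the required order, and the bends move to the lower right along each `Up` edge, so
that reversing the red edges leaves no cycle.

*From an edge labeling to a Schnyder realizer.* Call the darts from `red x` to `x` and from `v₁` to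
`v₂` turns. As the `Up` edges form no cycle, no face is walked along against `Up` edges only, and so
each face contains a turn (`Labeling.exists_isTurn`). There are `n - 1` turns and `2 n - 3` edges; by
Euler's formula there are at least as many faces as turns, so that each face contains exactly one
(`Labeling.isTurn_unique`). This gives the facial paths (`Labeling.exists_facialPaths`). Joining the
interior vertices of each facial path to its apex by green edges, where the apex of the outer
face is a new vertex, cuts all faces into triangles (`Completion.triangle`) and gives a Schnyder
realizer of a graph with `3 N - 6` edges on `N` vertices (`Completion.isSchnyderRealizer`). That the
new edges are not parallel to old ones follows from the functions of
`FacialPaths.exists_time`, which come from the shelling described next.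

*From a Schnyder realizer to a 2-canonical order.* Three outgoing edges at each inner vertex make
`3 N - 6` edges, so that the graph of a realizer is a triangulation
(`IsSchnyderRealizer.triangulation`). Therefore the tails of the green edges that enter `w`, together
with `red w` and `blue w`, form a path around `w`, which becomes the facial path of `w` when the
green edges are deleted (`FacialPaths.of_realizerLists`). Now the outer path starts with a red and
ends with a blue edge, unless only the base edge is left. Hence it has a vertex `w` between `red w`
and `blue w` (`Stage.eq_or_peak`), and when `w` is removed its facial path becomes part of the outer
path (`Stage.remove`). The reverse of this shelling adds vertices of degree two in the outer
face (`Build`, `FacialPaths.exists_build`), which is a 2-canonical order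
(`Build.exists_isTwoCanonicalOrder`).

*From a 2-canonical order to an L-representation.* Conversely a 2-canonical order is such a
construction (`Build.of_isTwoCanonicalOrder`). The L-shapes are drawn in this order, where the outer
path always forms the lower left staircase of the drawing: a new vertex with the neighbours `a` and
`b` gets an L-shape with its bend below and to the left of the staircase, the top end on the
horizontal leg of `a` and the right end on the vertical leg of `b` (`IsStaircase.step`). The graph has
`2 n - 3` edges, so that it is a maximal L-graph (`Build.isMaximalLGraph`).
-/

/-! ### Rotation systems seen from the vertices -/

namespace RotationSystem

variable {V : Type u} {G : SimpleGraph V}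

theorem rot_fst (R : RotationSystem G) (d : G.Dart) : (R.rot d).fst = d.fst :=
  (((R.sameCycle_iff d (R.rot d)).1 ⟨1, by simp⟩)).symm

open Classical in
/-- The neighbour of `x` that follows `a` in clockwise order around `x`, and `a` itself if `a` is
not a neighbour of `x`. -/
noncomputable def nx (R : RotationSystem G) (x a : V) : V :=
  if h : G.Adj x a then (R.rot ⟨(x, a), h⟩).snd else a

theorem nx_of_adj (R : RotationSystem G) {x a : V} (h : G.Adj x a) :
    R.nx x a = (R.rot ⟨(x, a), h⟩).snd := dif_pos h

theorem adj_nx (R : RotationSystem G) {x a : V} (h : G.Adj x a) : G.Adj x (R.nx x a) := by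
  rw [R.nx_of_adj h]
  have := (R.rot ⟨(x, a), h⟩).adj
  rwa [R.rot_fst] at this

theorem rot_mk (R : RotationSystem G) {x a : V} (h : G.Adj x a) :
    R.rot ⟨(x, a), h⟩ = ⟨(x, R.nx x a), R.adj_nx h⟩ := by
  apply SimpleGraph.Dart.ext
  apply Prod.ext
  · exact R.rot_fst _
  · exact (R.nx_of_adj h).symm

theorem nx_inj (R : RotationSystem G) {x a b : V} (ha : G.Adj x a) (hb : G.Adj x b)
    (h : R.nx x a = R.nx x b) : a = b := by
  have : R.rot ⟨(x, a), ha⟩ = R.rot ⟨(x, b), hb⟩ := by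
    rw [R.rot_mk, R.rot_mk]; simp [h]
  have := R.rot.injective this
  simpa using this

theorem adj_iterate (R : RotationSystem G) {x a : V} (h : G.Adj x a) (k : ℕ) :
    G.Adj x ((R.nx x)^[k] a) := by
  induction k with
  | zero => exact h
  | succ k ih => rw [Function.iterate_succ_apply']; exact R.adj_nx ih

theorem rot_pow (R : RotationSystem G) {x a : V} (h : G.Adj x a) (k : ℕ) :
    (R.rot ^ k) ⟨(x, a), h⟩ = ⟨(x, (R.nx x)^[k] a), R.adj_iterate h k⟩ := by
  induction k with
  | zero => rfl
  | succ k ih =>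
    rw [pow_succ', Equiv.Perm.mul_apply, ih, R.rot_mk]
    simp [Function.iterate_succ_apply']

theorem iterate_inj (R : RotationSystem G) {x a b : V} (ha : G.Adj x a) (hb : G.Adj x b) (k : ℕ)
    (h : (R.nx x)^[k] a = (R.nx x)^[k] b) : a = b := by
  induction k with
  | zero => exact h
  | succ k ih =>
    rw [Function.iterate_succ_apply', Function.iterate_succ_apply'] at h
    exact ih (R.nx_inj (R.adj_iterate ha k) (R.adj_iterate hb k) h)

instance finiteDart [Finite V] : Finite G.Dart :=
  Finite.of_injective (fun d : G.Dart => d.toProd) SimpleGraph.Dart.toProd_injective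

theorem exists_iterate [Finite V] (R : RotationSystem G) {x a b : V} (ha : G.Adj x a)
    (hb : G.Adj x b) : ∃ k, 1 ≤ k ∧ (R.nx x)^[k] a = b := by
  have h : R.rot.SameCycle ⟨(x, a), ha⟩ ⟨(x, b), hb⟩ := (R.sameCycle_iff _ _).2 rfl
  obtain ⟨i, hi, -, h⟩ := h.exists_pow_eq''
  refine ⟨i, hi, ?_⟩
  rw [R.rot_pow] at h
  simpa using h

/-- The permutation of the darts given by successor functions on the neighbours of each vertex. -/
noncomputable def permOfNx [Finite V] (f : V → V → V) (hadj : ∀ x a, G.Adj x a → G.Adj x (f x a))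
    (hinj : ∀ x a b, G.Adj x a → G.Adj x b → f x a = f x b → a = b) : Equiv.Perm G.Dart :=
  Equiv.ofBijective (fun d : G.Dart => (⟨(d.fst, f d.fst d.snd), hadj _ _ d.adj⟩ : G.Dart))
    (Finite.injective_iff_bijective.1 (fun d e he => by
      have h1 := congrArg (fun z : G.Dart => z.fst) he
      have h2 := congrArg (fun z : G.Dart => z.snd) he
      dsimp only at h1 h2
      apply SimpleGraph.Dart.ext
      refine Prod.ext h1 (hinj d.fst _ _ d.adj (h1 ▸ e.adj) ?_)
      rw [h2]; exact congrArg (fun z => f z e.snd) h1.symm))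

theorem permOfNx_pow [Finite V] (f : V → V → V) (hadj : ∀ x a, G.Adj x a → G.Adj x (f x a))
    (hinj : ∀ x a b, G.Adj x a → G.Adj x b → f x a = f x b → a = b) (k : ℕ) (d : G.Dart) :
    ((permOfNx f hadj hinj ^ k) d).toProd = (d.fst, (f d.fst)^[k] d.snd) := by
  induction k with
  | zero => rfl
  | succ k ih =>
    rw [pow_succ', Equiv.Perm.mul_apply, Function.iterate_succ_apply']
    have h1 := congrArg Prod.fst ih
    have h2 := congrArg Prod.snd ih
    refine Prod.ext h1 ?_
    change f ((permOfNx f hadj hinj ^ k) d).fst ((permOfNx f hadj hinj ^ k) d).snd = _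
    dsimp only at h1 h2 ⊢
    rw [h1, h2]

/-- A rotation system given by its successor function on the neighbours of each vertex. -/
noncomputable def ofNx [Finite V] (f : V → V → V) (hadj : ∀ x a, G.Adj x a → G.Adj x (f x a))
    (hinj : ∀ x a b, G.Adj x a → G.Adj x b → f x a = f x b → a = b)
    (htr : ∀ x a b, G.Adj x a → G.Adj x b → ∃ k, (f x)^[k] a = b) : RotationSystem G where
  rot := permOfNx f hadj hinj
  sameCycle_iff := by
    intro d e
    constructor
    · intro h
      obtain ⟨i, hi⟩ := h.exists_nat_pow_eq
      have := permOfNx_pow f hadj hinj i d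
      rw [hi] at this
      exact (congrArg Prod.fst this).symm
    · rintro h
      obtain ⟨k, hk⟩ := htr d.fst d.snd e.snd d.adj (by rw [h]; exact e.adj)
      refine ⟨k, ?_⟩
      rw [zpow_natCast]
      apply SimpleGraph.Dart.ext
      rw [permOfNx_pow, hk, h]

theorem nx_ofNx [Finite V] (f : V → V → V) (hadj : ∀ x a, G.Adj x a → G.Adj x (f x a))
    (hinj : ∀ x a b, G.Adj x a → G.Adj x b → f x a = f x b → a = b)
    (htr : ∀ x a b, G.Adj x a → G.Adj x b → ∃ k, (f x)^[k] a = b) {x a : V} (h : G.Adj x a) :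
    (ofNx f hadj hinj htr).nx x a = f x a := by
  rw [nx_of_adj _ h]; rfl

/-! ### The clockwise next neighbour in a set -/

/-- `b` is the first vertex of `A` met when turning clockwise around `x`, starting
immediately after `a`. -/
def NextIn (R : RotationSystem G) (A : Set V) (x a b : V) : Prop :=
  b ∈ A ∧ ∃ k : ℕ, 1 ≤ k ∧ (R.nx x)^[k] a = b ∧ ∀ j : ℕ, 1 ≤ j → j < k → (R.nx x)^[j] a ∉ A

theorem NextIn.adj {R : RotationSystem G} {A : Set V} {x a b : V} (h : R.NextIn A x a b)
    (ha : G.Adj x a) : G.Adj x b := by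
  obtain ⟨_, k, _, rfl, _⟩ := h
  exact R.adj_iterate ha k

theorem NextIn.unique {R : RotationSystem G} {A : Set V} {x a b c : V} (h : R.NextIn A x a b)
    (h' : R.NextIn A x a c) : b = c := by
  obtain ⟨hb, k, hk, rfl, hk'⟩ := h
  obtain ⟨hc, l, hl, rfl, hl'⟩ := h'
  rcases lt_trichotomy k l with h | h | h
  · exact absurd hb (hl' k hk h)
  · rw [h]
  · exact absurd hc (hk' l hl h)

theorem nextIn_of_nx {R : RotationSystem G} {A : Set V} {x a b : V} (h : R.nx x a = b)
    (hb : b ∈ A) : R.NextIn A x a b :=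
  ⟨hb, 1, le_rfl, h, fun j h1 h2 => absurd h1 (by omega)⟩

theorem exists_nextIn [Finite V] (R : RotationSystem G) {A : Set V} {x a c : V} (ha : G.Adj x a)
    (hc : G.Adj x c) (hcA : c ∈ A) : ∃ b, R.NextIn A x a b := by
  classical
  obtain ⟨k, hk, hkc⟩ := R.exists_iterate ha hc
  have hex : ∃ k, 1 ≤ k ∧ (R.nx x)^[k] a ∈ A := ⟨k, hk, hkc ▸ hcA⟩
  refine ⟨(R.nx x)^[Nat.find hex] a, (Nat.find_spec hex).2, Nat.find hex, (Nat.find_spec hex).1,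
    rfl, fun j h1 h2 h3 => Nat.find_min hex h2 ⟨h1, h3⟩⟩

theorem NextIn.inj {R : RotationSystem G} {A : Set V} {x a a' b : V} (ha : G.Adj x a)
    (ha' : G.Adj x a') (hA : a ∈ A) (hA' : a' ∈ A) (h : R.NextIn A x a b)
    (h' : R.NextIn A x a' b) : a = a' := by
  have key : ∀ {a a' : V} {k l : ℕ}, G.Adj x a → G.Adj x a' → a' ∈ A →
      (∀ j : ℕ, 1 ≤ j → j < k → (R.nx x)^[j] a ∉ A) →
      (R.nx x)^[k] a = (R.nx x)^[l] a' → l ≤ k → 1 ≤ l → a = a' := by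
    intro a a' k l ha ha' hA' hk he hlk hl
    obtain ⟨m, rfl⟩ := Nat.exists_eq_add_of_le hlk
    rw [Function.iterate_add_apply] at he
    have := R.iterate_inj (R.adj_iterate ha m) ha' l he
    rcases Nat.eq_zero_or_pos m with rfl | hm
    · exact this
    · exact absurd (this ▸ hA') (hk m hm (by omega))
  obtain ⟨_, k, hk, rfl, hk'⟩ := h
  obtain ⟨_, l, hl, h, hl'⟩ := h'
  rcases le_total l k with hlk | hlk
  · exact key ha ha' hA' hk' h.symm hlk hl
  · exact (key ha' ha hA hl' h hlk hk).symm

theorem NextIn.diff {R : RotationSystem G} {A : Set V} {x a b w : V} (h : R.NextIn A x a b)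
    (hb : b ≠ w) : R.NextIn (A \ {w}) x a b := by
  obtain ⟨hb', k, hk, rfl, hk'⟩ := h
  exact ⟨⟨hb', hb⟩, k, hk, rfl, fun j h1 h2 h3 => hk' j h1 h2 h3.1⟩

theorem NextIn.diff_trans {R : RotationSystem G} {A : Set V} {x a b w : V} (h : R.NextIn A x a w)
    (h' : R.NextIn A x w b) (hb : b ≠ w) : R.NextIn (A \ {w}) x a b := by
  obtain ⟨hw, k, hk, hkw, hk'⟩ := h
  obtain ⟨hb', l, hl, rfl, hl'⟩ := h'
  refine ⟨⟨hb', hb⟩, l + k, by omega, by rw [Function.iterate_add_apply, hkw], ?_⟩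
  intro j h1 h2 h3
  rcases lt_trichotomy j k with h | h | h
  · exact hk' j h1 h h3.1
  · subst h; exact h3.2 hkw
  · obtain ⟨m, rfl⟩ := Nat.exists_eq_add_of_lt h
    have : k + m + 1 = (m + 1) + k := by omega
    rw [this, Function.iterate_add_apply, hkw] at h3
    exact hl' (m + 1) (by omega) (by omega) h3.1

theorem NextIn.insert_of_not_adj {R : RotationSystem G} {A : Set V} {x a b z : V}
    (h : R.NextIn A x a b) (ha : G.Adj x a) (hz : ¬ G.Adj x z) : R.NextIn (insert z A) x a b := by
  obtain ⟨hb', k, hk, rfl, hk'⟩ := h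
  refine ⟨Or.inr hb', k, hk, rfl, fun j h1 h2 h3 => ?_⟩
  rcases h3 with h3 | h3
  · exact hz (h3 ▸ R.adj_iterate ha j)
  · exact hk' j h1 h2 h3

theorem NextIn.insert_right {R : RotationSystem G} {A : Set V} {x b z : V}
    (h : R.NextIn A x z b) : R.NextIn (insert z A) x z b := by
  obtain ⟨hb', k, hk, hkb, hk'⟩ := h
  classical
  by_cases hz : ∃ j, 1 ≤ j ∧ j < k ∧ (R.nx x)^[j] z = z
  · exfalso
    obtain ⟨j, h1, h2, h3⟩ := hz
    -- a return to `z` before `k` would make the first visit to `b` earlier than `k`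
    have : (R.nx x)^[k - j] z = b := by
      rw [← hkb]
      conv_rhs => rw [show k = (k - j) + j by omega, Function.iterate_add_apply, h3]
    exact hk' (k - j) (by omega) (by omega) (this ▸ hb')
  · push Not at hz
    refine ⟨Or.inr hb', k, hk, hkb, fun j h1 h2 h3 => ?_⟩
    rcases h3 with h3 | h3
    · exact hz j h1 h2 h3
    · exact hk' j h1 h2 h3

/-- If `b` comes next in `A` both after `a ∈ A` and after `z ∉ A`, then `z` comes immediately
after `a` once `z` is added to `A`. -/
theorem NextIn.insert_left {R : RotationSystem G} {A : Set V} {x a b z : V} (ha : G.Adj x a)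
    (hz : G.Adj x z) (haA : a ∈ A) (hzA : z ∉ A) (h : R.NextIn A x a b) (h' : R.NextIn A x z b) :
    R.NextIn (insert z A) x a z := by
  obtain ⟨hb', k, hk, hkb, hk'⟩ := h
  obtain ⟨_, l, hl, hlb, hl'⟩ := h'
  have hlk : l < k := by
    by_contra hlk
    obtain ⟨m, rfl⟩ := Nat.exists_eq_add_of_le (not_lt.1 hlk)
    rw [add_comm, Function.iterate_add_apply, ← Function.iterate_add_apply, add_comm,
      Function.iterate_add_apply] at hlb
    have := R.iterate_inj (R.adj_iterate hz m) ha k (hlb.trans hkb.symm)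
    rcases Nat.eq_zero_or_pos m with rfl | hm
    · exact hzA ((show z = a from this) ▸ haA)
    · exact hl' m hm (by omega) (this ▸ haA)
  have hza : (R.nx x)^[k - l] a = z := by
    apply R.iterate_inj (R.adj_iterate ha _) hz l
    rw [← Function.iterate_add_apply, show l + (k - l) = k by omega, hkb, hlb]
  have hfirst : ∀ j, 1 ≤ j → j < k - l → (R.nx x)^[j] a ≠ z := by
    intro j h1 h2 h3
    have h4 : (R.nx x)^[l + j] a = b := by rw [Function.iterate_add_apply, h3, hlb]
    exact hk' (l + j) (by omega) (by omega) (h4 ▸ hb')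
  refine ⟨Or.inl rfl, k - l, by omega, hza, fun j h1 h2 h3 => ?_⟩
  rcases h3 with h3 | h3
  · exact hfirst j h1 h2 h3
  · exact hk' j h1 (by omega) h3

/-- Elements of `A` other than the one just before `z` keep their successor when `z` is added. -/
theorem NextIn.insert_other {R : RotationSystem G} {A : Set V} {x a b z d f : V} (ha : G.Adj x a)
    (haA : a ∈ A) (h : R.NextIn A x a b) (h' : R.NextIn A x z b)
    (hd : G.Adj x d) (hdA : d ∈ A) (hda : d ≠ a) (hdf : R.NextIn A x d f) :
    R.NextIn (insert z A) x d f := by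
  obtain ⟨hf, k, hk, hkf, hk'⟩ := hdf
  refine ⟨Or.inr hf, k, hk, hkf, fun j h1 h2 h3 => ?_⟩
  rcases h3 with h3 | h3
  · have h4 : R.NextIn A x z f := by
      refine ⟨hf, k - j, by omega, ?_, fun i h5 h6 h7 => ?_⟩
      · rw [← h3, ← Function.iterate_add_apply, show k - j + j = k by omega, hkf]
      · rw [← h3, ← Function.iterate_add_apply] at h7
        exact hk' _ (by omega) (by omega) h7
    have h5 : f = b := h4.unique h'
    subst h5
    exact hda (NextIn.inj hd ha hdA haA ⟨hf, k, hk, hkf, hk'⟩ h)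
  · exact hk' j h1 h2 h3

theorem NextIn.congr {R : RotationSystem G} {A B : Set V} {x a b : V} (ha : G.Adj x a)
    (h : R.NextIn A x a b) (hAB : ∀ y, G.Adj x y → (y ∈ A ↔ y ∈ B)) : R.NextIn B x a b := by
  have hb := h.adj ha
  obtain ⟨hb', k, hk, rfl, hk'⟩ := h
  exact ⟨(hAB _ hb).1 hb', k, hk, rfl,
    fun j h1 h2 h3 => hk' j h1 h2 ((hAB _ (R.adj_iterate ha j)).2 h3)⟩

theorem nextIn_univ {R : RotationSystem G} {x a b : V} : R.NextIn Set.univ x a b ↔ R.nx x a = b := by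
  constructor
  · rintro ⟨-, k, hk, rfl, hk'⟩
    have : k = 1 := by
      by_contra hne
      exact hk' 1 le_rfl (by omega) trivial
    subst this; rfl
  · intro h; exact nextIn_of_nx h trivial

theorem isFirstClockwise_iff (R : RotationSystem G) (P : Set G.Dart) {x a b : V} (ha : G.Adj x a)
    (hb : G.Adj x b) : R.IsFirstClockwise P ⟨(x, a), ha⟩ ⟨(x, b), hb⟩ ↔
      R.NextIn {c | ∃ h : G.Adj x c, (⟨(x, c), h⟩ : G.Dart) ∈ P} x a b := by
  unfold IsFirstClockwise NextIn
  constructor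
  · rintro ⟨h1, k, hk, h2, h3⟩
    refine ⟨⟨hb, h1⟩, k, hk, ?_, fun j h4 h5 h6 => h3 j h4 h5 ?_⟩
    · rw [R.rot_pow] at h2; simpa using h2
    · obtain ⟨_, h6⟩ := h6
      rw [R.rot_pow]; exact h6
  · rintro ⟨⟨_, h1⟩, k, hk, h2, h3⟩
    refine ⟨h1, k, hk, ?_, fun j h4 h5 h6 => h3 j h4 h5 ?_⟩
    · rw [R.rot_pow]; simpa using h2
    · rw [R.rot_pow] at h6
      exact ⟨_, h6⟩

theorem mem_range_inclusionHom {A : Set V} {d : G.Dart} :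
    d ∈ Set.range (inclusionHom G A).mapDart ↔ d.fst ∈ A ∧ d.snd ∈ A := by
  constructor
  · rintro ⟨e, rfl⟩
    exact ⟨e.fst.2, e.snd.2⟩
  · rintro ⟨h1, h2⟩
    exact ⟨⟨(⟨d.fst, h1⟩, ⟨d.snd, h2⟩), d.adj⟩, rfl⟩

theorem isFirstClockwise_inclusionHom (R : RotationSystem G) {A : Set V} {x a b : V} (hx : x ∈ A)
    (ha : G.Adj x a) (hb : G.Adj x b) :
    R.IsFirstClockwise (Set.range (inclusionHom G A).mapDart) ⟨(x, a), ha⟩ ⟨(x, b), hb⟩ ↔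
      R.NextIn A x a b := by
  rw [isFirstClockwise_iff]
  constructor
  · intro h
    refine h.congr ha fun y hy => ⟨fun h => (mem_range_inclusionHom.1 h.2).2, fun h => ⟨hy, ?_⟩⟩
    exact mem_range_inclusionHom.2 ⟨hx, h⟩
  · intro h
    refine h.congr ha fun y hy => ⟨fun h => ⟨hy, mem_range_inclusionHom.2 ⟨hx, h⟩⟩, fun h => ?_⟩
    exact (mem_range_inclusionHom.1 h.2).2

theorem isInherited_inclusionHom_iff (R : RotationSystem G) {A : Set V}
    (R' : RotationSystem (G.induce A)) :
    R'.IsInherited (inclusionHom G A) R ↔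
      ∀ x a : A, G.Adj x a → R.NextIn A x a (R'.nx x a) := by
  constructor
  · intro h x a hxa
    have hxa' : (G.induce A).Adj x a := hxa
    have := h ⟨(x, a), hxa'⟩
    rw [R'.rot_mk hxa'] at this
    exact (R.isFirstClockwise_inclusionHom x.2 hxa (R'.adj_nx (a := a) hxa)).1 this
  · rintro h ⟨⟨x, a⟩, hxa⟩
    rw [R'.rot_mk]
    exact (R.isFirstClockwise_inclusionHom x.2 hxa (R'.adj_nx (a := a) hxa)).2 (h x a hxa)

/-- Every induced subgraph inherits a rotation system: the first-return map. -/
theorem exists_inherited [Finite V] (R : RotationSystem G) (A : Set V) :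
    ∃ R' : RotationSystem (G.induce A), R'.IsInherited (inclusionHom G A) R := by
  classical
  have hex : ∀ x a : A, ∃ b : A, G.Adj x a → R.NextIn A x a b := by
    intro x a
    by_cases h : G.Adj x a
    · obtain ⟨b, hb⟩ := R.exists_nextIn h h a.2
      exact ⟨⟨b, hb.1⟩, fun _ => hb⟩
    · exact ⟨a, fun h' => absurd h' h⟩
  choose f hf using hex
  refine ⟨ofNx f ?_ ?_ ?_, ?_⟩
  · intro x a h
    exact (hf x a h).adj h
  · intro x a b ha hb h
    have h1 := hf x a ha
    have h2 := hf x b hb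
    rw [← h] at h2
    exact Subtype.ext (NextIn.inj ha hb a.2 b.2 h1 h2)
  · intro x a b ha hb
    obtain ⟨k, -, hk⟩ := R.exists_iterate (x := x) (a := a) (b := b) ha hb
    induction k using Nat.strong_induction_on generalizing a with
    | _ k ih =>
      rcases Nat.eq_zero_or_pos k with rfl | hk0
      · exact ⟨0, Subtype.ext hk⟩
      · obtain ⟨h1, j, hj, h2, h3⟩ := hf x a ha
        have hjk : j ≤ k := by
          by_contra hjk
          exact h3 k hk0 (by omega) (hk ▸ b.2)
        obtain ⟨m, hm⟩ := ih (k - j) (by omega) (f x a) ((hf x a ha).adj ha) (by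
          rw [← h2, ← Function.iterate_add_apply, show k - j + j = k by omega, hk])
        exact ⟨m + 1, by rw [Function.iterate_succ_apply, hm]⟩
  · rw [isInherited_inclusionHom_iff]
    intro x a h
    have h' : (G.induce A).Adj x a := h
    erw [nx_ofNx _ _ _ _ h']
    exact hf x a h

/-! ### Clockwise lists of neighbours -/

/-- The list `a :: t` lists the neighbours of `x` in clockwise order. -/
structure IsCyc (R : RotationSystem G) (x a : V) (t : List V) : Prop where
  nodup : (a :: t).Nodup
  mem_iff : ∀ b, b ∈ a :: t ↔ G.Adj x b
  chain : List.IsChain (fun b c => R.nx x b = c) (a :: t ++ [a])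

theorem IsCyc.iterate {R : RotationSystem G} {x a : V} {t : List V} (h : R.IsCyc x a t) (i : ℕ)
    (hi : i < (a :: t).length) : (R.nx x)^[i] a = (a :: t)[i] := by
  induction i with
  | zero => rfl
  | succ i ih =>
    rw [Function.iterate_succ_apply', ih (by omega)]
    have := List.isChain_iff_getElem.1 h.chain i (by simp at hi ⊢; omega)
    simp only [List.cons_append, List.getElem_cons_succ] at this ⊢
    rw [List.getElem_append_left (by simpa using hi)] at this
    rw [← this]
    congr 1
    cases i with
    | zero => rfl
    | succ i => simp only [List.getElem_cons_succ]; rw [List.getElem_append_left]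

theorem IsCyc.length {R : RotationSystem G} {x a : V} {t : List V} (h : R.IsCyc x a t) :
    (G.neighborSet x).ncard = (a :: t).length := by
  classical
  have : G.neighborSet x = ((a :: t).toFinset : Set V) := by
    ext b; rw [SimpleGraph.mem_neighborSet, ← h.mem_iff]; simp
  rw [this, Set.ncard_coe_finset, List.toFinset_card_of_nodup h.nodup]

theorem exists_isCyc [Finite V] (R : RotationSystem G) {x a : V} (ha : G.Adj x a) :
    ∃ t, R.IsCyc x a t := by
  have hper : a ∈ Function.periodicPts (R.nx x) := by
    obtain ⟨k, hk, h⟩ := R.exists_iterate ha ha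
    exact ⟨k, hk, h⟩
  have hpos := Function.minimalPeriod_pos_of_mem_periodicPts hper
  set p := Function.minimalPeriod (R.nx x) a with hp
  obtain ⟨q, hq⟩ : ∃ q, p = q + 1 := ⟨p - 1, by omega⟩
  have hl : (List.range p).map (fun i => (R.nx x)^[i] a) =
      a :: (List.range q).map (fun i => (R.nx x)^[i+1] a) := by
    rw [hq, List.range_succ_eq_map]; simp [Function.comp_def]
  refine ⟨(List.range q).map (fun i => (R.nx x)^[i+1] a), ?_, ?_, ?_⟩
  · rw [← hl]
    refine (List.nodup_map_iff_inj_on List.nodup_range).2 ?_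
    intro i hi j hj h
    rw [List.mem_range] at hi hj
    exact (Function.iterate_eq_iterate_iff_of_lt_minimalPeriod hi hj).1 h
  · intro b
    rw [← hl, List.mem_map]
    constructor
    · rintro ⟨i, -, rfl⟩; exact R.adj_iterate ha i
    · intro hb
      obtain ⟨k, -, h⟩ := R.exists_iterate ha hb
      refine ⟨k % p, List.mem_range.2 (Nat.mod_lt _ hpos), ?_⟩
      rw [hp, Function.iterate_mod_minimalPeriod_eq, h]
  · have : a :: (List.range q).map (fun i => (R.nx x)^[i+1] a) ++ [a] =
        (List.range (p+1)).map (fun i => (R.nx x)^[i] a) := by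
      rw [← hl, List.range_succ, List.map_append]
      simp [hp, Function.iterate_minimalPeriod]
    rw [this, List.isChain_map, List.isChain_iff_getElem]
    intro i hi
    simp [Function.iterate_succ_apply']

/-- The list `l` is a concatenation of blocks, the `i`-th one consisting of elements with the `i`-th
property. -/
def Blocks {α : Type*} : List (α → Prop) → List α → Prop
  | [], l => l = []
  | Q :: Qs, l => ∃ l₁ l₂, l = l₁ ++ l₂ ∧ (∀ x ∈ l₁, Q x) ∧ Blocks Qs l₂

/-- The function `κ` gives the index of the block of each position; `j` is the index of the first block. -/
theorem blocks_of_monotone {α : Type*} (Qs : List (α → Prop)) :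
    ∀ (l : List α) (κ : ℕ → ℕ) (j : ℕ), Monotone κ → (∀ i, j ≤ κ i) →
      (∀ i (hi : i < l.length), ∃ Q, Qs[κ i - j]? = some Q ∧ Q l[i]) → Blocks Qs l := by
  induction Qs with
  | nil =>
    intro l κ j _ _ h
    cases l with
    | nil => rfl
    | cons a l => obtain ⟨Q, h, -⟩ := h 0 (by simp); simp at h
  | cons Q Qs ih =>
    intro l
    induction l with
    | nil =>
      intro κ j hm hj _
      exact ⟨[], [], rfl, by simp, ih [] (fun _ => 0) 0 (fun _ _ _ => le_rfl) (by simp) (by simp)⟩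
    | cons a l ihl =>
      intro κ j hm hj h
      by_cases h0 : κ 0 = j
      · obtain ⟨l₁, l₂, h1, h2, h3⟩ := ihl (fun i => κ (i + 1)) j
          (fun a b hab => hm (by omega)) (fun i => hj _) (fun i hi => by
            obtain ⟨Q', h4, h5⟩ := h (i + 1) (by simpa using hi)
            exact ⟨Q', h4, by simpa using h5⟩)
        refine ⟨a :: l₁, l₂, by simp [h1], ?_, h3⟩
        intro x hx
        rcases List.mem_cons.1 hx with rfl | hx
        · obtain ⟨Q', h4, h5⟩ := h 0 (by simp)
          simp only [h0, Nat.sub_self, List.getElem?_cons_zero, Option.some.injEq] at h4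
          subst h4
          exact h5
        · exact h2 x hx
      · refine ⟨[], a :: l, rfl, by simp, ih _ κ (j + 1) hm (fun i => ?_) (fun i hi => ?_)⟩
        · have := hm (Nat.zero_le i); have := hj 0; omega
        · obtain ⟨Q', h4, h5⟩ := h i hi
          have h6 : j + 1 ≤ κ i := by have := hm (Nat.zero_le i); have := hj 0; omega
          have h7 : κ i - j = (κ i - (j + 1)) + 1 := by omega
          rw [h7, List.getElem?_cons_succ] at h4
          exact ⟨Q', h4, h5⟩

theorem Blocks.exists_monotone {α : Type*} (Qs : List (α → Prop)) (l : List α) (h : Blocks Qs l) :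
    ∃ κ : ℕ → ℕ, Monotone κ ∧ (∀ i, κ i ≤ Qs.length - 1) ∧
      (∀ i (hi : i < l.length), ∃ Q, Qs[κ i]? = some Q ∧ Q l[i]) := by
  induction Qs generalizing l with
  | nil => exact ⟨fun _ => 0, fun _ _ _ => le_rfl, by simp, by simp [show l = [] from h]⟩
  | cons Q Qs ih =>
    obtain ⟨l₁, l₂, rfl, h1, h2⟩ := h
    obtain ⟨κ, hm, hb, hκ⟩ := ih l₂ h2
    refine ⟨fun i => if i < l₁.length then 0 else min (κ (i - l₁.length) + 1) Qs.length, ?_, ?_, ?_⟩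
    · intro a b hab
      dsimp only
      have := hm (show a - l₁.length ≤ b - l₁.length by omega)
      split_ifs <;> omega
    · intro i; dsimp only; split_ifs <;> simp
    · intro i hi
      by_cases h : i < l₁.length
      · refine ⟨Q, by simp [h], ?_⟩
        rw [List.getElem_append_left h]
        exact h1 _ (List.getElem_mem h)
      · obtain ⟨Q', h3, h4⟩ := hκ (i - l₁.length) (by simp at hi; omega)
        obtain ⟨h6, -⟩ := List.getElem?_eq_some_iff.1 h3
        have h5 : min (κ (i - l₁.length) + 1) Qs.length = κ (i - l₁.length) + 1 := by omega
        refine ⟨Q', ?_, ?_⟩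
        · simp only [h, if_false, h5, List.getElem?_cons_succ]; exact h3
        · rw [List.getElem_append_right (by omega)]
          exact h4

/-- A clockwise pattern is a block decomposition of the clockwise list of neighbours. -/
theorem IsCyc.pattern_iff {R : RotationSystem G} {x a : V} {t : List V} (h : R.IsCyc x a t)
    (ha : G.Adj x a) {m : ℕ} (P : Fin (m + 1) → Set G.Dart) :
    R.IsClockwisePattern ⟨(x, a), ha⟩ P ↔
      Blocks (List.ofFn fun i b => ∃ hb : G.Adj x b, (⟨(x, b), hb⟩ : G.Dart) ∈ P i) (a :: t) := by
  have key : ∀ i (hi : i < (a :: t).length) (S : Set G.Dart),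
      (R.rot ^ i) ⟨(x, a), ha⟩ ∈ S ↔
        ∃ hb : G.Adj x (a :: t)[i], (⟨(x, (a :: t)[i]), hb⟩ : G.Dart) ∈ S := by
    intro i hi S
    rw [R.rot_pow]
    constructor
    · intro h'
      have h2 := R.adj_iterate ha i
      simp only [h.iterate i hi] at h' h2
      exact ⟨h2, h'⟩
    · rintro ⟨h1, h2⟩
      simp only [h.iterate i hi]; exact h2
  constructor
  · rintro ⟨κ, hm, hκ⟩
    refine blocks_of_monotone _ _ (fun i => (κ i : ℕ)) 0 (fun a b hab => hm hab) (by simp) ?_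
    intro i hi
    have := hκ i (by rw [h.length]; exact hi)
    rw [key i hi] at this
    exact ⟨_, by rw [List.getElem?_ofFn, dif_pos (by omega)], this⟩
  · intro hB
    obtain ⟨κ, hm, hb, hκ⟩ := hB.exists_monotone
    simp only [List.length_ofFn] at hb
    refine ⟨fun i => ⟨κ i, by have := hb i; omega⟩, fun a b hab => hm hab, ?_⟩
    intro i hi
    rw [h.length] at hi
    rw [key i hi]
    obtain ⟨Q, h1, h2⟩ := hκ i hi
    have h3 : κ i < m + 1 := by have := hb i; omega
    rw [List.getElem?_ofFn, dif_pos h3] at h1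
    simp only [Option.some.injEq] at h1
    subst h1
    exact h2

end RotationSystem

/-! ### Counting edges and faces -/

section Orbits

variable {X : Type u} [Finite X] (σ : Equiv.Perm X)

open Classical in
/-- A permutation without fixed points and 2-cycles has cycles of length at least three, and a cycle has
length three if and only if the third power fixes it. -/
theorem card_fiber_ge_three (h1 : ∀ x, σ x ≠ x) (h2 : ∀ x, σ (σ x) ≠ x) [Fintype X]
    (q : Quotient (Equiv.Perm.SameCycle.setoid σ)) :
    3 ≤ (Finset.univ.filter fun x => (⟦x⟧ : Quotient (Equiv.Perm.SameCycle.setoid σ)) = q).card ∧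
      ((Finset.univ.filter fun x => (⟦x⟧ : Quotient (Equiv.Perm.SameCycle.setoid σ)) = q).card = 3 ↔
        ∀ x, (⟦x⟧ : Quotient (Equiv.Perm.SameCycle.setoid σ)) = q → σ (σ (σ x)) = x) := by
  obtain ⟨x, rfl⟩ := Quotient.exists_rep q
  have hmem : ∀ y, y ∈ (Finset.univ.filter fun z =>
      (⟦z⟧ : Quotient (Equiv.Perm.SameCycle.setoid σ)) = ⟦x⟧) ↔ σ.SameCycle y x := by
    intro y
    simp only [Finset.mem_filter, Finset.mem_univ, true_and]
    exact Quotient.eq (r := Equiv.Perm.SameCycle.setoid σ)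
  have hq : ∀ y, (⟦y⟧ : Quotient (Equiv.Perm.SameCycle.setoid σ)) = ⟦x⟧ ↔ σ.SameCycle y x :=
    fun y => Quotient.eq (r := Equiv.Perm.SameCycle.setoid σ)
  have hc3 : ∀ y, ({y, σ y, σ (σ y)} : Finset X).card = 3 := by
    intro y
    rw [Finset.card_eq_three]
    refine ⟨y, σ y, σ (σ y), (h1 y).symm, (h2 y).symm, ?_, rfl⟩
    exact fun h => h1 y (σ.injective h).symm
  have hsub : ∀ y, σ.SameCycle y x → ({y, σ y, σ (σ y)} : Finset X) ⊆ (Finset.univ.filter fun z =>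
      (⟦z⟧ : Quotient (Equiv.Perm.SameCycle.setoid σ)) = ⟦x⟧) := by
    intro y hy z hz
    rw [hmem]
    simp only [Finset.mem_insert, Finset.mem_singleton] at hz
    rcases hz with rfl | rfl | rfl
    · exact hy
    · exact Equiv.Perm.sameCycle_apply_left.2 hy
    · exact Equiv.Perm.sameCycle_apply_left.2 (Equiv.Perm.sameCycle_apply_left.2 hy)
  refine ⟨?_, ?_, ?_⟩
  · rw [← hc3 x]
    exact Finset.card_le_card (hsub x Equiv.Perm.SameCycle.rfl)
  · intro h y hy
    rw [hq] at hy
    have h4 := Finset.eq_of_subset_of_card_le (hsub y hy) (by rw [hc3, h])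
    have h5 : σ (σ (σ y)) ∈ ({y, σ y, σ (σ y)} : Finset X) := by
      rw [h4, hmem]
      exact Equiv.Perm.sameCycle_apply_left.2
        (Equiv.Perm.sameCycle_apply_left.2 (Equiv.Perm.sameCycle_apply_left.2 hy))
    simp only [Finset.mem_insert, Finset.mem_singleton] at h5
    rcases h5 with h5 | h5 | h5
    · exact h5
    · exact absurd h5 (h2 _)
    · exact absurd h5 (h1 _)
  · intro h
    rw [← hc3 x]
    congr 1
    refine (Finset.Subset.antisymm (hsub x Equiv.Perm.SameCycle.rfl) ?_).symm
    intro y hy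
    rw [hmem] at hy
    obtain ⟨i, hi⟩ := hy.symm.exists_nat_pow_eq
    have hx3 := h x rfl
    have : ∀ i : ℕ, (σ ^ i) x ∈ ({x, σ x, σ (σ x)} : Finset X) := by
      intro i
      induction i with
      | zero => simp
      | succ i ih =>
        rw [pow_succ', Equiv.Perm.mul_apply]
        simp only [Finset.mem_insert, Finset.mem_singleton] at ih ⊢
        rcases ih with ih | ih | ih <;> rw [ih] <;> simp [hx3]
    exact hi ▸ this i

/-- A permutation without cycles of length one or two has at most a third as many cycles as points;
equality means that all cycles have length three. -/
theorem three_mul_card_orbits (h1 : ∀ x, σ x ≠ x) (h2 : ∀ x, σ (σ x) ≠ x) :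
    3 * Nat.card (Quotient (Equiv.Perm.SameCycle.setoid σ)) ≤ Nat.card X ∧
      (3 * Nat.card (Quotient (Equiv.Perm.SameCycle.setoid σ)) = Nat.card X ↔
        ∀ x, σ (σ (σ x)) = x) := by
  classical
  have := Fintype.ofFinite X
  have hf := card_fiber_ge_three σ h1 h2
  have hsum : Fintype.card X = ∑ q : Quotient (Equiv.Perm.SameCycle.setoid σ),
      (Finset.univ.filter fun x =>
        (⟦x⟧ : Quotient (Equiv.Perm.SameCycle.setoid σ)) = q).card :=
    Finset.card_eq_sum_card_fiberwise (fun x _ => Finset.mem_coe.2 (Finset.mem_univ _))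
  have hconst : 3 * Fintype.card (Quotient (Equiv.Perm.SameCycle.setoid σ)) =
      ∑ q : Quotient (Equiv.Perm.SameCycle.setoid σ), 3 := by
    simp [mul_comm]
  rw [Nat.card_eq_fintype_card, Nat.card_eq_fintype_card]
  refine ⟨?_, ?_, ?_⟩
  · rw [hsum, hconst]
    exact Finset.sum_le_sum fun q _ => (hf q).1
  · intro h x
    rw [hsum, hconst] at h
    have := (Finset.sum_eq_sum_iff_of_le fun q _ => (hf q).1).1 h ⟦x⟧ (Finset.mem_univ _)
    exact (hf ⟦x⟧).2.1 this.symm x rfl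
  · intro h
    rw [hsum, hconst]
    exact Finset.sum_congr rfl fun q _ => ((hf q).2.2 fun x _ => h x).symm

end Orbits

section

variable {V : Type u} {G : SimpleGraph V}

theorem card_dart [Finite V] : Nat.card G.Dart = 2 * Nat.card G.edgeSet := by
  classical
  have := Fintype.ofFinite V
  rw [Nat.card_eq_fintype_card, SimpleGraph.dart_card_eq_twice_card_edges,
    Nat.card_eq_fintype_card, SimpleGraph.edgeFinset_card]

/-- A coloured orientation has one edge for each vertex of positive outdegree and each colour. -/
theorem ncard_of_isColoredOrientation [Finite V] {C : Type} {E : Set (Sym2 V)}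
    {S : C → Set G.Dart} (h : IsColoredOrientation E S) (X : Set V)
    (hout : ∀ x ∈ X, ∀ c, ∃! d : G.Dart, d.fst = x ∧ d ∈ S c)
    (hX : ∀ c, ∀ d ∈ S c, d.fst ∈ X) : E.ncard = X.ncard * Nat.card C := by
  choose f hf hf' using hout
  rw [← Nat.card_coe_set_eq, ← Nat.card_coe_set_eq, ← Nat.card_prod]
  symm
  refine Nat.card_congr (Equiv.ofBijective
    (fun p : X × C => (⟨(f p.1 p.1.2 p.2).edge, h.1 p.2 _ (hf p.1 p.1.2 p.2).2⟩ : E)) ⟨?_, ?_⟩)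
  · rintro ⟨⟨x, hx⟩, c⟩ ⟨⟨y, hy⟩, c'⟩ he
    simp only [Subtype.mk.injEq] at he
    have h1 := (hf x hx c)
    have h2 := (hf y hy c')
    obtain ⟨p, -, hp⟩ := h.2 _ (h.1 c _ h1.2)
    have e1 := hp (c, f x hx c) ⟨rfl, h1.2⟩
    have e2 := hp (c', f y hy c') ⟨he.symm, h2.2⟩
    have e3 := e1.trans e2.symm
    simp only [Prod.mk.injEq] at e3
    obtain ⟨rfl, e3⟩ := e3
    have : x = y := by rw [← h1.1, ← h2.1, e3]
    subst this; rfl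
  · rintro ⟨e, he⟩
    obtain ⟨⟨c, d⟩, ⟨hd1, hd2⟩, -⟩ := h.2 e he
    refine ⟨(⟨d.fst, hX c d hd2⟩, c), ?_⟩
    apply Subtype.ext
    simp only
    rw [← hf' d.fst (hX c d hd2) c d ⟨rfl, hd2⟩]
    exact hd1

namespace RotationSystem

theorem facePerm_mk (R : RotationSystem G) {x y : V} (h : G.Adj x y) :
    R.facePerm ⟨(x, y), h⟩ = ⟨(y, R.nx y x), R.adj_nx h.symm⟩ := by
  have : R.facePerm ⟨(x, y), h⟩ = R.rot ⟨(y, x), h.symm⟩ := rfl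
  rw [this, R.rot_mk]

theorem facePerm_fst (R : RotationSystem G) (d : G.Dart) : (R.facePerm d).fst = d.snd := by
  obtain ⟨⟨x, y⟩, h⟩ := d
  rw [R.facePerm_mk]

theorem facePerm_ne (R : RotationSystem G) (d : G.Dart) : R.facePerm d ≠ d := by
  intro h
  have := R.facePerm_fst d
  rw [h] at this
  exact d.fst_ne_snd this

theorem facePerm_facePerm_ne [Finite V] (R : RotationSystem G)
    (hdeg : ∀ x, ∃ a b, a ≠ b ∧ G.Adj x a ∧ G.Adj x b) (d : G.Dart) :
    R.facePerm (R.facePerm d) ≠ d := by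
  obtain ⟨⟨x, y⟩, h⟩ := d
  intro he
  rw [R.facePerm_mk, R.facePerm_mk] at he
  have h1 : R.nx y x = x := by
    have := congrArg (fun d : G.Dart => d.fst) he
    exact this
  obtain ⟨a, b, hab, ha, hb⟩ := hdeg y
  have h2 : ∀ c, G.Adj y c → c = x := by
    intro c hc
    obtain ⟨k, -, hk⟩ := R.exists_iterate h.symm hc
    rw [← hk]
    exact Function.iterate_fixed h1 k
  exact hab ((h2 a ha).trans (h2 b hb).symm)

theorem card_isolated (hdeg : ∀ x, ∃ a, G.Adj x a) :
    Nat.card {x : V // ∀ y, ¬ G.Adj x y} = 0 := by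
  have : IsEmpty {x : V // ∀ y, ¬ G.Adj x y} :=
    ⟨fun x => by obtain ⟨a, ha⟩ := hdeg x; exact x.2 a ha⟩
  exact Nat.card_of_isEmpty

theorem one_le_card_connectedComponent [Finite V] [Nonempty V] :
    1 ≤ Nat.card G.ConnectedComponent := by
  have : Nonempty G.ConnectedComponent := ⟨G.connectedComponentMk (Classical.arbitrary V)⟩
  exact Nat.card_pos

theorem connected_of_card [Finite V] [Nonempty V] (h : Nat.card G.ConnectedComponent ≤ 1) :
    G.Connected := by
  have : Subsingleton G.ConnectedComponent := Finite.card_le_one_iff_subsingleton.1 h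
  have : Nonempty V := inferInstance
  refine SimpleGraph.Connected.mk fun x y => ?_
  exact SimpleGraph.ConnectedComponent.exact (Subsingleton.elim _ _)

theorem card_of_connected [Finite V] (h : G.Connected) : Nat.card G.ConnectedComponent = 1 := by
  have := h.preconnected.subsingleton_connectedComponent
  have := h.nonempty
  have : Nonempty G.ConnectedComponent := ⟨G.connectedComponentMk (Classical.arbitrary V)⟩
  exact Nat.card_eq_one_iff_unique.2 ⟨inferInstance, inferInstance⟩

/-- A plane graph of minimum degree two has at most `3n - 6` edges; in case of equality it is
connected and all its faces are triangles. -/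
theorem card_edges_le [Finite V] [Nonempty V] (R : RotationSystem G) (hR : R.IsPlanar)
    (hdeg : ∀ x, ∃ a b, a ≠ b ∧ G.Adj x a ∧ G.Adj x b) :
    Nat.card G.edgeSet + 6 ≤ 3 * Nat.card V ∧
      (3 * Nat.card V ≤ Nat.card G.edgeSet + 6 → G.Connected ∧
        ∀ d, R.facePerm (R.facePerm (R.facePerm d)) = d) := by
  have h1 := three_mul_card_orbits R.facePerm R.facePerm_ne (R.facePerm_facePerm_ne hdeg)
  have h2 := card_dart (G := G)
  have h3 := card_isolated (G := G) fun x => by obtain ⟨a, _, _, ha, _⟩ := hdeg x; exact ⟨a, ha⟩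
  have h4 := one_le_card_connectedComponent (G := G)
  unfold IsPlanar Face at hR
  rw [h2] at h1
  refine ⟨by omega, fun h => ⟨connected_of_card (by omega), h1.2.1 (by omega)⟩⟩

/-- A connected triangulation with `3n - 6` edges satisfies Euler's formula. -/
theorem isPlanar_of_triangles [Finite V] (R : RotationSystem G) (hc : G.Connected)
    (hdeg : ∀ x, ∃ a b, a ≠ b ∧ G.Adj x a ∧ G.Adj x b)
    (htri : ∀ d, R.facePerm (R.facePerm (R.facePerm d)) = d)
    (hE : Nat.card G.edgeSet + 6 = 3 * Nat.card V) : R.IsPlanar := by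
  have h1 := three_mul_card_orbits R.facePerm R.facePerm_ne (R.facePerm_facePerm_ne hdeg)
  have h2 := card_dart (G := G)
  have h3 := card_isolated (G := G) fun x => by obtain ⟨a, _, _, ha, _⟩ := hdeg x; exact ⟨a, ha⟩
  have h4 := card_of_connected hc
  have h5 := h1.2.2 htri
  unfold IsPlanar Face
  omega

/-- A connected plane graph of minimum degree two with `3n - 6` edges is maximally planar. -/
theorem isMaximallyPlanar_of_card [Finite V] [Nonempty V] (R : RotationSystem G) (hR : R.IsPlanar)
    (hdeg : ∀ x, ∃ a b, a ≠ b ∧ G.Adj x a ∧ G.Adj x b)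
    (hE : Nat.card G.edgeSet + 6 = 3 * Nat.card V) : IsMaximallyPlanar G := by
  refine ⟨⟨R, hR⟩, ?_⟩
  rintro G' hlt ⟨R', hR'⟩
  have h1 := (card_edges_le R' hR' fun x => by
    obtain ⟨a, b, hab, ha, hb⟩ := hdeg x
    exact ⟨a, b, hab, hlt.le ha, hlt.le hb⟩).1
  have h2 : G.edgeSet ⊂ G'.edgeSet := SimpleGraph.edgeSet_ssubset_edgeSet.2 hlt
  have h3 := Set.ncard_lt_ncard h2
  rw [← Nat.card_coe_set_eq, ← Nat.card_coe_set_eq] at h3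
  omega

end RotationSystem

end

/-! ### Conditions on consecutive triples of a list -/

/-- The relation `Q` holds for any three consecutive elements of the list. -/
def Chain3 {α : Type*} (Q : α → α → α → Prop) : List α → Prop
  | a :: b :: c :: l => Q a b c ∧ Chain3 Q (b :: c :: l)
  | _ => True

namespace Chain3

variable {α : Type*} {Q : α → α → α → Prop}

theorem tail {a : α} {l : List α} (h : Chain3 Q (a :: l)) : Chain3 Q l := by
  match l, h with
  | [], _ => trivial
  | [_], _ => trivial
  | _ :: _ :: _, h => exact h.2

theorem append_iff (l r : List α) (x y : α) :
    Chain3 Q (l ++ x :: y :: r) ↔ Chain3 Q (l ++ [x, y]) ∧ Chain3 Q (x :: y :: r) := by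
  induction l with
  | nil => simp [Chain3]
  | cons a l ih =>
    cases l with
    | nil => simp [Chain3]
    | cons b l =>
      cases l with
      | nil => simp only [List.cons_append, List.nil_append, Chain3] at ih ⊢; tauto
      | cons c l => simp only [List.cons_append, Chain3] at ih ⊢; tauto

theorem triple {l r : List α} {x y z : α} (h : Chain3 Q (l ++ x :: y :: z :: r)) : Q x y z :=
  ((append_iff l _ x y).1 h).2.1

theorem left_of_append {l r : List α} (h : Chain3 Q (l ++ r)) : Chain3 Q l := by
  induction l with
  | nil => trivial
  | cons a l ih =>
    match l, h, ih with
    | [], _, _ => trivial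
    | [_], _, _ => trivial
    | _ :: _ :: _, h, ih => exact ⟨h.1, ih h.2⟩

theorem right_of_append {l r : List α} (h : Chain3 Q (l ++ r)) : Chain3 Q r := by
  induction l with
  | nil => exact h
  | cons a l ih => exact ih h.tail

theorem imp {Q' : α → α → α → Prop} {l : List α} (h : Chain3 Q l)
    (hQ : ∀ a b c, a ∈ l → b ∈ l → c ∈ l → Q a b c → Q' a b c) : Chain3 Q' l := by
  induction l with
  | nil => trivial
  | cons a l ih =>
    match l, h, hQ, ih with
    | [], _, _, _ => trivial
    | [_], _, _, _ => trivial
    | b :: c :: l, h, hQ, ih =>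
      exact ⟨hQ _ _ _ (by simp) (by simp) (by simp) h.1,
        ih h.2 fun x y z hx hy hz => hQ x y z (by simp [hx]) (by simp [hy]) (by simp [hz])⟩

end Chain3

/-! ### Facial paths and shelling -/

namespace RotationSystem

variable {V : Type u} {G : SimpleGraph V}

theorem forall_adj_of_iterate [Finite V] (R : RotationSystem G) {x b : V} (hb : G.Adj x b) {m : ℕ}
    (hm : 1 ≤ m) (hper : (R.nx x)^[m] b = b) {p : V → Prop} (hp : ∀ j < m, p ((R.nx x)^[j] b))
    {g : V} (hg : G.Adj x g) : p g := by
  obtain ⟨k, -, rfl⟩ := R.exists_iterate hb hg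
  have : (R.nx x)^[k] b = (R.nx x)^[k % m] b := by
    conv_lhs => rw [← Nat.mod_add_div k m, Function.iterate_add_apply, Function.iterate_mul,
      Function.iterate_fixed hper]
  rw [this]
  exact hp _ (Nat.mod_lt _ hm)

theorem NextIn.eq_or_eq [Finite V] {R : RotationSystem G} {A : Set V} {x a b g : V}
    (h : R.NextIn A x b a) (hab : R.nx x a = b) (hb : G.Adj x b) (hg : G.Adj x g) (hgA : g ∈ A) :
    g = a ∨ g = b := by
  obtain ⟨_, k, hk, hka, hk'⟩ := h
  refine R.forall_adj_of_iterate hb (m := k + 1) (by omega)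
    (by rw [Function.iterate_succ_apply', hka, hab]) (p := fun g => g ∈ A → g = a ∨ g = b) ?_ hg hgA
  intro j hj hjA
  rcases Nat.eq_zero_or_pos j with rfl | h0
  · exact Or.inr rfl
  · rcases Nat.lt_or_ge j k with h1 | h1
    · exact absurd hjA (hk' j h0 h1)
    · left; rw [← hka, show j = k by omega]

theorem NextIn.eq_of_self [Finite V] {R : RotationSystem G} {A : Set V} {x b g : V}
    (h : R.NextIn A x b b) (hb : G.Adj x b) (hg : G.Adj x g) (hgA : g ∈ A) : g = b := by
  obtain ⟨_, k, hk, hka, hk'⟩ := h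
  refine R.forall_adj_of_iterate hb hk hka (p := fun g => g ∈ A → g = b) ?_ hg hgA
  intro j hj hjA
  rcases Nat.eq_zero_or_pos j with rfl | h0
  · rfl
  · exact absurd hjA (hk' j h0 hj)

/-- The vertices other than the ends of the base edge. -/
def Inner (v₁ v₂ x : V) : Prop := x ≠ v₁ ∧ x ≠ v₂

/-- The directed edges from `red x` to `x`, from `x` to `blue x`, and from `v₁` to `v₂`. -/
def Up (v₁ v₂ : V) (red blue : V → V) (p q : V) : Prop :=
  (Inner v₁ v₂ q ∧ red q = p) ∨ (Inner v₁ v₂ p ∧ blue p = q) ∨ (p = v₁ ∧ q = v₂)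

/-- The facial path of an apex `w` with interior `I w`: from `red w` to `blue w`, and from `v₁` to
`v₂` for the outer face, whose apex is `none`. -/
def path (v₁ v₂ : V) (red blue : V → V) (I : Option V → List V) : Option V → List V
  | none => v₁ :: I none ++ [v₂]
  | some w => red w :: I (some w) ++ [blue w]

/-- The facial path of `w`, preceded and followed by the neighbours that its first and its last
vertex have on the rest of the boundary of the face. -/
def closedPath (v₁ v₂ : V) (red blue : V → V) (I : Option V → List V) : Option V → List V
  | none => v₂ :: path v₁ v₂ red blue I none ++ [v₁]
  | some w => w :: path v₁ v₂ red blue I (some w) ++ [w]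

/-- The apices of faces: the inner vertices, and `none`. -/
def Apex (v₁ v₂ : V) (w : Option V) : Prop := ∀ x, w = some x → Inner v₁ v₂ x

/-- Each face has a single apex `w`, and its boundary consists of the two edges at the apex and of
a path of `Up` edges with interior `I w`; the face of the apex `none` is the outer face. -/
structure FacialPaths (R : RotationSystem G) (v₁ v₂ : V) (red blue : V → V)
    (I : Option V → List V) : Prop where
  base : G.Adj v₁ v₂
  adj_red : ∀ x, Inner v₁ v₂ x → G.Adj x (red x)
  adj_blue : ∀ x, Inner v₁ v₂ x → G.Adj x (blue x)
  nx_red : ∀ x, Inner v₁ v₂ x → R.nx x (red x) = blue x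
  up : ∀ w, Apex v₁ v₂ w → List.IsChain (Up v₁ v₂ red blue) (path v₁ v₂ red blue I w)
  corner : ∀ w, Apex v₁ v₂ w →
    Chain3 (fun p g s => R.nx g s = p) (closedPath v₁ v₂ red blue I w)
  inner : ∀ w, Apex v₁ v₂ w → ∀ g ∈ I w, Inner v₁ v₂ g
  exists_apex : ∀ g, Inner v₁ v₂ g → ∃ w, Apex v₁ v₂ w ∧ g ∈ I w
  unique : ∀ w w', Apex v₁ v₂ w → Apex v₁ v₂ w' → ∀ g, g ∈ I w → g ∈ I w' → w = w'
  nodup : ∀ w, Apex v₁ v₂ w → (I w).Nodup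
  /-- The graph obtained by joining each apex to the interior of its path is connected. -/
  connected : ∀ Y : Set V, (∀ x ∈ Y, Inner v₁ v₂ x) → (∀ x ∈ Y, ∀ y, G.Adj x y → y ∈ Y) →
    (∀ w, Inner v₁ v₂ w → ∀ g ∈ I (some w), (g ∈ Y ↔ w ∈ Y)) → Y = ∅

variable {R : RotationSystem G} {v₁ v₂ : V} {red blue : V → V} {I : Option V → List V}

/-- The apex of the face at `g` has been removed. -/
def Exposed (v₁ v₂ : V) (I : Option V → List V) (A : Set V) (g : V) : Prop :=
  ∃ w, Apex v₁ v₂ w ∧ g ∈ I w ∧ ∀ x, w = some x → x ∉ A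

/-- A stage of the shelling: the vertices outside `A` have been removed, and `P` is the path that
bounds the outer face of the subgraph induced on `A`, together with the base edge. -/
structure Stage (R : RotationSystem G) (v₁ v₂ : V) (red blue : V → V) (I : Option V → List V)
    (A : Set V) (P : List V) : Prop where
  mem₁ : v₁ ∈ A
  mem₂ : v₂ ∈ A
  head : P.head? = some v₁
  last : P.getLast? = some v₂
  nodup : P.Nodup
  up : List.IsChain (Up v₁ v₂ red blue) P
  mem_iff : ∀ g, Inner v₁ v₂ g → (g ∈ P ↔ g ∈ A ∧ Exposed v₁ v₂ I A g)
  removed : ∀ g, Inner v₁ v₂ g → g ∉ A → Exposed v₁ v₂ I A g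
  covered : ∀ g, Inner v₁ v₂ g → g ∈ A → g ∉ P → ∀ y, G.Adj g y → y ∈ A
  next : Chain3 (fun p g s => R.NextIn A g s p) (v₂ :: P ++ [v₁])

theorem Stage.subset {A : Set V} {P : List V} (h : Stage R v₁ v₂ red blue I A P) {g : V}
    (hg : g ∈ P) : g ∈ A := by
  by_cases h1 : g = v₁
  · exact h1 ▸ h.mem₁
  by_cases h2 : g = v₂
  · exact h2 ▸ h.mem₂
  · exact ((h.mem_iff g ⟨h1, h2⟩).1 hg).1

/-- The shelling starts with the whole graph, whose outer path is the facial path of `none`. -/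
theorem FacialPaths.stage_univ (h : FacialPaths R v₁ v₂ red blue I) :
    Stage R v₁ v₂ red blue I Set.univ (path v₁ v₂ red blue I none) := by
  have hn : Apex v₁ v₂ none := fun x hx => by simp at hx
  have hex : ∀ g, g ∈ I none ↔ Exposed v₁ v₂ I Set.univ g := by
    intro g
    constructor
    · intro hg; exact ⟨none, hn, hg, by simp⟩
    · rintro ⟨w, hw, hg, h1⟩
      cases w with
      | none => exact hg
      | some x => exact absurd trivial (h1 x rfl)
  refine ⟨trivial, trivial, by simp [path], ?_, ?_, h.up none hn, ?_, ?_, ?_, ?_⟩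
  · simp [path, List.getLast?_append, List.getLast?_cons]
  · have h1 : v₁ ∉ I none := fun h1 => (h.inner none hn _ h1).1 rfl
    have h2 : v₂ ∉ I none := fun h1 => (h.inner none hn _ h1).2 rfl
    have := h.nodup none hn
    have h3 := h.base.ne
    simp only [path, List.cons_append, List.nodup_cons, List.mem_append, List.mem_singleton,
      List.nodup_append, List.nodup_nil, List.not_mem_nil]
    refine ⟨by tauto, this, by simp, ?_⟩
    rintro a ha b rfl rfl
    exact h2 ha
  · intro g hg
    simp only [path, List.cons_append, List.mem_cons, List.mem_append, List.not_mem_nil, or_false,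
      Set.mem_univ, true_and, ← hex]
    constructor
    · rintro (h1 | h1 | h1)
      · exact absurd h1 hg.1
      · exact h1
      · exact absurd h1 hg.2
    · tauto
  · intro g _ hg; exact absurd trivial hg
  · intros; trivial
  · exact (h.corner none hn).imp fun a b c _ _ _ hQ => nextIn_of_nx hQ trivial

/-- A path of `Up` edges that begins with a red edge and ends in `v₂` changes from red to blue at some
vertex, since only blue edges enter `v₂`. -/
theorem exists_peak {y : V} : ∀ (x : V) (r : List V), List.IsChain (Up v₁ v₂ red blue) (x :: y :: r) →
    Inner v₁ v₂ y → red y = x → (y :: r).getLast? = some v₂ → v₁ ∉ y :: r → (y :: r).Nodup →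
    ∃ l₁ a w b l₂, x :: y :: r = l₁ ++ a :: w :: b :: l₂ ∧ Inner v₁ v₂ w ∧ red w = a ∧
      blue w = b := by
  intro x r
  induction r generalizing x y with
  | nil =>
    intro _ hy _ h _ _
    simp at h
    exact absurd h hy.2
  | cons z r ih =>
    intro hc hy hr hl h1 hn
    rw [List.isChain_cons_cons, List.isChain_cons_cons] at hc
    obtain ⟨_, hyz, hc⟩ := hc
    rcases hyz with ⟨h2, h3⟩ | ⟨-, h3⟩ | ⟨h3, -⟩
    · obtain ⟨l₁, a, w, b, l₂, h4, h5⟩ := ih (y := z) y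
        (List.isChain_cons_cons.2 ⟨Or.inl ⟨h2, h3⟩, hc⟩) h2 h3 (by
          rw [List.getLast?_cons_cons] at hl; exact hl)
        (fun h => h1 (List.mem_cons_of_mem _ h)) (List.nodup_cons.1 hn).2
      exact ⟨x :: l₁, a, w, b, l₂, by rw [h4]; rfl, h5⟩
    · exact ⟨[], x, y, z, r, rfl, hy, hr, h3⟩
    · exact absurd h3 hy.1

/-- Unless only the base edge is left, the outer path passes through some vertex along its two
outgoing edges: the path starts with a red edge, as no blue edge begins in `v₁`. -/
theorem Stage.eq_or_peak {A : Set V} {P : List V} (h : Stage R v₁ v₂ red blue I A P)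
    (hne : v₁ ≠ v₂) : P = [v₁, v₂] ∨ ∃ l₁ a w b l₂, P = l₁ ++ a :: w :: b :: l₂ ∧ Inner v₁ v₂ w ∧
      red w = a ∧ blue w = b := by
  obtain ⟨r, rfl⟩ : ∃ r, P = v₁ :: r := by
    have := h.head
    cases P with
    | nil => simp at this
    | cons a r => simp at this; exact ⟨r, by rw [this]⟩
  have hl := h.last
  have hn := h.nodup
  have hup := h.up
  cases r with
  | nil => simp at hl; exact absurd hl hne
  | cons y r =>
    rw [List.nodup_cons] at hn
    rw [List.getLast?_cons_cons] at hl
    have hy1 : y ≠ v₁ := fun h => hn.1 (by simp [h])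
    by_cases hy : y = v₂
    · left
      cases r with
      | nil => rw [hy]
      | cons z r =>
        rw [List.getLast?_cons_cons] at hl
        have := List.mem_of_getLast? hl
        rw [← hy] at this
        exact absurd this (List.nodup_cons.1 hn.2).1
    · right
      refine exists_peak v₁ r hup ⟨hy1, hy⟩ ?_ hl hn.1 hn.2
      rcases (List.isChain_cons_cons.1 hup).1 with h1 | h1 | h1
      · exact h1.2
      · exact absurd rfl h1.1.1
      · exact absurd h1.2 hy

/-- If the outer path is the base edge, then no other vertex is left: the inner vertices in `A` would be
closed under adjacency and under the passage between an apex and its facial path. -/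
theorem Stage.eq_base [Finite V] (hF : FacialPaths R v₁ v₂ red blue I) {A : Set V}
    (h : Stage R v₁ v₂ red blue I A [v₁, v₂]) : A = {v₁, v₂} := by
  have hx : ∀ g, Inner v₁ v₂ g → g ∉ [v₁, v₂] := by
    intro g hg hg'
    simp only [List.mem_cons, List.not_mem_nil, or_false] at hg'
    rcases hg' with h1 | h1
    · exact hg.1 h1
    · exact hg.2 h1
  have hY := hF.connected {g | g ∈ A ∧ Inner v₁ v₂ g} (fun g hg => hg.2) ?_ ?_
  · ext g
    simp only [Set.mem_insert_iff, Set.mem_singleton_iff]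
    constructor
    · intro hg
      by_contra hne
      push Not at hne
      have : g ∈ {g | g ∈ A ∧ Inner v₁ v₂ g} := ⟨hg, hne⟩
      rw [hY] at this; exact this
    · rintro (rfl | rfl)
      · exact h.mem₁
      · exact h.mem₂
  · rintro g ⟨hgA, hg⟩ y hy
    refine ⟨h.covered g hg hgA (hx g hg) y hy, ?_, ?_⟩
    · rintro rfl
      have := h.next
      exact hg.2 (NextIn.eq_of_self this.1 hF.base hy.symm hgA)
    · rintro rfl
      have := h.next
      exact hg.1 (NextIn.eq_of_self this.2.1 hF.base.symm hy.symm hgA)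
  · intro w hw g hg
    have hgi := hF.inner (some w) (by rintro x ⟨⟩; exact hw) g hg
    constructor
    · rintro ⟨hgA, -⟩
      refine ⟨?_, hw⟩
      by_contra hwA
      refine hx g hgi ((h.mem_iff g hgi).2 ⟨hgA, some w, by rintro x ⟨⟩; exact hw, hg, ?_⟩)
      rintro x ⟨⟩; exact hwA
    · rintro ⟨hwA, -⟩
      refine ⟨?_, hgi⟩
      by_contra hgA
      obtain ⟨u, hu, hgu, hu'⟩ := h.removed g hgi hgA
      have := hF.unique u (some w) hu (by rintro x ⟨⟩; exact hw) g hgu hg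
      exact hu' w this hwA

/-- Removing a vertex `w` that is preceded by `red w` and followed by `blue w` on the outer path:
the facial path of `w` becomes part of the outer path. -/
theorem Stage.remove [Finite V] (hF : FacialPaths R v₁ v₂ red blue I) {A : Set V} {l₁ l₂ : List V}
    {w : V} (hw : Inner v₁ v₂ w) (h : Stage R v₁ v₂ red blue I A (l₁ ++ red w :: w :: blue w :: l₂)) :
    Stage R v₁ v₂ red blue I (A \ {w}) (l₁ ++ red w :: I (some w) ++ blue w :: l₂) := by
  have hap : Apex v₁ v₂ (some w) := by rintro x ⟨⟩; exact hw
  have hwA : w ∈ A := h.subset (by simp)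
  have haA : red w ∈ A := h.subset (by simp)
  have hbA : blue w ∈ A := h.subset (by simp)
  have hwe : Exposed v₁ v₂ I A w := ((h.mem_iff w hw).1 (by simp)).2
  have hIw : ∀ g ∈ I (some w), ¬ Exposed v₁ v₂ I A g := by
    rintro g hg ⟨u, hu, hgu, hu'⟩
    exact hu' w (hF.unique u (some w) hu hap g hgu hg) hwA
  have hIA : ∀ g ∈ I (some w), g ∈ A := by
    intro g hg
    by_contra hgA
    exact hIw g hg (h.removed g (hF.inner _ hap g hg) hgA)
  have hIP : ∀ g ∈ I (some w), g ∉ l₁ ++ red w :: w :: blue w :: l₂ := by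
    intro g hg hgP
    exact hIw g hg ((h.mem_iff g (hF.inner _ hap g hg)).1 hgP).2
  have hwI : w ∉ I (some w) := fun hwI => hIw w hwI hwe
  have hexp : ∀ g, Exposed v₁ v₂ I (A \ {w}) g ↔ Exposed v₁ v₂ I A g ∨ g ∈ I (some w) := by
    intro g
    constructor
    · rintro ⟨u, hu, hgu, hu'⟩
      by_cases hue : u = some w
      · right; rw [← hue]; exact hgu
      · left
        refine ⟨u, hu, hgu, fun x hx hxA => hu' x hx ⟨hxA, ?_⟩⟩
        rintro rfl
        exact hue hx
    · rintro (⟨u, hu, hgu, hu'⟩ | hg)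
      · exact ⟨u, hu, hgu, fun x hx hxA => hu' x hx hxA.1⟩
      · exact ⟨some w, hap, hg, by rintro x ⟨⟩ hx; exact hx.2 rfl⟩
  have hnd := h.nodup
  have hnd' : (l₁ ++ red w :: blue w :: l₂).Nodup ∧ w ∉ l₁ ++ red w :: blue w :: l₂ := by
    have hp : (l₁ ++ red w :: w :: blue w :: l₂).Perm (w :: (l₁ ++ red w :: blue w :: l₂)) := by
      have := (List.perm_middle (a := w) (l₁ := l₁ ++ [red w]) (l₂ := blue w :: l₂))
      simpa using this
    have := hp.nodup_iff.1 hnd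
    rw [List.nodup_cons] at this
    exact ⟨this.2, this.1⟩
  have hmem : ∀ g, g ∈ l₁ ++ red w :: I (some w) ++ blue w :: l₂ ↔
      (g ∈ l₁ ++ red w :: blue w :: l₂ ∨ g ∈ I (some w)) := by
    intro g; simp only [List.mem_append, List.mem_cons]; tauto
  have hmem' : ∀ g, g ∈ l₁ ++ red w :: w :: blue w :: l₂ ↔
      (g ∈ l₁ ++ red w :: blue w :: l₂ ∨ g = w) := by
    intro g; simp only [List.mem_append, List.mem_cons]; tauto
  refine ⟨⟨h.mem₁, fun h' => hw.1 h'.symm⟩, ⟨h.mem₂, fun h' => hw.2 h'.symm⟩, ?_, ?_, ?_, ?_, ?_, ?_,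
    ?_, ?_⟩
  · have := h.head
    cases l₁ <;> simpa using this
  · have := h.last
    simp only [List.getLast?_append, List.getLast?_cons_cons] at this ⊢
    simpa [List.getLast?_cons] using this
  · have hp : (l₁ ++ red w :: I (some w) ++ blue w :: l₂).Perm
        (I (some w) ++ (l₁ ++ red w :: blue w :: l₂)) := by
      have h1 := List.perm_append_comm_assoc (l₁ ++ [red w]) (I (some w)) (blue w :: l₂)
      simpa using h1
    rw [hp.nodup_iff, List.nodup_append]
    refine ⟨hF.nodup _ hap, hnd'.1, ?_⟩
    rintro g hg _ hg' rfl
    exact hIP g hg ((hmem' g).2 (Or.inl hg'))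
  · have h1 := h.up
    have h2 := hF.up _ hap
    simp only [path] at h2
    rw [List.isChain_split] at h1
    have h3 : List.IsChain (Up v₁ v₂ red blue) (blue w :: l₂) := by
      have := h1.2.tail.tail
      simpa using this
    have h4 : l₁ ++ red w :: I (some w) ++ blue w :: l₂ =
        l₁ ++ red w :: (I (some w) ++ blue w :: l₂) := by simp
    rw [h4, List.isChain_split]
    refine ⟨h1.1, ?_⟩
    rw [← List.cons_append, List.isChain_split]
    exact ⟨h2, h3⟩
  · intro g hg
    rw [hmem, hexp, Set.mem_sdiff, Set.mem_singleton_iff]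
    have h1 := h.mem_iff g hg
    rw [hmem'] at h1
    constructor
    · rintro (h2 | h2)
      · have h3 := h1.1 (Or.inl h2)
        refine ⟨⟨h3.1, ?_⟩, Or.inl h3.2⟩
        rintro rfl; exact hnd'.2 h2
      · refine ⟨⟨hIA g h2, ?_⟩, Or.inr h2⟩
        rintro rfl; exact hwI h2
    · rintro ⟨⟨h2, h3⟩, h4 | h4⟩
      · rcases h1.2 ⟨h2, h4⟩ with h5 | h5
        · exact Or.inl h5
        · exact absurd h5 h3
      · exact Or.inr h4
  · intro g hg hgA
    rw [hexp]
    by_cases h1 : g ∈ A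
    · have : g = w := by
        by_contra h2; exact hgA ⟨h1, h2⟩
      rw [this]; exact Or.inl hwe
    · exact Or.inl (h.removed g hg h1)
  · rintro g hg ⟨hgA, hgw⟩ hgP y hy
    rw [hmem] at hgP
    push Not at hgP
    refine ⟨h.covered g hg hgA ?_ y hy, ?_⟩
    · rw [hmem']; push Not; exact ⟨hgP.1, hgw⟩
    · intro hyw
      have hyw : y = w := hyw
      subst hyw
      -- the only neighbours of the removed vertex in `A` are its two neighbours on the path
      have hnext : R.NextIn A y (blue y) (red y) := by
        have := h.next
        have e : v₂ :: (l₁ ++ red y :: y :: blue y :: l₂) ++ [v₁] =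
          (v₂ :: l₁) ++ red y :: y :: blue y :: (l₂ ++ [v₁]) := by simp
        rw [e] at this
        exact this.triple
      rcases hnext.eq_or_eq (hF.nx_red y hw) (hF.adj_blue y hw) hy.symm hgA with h1 | h1
      · exact hgP.1 (by simp [h1])
      · exact hgP.1 (by simp [h1])
  · obtain ⟨k₁, a₀, hk₁⟩ : ∃ k₁ a₀, v₂ :: l₁ = k₁ ++ [a₀] :=
      ⟨_, _, (List.dropLast_append_getLast (l := v₂ :: l₁) (by simp)).symm⟩
    obtain ⟨b₀, k₂, hk₂⟩ : ∃ b₀ k₂, l₂ ++ [v₁] = b₀ :: k₂ := by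
      cases l₂ with
      | nil => exact ⟨_, _, rfl⟩
      | cons x l => exact ⟨_, _, rfl⟩
    have e1 : v₂ :: (l₁ ++ red w :: w :: blue w :: l₂) ++ [v₁] =
        k₁ ++ a₀ :: red w :: w :: blue w :: b₀ :: k₂ := by
      have : v₂ :: (l₁ ++ red w :: w :: blue w :: l₂) ++ [v₁] =
        (v₂ :: l₁) ++ red w :: w :: blue w :: (l₂ ++ [v₁]) := by simp
      rw [this, hk₁, hk₂]; simp
    have e2 : v₂ :: (l₁ ++ red w :: I (some w) ++ blue w :: l₂) ++ [v₁] =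
        k₁ ++ a₀ :: red w :: (I (some w) ++ blue w :: b₀ :: k₂) := by
      have : v₂ :: (l₁ ++ red w :: I (some w) ++ blue w :: l₂) ++ [v₁] =
        (v₂ :: l₁) ++ red w :: (I (some w) ++ blue w :: (l₂ ++ [v₁])) := by simp
      rw [this, hk₁, hk₂]; simp
    obtain ⟨c, r, hc⟩ : ∃ c r, I (some w) ++ [blue w] = c :: r := by
      cases I (some w) with
      | nil => exact ⟨_, _, rfl⟩
      | cons x l => exact ⟨_, _, rfl⟩
    obtain ⟨r', c', hc'⟩ : ∃ r' c', red w :: I (some w) = r' ++ [c'] :=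
      ⟨_, _, (List.dropLast_append_getLast (l := red w :: I (some w)) (by simp)).symm⟩
    have hold := h.next
    rw [e1] at hold
    have hcor := hF.corner _ hap
    simp only [closedPath, path] at hcor
    have hw1 : w ∉ k₁ ++ [a₀] := by
      rw [← hk₁]
      intro h1
      rcases List.mem_cons.1 h1 with h1 | h1
      · exact hw.2 h1
      · exact hnd'.2 (by simp [h1])
    have hw2 : w ∉ b₀ :: k₂ := by
      rw [← hk₂]
      intro h1
      rcases List.mem_append.1 h1 with h1 | h1
      · exact hnd'.2 (by simp [h1])
      · simp at h1; exact hw.1 h1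
    have hwa : w ≠ red w := fun h1 => hnd'.2 (by rw [← h1]; simp)
    have hwb : w ≠ blue w := fun h1 => hnd'.2 (by rw [← h1]; simp)
    have hmid : ∀ p ∈ red w :: I (some w) ++ [blue w], p ∈ A \ {w} := by
      intro p hp
      simp only [List.cons_append, List.mem_cons, List.mem_append, List.not_mem_nil,
        or_false] at hp
      rcases hp with rfl | hp | rfl
      · exact ⟨haA, hwa.symm⟩
      · exact ⟨hIA p hp, by rintro rfl; exact hwI hp⟩
      · exact ⟨hbA, hwb.symm⟩
    have hL : Chain3 (fun p g s => R.NextIn (A \ {w}) g s p) (red w :: I (some w) ++ [blue w]) := by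
      have : Chain3 (fun p g s => R.nx g s = p) (red w :: I (some w) ++ [blue w]) :=
        (Chain3.left_of_append hcor).tail
      exact this.imp fun a b c ha _ _ hQ => nextIn_of_nx hQ (hmid a ha)
    have hfirst : R.NextIn (A \ {w}) (red w) c a₀ := by
      have h1 : R.nx (red w) c = w := by
        have : w :: (red w :: I (some w) ++ [blue w]) ++ [w] = w :: red w :: c :: (r ++ [w]) := by
          rw [List.cons_append, List.cons_append, List.cons_append, hc]; simp
        rw [this] at hcor
        exact hcor.1
      have h2 : R.NextIn A (red w) w a₀ := hold.triple
      exact (nextIn_of_nx h1 hwA).diff_trans h2 (by rintro rfl; exact hw1 (by simp))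
    have hlast : R.NextIn (A \ {w}) (blue w) b₀ c' := by
      have h1 : R.nx (blue w) w = c' := by
        have : w :: (red w :: I (some w) ++ [blue w]) ++ [w] =
            (w :: r') ++ c' :: blue w :: w :: [] := by
          rw [hc']; simp
        rw [this] at hcor
        exact hcor.triple
      have h2 : R.NextIn A (blue w) b₀ w := by
        have : k₁ ++ a₀ :: red w :: w :: blue w :: b₀ :: k₂ =
          (k₁ ++ [a₀, red w]) ++ w :: blue w :: b₀ :: k₂ := by simp
        rw [this] at hold
        exact hold.triple
      have hcm : c' ∈ red w :: I (some w) := by rw [hc']; simp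
      have hcm' := hmid c' (by
        rw [List.mem_append]; exact Or.inl hcm)
      exact h2.diff_trans (nextIn_of_nx h1 hcm'.1) hcm'.2
    rw [e2, Chain3.append_iff]
    constructor
    · have : Chain3 (fun p g s => R.NextIn A g s p) (k₁ ++ [a₀, red w]) :=
        ((Chain3.append_iff _ _ _ _).1 hold).1
      refine this.imp fun a b c ha _ _ hQ => hQ.diff ?_
      rintro rfl
      simp only [List.mem_append, List.mem_cons, List.not_mem_nil, or_false] at ha hw1
      tauto
    · have e3 : red w :: (I (some w) ++ blue w :: b₀ :: k₂) = r' ++ c' :: blue w :: b₀ :: k₂ := by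
        rw [← List.cons_append, hc']; simp
      have e4 : red w :: (I (some w) ++ blue w :: b₀ :: k₂) = red w :: c :: (r ++ b₀ :: k₂) := by
        have : I (some w) ++ blue w :: b₀ :: k₂ = (I (some w) ++ [blue w]) ++ b₀ :: k₂ := by simp
        rw [this, hc]; simp
      rw [e4]
      refine ⟨hfirst, ?_⟩
      rw [← e4, e3, Chain3.append_iff]
      refine ⟨?_, hlast, ?_⟩
      · rw [hc'] at hL; simpa using hL
      · have h5 : Chain3 (fun p g s => R.NextIn A g s p) (blue w :: b₀ :: k₂) := by
          have : k₁ ++ a₀ :: red w :: w :: blue w :: b₀ :: k₂ =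
            (k₁ ++ [a₀, red w, w]) ++ blue w :: b₀ :: k₂ := by simp
          rw [this] at hold
          exact hold.right_of_append
        refine h5.imp fun a b c ha _ _ hQ => hQ.diff ?_
        rintro rfl
        rcases List.mem_cons.1 ha with h6 | h6
        · exact hwb h6
        · exact hw2 h6

/-- Induction along the shelling. -/
theorem FacialPaths.shelling [Finite V] (hF : FacialPaths R v₁ v₂ red blue I)
    (Q : Set V → List V → Prop) (hbase : Q {v₁, v₂} [v₁, v₂])
    (hstep : ∀ A l₁ w l₂, Inner v₁ v₂ w →
      Stage R v₁ v₂ red blue I A (l₁ ++ red w :: w :: blue w :: l₂) →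
      Stage R v₁ v₂ red blue I (A \ {w}) (l₁ ++ red w :: I (some w) ++ blue w :: l₂) →
      Q (A \ {w}) (l₁ ++ red w :: I (some w) ++ blue w :: l₂) →
      Q A (l₁ ++ red w :: w :: blue w :: l₂)) :
    Q Set.univ (path v₁ v₂ red blue I none) := by
  have key : ∀ (n : ℕ) A P, A.ncard = n → Stage R v₁ v₂ red blue I A P → Q A P := by
    intro n
    induction n using Nat.strong_induction_on with
    | _ n ih =>
      intro A P hn hS
      rcases hS.eq_or_peak hF.base.ne with rfl | ⟨l₁, a, w, b, l₂, rfl, hw, rfl, rfl⟩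
      · rw [hS.eq_base hF]; exact hbase
      · have hS' := hS.remove hF hw
        refine hstep A l₁ w l₂ hw hS hS' (ih _ ?_ _ _ rfl hS')
        rw [← hn]
        exact Set.ncard_sdiff_singleton_lt_of_mem (hS.subset (by simp))
  exact key _ _ _ rfl hF.stage_univ

/-- The facial paths determine a time `t`, which increases from a facial path to its apex, and
a coordinate `x`, which increases along the edges. -/
theorem FacialPaths.exists_time [Finite V] (hF : FacialPaths R v₁ v₂ red blue I) :
    ∃ (t : V → ℕ) (x : V → ℚ),
      (∀ w, Inner v₁ v₂ w → ∀ g ∈ path v₁ v₂ red blue I (some w), t g < t w) ∧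
      ∀ p q, Up v₁ v₂ red blue p q → x p < x q := by
  classical
  have key := hF.shelling (fun A _ => ∃ (t : V → ℕ) (x : V → ℚ),
      (∀ w ∈ A, Inner v₁ v₂ w → ∀ g ∈ path v₁ v₂ red blue I (some w), g ∈ A ∧ t g < t w) ∧
      ∀ p ∈ A, ∀ q ∈ A, Up v₁ v₂ red blue p q → x p < x q) ?_ ?_
  · obtain ⟨t, x, h1, h2⟩ := key
    exact ⟨t, x, fun w hw g hg => (h1 w trivial hw g hg).2, fun p q h => h2 p trivial q trivial h⟩
  · refine ⟨fun _ => 0, fun y => if y = v₁ then 0 else 1, ?_, ?_⟩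
    · rintro w (rfl | rfl) hw
      · exact absurd rfl hw.1
      · exact absurd rfl hw.2
    · have hne := hF.base.ne
      rintro p hp q hq (⟨h1, -⟩ | ⟨h1, -⟩ | ⟨rfl, rfl⟩)
      · rcases hq with rfl | rfl
        · exact absurd rfl h1.1
        · exact absurd rfl h1.2
      · rcases hp with rfl | rfl
        · exact absurd rfl h1.1
        · exact absurd rfl h1.2
      · simp [hne.symm]
  · rintro A l₁ w l₂ hw hS hS' ⟨t, x, ht, hx⟩
    have hap : Apex v₁ v₂ (some w) := by rintro x ⟨⟩; exact hw
    have hpath : ∀ g ∈ path v₁ v₂ red blue I (some w), g ∈ A \ {w} := by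
      intro g hg
      refine hS'.subset ?_
      simp only [path, List.mem_append, List.mem_cons, List.not_mem_nil, or_false] at hg ⊢
      tauto
    have hlt : x (red w) < x (blue w) := by
      have h1 : List.IsChain (fun p q => x p < x q) (path v₁ v₂ red blue I (some w)) :=
        (hF.up _ hap).imp_of_mem_imp fun p q hp hq h => hx p (hpath p hp) q (hpath q hq) h
      have h2 : ((path v₁ v₂ red blue I (some w)).map x).IsChain (· < ·) :=
        List.isChain_map_of_isChain x (fun _ _ h => h) h1
      rw [List.isChain_iff_pairwise] at h2
      simp only [path, List.map_append, List.map_cons, List.cons_append, List.pairwise_cons] at h2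
      exact h2.1 _ (by simp)
    obtain ⟨M, hM⟩ := (Set.finite_range t).bddAbove
    have hM' : ∀ y, t y ≤ M := fun y => hM ⟨y, rfl⟩
    have hpar : ∀ y ∈ A \ {w}, Inner v₁ v₂ y → red y ≠ w ∧ blue y ≠ w := by
      intro y hy hyi
      have h1 := ht y hy hyi (red y) (by simp [path])
      have h2 := ht y hy hyi (blue y) (by simp [path])
      exact ⟨h1.1.2, h2.1.2⟩
    have hwr : red w ≠ w := (hpath (red w) (by simp [path])).2
    have hwb : blue w ≠ w := (hpath (blue w) (by simp [path])).2
    -- `w` comes later than all other vertices, and its coordinate is between those of its neighbours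
    refine ⟨Function.update t w (M + 1), Function.update x w ((x (red w) + x (blue w)) / 2), ?_, ?_⟩
    · intro y hy hyi g hg
      by_cases hyw : y = w
      · subst hyw
        have := hpath g hg
        refine ⟨this.1, ?_⟩
        rw [Function.update_self, Function.update_of_ne this.2]
        have := hM' g; omega
      · obtain ⟨h1, h2⟩ := ht y ⟨hy, hyw⟩ hyi g hg
        exact ⟨h1.1, by rw [Function.update_of_ne hyw, Function.update_of_ne h1.2]; exact h2⟩
    · intro p hp q hq hpq
      by_cases hpw : p = w
      · subst hpw
        have hqb : q = blue p := by
          rcases hpq with ⟨h1, h2⟩ | ⟨-, h2⟩ | ⟨h2, -⟩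
          · exfalso
            by_cases hqp : q = p
            · exact hwr (hqp ▸ h2)
            · exact (hpar q ⟨hq, hqp⟩ h1).1 h2
          · exact h2.symm
          · exact absurd h2 hw.1
        subst hqb
        rw [Function.update_self, Function.update_of_ne hwb]
        linarith
      · by_cases hqw : q = w
        · subst hqw
          have hqb : p = red q := by
            rcases hpq with ⟨-, h2⟩ | ⟨h1, h2⟩ | ⟨-, h2⟩
            · exact h2.symm
            · exact absurd h2 (hpar p ⟨hp, hpw⟩ h1).2
            · exact absurd h2 hw.2
          subst hqb
          rw [Function.update_self, Function.update_of_ne hwr]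
          linarith
        · rw [Function.update_of_ne hpw, Function.update_of_ne hqw]
          exact hx p ⟨hp, hpw⟩ q ⟨hq, hqw⟩ hpq

end RotationSystem

/-! ### Building a plane graph by adding vertices of degree two -/

namespace Chain3

variable {α : Type*} {Q Q' : α → α → α → Prop}

/-- A weakening of the relation is needed only for the elements in the middle of a triple. -/
theorem imp_mid {y z : α} {l : List α} (h : Chain3 Q (y :: l ++ [z]))
    (hQ : ∀ a b c, b ∈ l → Q a b c → Q' a b c) : Chain3 Q' (y :: l ++ [z]) := by
  induction l generalizing y with
  | nil => trivial
  | cons b l ih =>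
    obtain ⟨c, r, hr⟩ : ∃ c r, l ++ [z] = c :: r := by
      cases l with
      | nil => exact ⟨_, _, rfl⟩
      | cons x l => exact ⟨_, _, rfl⟩
    have ih' := ih (y := b) h.tail fun a b c hb => hQ a b c (List.mem_cons_of_mem _ hb)
    simp only [List.cons_append, hr] at h ih' ⊢
    exact ⟨hQ _ _ _ (by simp) h.1, ih'⟩

theorem reverse {l : List α} (h : Chain3 Q l) : Chain3 (fun a b c => Q c b a) l.reverse := by
  induction l with
  | nil => trivial
  | cons a l ih =>
    match l, h, ih with
    | [], _, _ => trivial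
    | [_], _, _ => trivial
    | b :: c :: l, h, ih =>
      have e : (a :: b :: c :: l).reverse = l.reverse ++ c :: b :: [a] := by simp
      rw [e, append_iff]
      refine ⟨?_, h.1, trivial⟩
      simpa using ih h.2

end Chain3

namespace RotationSystem

variable {V : Type u} {G : SimpleGraph V} {R : RotationSystem G} {v₁ v₂ : V}

/-- `Build R v₁ v₂ o P`: starting with the base edge, the vertices of the list `o` (latest first)
have been added one by one, each one in the outer face and joined to exactly two
vertices of the outer path, which is `P` in the end. The closed outer path enters `a` and `b` from `a₀`
and `b₀`; that these follow `x` clockwise around `a` and `b` means that `x` is in the outer face. -/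
inductive Build (R : RotationSystem G) (v₁ v₂ : V) : List V → List V → Prop
  | base : Build R v₁ v₂ [v₂, v₁] [v₁, v₂]
  | step (o l₁ m l₂ k k' : List V) (a b x a₀ b₀ : V) (h : Build R v₁ v₂ o (l₁ ++ a :: m ++ b :: l₂))
      (hx : x ∉ o) (hadj : ∀ y ∈ o, G.Adj x y ↔ y = a ∨ y = b) (hk : v₂ :: l₁ = k ++ [a₀])
      (hk' : a :: m = k' ++ [b₀]) (ha : R.NextIn {y | y ∈ o} a x a₀)
      (hb : R.NextIn {y | y ∈ o} b x b₀) : Build R v₁ v₂ (x :: o) (l₁ ++ a :: x :: b :: l₂)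

/-- The shelling in reverse order: when `w` is removed, `red w` and `blue w` are the only neighbours of `w`
that are left. -/
theorem FacialPaths.exists_build [Finite V] {red blue : V → V} {I : Option V → List V}
    (hF : FacialPaths R v₁ v₂ red blue I) : ∃ o P, Build R v₁ v₂ o P ∧ ∀ y, y ∈ o := by
  have := hF.shelling (fun A P => ∃ o, Build R v₁ v₂ o P ∧ ∀ y, y ∈ o ↔ y ∈ A) ?_ ?_
  · obtain ⟨o, h, ho⟩ := this
    exact ⟨o, _, h, fun y => (ho y).2 trivial⟩
  · exact ⟨_, Build.base, by intro y; simp [or_comm]⟩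
  · rintro A l₁ w l₂ hw hS hS' ⟨o, hB, ho⟩
    have hA : {y | y ∈ o} = A \ {w} := Set.ext ho
    have hwA : w ∈ A := hS.subset (by simp)
    obtain ⟨k, a₀, hk⟩ : ∃ k₁ a₀, v₂ :: l₁ = k₁ ++ [a₀] :=
      ⟨_, _, (List.dropLast_append_getLast (l := v₂ :: l₁) (by simp)).symm⟩
    obtain ⟨k', b₀, hk'⟩ : ∃ r' c', red w :: I (some w) = r' ++ [c'] :=
      ⟨_, _, (List.dropLast_append_getLast (l := red w :: I (some w)) (by simp)).symm⟩
    have hold := hS.next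
    have e1 : v₂ :: (l₁ ++ red w :: w :: blue w :: l₂) ++ [v₁] =
        k ++ a₀ :: red w :: w :: (blue w :: l₂ ++ [v₁]) := by
      have : v₂ :: (l₁ ++ red w :: w :: blue w :: l₂) ++ [v₁] =
        (v₂ :: l₁) ++ red w :: w :: blue w :: (l₂ ++ [v₁]) := by simp
      rw [this, hk]; simp
    have e2 : v₂ :: (l₁ ++ red w :: w :: blue w :: l₂) ++ [v₁] =
        (v₂ :: l₁) ++ red w :: w :: blue w :: (l₂ ++ [v₁]) := by simp
    have hab : R.NextIn A w (blue w) (red w) := by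
      rw [e2] at hold; exact hold.triple
    refine ⟨w :: o, Build.step o l₁ (I (some w)) l₂ k k' (red w) (blue w) w a₀ b₀ hB ?_ ?_ hk hk' ?_ ?_,
      ?_⟩
    · rw [ho]; exact fun h => h.2 rfl
    · intro y hy
      have hy' := (ho y).1 hy
      constructor
      · intro h; exact hab.eq_or_eq (hF.nx_red w hw) (hF.adj_blue w hw) h hy'.1
      · rintro (rfl | rfl)
        · exact hF.adj_red w hw
        · exact hF.adj_blue w hw
    · rw [hA]
      have h1 : R.NextIn A (red w) w a₀ := by rw [e1] at hold; exact hold.triple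
      refine h1.diff ?_
      have hn := hS.nodup
      rintro rfl
      have h2 : a₀ ∈ v₂ :: l₁ := by rw [hk]; simp
      rcases List.mem_cons.1 h2 with h2 | h2
      · exact hw.2 h2
      · rw [List.nodup_append] at hn
        exact hn.2.2 _ h2 _ (by simp) rfl
    · rw [hA]
      have hap : Apex v₁ v₂ (some w) := by rintro x ⟨⟩; exact hw
      have hcor := hF.corner _ hap
      simp only [closedPath, path] at hcor
      have e3 : w :: (red w :: I (some w) ++ [blue w]) ++ [w] = (w :: k') ++ b₀ :: blue w :: w :: [] := by
        rw [hk']; simp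
      rw [e3] at hcor
      refine nextIn_of_nx hcor.triple (hS'.subset ?_)
      have : b₀ ∈ red w :: I (some w) := by rw [hk']; simp
      simp only [List.mem_append, List.mem_cons] at this ⊢
      tauto
    · intro y
      rw [List.mem_cons, ho, Set.mem_sdiff, Set.mem_singleton_iff]
      constructor
      · rintro (rfl | h)
        · exact hwA
        · exact h.1
      · intro h
        by_cases hy : y = w
        · exact Or.inl hy
        · exact Or.inr ⟨h, hy⟩

/-- The invariants of the construction. -/
structure BuildFacts (R : RotationSystem G) (v₁ v₂ : V) (o P : List V) : Prop where
  nodup_o : o.Nodup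
  eq_append : ∃ o', o = o' ++ [v₂, v₁]
  head : P.head? = some v₁
  last : P.getLast? = some v₂
  nodup : P.Nodup
  subset : ∀ y ∈ P, y ∈ o
  adj : List.IsChain G.Adj (v₂ :: P ++ [v₁])
  next : Chain3 (fun p g s => R.NextIn {y | y ∈ o} g s p) (v₂ :: P ++ [v₁])
  length : P.length = 2 → o = [v₂, v₁]
  connected : (G.induce {y | y ∈ o}).Connected
  connected_diff : ∀ y ∈ o, (G.induce ({y | y ∈ o} \ {y})).Connected

theorem connected_insert {B : Set V} {a x : V} (h : (G.induce B).Connected) (ha : a ∈ B)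
    (hax : G.Adj x a) : (G.induce (insert x B)).Connected := by
  have h1 := G.induce_union_connected (s := {x, a}) (t := B)
    (G.induce_pair_connected_of_adj hax).preconnected h.preconnected ⟨a, by simp, ha⟩
  have : ({x, a} ∪ B : Set V) = insert x B := by
    ext y; simp only [Set.mem_union, Set.mem_insert_iff, Set.mem_singleton_iff]
    constructor
    · rintro ((h | rfl) | h) <;> tauto
    · tauto
  rw [this] at h1
  exact h1

theorem connected_singleton (x : V) : (G.induce {x}).Connected := by
  have : Nonempty ({x} : Set V) := ⟨⟨x, rfl⟩⟩
  refine SimpleGraph.Connected.mk fun a b => ?_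
  have : a = b := Subtype.ext (a.2.trans b.2.symm)
  rw [this]

theorem Build.facts [Finite V] (hbase : G.Adj v₁ v₂) {o P : List V} (h : Build R v₁ v₂ o P) :
    BuildFacts R v₁ v₂ o P := by
  induction h with
  | base =>
    have hs : ({y | y ∈ [v₂, v₁]} : Set V) = {v₂, v₁} := by ext; simp
    refine ⟨by simp [hbase.ne.symm], ⟨[], rfl⟩, rfl, rfl, by simp [hbase.ne], ?_, ?_, ?_,
      fun _ => rfl, ?_, ?_⟩
    · intro y; simp; tauto
    · simp [hbase, hbase.symm]
    · rw [hs]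
      refine ⟨?_, ?_, trivial⟩
      · obtain ⟨b, hb⟩ := R.exists_nextIn (A := {v₂, v₁}) hbase hbase (by simp)
        have hb1 := hb.adj hbase
        have : b = v₂ := by
          rcases hb.1 with h | h
          · exact h
          · exact absurd h.symm hb1.ne
        rwa [this] at hb
      · obtain ⟨b, hb⟩ := R.exists_nextIn (A := {v₂, v₁}) hbase.symm hbase.symm (by simp)
        have hb1 := hb.adj hbase.symm
        have : b = v₁ := by
          rcases hb.1 with h | h
          · exact absurd h.symm hb1.ne
          · exact h
        rwa [this] at hb
    · rw [hs]; exact connected_insert (connected_singleton _) rfl hbase.symm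
    · rw [hs]
      intro y hy
      simp only [List.mem_cons, List.not_mem_nil, or_false] at hy
      have hne := hbase.ne
      rcases hy with rfl | rfl
      · have : ({y, v₁} \ {y} : Set V) = {v₁} := by ext z; simp; rintro rfl; exact hne
        rw [this]; exact connected_singleton _
      · have : ({v₂, y} \ {y} : Set V) = {v₂} := by
          ext z; simp; constructor
          · tauto
          · rintro rfl; exact ⟨Or.inl rfl, hne.symm⟩
        rw [this]; exact connected_singleton _
  | step o l₁ m l₂ k k' a b x a₀ b₀ _ hx hadj hk hk' hna hnb ih =>
    have hs : ({y | y ∈ x :: o} : Set V) = insert x {y | y ∈ o} := by ext; simp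
    have hao : a ∈ o := ih.subset a (by simp)
    have hbo : b ∈ o := ih.subset b (by simp)
    have hxa : G.Adj x a := (hadj a hao).2 (Or.inl rfl)
    have hxb : G.Adj x b := (hadj b hbo).2 (Or.inr rfl)
    have hxP : x ∉ l₁ ++ a :: m ++ b :: l₂ := fun h => hx (ih.subset x h)
    have hsub : (l₁ ++ a :: b :: l₂).Sublist (l₁ ++ a :: m ++ b :: l₂) := by
      rw [List.append_assoc]
      refine (List.Sublist.refl _).append ?_
      rw [List.cons_append]
      exact (List.sublist_append_right m _).cons_cons a
    have hnd := hsub.nodup ih.nodup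
    have hab : a ≠ b := by
      rintro rfl
      rw [List.nodup_append] at hnd
      simp at hnd
    have hmem : ∀ y, y ∈ l₁ ++ a :: x :: b :: l₂ ↔ (y ∈ l₁ ++ a :: b :: l₂ ∨ y = x) := by
      intro y; simp only [List.mem_append, List.mem_cons]; tauto
    obtain ⟨b₁, k₂, hk₂⟩ : ∃ b₁ k₂, l₂ ++ [v₁] = b₁ :: k₂ := by
      cases l₂ with
      | nil => exact ⟨_, _, rfl⟩
      | cons x l => exact ⟨_, _, rfl⟩
    obtain ⟨c, r, hc⟩ : ∃ c r, m ++ [b] = c :: r := by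
      cases m with
      | nil => exact ⟨_, _, rfl⟩
      | cons x l => exact ⟨_, _, rfl⟩
    have e0 : v₂ :: (l₁ ++ a :: m ++ b :: l₂) ++ [v₁] = (v₂ :: l₁) ++ a :: (m ++ b :: (l₂ ++ [v₁])) := by
      simp
    have e0' : v₂ :: (l₁ ++ a :: m ++ b :: l₂) ++ [v₁] = (v₂ :: l₁ ++ a :: m) ++ b :: (l₂ ++ [v₁]) := by
      simp
    have e1 : v₂ :: (l₁ ++ a :: m ++ b :: l₂) ++ [v₁] = k ++ a₀ :: a :: c :: (r ++ b₁ :: k₂) := by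
      have : m ++ b :: (l₂ ++ [v₁]) = (m ++ [b]) ++ (l₂ ++ [v₁]) := by simp
      rw [e0, hk, this, hc, hk₂]; simp
    have e2 : v₂ :: (l₁ ++ a :: m ++ b :: l₂) ++ [v₁] = (v₂ :: l₁ ++ k') ++ b₀ :: b :: b₁ :: k₂ := by
      rw [e0', hk', hk₂]; simp
    have e3 : v₂ :: (l₁ ++ a :: x :: b :: l₂) ++ [v₁] = k ++ a₀ :: a :: x :: b :: b₁ :: k₂ := by
      have : v₂ :: (l₁ ++ a :: x :: b :: l₂) ++ [v₁] = (v₂ :: l₁) ++ a :: x :: b :: (l₂ ++ [v₁]) := by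
        simp
      rw [this, hk, hk₂]; simp
    have hold1 := ih.next
    have hold2 := ih.next
    rw [e1] at hold1
    rw [e2] at hold2
    have t1 : R.NextIn {y | y ∈ o} a c a₀ := hold1.triple
    have t2 : R.NextIn {y | y ∈ o} b b₁ b₀ := hold2.triple
    have hadj' := ih.adj
    have hbb₁ : G.Adj b b₁ := by
      rw [e2, List.isChain_split] at hadj'
      exact (List.isChain_cons_cons.1 (List.isChain_cons_cons.1 hadj'.2).2).1
    have hb₁o : b₁ ∈ o := by
      have h1 : b₁ ∈ l₂ ++ [v₁] := by rw [hk₂]; simp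
      rcases List.mem_append.1 h1 with h1 | h1
      · exact ih.subset _ (by simp [h1])
      · obtain ⟨o', ho'⟩ := ih.eq_append
        simp at h1; rw [h1, ho']; simp
    refine ⟨?_, ?_, ?_, ?_, ?_, ?_, ?_, ?_, ?_, ?_, ?_⟩
    · exact List.nodup_cons.2 ⟨hx, ih.nodup_o⟩
    · obtain ⟨o', ho'⟩ := ih.eq_append
      exact ⟨x :: o', by rw [ho']; rfl⟩
    · have := ih.head
      cases l₁ <;> simpa using this
    · have := ih.last
      simp only [List.getLast?_append, List.getLast?_cons_cons] at this ⊢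
      simpa [List.getLast?_cons] using this
    · have hp : (l₁ ++ a :: x :: b :: l₂).Perm (x :: (l₁ ++ a :: b :: l₂)) := by
        have := (List.perm_middle (a := x) (l₁ := l₁ ++ [a]) (l₂ := b :: l₂))
        simpa using this
      rw [hp.nodup_iff, List.nodup_cons]
      exact ⟨fun h => hxP (hsub.subset h), hnd⟩
    · intro y hy
      rw [hmem] at hy
      rcases hy with hy | rfl
      · exact List.mem_cons_of_mem _ (ih.subset y (hsub.subset hy))
      · simp
    · have h1 := hadj'
      rw [e0, List.isChain_split] at h1
      rw [e0', List.isChain_split] at hadj'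
      have : v₂ :: (l₁ ++ a :: x :: b :: l₂) ++ [v₁] = (v₂ :: l₁) ++ a :: x :: b :: (l₂ ++ [v₁]) := by
        simp
      rw [this, List.isChain_split]
      exact ⟨h1.1, List.isChain_cons_cons.2 ⟨hxa.symm, List.isChain_cons_cons.2 ⟨hxb, hadj'.2⟩⟩⟩
    · rw [hs, e3, Chain3.append_iff]
      have hoth : ∀ {g s p : V}, g ∈ o → g ≠ a → g ≠ b → G.Adj g s → R.NextIn {y | y ∈ o} g s p →
          R.NextIn (insert x {y | y ∈ o}) g s p := by
        intro g s p hg hga hgb hgs hn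
        refine hn.insert_of_not_adj hgs fun h => ?_
        rcases (hadj g hg).1 h.symm with h | h
        · exact hga h
        · exact hgb h
      -- adjacency of consecutive elements is carried along with the corner condition
      have hboth : Chain3 (fun p g s => G.Adj g s ∧ R.NextIn {y | y ∈ o} g s p)
          (v₂ :: (l₁ ++ a :: m ++ b :: l₂) ++ [v₁]) := by
        have : ∀ l : List V, List.IsChain G.Adj l → Chain3 (fun p g s => R.NextIn {y | y ∈ o} g s p) l →
            Chain3 (fun p g s => G.Adj g s ∧ R.NextIn {y | y ∈ o} g s p) l := by
          intro l
          induction l with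
          | nil => intros; trivial
          | cons p l ihl =>
            match l, ihl with
            | [], _ => intros; trivial
            | [_], _ => intros; trivial
            | g :: s :: l, ihl =>
              intro h1 h2
              rw [List.isChain_cons_cons] at h1
              exact ⟨⟨(List.isChain_cons_cons.1 h1.2).1, h2.1⟩, ihl h1.2 h2.2⟩
        exact this _ ih.adj ih.next
      have hb1 := hboth
      have hb2 := hboth
      rw [e1, Chain3.append_iff] at hb1
      have e5 : k ++ [a₀, a] = v₂ :: l₁ ++ [a] := by rw [hk]; simp
      have hb2' : Chain3 (fun p g s => G.Adj g s ∧ R.NextIn {y | y ∈ o} g s p) (b :: l₂ ++ [v₁]) := by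
        rw [e0'] at hb2
        have := hb2.right_of_append
        simpa using this
      refine ⟨?_, NextIn.insert_right hna, ?_, ?_, ?_⟩
      · rw [e5]
        have h1 := hb1.1
        rw [e5] at h1
        refine h1.imp_mid fun p g s hg hQ => ?_
        refine hoth (ih.subset g (by simp [hg])) ?_ ?_ hQ.1 hQ.2
        · rintro rfl
          rw [List.nodup_append] at hnd
          exact hnd.2.2 _ hg _ (by simp) rfl
        · rintro rfl
          rw [List.nodup_append] at hnd
          exact hnd.2.2 _ hg _ (by simp) rfl
      · obtain ⟨f, hf⟩ := R.exists_nextIn (A := insert x {y | y ∈ o}) hxb hxb (Or.inr hbo)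
        have hxf := hf.adj hxb
        have hfo : f ∈ o := by
          rcases hf.1 with h1 | h1
          · exact absurd h1.symm hxf.ne
          · exact h1
        rcases (hadj f hfo).1 hxf with rfl | rfl
        · exact hf
        · exact absurd (hf.eq_of_self hxb hxa (Or.inr hao)) hab
      · exact NextIn.insert_left hbb₁ hxb.symm hb₁o hx t2 hnb
      · have h1 := hb2'
        have e6 : b :: l₂ ++ [v₁] = b :: b₁ :: k₂ := by rw [List.cons_append, hk₂]
        rw [← e6]
        refine h1.imp_mid fun p g s hg hQ => ?_
        refine hoth (ih.subset g (by simp [hg])) ?_ ?_ hQ.1 hQ.2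
        · rintro rfl
          rw [List.nodup_append] at hnd
          have := hnd.2.1
          simp [hg] at this
        · rintro rfl
          rw [List.nodup_append] at hnd
          have := hnd.2.1
          simp [hg] at this
    · intro h
      simp at h
      omega
    · rw [hs]; exact connected_insert ih.connected hao hxa
    · intro y hy
      rw [hs]
      by_cases hyx : y = x
      · subst hyx
        have : (insert y {z | z ∈ o} \ {y} : Set V) = {z | z ∈ o} := by
          ext z; simp; rintro hz rfl; exact hx hz
        rw [this]; exact ih.connected
      · have hyo : y ∈ o := by
          rcases List.mem_cons.1 hy with h | h
          · exact absurd h hyx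
          · exact h
        have e : (insert x {z | z ∈ o} \ {y} : Set V) = insert x ({z | z ∈ o} \ {y}) := by
          ext z; simp only [Set.mem_sdiff, Set.mem_insert_iff, Set.mem_ofPred_eq, Set.mem_singleton_iff]
          constructor
          · tauto
          · rintro (rfl | h)
            · exact ⟨Or.inl rfl, fun h => hyx h.symm⟩
            · tauto
        rw [e]
        by_cases hya : a = y
        · exact connected_insert (ih.connected_diff y hyo) ⟨hbo, fun h => hab (hya.trans (Eq.symm h))⟩ hxb
        · exact connected_insert (ih.connected_diff y hyo) ⟨hao, hya⟩ hxa

/-- The earlier stages of a construction. -/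
theorem Build.suffix {o P : List V} (h : Build R v₁ v₂ o P) : ∀ s o', o = s ++ o' → 2 ≤ o'.length →
    ∃ P', Build R v₁ v₂ o' P' := by
  induction h with
  | base =>
    intro s o' hs hl
    cases s with
    | nil => simp at hs; subst hs; exact ⟨_, Build.base⟩
    | cons a s =>
      have := congrArg List.length hs
      simp at this; omega
  | step o l₁ m l₂ k k' a b x a₀ b₀ hB hx hadj hk hk' hna hnb ih =>
    intro s o' hs hl
    cases s with
    | nil =>
      simp at hs; subst hs
      exact ⟨_, Build.step o l₁ m l₂ k k' a b x a₀ b₀ hB hx hadj hk hk' hna hnb⟩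
    | cons y s =>
      simp at hs
      exact ih s o' hs.2 hl

end RotationSystem

/-! ### Outer paths and canonical orders -/

namespace RotationSystem

variable {V : Type u} {G : SimpleGraph V} {R : RotationSystem G} {v₁ v₂ : V}

theorem exists_walk_of_isChain {W : Type u} {K : SimpleGraph W} (l : List W) (x y : W)
    (hc : List.IsChain K.Adj l) (hx : l.head? = some x) (hy : l.getLast? = some y) :
    ∃ q : K.Walk x y, q.support = l := by
  induction l generalizing x with
  | nil => simp at hx
  | cons a l ih =>
    simp at hx; subst hx
    cases l with
    | nil => simp at hy; subst hy; exact ⟨SimpleGraph.Walk.nil, rfl⟩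
    | cons b l =>
      rw [List.isChain_cons_cons] at hc
      rw [List.getLast?_cons_cons] at hy
      obtain ⟨q, hq⟩ := ih b hc.2 rfl hy
      exact ⟨SimpleGraph.Walk.cons hc.1 q, by simp [hq]⟩

theorem mem_darts_of_support {W : Type u} {K : SimpleGraph W} {x y : W} (q : K.Walk x y)
    {s t : List W} {g p : W} (h : q.support = s ++ g :: p :: t) :
    ∃ hgp : K.Adj g p, (⟨(g, p), hgp⟩ : K.Dart) ∈ q.darts := by
  induction q generalizing s with
  | nil =>
    have := congrArg List.length h
    simp at this; omega
  | @cons u v w huv q ih =>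
    cases s with
    | nil =>
      rw [SimpleGraph.Walk.support_cons, ← q.cons_tail_support] at h
      simp only [List.nil_append, List.cons.injEq] at h
      obtain ⟨rfl, rfl, -⟩ := h
      exact ⟨huv, by simp⟩
    | cons a s =>
      rw [SimpleGraph.Walk.support_cons] at h
      simp at h
      obtain ⟨h1, h2⟩ := ih h.2
      exact ⟨h1, by simp [h2]⟩

/-- A walk that turns to the next neighbour at each vertex follows the boundary of a face. -/
theorem isChain_facePerm_darts {W : Type u} {K : SimpleGraph W} (S : RotationSystem K) {x y : W}
    (q : K.Walk x y) (h : Chain3 (fun s g p => S.nx g s = p) q.support) :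
    List.IsChain (fun e e' => S.facePerm e = e') q.darts := by
  induction q with
  | nil => simp
  | @cons u v w huv q ih =>
    rw [SimpleGraph.Walk.support_cons] at h
    rw [SimpleGraph.Walk.darts_cons]
    have ih' := ih h.tail
    cases q with
    | nil => simp
    | @cons _ z _ hvz q =>
      rw [SimpleGraph.Walk.darts_cons] at ih' ⊢
      rw [List.isChain_cons_cons]
      refine ⟨?_, ih'⟩
      rw [S.facePerm_mk]
      rw [SimpleGraph.Walk.support_cons, ← q.cons_tail_support] at h
      have : S.nx v u = z := h.1
      simp [this]

theorem notMem_edges_of_isPath {W : Type u} {K : SimpleGraph W} {x y : W} (q : K.Walk x y)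
    (hq : q.IsPath) (hl : 3 ≤ q.support.length) : s(y, x) ∉ q.edges := by
  intro he
  cases q with
  | nil => simp at he
  | @cons _ c _ hac q =>
    rw [SimpleGraph.Walk.cons_isPath_iff] at hq
    rw [SimpleGraph.Walk.edges_cons, List.mem_cons] at he
    rcases he with he | he
    · have hc : c = y := by
        rw [Sym2.eq_iff] at he
        rcases he with ⟨h1, h2⟩ | ⟨h1, -⟩
        · exact h2.symm.trans h1.symm
        · exact h1.symm
      subst hc
      have hnil := SimpleGraph.Walk.length_eq_zero_iff.2 (SimpleGraph.Walk.isPath_iff_nil.1 hq.1)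
      rw [SimpleGraph.Walk.length_support, SimpleGraph.Walk.length_cons] at hl
      omega
    · exact hq.2 (SimpleGraph.Walk.snd_mem_support_of_mem_edges q he)

theorem IsChain.sameCycle {X : Type*} (σ : Equiv.Perm X) (l : List X) {a : X}
    (h : List.IsChain (fun e e' => σ e = e') (a :: l)) : ∀ e ∈ a :: l, σ.SameCycle a e := by
  induction l generalizing a with
  | nil => intro e he; simp at he; rw [he]
  | cons b l ih =>
    intro e he
    rw [List.isChain_cons_cons] at h
    rcases List.mem_cons.1 he with rfl | he
    · exact Equiv.Perm.SameCycle.rfl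
    · have := ih h.2 e he
      rw [← h.1] at this
      exact Equiv.Perm.sameCycle_apply_left.1 this

/-- Given the inherited rotation system of a stage of the construction, the outer face is bounded by
the base edge and the outer path. -/
theorem BuildFacts.exists_outerPath [Finite V] {o P : List V} (h : BuildFacts R v₁ v₂ o P)
    (hlen : 3 ≤ o.length) (R' : RotationSystem (G.induce {y | y ∈ o}))
    (hR' : R'.IsInherited (inclusionHom G _) R) :
    ∃ (d : (G.induce {y | y ∈ o}).Dart) (q : (G.induce {y | y ∈ o}).Walk d.snd d.fst),
      (d.fst : V) = v₁ ∧ (d.snd : V) = v₂ ∧ IsOuterPath R' d q ∧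
      (∀ y : {y | y ∈ o}, (y : V) ∈ P → y ∈ q.support) ∧
      ∀ s t (p g : {y | y ∈ o}), v₂ :: P = s ++ (p : V) :: g :: t →
        ∃ hgp : (G.induce {y | y ∈ o}).Adj g p, R'.OnLeftFace d ⟨(g, p), hgp⟩ := by
  have hv₁ : v₁ ∈ o := by obtain ⟨o', ho'⟩ := h.eq_append; rw [ho']; simp
  have hv₂ : v₂ ∈ o := by obtain ⟨o', ho'⟩ := h.eq_append; rw [ho']; simp
  obtain ⟨P', rfl⟩ : ∃ P' : List {y | y ∈ o}, P'.map Subtype.val = P :=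
    ⟨P.pmap (fun y hy => (⟨y, hy⟩ : {y | y ∈ o})) h.subset, by rw [List.map_pmap, List.pmap_eq_map]; simp⟩
  let a₁ : {y | y ∈ o} := ⟨v₁, hv₁⟩
  let a₂ : {y | y ∈ o} := ⟨v₂, hv₂⟩
  have hmapL : (a₂ :: P' ++ [a₁]).map Subtype.val = v₂ :: P'.map Subtype.val ++ [v₁] := by
    simp [a₁, a₂]
  have hchain : List.IsChain (G.induce {y | y ∈ o}).Adj (a₂ :: P' ++ [a₁]) := by
    have := h.adj
    rw [← hmapL, List.isChain_map] at this
    exact this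
  have hcorner : Chain3 (fun p g s => R'.nx g s = p) (a₂ :: P' ++ [a₁]) := by
    have h1 := h.next
    rw [← hmapL] at h1
    have : ∀ l : List {y | y ∈ o}, List.IsChain (G.induce {y | y ∈ o}).Adj l →
        Chain3 (fun p g s => R.NextIn {y | y ∈ o} g s p) (l.map Subtype.val) →
        Chain3 (fun p g s => R'.nx g s = p) l := by
      intro l
      induction l with
      | nil => intros; trivial
      | cons p l ihl =>
        match l, ihl with
        | [], _ => intros; trivial
        | [_], _ => intros; trivial
        | g :: s :: l, ihl =>
          intro h1 h2
          rw [List.isChain_cons_cons] at h1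
          have h3 : (G.induce {y | y ∈ o}).Adj g s := (List.isChain_cons_cons.1 h1.2).1
          have h4 := (R.isInherited_inclusionHom_iff R').1 hR' g s h3
          exact ⟨Subtype.ext (h4.unique h2.1), ihl h1.2 h2.2⟩
    exact this _ hchain h1
  have hhead : P'.head? = some a₁ := by
    have := h.head
    rw [List.head?_map] at this
    cases hh : P'.head? with
    | none => rw [hh] at this; simp at this
    | some z => rw [hh] at this; simp at this; congr 1; exact Subtype.ext this
  have hlast : P'.getLast? = some a₂ := by
    have := h.last
    rw [List.getLast?_map] at this
    cases hh : P'.getLast? with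
    | none => rw [hh] at this; simp at this
    | some z => rw [hh] at this; simp at this; congr 1; exact Subtype.ext this
  have hnd : P'.Nodup := List.Nodup.of_map _ h.nodup
  obtain ⟨q, hq⟩ := exists_walk_of_isChain (K := G.induce {y | y ∈ o}) P'.reverse a₂ a₁
    (by
      rw [List.isChain_reverse]
      have h1 := hchain.tail
      simp only [List.cons_append, List.tail_cons] at h1
      exact h1.left_of_append.imp fun a b hab => hab.symm)
    (by rw [List.head?_reverse, hlast]) (by rw [List.getLast?_reverse, hhead])
  have h12 : (G.induce {y | y ∈ o}).Adj a₁ a₂ := by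
    have : G.Adj v₂ v₁ := by
      have h1 := h.adj
      have h2 := h.head
      cases hP : P'.map Subtype.val with
      | nil => rw [hP] at h2; simp at h2
      | cons z l =>
        rw [hP] at h1 h2
        simp at h2; subst h2
        exact (List.isChain_cons_cons.1 h1).1
    exact this.symm
  have hsupp : (SimpleGraph.Walk.cons h12 q).support = a₁ :: P'.reverse := by
    rw [SimpleGraph.Walk.support_cons, hq]
  have hrev : (a₂ :: P' ++ [a₁]).reverse = a₁ :: P'.reverse ++ [a₂] := by simp
  have hcr : Chain3 (fun s g p => R'.nx g s = p) (a₁ :: P'.reverse ++ [a₂]) := by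
    rw [← hrev]; exact hcorner.reverse
  have hfc := R'.isChain_facePerm_darts (SimpleGraph.Walk.cons h12 q)
    (by rw [hsupp]; exact hcr.left_of_append)
  have hsame : ∀ e ∈ (SimpleGraph.Walk.cons h12 q).darts, R'.OnLeftFace ⟨(a₁, a₂), h12⟩ e := by
    rw [SimpleGraph.Walk.darts_cons] at hfc ⊢
    exact IsChain.sameCycle _ _ hfc
  have hclosed : ∀ e ∈ (SimpleGraph.Walk.cons h12 q).darts,
      R'.facePerm e ∈ (SimpleGraph.Walk.cons h12 q).darts := by
    intro e he
    obtain ⟨s, t, hst⟩ := List.append_of_mem he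
    cases t with
    | cons e' t =>
      rw [hst] at hfc
      have := hfc.right_of_append
      rw [List.isChain_cons_cons] at this
      rw [this.1, hst]; simp
    | nil =>
      have hsup : (SimpleGraph.Walk.cons h12 q).support =
          a₁ :: (SimpleGraph.Walk.cons h12 q).darts.map (·.snd) :=
        (SimpleGraph.Walk.cons_map_snd_darts _).symm
      have hsup' : (SimpleGraph.Walk.cons h12 q).support =
          (SimpleGraph.Walk.cons h12 q).darts.map (·.fst) ++ [a₁] :=
        (SimpleGraph.Walk.map_fst_darts_append _).symm
      rw [hsupp] at hsup'
      rw [hst] at hsup'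
      have h1 : e.snd = a₁ := by
        have h2 := hsup
        rw [hst] at h2
        have h3 : (SimpleGraph.Walk.cons h12 q).support.getLast? = some a₁ := by
          rw [hsupp, List.getLast?_cons, List.getLast?_reverse, hhead]; rfl
        rw [h2] at h3
        simpa [List.getLast?_cons, List.getLast?_append] using h3
      have h2 : R'.nx a₁ e.fst = a₂ := by
        rw [hsup'] at hcr
        have e6 : (s ++ [e]).map (·.fst) ++ [a₁] ++ [a₂] = s.map (·.fst) ++ e.fst :: a₁ :: a₂ :: [] := by
          simp
        rw [e6] at hcr
        exact hcr.triple
      have h3 : R'.facePerm e = ⟨(a₁, a₂), h12⟩ := by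
        obtain ⟨⟨x, y⟩, hxy⟩ := e
        dsimp only at h1 h2
        subst h1
        rw [R'.facePerm_mk]
        simp [h2]
      rw [h3]; simp
  refine ⟨⟨(a₁, a₂), h12⟩, q, rfl, rfl, ⟨?_, ?_⟩, ?_, ?_⟩
  · rw [SimpleGraph.Walk.cons_isCycle_iff]
    have hpath : q.IsPath := by
      rw [SimpleGraph.Walk.isPath_def, hq]; exact List.nodup_reverse.2 hnd
    have hql : q.support.length = P'.length := by rw [hq]; simp
    refine ⟨hpath, notMem_edges_of_isPath q hpath ?_⟩
    by_contra hlt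
    have h0 : P'.length ≠ 0 := by rintro h0; rw [List.length_eq_zero_iff.1 h0] at hhead; simp at hhead
    have h1 : P'.length ≠ 1 := by
      rintro h1
      obtain ⟨z, rfl⟩ := List.length_eq_one_iff.1 h1
      simp at hhead hlast
      exact h12.ne (hhead.symm.trans hlast)
    have := h.length (by rw [List.length_map]; omega)
    rw [this] at hlen; simp at hlen
  · intro e
    refine ⟨fun he => hsame e he, fun he => ?_⟩
    obtain ⟨i, hi⟩ := Equiv.Perm.SameCycle.exists_nat_pow_eq he
    rw [← hi]
    clear hi
    induction i with
    | zero => simp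
    | succ i ih => rw [pow_succ', Equiv.Perm.mul_apply]; exact hclosed _ ih
  · rintro y hy
    rw [hq, List.mem_reverse]
    obtain ⟨z, hz, hzy⟩ := List.mem_map.1 hy
    rwa [← Subtype.ext hzy]
  · intro s t p g hst
    have h1 : a₂ :: P' = (a₂ :: P').take s.length ++ p :: g :: (a₂ :: P').drop (s.length + 2) := by
      have h2 : (a₂ :: P').map Subtype.val = s ++ (p : V) :: g :: t := by rw [← hst]; simp [a₂]
      obtain ⟨s', r', e1, e2, e3⟩ := List.map_eq_append_iff.1 h2
      obtain ⟨p', r'', e4, e5, e6⟩ := List.map_eq_cons_iff.1 e3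
      obtain ⟨g', r3, e7, e8, e9⟩ := List.map_eq_cons_iff.1 e6
      have e5' := Subtype.ext e5
      have e8' := Subtype.ext e8
      subst e5' e8' e7 e4 e2
      rw [e1]; simp
    generalize (a₂ :: P').take s.length = s' at h1
    generalize (a₂ :: P').drop (s.length + 2) = t' at h1
    have h3 : ∃ hgp : (G.induce {y | y ∈ o}).Adj g p,
        (⟨(g, p), hgp⟩ : (G.induce {y | y ∈ o}).Dart) ∈ (SimpleGraph.Walk.cons h12 q).darts := by
      cases s' with
      | nil =>
        rw [List.nil_append, List.cons.injEq] at h1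
        obtain ⟨rfl, h1⟩ := h1
        rw [h1] at hhead
        have h6 : g = a₁ := by simpa using hhead
        subst h6
        exact ⟨h12, by simp⟩
      | cons z s' =>
        rw [List.cons_append, List.cons.injEq] at h1
        have h6 : (SimpleGraph.Walk.cons h12 q).support =
            (a₁ :: t'.reverse) ++ g :: p :: s'.reverse := by
          rw [hsupp, h1.2]; simp
        exact mem_darts_of_support _ h6
    obtain ⟨hgp, hm⟩ := h3
    exact ⟨hgp, hsame _ hm⟩

end RotationSystem

/-! ### Constructions and 2-canonical orders -/

namespace RotationSystem

variable {V : Type u} {G : SimpleGraph V} {R : RotationSystem G} {v₁ v₂ : V}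

/-- An induced subgraph of an induced subgraph. -/
def induceInduceIso (G : SimpleGraph V) (A : Set V) (y : A) :
    (G.induce A).induce {y}ᶜ ≃g G.induce (A \ {(y : V)}) where
  toFun x := ⟨x.1.1, x.1.2, fun h => x.2 (Subtype.ext h)⟩
  invFun x := ⟨⟨x.1, x.2.1⟩, fun h => x.2.2 (congrArg Subtype.val h)⟩
  left_inv _ := rfl
  right_inv _ := rfl
  map_rel_iff' := Iff.rfl

theorem BuildFacts.isBiconnected {o P : List V} (h : BuildFacts R v₁ v₂ o P) :
    IsBiconnected (G.induce {y | y ∈ o}) :=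
  ⟨h.connected, fun y => (induceInduceIso G _ y).connected_iff.2 (h.connected_diff y y.2)⟩

/-- The stages of a construction are the graphs `G_i` of a 2-canonical order. -/
theorem Build.exists_isTwoCanonicalOrder [Finite V] (hbase : G.Adj v₁ v₂) {o P : List V}
    (h : Build R v₁ v₂ o P) (ho : ∀ y, y ∈ o) :
    ∃ ord : V ≃ Fin (Nat.card V), IsTwoCanonicalOrder R v₁ v₂ ord := by
  classical
  have hF := h.facts hbase
  have hnd : o.reverse.Nodup := List.nodup_reverse.2 hF.nodup_o
  have hmem : ∀ y, y ∈ o.reverse := fun y => List.mem_reverse.2 (ho y)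
  let e := hnd.getEquivOfForallMemList _ hmem
  have hcard : o.reverse.length = Nat.card V := by
    rw [Nat.card_congr e.symm, Nat.card_eq_fintype_card, Fintype.card_fin]
  let ord : V ≃ Fin (Nat.card V) := e.symm.trans (finCongr hcard)
  have hord : ∀ x, (ord x : ℕ) = o.reverse.idxOf x := fun x => rfl
  have hget : ∀ x i, (ord x : ℕ) = i ↔ o.reverse[i]? = some x := by
    intro x i
    rw [hord]
    constructor
    · rintro rfl
      rw [List.getElem?_eq_some_iff]
      exact ⟨List.idxOf_lt_length_iff.2 (hmem x), by simp⟩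
    · intro hx
      obtain ⟨h1, h2⟩ := List.getElem?_eq_some_iff.1 hx
      rw [← h2, hnd.idxOf_getElem]
  have hfv : ∀ i, firstVertices ord i = {y | y ∈ (o.reverse.take i).reverse} := by
    intro i
    ext x
    change (ord x : ℕ) < i ↔ x ∈ (o.reverse.take i).reverse
    rw [List.mem_reverse, List.mem_take_iff_getElem]
    constructor
    · intro hx
      have := (hget x (ord x)).1 rfl
      obtain ⟨h1, h2⟩ := List.getElem?_eq_some_iff.1 this
      exact ⟨ord x, by omega, h2⟩
    · rintro ⟨j, hj, h2⟩
      have := (hget x j).2 (List.getElem?_eq_some_iff.2 ⟨by omega, h2⟩)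
      omega
  have hbuild : ∀ i, 2 ≤ i → i ≤ o.length → ∃ P', Build R v₁ v₂ (o.reverse.take i).reverse P' := by
    intro i hi hi'
    refine h.suffix (o.reverse.drop i).reverse _ ?_ (by simp; omega)
    rw [← List.reverse_append, List.take_append_drop, List.reverse_reverse]
  have hlen : o.length = Nat.card V := by rw [← hcard, List.length_reverse]
  -- the data for adding the vertex `x` of position `i`
  have hstep : ∀ i, 2 ≤ i → ∀ x, (ord x : ℕ) = i → ∃ P',
      Build R v₁ v₂ (x :: (o.reverse.take i).reverse) P' := by
    intro i hi x hx
    have h1 := (hget x i).1 hx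
    obtain ⟨h2, h3⟩ := List.getElem?_eq_some_iff.1 h1
    obtain ⟨P', hP'⟩ := hbuild (i + 1) (by omega) (by simpa using h2)
    rw [List.take_succ_eq_append_getElem h2, h3, List.reverse_append] at hP'
    exact ⟨P', hP'⟩
  refine ⟨ord, ⟨?_, ?_, ?_, ?_⟩, ?_⟩
  · obtain ⟨o', ho'⟩ := hF.eq_append
    rw [hget, ho']; simp
  · obtain ⟨o', ho'⟩ := hF.eq_append
    rw [hget, ho']; simp
  · intro i hi hi'
    rw [hfv]
    obtain ⟨P', hP'⟩ := hbuild i (by omega) (by omega)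
    have hF' := hP'.facts hbase
    obtain ⟨R', hR'⟩ := R.exists_inherited {y | y ∈ (o.reverse.take i).reverse}
    obtain ⟨d, q, h1, h2, h3, -, -⟩ := hF'.exists_outerPath (by simp; omega) R' hR'
    exact ⟨hF'.isBiconnected, R', d, q, hR', h1, h2, h3⟩
  · intro i hi x hx
    rw [hfv]
    obtain ⟨P', hP'⟩ := hstep i (by omega) x hx
    have hi' : i < o.length := by rw [hlen, ← hx]; exact (ord x).2
    generalize ho' : (o.reverse.take i).reverse = o' at hP' ⊢
    have hl' : 3 ≤ o'.length := by rw [← ho']; simp; omega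
    obtain ⟨R', hR'⟩ := R.exists_inherited {y | y ∈ o'}
    cases hP' with
    | base => simp at hl'
    | step o l₁ m l₂ k k' a b x a₀ b₀ hB hxo hadj hk hk' hna hnb =>
      have hF' := hB.facts hbase
      obtain ⟨d, q, h1, h2, h3, h4, h5⟩ := hF'.exists_outerPath hl' R' hR'
      refine ⟨R', d, q, hR', h1, h2, h3, ?_, ?_⟩
      · have hv₂ : v₂ ∈ o' := by obtain ⟨o', ho'⟩ := hF'.eq_append; rw [ho']; simp
        have hsub : ∀ y ∈ v₂ :: (l₁ ++ a :: m ++ b :: l₂), y ∈ o' := by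
          intro y hy
          rcases List.mem_cons.1 hy with rfl | hy
          · exact hv₂
          · exact hF'.subset y hy
        have main : ∀ s t p g, v₂ :: (l₁ ++ a :: m ++ b :: l₂) = s ++ p :: g :: t →
            R.NextIn {y | y ∈ o'} g x p → ∀ hgx : G.Adj g x, ∃ e : (G.induce {y | y ∈ o'}).Dart,
              R'.OnLeftFace d e ∧ R.IsFirstClockwise (Set.range (inclusionHom G {y | y ∈ o'}).mapDart)
                ⟨(g, x), hgx⟩ ((inclusionHom G _).mapDart e) := by
          intro s t p g hst hn hgx
          have hp : p ∈ o' := hsub p (by rw [hst]; simp)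
          have hg : g ∈ o' := hsub g (by rw [hst]; simp)
          obtain ⟨hgp, h6⟩ := h5 s t ⟨p, hp⟩ ⟨g, hg⟩ hst
          exact ⟨_, h6, (R.isFirstClockwise_inclusionHom hg hgx hgp).2 hn⟩
        rintro ⟨⟨y, z⟩, hyz⟩ hy hz
        dsimp only at hy hz
        subst hz
        rcases (hadj y hy).1 hyz.symm with rfl | rfl
        · refine main k (m ++ b :: l₂) a₀ y ?_ hna hyz
          have : v₂ :: (l₁ ++ y :: m ++ b :: l₂) = (v₂ :: l₁) ++ y :: (m ++ b :: l₂) := by simp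
          rw [this, hk]; simp
        · refine main (v₂ :: l₁ ++ k') l₂ b₀ y ?_ hnb hyz
          have : v₂ :: (l₁ ++ a :: m ++ y :: l₂) = (v₂ :: l₁) ++ (a :: m) ++ y :: l₂ := by simp
          rw [this, hk']; simp
      · intro y hy
        refine h4 y ?_
        rcases (hadj y y.2).1 hy with h | h <;> rw [h] <;> simp
  · intro x hx
    obtain ⟨P', hP'⟩ := hstep _ hx x rfl
    have hset : {y : V | G.Adj x y ∧ ord y < ord x} =
        {y | G.Adj x y ∧ y ∈ (o.reverse.take (ord x)).reverse} := by
      ext y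
      have : y ∈ firstVertices ord (ord x) ↔ y ∈ (o.reverse.take (ord x)).reverse := by
        rw [hfv]; rfl
      change (_ ∧ (ord y : ℕ) < ord x) ↔ _ ∧ _
      rw [← this]; rfl
    rw [hset]
    have hi' : (ord x : ℕ) < o.length := by rw [hlen]; exact (ord x).2
    have hl' : 2 ≤ (o.reverse.take (ord x)).reverse.length := by simp; omega
    generalize (o.reverse.take (ord x)).reverse = o' at hP' hl'
    cases hP' with
    | base => simp at hl'
    | step o l₁ m l₂ k k' a b x a₀ b₀ hB hxo hadj hk hk' hna hnb =>
      have hF' := hB.facts hbase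
      have hab : a ≠ b := by
        have := hF'.nodup
        rintro rfl
        rw [List.nodup_append] at this
        exact this.2.2 a (by simp) a (by simp) rfl
      have : {y | G.Adj x y ∧ y ∈ o'} = {a, b} := by
        ext y
        simp only [Set.mem_ofPred_eq, Set.mem_insert_iff, Set.mem_singleton_iff]
        constructor
        · rintro ⟨h1, h2⟩; exact (hadj y h2).1 h1
        · intro h1
          have hy : y ∈ o' := by
            rcases h1 with rfl | rfl <;> exact hF'.subset _ (by simp)
          exact ⟨(hadj y hy).2 h1, hy⟩
      rw [this, Set.ncard_pair hab]

/-- An element occurring once in a list has a unique predecessor. -/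
theorem pred_unique {α : Type*} {v p b : α} {s t l₁ l₂ : List α}
    (h : v :: (l₁ ++ b :: l₂) = s ++ p :: b :: t) (h1 : b ∉ l₁) (h2 : b ∉ l₂) :
    ∃ k, v :: l₁ = k ++ [p] := by
  cases s with
  | nil =>
    rw [List.nil_append, List.cons.injEq] at h
    obtain ⟨rfl, h⟩ := h
    cases l₁ with
    | nil => exact ⟨[], rfl⟩
    | cons c l₁ =>
      rw [List.cons_append, List.cons.injEq] at h
      exact absurd (by simp [h.1]) h1
  | cons a s =>
    rw [List.cons_append, List.cons.injEq] at h
    obtain ⟨rfl, h⟩ := h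
    have h3 : (s ++ [p]) ++ b :: t = l₁ ++ b :: l₂ := by rw [h]; simp
    have : s ++ [p] = l₁ := by
      have h4 : l₁ ++ b :: l₂ = (s ++ [p]) ++ b :: t := h3.symm
      rw [List.append_eq_append_iff] at h4
      rcases h4 with ⟨c, h5, h6⟩ | ⟨c, h5, h6⟩
      · cases c with
        | nil => simpa using h5
        | cons z c =>
          rw [List.cons_append, List.cons.injEq] at h6
          exact absurd (by rw [h6.2]; simp) h2
      · cases c with
        | nil => simpa using h5.symm
        | cons z c =>
          rw [List.cons_append, List.cons.injEq] at h6
          exact absurd (by rw [h5]; simp [h6.1]) h1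
    exact ⟨v :: s, by rw [← this]; rfl⟩

/-- By induction, the outer cycle of each `G_i` is the outer path of a construction together with the base
edge, since both bound the face at the base edge. -/
theorem Build.of_isTwoCanonicalOrder [Finite V] (hbase : G.Adj v₁ v₂)
    {ord : V ≃ Fin (Nat.card V)} (h : IsTwoCanonicalOrder R v₁ v₂ ord) :
    ∃ o P, Build R v₁ v₂ o P ∧ ∀ y, y ∈ o := by
  obtain ⟨⟨hfirst, hsecond, -, hattach⟩, hdeg⟩ := h
  have hcard : 2 ≤ Nat.card V := by have := (ord v₂).2; omega
  have key : ∀ i, 2 ≤ i → i ≤ Nat.card V → ∃ o P, Build R v₁ v₂ o P ∧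
      ({y | y ∈ o} = firstVertices ord i) ∧ (i = 2 → P = [v₁, v₂]) := by
    intro i hi
    induction i, hi using Nat.le_induction with
    | base =>
      intro _
      refine ⟨_, _, Build.base, ?_, fun _ => rfl⟩
      ext y
      change y ∈ [v₂, v₁] ↔ (ord y : ℕ) < 2
      simp only [List.mem_cons, List.not_mem_nil, or_false]
      constructor
      · rintro (rfl | rfl) <;> omega
      · intro hy
        have h2 : (ord y : ℕ) = 0 ∨ (ord y : ℕ) = 1 := by omega
        rcases h2 with h2 | h2
        · right; exact ord.injective (Fin.ext (h2.trans hfirst.symm))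
        · left; exact ord.injective (Fin.ext (h2.trans hsecond.symm))
    | succ i hi ih =>
      intro hi'
      obtain ⟨o, P, hB, ho, hP2⟩ := ih (by omega)
      have hF := hB.facts hbase
      have hmem : ∀ y, y ∈ o ↔ (ord y : ℕ) < i := by
        intro y
        have : y ∈ {y | y ∈ o} ↔ y ∈ firstVertices ord i := by rw [ho]
        exact this
      obtain ⟨x, hx⟩ : ∃ x, (ord x : ℕ) = i := ⟨ord.symm ⟨i, by omega⟩, by simp⟩
      have hxo : x ∉ o := by rw [hmem]; omega
      obtain ⟨y, z, hyz, hset⟩ := Set.ncard_eq_two.1 (hdeg x (by omega))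
      have hadj : ∀ u ∈ o, G.Adj x u ↔ u = y ∨ u = z := by
        intro u hu
        have : u ∈ {y : V | G.Adj x y ∧ ord y < ord x} ↔ u ∈ ({y, z} : Set V) := by rw [hset]
        simp only [Set.mem_ofPred_eq, Set.mem_insert_iff, Set.mem_singleton_iff] at this
        rw [← this]
        have h1 : ord u < ord x := by rw [Fin.lt_def, hx, ← hmem]; exact hu
        simp [h1]
      have hyo : ∀ u, u = y ∨ u = z → u ∈ o := by
        intro u hu
        have : u ∈ {y : V | G.Adj x y ∧ ord y < ord x} := by rw [hset]; exact hu
        rw [hmem, ← hx]; exact this.2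
      have hv₁ : v₁ ∈ o := by rw [hmem]; omega
      have hv₂ : v₂ ∈ o := by rw [hmem]; omega
      -- each neighbour of `x` lies on the outer path, and `x` is attached from the outer side
      have hpred : ∀ g, g = y ∨ g = z → ∃ s t p, v₂ :: P = s ++ p :: g :: t ∧
          R.NextIn {y | y ∈ o} g x p := by
        intro g hg
        have hgo := hyo g hg
        have hgx : G.Adj g x := ((hadj g hgo).2 hg).symm
        by_cases hi2 : i = 2
        · have hg12 : g = v₁ ∨ g = v₂ := by
            have h1 := (hmem g).1 hgo
            have h2 : (ord g : ℕ) = 0 ∨ (ord g : ℕ) = 1 := by omega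
            rcases h2 with h2 | h2
            · left; exact ord.injective (Fin.ext (h2.trans hfirst.symm))
            · right; exact ord.injective (Fin.ext (h2.trans hsecond.symm))
          have ho2 : ∀ u ∈ o, u = v₁ ∨ u = v₂ := by
            intro u hu
            have h1 := (hmem u).1 hu
            have h2 : (ord u : ℕ) = 0 ∨ (ord u : ℕ) = 1 := by omega
            rcases h2 with h2 | h2
            · left; exact ord.injective (Fin.ext (h2.trans hfirst.symm))
            · right; exact ord.injective (Fin.ext (h2.trans hsecond.symm))
          rw [hP2 hi2]
          rcases hg12 with rfl | rfl
          · obtain ⟨p, hp⟩ := R.exists_nextIn (A := {y | y ∈ o}) hgx hbase hv₂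
            have hgp := hp.adj hgx
            have : p = v₂ := by
              rcases ho2 p hp.1 with h | h
              · exact absurd h.symm hgp.ne
              · exact h
            subst this
            exact ⟨[], [p], p, rfl, hp⟩
          · obtain ⟨p, hp⟩ := R.exists_nextIn (A := {y | y ∈ o}) hgx hbase.symm hv₁
            have hgp := hp.adj hgx
            have : p = v₁ := by
              rcases ho2 p hp.1 with h | h
              · exact h
              · exact absurd h.symm hgp.ne
            subst this
            exact ⟨[g], [], p, rfl, hp⟩
        · have hat := hattach i (by omega) x hx
          rw [← ho] at hat
          obtain ⟨R', d, q, hR', hd1, hd2, -, hleft, -⟩ := hat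
          obtain ⟨e, he1, he2⟩ := hleft ⟨(g, x), hgx⟩ hgo rfl
          have hin := (R.isInherited_inclusionHom_iff R').1 hR'
          -- the darts against the direction of the outer path form a union of orbits
          have hclosed : ∀ e : (G.induce {y | y ∈ o}).Dart,
              (∃ s t, v₂ :: P = s ++ (e.snd : V) :: (e.fst : V) :: t) →
              ∃ s t, v₂ :: P = s ++ ((R'.facePerm e).snd : V) :: ((R'.facePerm e).fst : V) :: t := by
            rintro ⟨⟨u, p⟩, hup⟩ ⟨s, t, hst⟩
            rw [R'.facePerm_mk]
            dsimp only at hst ⊢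
            have hnx := hin p u hup.symm
            rcases List.eq_nil_or_concat s with hs | ⟨s', z', hs⟩
            · subst hs
              rw [List.nil_append, List.cons.injEq] at hst
              have hp2 : (p : V) = v₂ := hst.1.symm
              have hu1 : (u : V) = v₁ := by
                have := hF.head; rw [hst.2] at this; simpa using this
              obtain ⟨s, z', hP⟩ : ∃ s z', P = s ++ [z', v₂] := by
                have h1 := hF.last
                obtain ⟨s, hs⟩ := List.getLast?_eq_some_iff.1 h1
                rcases List.eq_nil_or_concat s with hs' | ⟨s', z', hs'⟩
                · subst hs'
                  have := hF.head
                  rw [hs] at this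
                  simp at this
                  exact absurd this.symm hbase.ne
                · exact ⟨s', z', by rw [hs, hs']; simp⟩
              have hch := hF.next
              have e5 : v₂ :: P ++ [v₁] = (v₂ :: s) ++ z' :: v₂ :: v₁ :: [] := by rw [hP]; simp
              rw [e5] at hch
              have h6 : R.NextIn {y | y ∈ o} v₂ v₁ z' := hch.triple
              rw [hp2, hu1] at hnx
              have h7 := hnx.unique h6
              refine ⟨v₂ :: s, [], ?_⟩
              rw [h7, hp2, hP]; simp
            · rw [List.concat_eq_append] at hs
              subst hs
              have hch := hF.next
              have e5 : v₂ :: P ++ [v₁] = s' ++ z' :: (p : V) :: (u : V) :: (t ++ [v₁]) := by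
                rw [hst]; simp
              rw [e5] at hch
              have h7 := hnx.unique hch.triple
              refine ⟨s', u :: t, ?_⟩
              rw [h7, hst]; simp
          have hall : ∀ k : ℕ, ∃ s t, v₂ :: P =
              s ++ (((R'.facePerm ^ k) d).snd : V) :: (((R'.facePerm ^ k) d).fst : V) :: t := by
            intro k
            induction k with
            | zero =>
              have h1 := hF.head
              cases P with
              | nil => simp at h1
              | cons w P =>
                simp at h1
                exact ⟨[], P, by simp [hd1, hd2, h1]⟩
            | succ k ihk =>
              rw [pow_succ', Equiv.Perm.mul_apply]
              exact hclosed _ ihk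
          obtain ⟨k, hk⟩ := Equiv.Perm.SameCycle.exists_nat_pow_eq he1
          obtain ⟨s, t, hst⟩ := hall k
          rw [hk] at hst
          have hge : (e.fst : V) = g := by
            obtain ⟨-, j, -, hj, -⟩ := he2
            rw [R.rot_pow] at hj
            have := congrArg (fun c : G.Dart => c.fst) hj
            exact this.symm
          obtain ⟨⟨u, p⟩, hup⟩ := e
          dsimp only at hge hst
          subst hge
          exact ⟨s, t, p, hst, (R.isFirstClockwise_inclusionHom hgo hgx hup).1 he2⟩
      -- the two neighbours in their order along the outer path
      have main : ∀ y z, (∀ u ∈ o, G.Adj x u ↔ u = y ∨ u = z) →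
          (∀ g, g = y ∨ g = z → ∃ s t p, v₂ :: P = s ++ p :: g :: t ∧
            R.NextIn {y | y ∈ o} g x p) →
          ∀ l₁ m l₂, P = l₁ ++ y :: m ++ z :: l₂ → ∃ o' P', Build R v₁ v₂ o' P' ∧
            ({y | y ∈ o'} = firstVertices ord (i + 1)) ∧ (i + 1 = 2 → P' = [v₁, v₂]) := by
        intro y z hadj hpred l₁ m l₂ hP
        have hnd := hF.nodup
        have hPy : P = l₁ ++ y :: (m ++ z :: l₂) := by rw [hP]; simp
        have hPz : P = (l₁ ++ y :: m) ++ z :: l₂ := by rw [hP]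
        have hy1 : y ∉ l₁ ∧ y ∉ m ++ z :: l₂ := by
          rw [hPy, List.nodup_append, List.nodup_cons] at hnd
          exact ⟨fun h => hnd.2.2 _ h _ (by simp) rfl, hnd.2.1.1⟩
        have hz1 : z ∉ l₁ ++ y :: m ∧ z ∉ l₂ := by
          rw [hPz, List.nodup_append, List.nodup_cons] at hnd
          exact ⟨fun h => hnd.2.2 _ h _ (by simp) rfl, hnd.2.1.1⟩
        obtain ⟨s, t, a₀, h1, h2⟩ := hpred y (Or.inl rfl)
        obtain ⟨s', t', b₀, h3, h4⟩ := hpred z (Or.inr rfl)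
        rw [hPy] at h1
        rw [hPz] at h3
        obtain ⟨k, hk⟩ := pred_unique h1 hy1.1 hy1.2
        obtain ⟨k', hk'⟩ := pred_unique h3 hz1.1 hz1.2
        obtain ⟨k'', hk''⟩ : ∃ k'', y :: m = k'' ++ [b₀] := by
          obtain ⟨r, c, hrc⟩ : ∃ r c, y :: m = r ++ [c] :=
            ⟨_, _, (List.dropLast_append_getLast (l := y :: m) (by simp)).symm⟩
          rw [hrc] at hk'
          have e7 : (v₂ :: (l₁ ++ r)) ++ [c] = k' ++ [b₀] := by rw [← hk']; simp
          have := List.append_inj' e7 rfl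
          exact ⟨r, by rw [hrc, this.2]⟩
        rw [hP] at hB
        refine ⟨x :: o, _, Build.step o l₁ m l₂ k k'' y z x a₀ b₀ hB hxo hadj hk hk'' h2 h4, ?_,
          fun h => by omega⟩
        ext u
        change u ∈ x :: o ↔ (ord u : ℕ) < i + 1
        rw [List.mem_cons, hmem]
        constructor
        · rintro (rfl | h) <;> omega
        · intro h
          rcases Nat.lt_or_ge (ord u : ℕ) i with h5 | h5
          · exact Or.inr h5
          · left; exact ord.injective (Fin.ext (by omega))
      have hPmem : ∀ g, g = y ∨ g = z → g ∈ P := by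
        intro g hg
        obtain ⟨s, t, p, h1, -⟩ := hpred g hg
        cases s with
        | nil => simp at h1; rw [h1.2]; simp
        | cons c s => simp at h1; rw [h1.2]; simp
      obtain ⟨l₁, r, hP⟩ := List.append_of_mem (hPmem y (Or.inl rfl))
      have hzP := hPmem z (Or.inr rfl)
      rw [hP, List.mem_append, List.mem_cons] at hzP
      rcases hzP with hz | hz | hz
      · obtain ⟨l₀, m, rfl⟩ := List.append_of_mem hz
        exact main z y (fun u hu => (hadj u hu).trans or_comm) (fun g hg => hpred g hg.symm) l₀ m r
          (by rw [hP])
      · exact absurd hz.symm hyz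
      · obtain ⟨m, l₂, rfl⟩ := List.append_of_mem hz
        exact main y z hadj hpred l₁ m l₂ (by rw [hP]; simp)
  obtain ⟨o, P, hB, ho, -⟩ := key _ hcard le_rfl
  refine ⟨o, P, hB, fun y => ?_⟩
  have : y ∈ firstVertices ord (Nat.card V) := (ord y).2
  rw [← ho] at this
  exact this

end RotationSystem

/-! ### L-representations from vertex additions -/

theorem CyclicLT.irrefl_left {a c : ℝ} : ¬ CyclicLT a a c := by
  rintro (⟨h1, h2⟩ | ⟨h1, h2⟩ | ⟨h1, h2⟩) <;> linarith

theorem CyclicLT.irrefl_mid {a b : ℝ} : ¬ CyclicLT a b b := by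
  rintro (⟨h1, h2⟩ | ⟨h1, h2⟩ | ⟨h1, h2⟩) <;> linarith

theorem CyclicLT.irrefl_ends {a b : ℝ} : ¬ CyclicLT a b a := by
  rintro (⟨h1, h2⟩ | ⟨h1, h2⟩ | ⟨h1, h2⟩) <;> linarith

theorem CyclicLT.not_left {c x p e : ℝ} (h : CyclicLT c x p) (he : ¬ CyclicLT c e p) :
    ¬ CyclicLT c e x := by
  unfold CyclicLT at *; grind

theorem CyclicLT.not_right {c x p e : ℝ} (h : CyclicLT c x p) (he : ¬ CyclicLT c e p) :
    ¬ CyclicLT x e p := by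
  unfold CyclicLT at *; grind

/-- A number `x` in an arc from `c` to `p` that contains neither `d` nor `f` does not separate
`d` from `f` unless `c` or `p` does. -/
theorem CyclicLT.not_insert {c x p d f : ℝ} (h : CyclicLT c x p) (hd : ¬ CyclicLT c d p)
    (hf : ¬ CyclicLT c f p) (hc : ¬ CyclicLT d c f) (hp : ¬ CyclicLT d p f) (hne : d ≠ c) :
    ¬ CyclicLT d x f := by
  unfold CyclicLT at *; grind

namespace RotationSystem

variable {V : Type u} {G : SimpleGraph V} {R : RotationSystem G} {v₁ v₂ : V}

/-- Inserting a neighbour `x` of `g` between the cyclically consecutive neighbours `c` and `p`, and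
its parameter between theirs, keeps the cyclic order of the parameters correct. Here `Par d r`
says that `r` is a parameter of the contact of `g` and `d`. -/
theorem not_cyclicLT_insert [Finite V] {A : Set V} {g c p x : V} {Par : V → ℝ → Prop} {c₀ p₀ X : ℝ}
    (hc : G.Adj g c) (hcA : c ∈ A) (hx : G.Adj g x) (hxA : x ∉ A) (hcp : R.NextIn A g c p)
    (hxp : R.NextIn A g x p)
    (hold : ∀ d ∈ A, ∀ e ∈ A, ∀ f, G.Adj g d → G.Adj g e → R.NextIn A g d f → ∀ r s t, Par d r →
      Par e s → Par f t → ¬ CyclicLT r s t)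
    (hinj : ∀ d ∈ A, G.Adj g d → ∀ e ∈ A, G.Adj g e → ∀ r, Par d r → Par e r → d = e)
    (hX : ∀ r, Par x r → r = X) (hcc : ∀ r, Par c r ↔ r = c₀) (hpp : ∀ r, Par p r ↔ r = p₀)
    (hcyc : c = p ∨ CyclicLT c₀ X p₀) :
    ∀ d ∈ insert x A, ∀ e ∈ insert x A, ∀ f, G.Adj g d → G.Adj g e →
      R.NextIn (insert x A) g d f → ∀ r s t, Par d r → Par e s → Par f t → ¬ CyclicLT r s t := by
  intro d hd e he f hgd hge hdf r s t hr hs ht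
  rcases hcyc with rfl | hcyc
  -- `c` is the only neighbour in `A`, so that there are at most two different parameters
  · have hone : ∀ y ∈ insert x A, G.Adj g y → ∀ r, Par y r → r = c₀ ∨ r = X := by
      rintro y (rfl | hy) hgy r hr
      · exact Or.inr (hX r hr)
      · have := NextIn.eq_of_self hcp hc hgy hy
        subst this
        exact Or.inl ((hcc r).1 hr)
    rcases hone d hd hgd r hr with rfl | rfl <;> rcases hone e he hge s hs with rfl | rfl <;>
      rcases hone f hdf.1 (hdf.adj hgd) t ht with rfl | rfl <;>
      first | exact CyclicLT.irrefl_left | exact CyclicLT.irrefl_mid | exact CyclicLT.irrefl_ends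
  · have hgp := hcp.adj hc
    have hold' : ∀ e ∈ A, G.Adj g e → ∀ s, Par e s → ¬ CyclicLT c₀ s p₀ := fun e he hge s hs =>
      hold c hcA e he p hc hge hcp _ _ _ ((hcc _).2 rfl) hs ((hpp _).2 rfl)
    rcases hd with rfl | hd
    · have : f = p := hdf.unique hxp.insert_right
      subst this
      obtain rfl := hX r hr
      obtain rfl := (hpp t).1 ht
      rcases he with rfl | he
      · rw [hX s hs]; exact CyclicLT.irrefl_left
      · exact hcyc.not_right (hold' e he hge s hs)
    · by_cases hdc : d = c
      · subst hdc
        have : f = x := hdf.unique (NextIn.insert_left hc hx hcA hxA hcp hxp)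
        subst this
        obtain rfl := hX t ht
        obtain rfl := (hcc r).1 hr
        rcases he with rfl | he
        · rw [hX s hs]; exact CyclicLT.irrefl_mid
        · exact hcyc.not_left (hold' e he hge s hs)
      · obtain ⟨f', hf'⟩ := R.exists_nextIn hgd hc hcA
        have : f = f' := hdf.unique (NextIn.insert_other hc hcA hcp hxp hgd hd hdc hf')
        subst this
        rcases he with rfl | he
        · rw [hX s hs]
          refine hcyc.not_insert (hold' d hd hgd r hr) (hold' f hf'.1 (hf'.adj hgd) t ht)
            (hold d hd c hcA f hgd hc hf' _ _ _ hr ((hcc _).2 rfl) ht)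
            (hold d hd p hcp.1 f hgd hgp hf' _ _ _ hr ((hpp _).2 rfl) ht) ?_
          rintro rfl
          exact hdc (hinj d hd hgd c hcA hc _ hr ((hcc _).2 rfl))
        · exact hold d hd e he f hgd hge hf' r s t hr hs ht

/-- The L-shapes of `a` and `b`, which touch in `(b.x, a.y)`, are consecutive steps of the
lower-left staircase of the L-shapes of `o`. -/
structure IsStair (L : V → LShape) (o : List V) (a b : V) : Prop where
  x_lt : (L a).x < (L b).x
  y_lt : (L b).y < (L a).y
  le_right : (L b).x ≤ (L a).right
  le_top : (L a).y ≤ (L b).top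
  contact : ∀ p ∈ (L a).points, p ∈ (L b).points → p = ((L b).x, (L a).y)
  left : ∀ u ∈ o, ∀ p ∈ (L u).points, p.1 < (L b).x → p.2 ≤ (L a).y → u = a
  below : ∀ u ∈ o, ∀ p ∈ (L u).points, p.1 ≤ (L b).x → p.2 < (L a).y → u = b

theorem IsStair.mem_left {L : V → LShape} {o : List V} {a b : V} (h : IsStair L o a b) :
    ((L b).x, (L a).y) ∈ (L a).points :=
  Or.inr ⟨rfl, h.x_lt.le, h.le_right⟩

theorem IsStair.mem_right {L : V → LShape} {o : List V} {a b : V} (h : IsStair L o a b) :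
    ((L b).x, (L a).y) ∈ (L b).points :=
  Or.inl ⟨rfl, h.y_lt.le, h.le_top⟩

/-- The L-shapes of the vertices in `o` represent the induced subgraph with its embedding, and their
lower-left staircase is formed by the path `P`. -/
structure IsStaircase (R : RotationSystem G) (v₁ v₂ : V) (o P : List V) (L : V → LShape) :
    Prop where
  disjoint : ∀ u ∈ o, ∀ w ∈ o, u ≠ w → Disjoint (L u).interior (L w).interior
  touch : ∀ u ∈ o, ∀ w ∈ o, u ≠ w → (G.Adj u w ↔ ((L u).points ∩ (L w).points).Nonempty)
  triple : ∀ u ∈ o, ∀ v ∈ o, ∀ w ∈ o, u ≠ v → v ≠ w → u ≠ w →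
    ∀ p ∈ (L u).points, p ∈ (L v).points → p ∉ (L w).points
  top : ∀ u ∈ o, (L u).y ≤ (L v₁).y
  right : ∀ u ∈ o, (L u).x ≤ (L v₂).x
  base : ∀ p, p ∈ (L v₁).points ∧ p ∈ (L v₂).points ↔ p = ((L v₂).x, (L v₁).y)
  stair : P.IsChain (IsStair L o)
  cyclic : ∀ u ∈ o, ∀ d ∈ o, ∀ e ∈ o, ∀ f, G.Adj u d → G.Adj u e → R.NextIn {y | y ∈ o} u d f →
    ∀ p q r, p ∈ (L u).points → p ∈ (L d).points → q ∈ (L u).points → q ∈ (L e).points →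
      r ∈ (L u).points → r ∈ (L f).points → ¬ CyclicLT (p.2 - p.1) (q.2 - q.1) (r.2 - r.1)

/-- Along an L-shape, `p.2 - p.1` determines the point `p`. -/
theorem _root_.LShape.eq_of_sub_eq {L : LShape} {p q : ℝ × ℝ} (hp : p ∈ L.points)
    (hq : q ∈ L.points) (h : p.2 - p.1 = q.2 - q.1) : p = q := by
  simp only [LShape.points, Set.mem_ofPred_eq] at hp hq
  obtain ⟨p1, p2⟩ := p
  obtain ⟨q1, q2⟩ := q
  dsimp only at *
  rcases hp with ⟨h1, h2, h3⟩ | ⟨h1, h2, h3⟩ <;> rcases hq with ⟨h4, h5, h6⟩ | ⟨h4, h5, h6⟩ <;>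
    (ext <;> dsimp only <;> linarith)

/-- A new L-shape `N` in the corner between the steps at `a` and `b` meets the other L-shapes
exactly in its two endpoints. -/
theorem contact_new {L : V → LShape} {o : List V} {a s b₀ b : V} {N : LShape}
    (has : IsStair L o a s) (hb : IsStair L o b₀ b) (hba : b₀ ≠ b) (has' : a ≠ s)
    (hx : N.x < (L s).x) (hy : N.y < (L b₀).y) (ht : N.top = (L a).y) (hr : N.right = (L b).x)
    {u : V} (hu : u ∈ o) {p : ℝ × ℝ} (hpN : p ∈ N.points) (hpu : p ∈ (L u).points) :
    (u = a ∧ p = (N.x, N.top)) ∨ (u = b ∧ p = (N.right, N.y)) := by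
  obtain ⟨p1, p2⟩ := p
  simp only [LShape.points, Set.mem_ofPred_eq] at hpN
  rcases hpN with ⟨h1, h2, h3⟩ | ⟨h1, h2, h3⟩
  · left
    have h4 : u = a := has.left u hu _ hpu (by simp only; linarith) (by simp only; linarith)
    refine ⟨h4, ?_⟩
    rcases h3.lt_or_eq with h5 | h5
    · exact absurd (h4.symm.trans
        (has.below u hu _ hpu (by simp only; linarith) (by simp only; linarith))) has'
    · rw [h1, h5]
  · right
    have h4 : u = b := hb.below u hu _ hpu (by simp only; linarith) (by simp only; linarith)
    refine ⟨h4, ?_⟩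
    rcases h3.lt_or_eq with h5 | h5
    · exact absurd
        ((hb.left u hu _ hpu (by simp only; linarith) (by simp only; linarith)).symm.trans h4) hba
    · rw [h1, h5]

theorem IsStair.ne {L : V → LShape} {o : List V} {a b : V} (h : IsStair L o a b) : a ≠ b := by
  rintro rfl; exact lt_irrefl _ h.x_lt

theorem isStaircase_base (R : RotationSystem G) (h : G.Adj v₁ v₂) :
    ∃ L, IsStaircase R v₁ v₂ [v₂, v₁] [v₁, v₂] L := by
  classical
  let L₁ : LShape := ⟨0, 1, 2, 1, by norm_num, by norm_num⟩
  let L₂ : LShape := ⟨1, 0, 2, 2, by norm_num, by norm_num⟩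
  let L : V → LShape := fun v => if v = v₁ then L₁ else L₂
  have e1 : L v₁ = L₁ := if_pos rfl
  have e2 : L v₂ = L₂ := if_neg h.ne.symm
  have hc : ∀ p, p ∈ L₁.points ∧ p ∈ L₂.points ↔ p = (1, 1) := by
    rintro ⟨p1, p2⟩
    simp only [LShape.points, Set.mem_ofPred_eq, Prod.mk.injEq, L₁, L₂]
    constructor
    · rintro ⟨⟨h1, h2, h3⟩ | ⟨h1, h2, h3⟩, ⟨h4, h5, h6⟩ | ⟨h4, h5, h6⟩⟩ <;> constructor <;> linarith
    · rintro ⟨rfl, rfl⟩; norm_num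
  have hint : Disjoint L₁.interior L₂.interior := by
    rw [Set.disjoint_left]
    intro p hp hq
    have := (hc p).1 ⟨hp.1, hq.1⟩
    subst this
    exact hp.2 (Or.inr rfl)
  have hne : (L₁.points ∩ L₂.points).Nonempty := ⟨(1, 1), (hc _).2 rfl⟩
  refine ⟨L, ?_, ?_, ?_, ?_, ?_, ?_, ?_, ?_⟩
  · intro u hu w hw huw
    simp only [List.mem_cons, List.not_mem_nil, or_false] at hu hw
    rcases hu with rfl | rfl <;> rcases hw with rfl | rfl
    · exact absurd rfl huw
    · rw [e1, e2]; exact hint.symm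
    · rw [e1, e2]; exact hint
    · exact absurd rfl huw
  · intro u hu w hw huw
    simp only [List.mem_cons, List.not_mem_nil, or_false] at hu hw
    rcases hu with rfl | rfl <;> rcases hw with rfl | rfl
    · exact absurd rfl huw
    · rw [e1, e2, Set.inter_comm]; exact iff_of_true h.symm hne
    · rw [e1, e2]; exact iff_of_true h hne
    · exact absurd rfl huw
  · intro u hu v hv w hw huv hvw huw
    simp only [List.mem_cons, List.not_mem_nil, or_false] at hu hv hw
    rcases hu with rfl | rfl <;> rcases hv with rfl | rfl <;> rcases hw with rfl | rfl <;>
      contradiction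
  · intro u hu
    simp only [List.mem_cons, List.not_mem_nil, or_false] at hu
    rcases hu with rfl | rfl
    · rw [e1, e2]; norm_num [L₁, L₂]
    · exact le_rfl
  · intro u hu
    simp only [List.mem_cons, List.not_mem_nil, or_false] at hu
    rcases hu with rfl | rfl
    · exact le_rfl
    · rw [e1, e2]; norm_num [L₁, L₂]
  · rw [e1, e2]; exact hc
  · rw [List.isChain_cons_cons]
    refine ⟨⟨?_, ?_, ?_, ?_, ?_, ?_, ?_⟩, by simp⟩
    · rw [e1, e2]; norm_num [L₁, L₂]
    · rw [e1, e2]; norm_num [L₁, L₂]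
    · rw [e1, e2]
    · rw [e1, e2]; norm_num [L₁, L₂]
    · rw [e1, e2]; exact fun p hp hq => (hc p).1 ⟨hp, hq⟩
    · intro u hu p hp h1 h2
      simp only [List.mem_cons, List.not_mem_nil, or_false] at hu
      rcases hu with rfl | rfl
      · rw [e2] at h1 hp
        simp only [LShape.points, Set.mem_ofPred_eq] at hp
        rcases hp with hp | hp <;> linarith
      · rfl
    · intro u hu p hp h1 h2
      simp only [List.mem_cons, List.not_mem_nil, or_false] at hu
      rcases hu with rfl | rfl
      · rfl
      · rw [e1] at h2 hp
        simp only [LShape.points, Set.mem_ofPred_eq] at hp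
        rcases hp with hp | hp <;> linarith
  · intro u hu d hd e he f hud hue hdf p q r h1 h2 h3 h4 h5 h6
    have hc' : ∀ p ∈ (L v₁).points, p ∈ (L v₂).points → p = (1, 1) := by
      rw [e1, e2]; exact fun p hp hq => (hc p).1 ⟨hp, hq⟩
    have : p = (1, 1) ∧ q = (1, 1) := by
      simp only [List.mem_cons, List.not_mem_nil, or_false] at hu hd he
      rcases hu with rfl | rfl <;> rcases hd with rfl | rfl <;> rcases he with rfl | rfl
      all_goals first | exact absurd rfl hud.ne | exact absurd rfl hue.ne | skip
      · exact ⟨hc' _ h2 h1, hc' _ h4 h3⟩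
      · exact ⟨hc' _ h1 h2, hc' _ h3 h4⟩
    rw [this.1, this.2]; exact CyclicLT.irrefl_left

theorem IsStair.congr {L L' : V → LShape} {o : List V} {a b x : V} (h : IsStair L o a b)
    (ha : a ∈ o) (hb : b ∈ o) (hL : ∀ y ∈ o, L' y = L y)
    (hx : ∀ p ∈ (L' x).points, (L b).x < p.1 ∨ (L a).y < p.2) : IsStair L' (x :: o) a b := by
  refine ⟨?_, ?_, ?_, ?_, ?_, ?_, ?_⟩
  · rw [hL a ha, hL b hb]; exact h.x_lt
  · rw [hL a ha, hL b hb]; exact h.y_lt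
  · rw [hL a ha, hL b hb]; exact h.le_right
  · rw [hL a ha, hL b hb]; exact h.le_top
  · rw [hL a ha, hL b hb]; exact h.contact
  · rw [hL a ha, hL b hb]
    intro u hu p hp h1 h2
    rcases List.mem_cons.1 hu with rfl | hu
    · rcases hx p hp with h3 | h3 <;> linarith
    · rw [hL u hu] at hp; exact h.left u hu p hp h1 h2
  · rw [hL a ha, hL b hb]
    intro u hu p hp h1 h2
    rcases List.mem_cons.1 hu with rfl | hu
    · rcases hx p hp with h3 | h3 <;> linarith
    · rw [hL u hu] at hp; exact h.below u hu p hp h1 h2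

end RotationSystem

namespace RotationSystem

variable {V : Type u} {G : SimpleGraph V} {R : RotationSystem G} {v₁ v₂ : V}

theorem IsStaircase.pairwise {o P : List V} {L : V → LShape} (h : IsStaircase R v₁ v₂ o P L) :
    P.Pairwise fun a b => (L a).x < (L b).x ∧ (L b).y < (L a).y := by
  have : IsTrans V fun a b => (L a).x < (L b).x ∧ (L b).y < (L a).y :=
    ⟨fun a b c h1 h2 => ⟨h1.1.trans h2.1, h2.2.trans h1.2⟩⟩
  exact (h.stair.imp fun a b hab => ⟨hab.x_lt, hab.y_lt⟩).pairwise

/-- Adding the L-shape of `x`, which ends at the horizontal leg of `a` and at the vertical leg of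
`b`. -/
theorem IsStaircase.step [Finite V] (hbase : G.Adj v₁ v₂) {L : V → LShape}
    {o l₁ m l₂ k k' : List V} {a b x a₀ b₀ : V} (ih : BuildFacts R v₁ v₂ o (l₁ ++ a :: m ++ b :: l₂))
    (h : IsStaircase R v₁ v₂ o (l₁ ++ a :: m ++ b :: l₂) L)
    (hx : x ∉ o) (hadj : ∀ y ∈ o, G.Adj x y ↔ y = a ∨ y = b) (hk : v₂ :: l₁ = k ++ [a₀])
    (hk' : a :: m = k' ++ [b₀]) (hna : R.NextIn {y | y ∈ o} a x a₀)
    (hnb : R.NextIn {y | y ∈ o} b x b₀) :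
    ∃ L', IsStaircase R v₁ v₂ (x :: o) (l₁ ++ a :: x :: b :: l₂) L' := by
  classical
  have hs : ({y | y ∈ x :: o} : Set V) = insert x {y | y ∈ o} := by ext; simp
  have hao : a ∈ o := ih.subset a (by simp)
  have hbo : b ∈ o := ih.subset b (by simp)
  have hv₁ : v₁ ∈ o := by obtain ⟨o', ho'⟩ := ih.eq_append; rw [ho']; simp
  have hv₂ : v₂ ∈ o := by obtain ⟨o', ho'⟩ := ih.eq_append; rw [ho']; simp
  have hxa : G.Adj x a := (hadj a hao).2 (Or.inl rfl)
  have hxb : G.Adj x b := (hadj b hbo).2 (Or.inr rfl)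
  obtain ⟨b₁, k₂, hk₂⟩ : ∃ b₁ k₂, l₂ ++ [v₁] = b₁ :: k₂ := by
    cases l₂ with
    | nil => exact ⟨_, _, rfl⟩
    | cons x l => exact ⟨_, _, rfl⟩
  obtain ⟨c, r, hc⟩ : ∃ c r, m ++ [b] = c :: r := by
    cases m with
    | nil => exact ⟨_, _, rfl⟩
    | cons x l => exact ⟨_, _, rfl⟩
  have e0 : l₁ ++ a :: m ++ b :: l₂ = l₁ ++ a :: c :: (r ++ l₂) := by
    have : l₁ ++ a :: m ++ b :: l₂ = l₁ ++ a :: (m ++ [b]) ++ l₂ := by simp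
    rw [this, hc]; simp
  have e0' : l₁ ++ a :: m ++ b :: l₂ = (l₁ ++ k') ++ b₀ :: b :: l₂ := by
    rw [hk']; simp
  have e1 : v₂ :: (l₁ ++ a :: m ++ b :: l₂) ++ [v₁] = k ++ a₀ :: a :: c :: (r ++ b₁ :: k₂) := by
    have : v₂ :: (l₁ ++ a :: m ++ b :: l₂) ++ [v₁] =
      (v₂ :: l₁) ++ a :: ((m ++ [b]) ++ (l₂ ++ [v₁])) := by simp
    rw [this, hk, hc, hk₂]; simp
  have e2 : v₂ :: (l₁ ++ a :: m ++ b :: l₂) ++ [v₁] = (v₂ :: l₁ ++ k') ++ b₀ :: b :: b₁ :: k₂ := by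
    have : v₂ :: (l₁ ++ a :: m ++ b :: l₂) ++ [v₁] =
      v₂ :: l₁ ++ (a :: m) ++ b :: (l₂ ++ [v₁]) := by simp
    rw [this, hk', hk₂]; simp
  have hold1 := ih.next
  have hold2 := ih.next
  rw [e1] at hold1
  rw [e2] at hold2
  have t1 : R.NextIn {y | y ∈ o} a c a₀ := hold1.triple
  have t2 : R.NextIn {y | y ∈ o} b b₁ b₀ := hold2.triple
  have hac : IsStair L o a c := by
    have := h.stair
    rw [e0, List.isChain_split] at this
    exact (List.isChain_cons_cons.1 this.2).1
  have hb₀b : IsStair L o b₀ b := by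
    have := h.stair
    rw [e0', List.isChain_split] at this
    exact (List.isChain_cons_cons.1 this.2).1
  have hab₁ : G.Adj b b₁ := by
    have := ih.adj
    rw [e2, List.isChain_split] at this
    exact (List.isChain_cons_cons.1 (List.isChain_cons_cons.1 this.2).2).1
  have hac' : G.Adj a c := by
    have := ih.adj
    rw [e1, List.isChain_split] at this
    exact (List.isChain_cons_cons.1 (List.isChain_cons_cons.1 this.2).2).1
  have hco : c ∈ o := ih.subset c (by rw [e0]; simp)
  have hb₀o : b₀ ∈ o := ih.subset b₀ (by rw [e0']; simp)
  have hb₁o : b₁ ∈ o := by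
    have h1 : b₁ ∈ l₂ ++ [v₁] := by rw [hk₂]; simp
    rcases List.mem_append.1 h1 with h1 | h1
    · exact ih.subset _ (by simp [h1])
    · rw [List.mem_singleton.1 h1]; exact hv₁
  have hpw := h.pairwise
  have hcb : (L c).x ≤ (L b).x := by
    rw [e0] at hpw
    have h1 := (List.pairwise_append.1 hpw).2.1
    have h2 := (List.pairwise_cons.1 (List.pairwise_cons.1 h1).2).1
    have h3 : b ∈ c :: r := by rw [← hc]; simp
    rcases List.mem_cons.1 h3 with h3 | h3
    · rw [h3]
    · exact (h2 b (by simp [h3])).1.le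
  have hb₀a : (L b₀).y ≤ (L a).y := by
    have h1 : b₀ ∈ a :: m := by rw [hk']; simp
    rcases List.mem_cons.1 h1 with h1 | h1
    · rw [h1]
    · rw [List.append_assoc] at hpw
      have h2 := (List.pairwise_append.1 hpw).2.1
      exact ((List.pairwise_cons.1 h2).1 b₀ (by simp [h1])).2.le
  -- the bend of the new L-shape is between the bends of `a` and of its successor `c` horizontally, and
  -- between those of the predecessor `b₀` of `b` and of `b` vertically
  obtain ⟨X, hX1, hX2⟩ := exists_between hac.x_lt
  obtain ⟨Y, hY1, hY2⟩ := exists_between hb₀b.y_lt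
  let N : LShape := ⟨X, Y, (L a).y, (L b).x, hY2.trans_le hb₀a, hX2.trans_le hcb⟩
  let L' : V → LShape := Function.update L x N
  have hLx : L' x = N := Function.update_self ..
  have hL : ∀ y ∈ o, L' y = L y := fun y hy =>
    Function.update_of_ne (by rintro rfl; exact hx hy) _ _
  have hab : a ≠ b := by
    rintro rfl; exact absurd (hX1.trans (hX2.trans_le hcb)) (lt_irrefl _)
  have hcon : ∀ u ∈ o, ∀ p ∈ N.points, p ∈ (L u).points →
      (u = a ∧ p = (X, (L a).y)) ∨ (u = b ∧ p = ((L b).x, Y)) := fun u hu p hpN hpu =>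
    contact_new hac hb₀b hb₀b.ne hac.ne hX2 hY2 rfl rfl hu hpN hpu
  have hNa : (X, (L a).y) ∈ N.points := Or.inl ⟨rfl, (hY2.trans_le hb₀a).le, le_rfl⟩
  have hNb : ((L b).x, Y) ∈ N.points := Or.inr ⟨rfl, (hX2.trans_le hcb).le, le_rfl⟩
  have haN : (X, (L a).y) ∈ (L a).points := Or.inr ⟨rfl, hX1.le, hX2.le.trans hac.le_right⟩
  have hbN : ((L b).x, Y) ∈ (L b).points := Or.inl ⟨rfl, hY1.le, hY2.le.trans hb₀b.le_top⟩
  have hdis : ∀ u ∈ o, Disjoint N.interior (L u).interior := by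
    intro u hu
    rw [Set.disjoint_left]
    intro p hp hq
    rcases hcon u hu p hp.1 hq.1 with ⟨-, h1⟩ | ⟨-, h1⟩
    · exact hp.2 (Or.inl h1)
    · exact hp.2 (Or.inr h1)
  have htouch : ∀ u ∈ o, G.Adj x u ↔ (N.points ∩ (L u).points).Nonempty := by
    intro u hu
    rw [hadj u hu]
    constructor
    · rintro (rfl | rfl)
      · exact ⟨_, hNa, haN⟩
      · exact ⟨_, hNb, hbN⟩
    · rintro ⟨p, hp, hq⟩
      exact (hcon u hu p hp hq).imp And.left And.left
  have htr : ∀ u ∈ o, ∀ w ∈ o, u ≠ w → ∀ p ∈ N.points, p ∈ (L u).points → p ∉ (L w).points := by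
    intro u hu w hw huw p hp h1 h2
    have hne : (X, (L a).y) ≠ ((L b).x, Y) := fun h =>
      absurd (Prod.ext_iff.1 h).1 (hX2.trans_le hcb).ne
    rcases hcon u hu p hp h1 with ⟨h3, h4⟩ | ⟨h3, h4⟩ <;>
      rcases hcon w hw p hp h2 with ⟨h5, h6⟩ | ⟨h5, h6⟩
    · exact huw (h3.trans h5.symm)
    · exact hne (h4.symm.trans h6)
    · exact hne (h6.symm.trans h4)
    · exact huw (h3.trans h5.symm)
  -- the cyclic order at a neighbour `g` of `x` on the staircase
  have hcyc : ∀ g ∈ o, ∀ c ∈ o, ∀ p ∈ o, G.Adj g x → G.Adj g c → R.NextIn {y | y ∈ o} g c p →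
      R.NextIn {y | y ∈ o} g x p → ∀ q₁ q₂ q₃ : ℝ × ℝ,
      (∀ q, q ∈ (L g).points ∧ q ∈ (L c).points ↔ q = q₁) →
      (∀ q ∈ (L g).points, q ∈ N.points → q = q₂) →
      (∀ q, q ∈ (L g).points ∧ q ∈ (L p).points ↔ q = q₃) →
      (c = p ∨ CyclicLT (q₁.2 - q₁.1) (q₂.2 - q₂.1) (q₃.2 - q₃.1)) →
      ∀ d ∈ x :: o, ∀ e ∈ x :: o, ∀ f, G.Adj g d → G.Adj g e → R.NextIn {y | y ∈ x :: o} g d f →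
      ∀ p q r, p ∈ (L' g).points → p ∈ (L' d).points → q ∈ (L' g).points → q ∈ (L' e).points →
      r ∈ (L' g).points → r ∈ (L' f).points → ¬ CyclicLT (p.2 - p.1) (q.2 - q.1) (r.2 - r.1) := by
    intro g hg c hc p hp hgx hgc hcp hxp q₁ q₂ q₃ h1 h2 h3 h4 d hd e he f hgd hge hdf p' q' r'
      h5 h6 h7 h8 h9 h10
    have := not_cyclicLT_insert (R := R) (A := {y | y ∈ o}) (g := g) (c := c) (p := p) (x := x)
      (Par := fun d r => ∃ q : ℝ × ℝ, q ∈ (L g).points ∧ q ∈ (L' d).points ∧ r = q.2 - q.1)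
      (c₀ := q₁.2 - q₁.1) (X := q₂.2 - q₂.1) (p₀ := q₃.2 - q₃.1)
      hgc hc hgx hx hcp hxp ?_ ?_ ?_ ?_ ?_ h4 d (hs ▸ hd) e (hs ▸ he) f hgd hge (hs ▸ hdf) _ _ _
      ⟨p', hL g hg ▸ h5, h6, rfl⟩ ⟨q', hL g hg ▸ h7, h8, rfl⟩ ⟨r', hL g hg ▸ h9, h10, rfl⟩
    · exact this
    · rintro d hd e he f hgd hge hdf _ _ _ ⟨p, hp1, hp2, rfl⟩ ⟨q, hq1, hq2, rfl⟩ ⟨r, hr1, hr2, rfl⟩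
      rw [hL d hd] at hp2
      rw [hL e he] at hq2
      rw [hL f hdf.1] at hr2
      exact h.cyclic g hg d hd e he f hgd hge hdf p q r hp1 hp2 hq1 hq2 hr1 hr2
    · rintro d hd hgd e he hge _ ⟨p, hp1, hp2, rfl⟩ ⟨q, hq1, hq2, hpq⟩
      rw [hL d hd] at hp2
      rw [hL e he] at hq2
      by_contra hde
      have := LShape.eq_of_sub_eq hp1 hq1 hpq
      subst this
      exact h.triple g hg d hd e he hgd.ne hde hge.ne p hp1 hp2 hq2
    · rintro _ ⟨q, hq1, hq2, rfl⟩
      rw [hLx] at hq2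
      rw [h2 q hq1 hq2]
    · intro s
      rw [hL c hc]
      constructor
      · rintro ⟨q, hq1, hq2, rfl⟩
        rw [(h1 q).1 ⟨hq1, hq2⟩]
      · rintro rfl
        exact ⟨q₁, ((h1 _).2 rfl).1, ((h1 _).2 rfl).2, rfl⟩
    · intro s
      rw [hL p hp]
      constructor
      · rintro ⟨q, hq1, hq2, rfl⟩
        rw [(h3 q).1 ⟨hq1, hq2⟩]
      · rintro rfl
        exact ⟨q₃, ((h3 _).2 rfl).1, ((h3 _).2 rfl).2, rfl⟩
  have hstair : ∀ a b, IsStair L o a b → ∀ q, q ∈ (L a).points ∧ q ∈ (L b).points ↔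
      q = ((L b).x, (L a).y) := fun a b hab q =>
    ⟨fun hq => hab.contact q hq.1 hq.2, fun hq => hq ▸ ⟨hab.mem_left, hab.mem_right⟩⟩
  have hswap : ∀ a b q₀, (∀ q, q ∈ (L a).points ∧ q ∈ (L b).points ↔ q = q₀) →
      ∀ q, q ∈ (L b).points ∧ q ∈ (L a).points ↔ q = q₀ := fun a b q₀ h q =>
    and_comm.trans (h q)
  refine ⟨L', ?_, ?_, ?_, ?_, ?_, ?_, ?_, ?_⟩
  · intro u hu w hw huw
    rcases List.mem_cons.1 hu with rfl | hu' <;> rcases List.mem_cons.1 hw with rfl | hw'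
    · exact absurd rfl huw
    · rw [hLx, hL w hw']; exact hdis w hw'
    · rw [hLx, hL u hu']; exact (hdis u hu').symm
    · rw [hL u hu', hL w hw']; exact h.disjoint u hu' w hw' huw
  · intro u hu w hw huw
    rcases List.mem_cons.1 hu with rfl | hu' <;> rcases List.mem_cons.1 hw with rfl | hw'
    · exact absurd rfl huw
    · rw [hLx, hL w hw']; exact htouch w hw'
    · rw [hLx, hL u hu', SimpleGraph.adj_comm, Set.inter_comm]; exact htouch u hu'
    · rw [hL u hu', hL w hw']; exact h.touch u hu' w hw' huw
  · intro u hu v hv w hw huv hvw huw p h1 h2 h3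
    rcases List.mem_cons.1 hu with rfl | hu' <;> rcases List.mem_cons.1 hv with rfl | hv' <;>
      rcases List.mem_cons.1 hw with rfl | hw' <;> try contradiction
    · rw [hLx] at h1; rw [hL v hv'] at h2; rw [hL w hw'] at h3
      exact htr v hv' w hw' hvw p h1 h2 h3
    · rw [hL u hu'] at h1; rw [hLx] at h2; rw [hL w hw'] at h3
      exact htr u hu' w hw' huw p h2 h1 h3
    · rw [hL u hu'] at h1; rw [hL v hv'] at h2; rw [hLx] at h3
      exact htr u hu' v hv' huv p h3 h1 h2
    · rw [hL u hu'] at h1; rw [hL v hv'] at h2; rw [hL w hw'] at h3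
      exact h.triple u hu' v hv' w hw' huv hvw huw p h1 h2 h3
  · intro u hu
    rw [hL v₁ hv₁]
    rcases List.mem_cons.1 hu with rfl | hu
    · rw [hLx]; exact hY2.le.trans (h.top b₀ hb₀o)
    · rw [hL u hu]; exact h.top u hu
  · intro u hu
    rw [hL v₂ hv₂]
    rcases List.mem_cons.1 hu with rfl | hu
    · rw [hLx]; exact hX2.le.trans (h.right c hco)
    · rw [hL u hu]; exact h.right u hu
  · rw [hL v₁ hv₁, hL v₂ hv₂]; exact h.base
  · have hst := h.stair
    have hxpts : ∀ p ∈ N.points, X ≤ p.1 ∧ Y ≤ p.2 := by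
      rintro ⟨p1, p2⟩ (⟨h1, h2, h3⟩ | ⟨h1, h2, h3⟩)
      · exact ⟨h1.ge, h2⟩
      · exact ⟨h2, h1.ge⟩
    have hp1 : (l₁ ++ [a]).IsChain (IsStair L o) := by
      rw [List.append_assoc] at hst
      exact (List.isChain_split.1 hst).1
    have hp2 : (b :: l₂).IsChain (IsStair L o) := by
      exact (List.isChain_split.1 hst).2
    have hm1 : ∀ g ∈ l₁ ++ [a], (L g).x ≤ (L a).x := by
      intro g hg
      rcases List.mem_append.1 hg with hg | hg
      · rw [List.append_assoc] at hpw
        exact ((List.pairwise_append.1 hpw).2.2 g hg a (by simp)).1.le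
      · rw [List.mem_singleton.1 hg]
    have hm2 : ∀ g ∈ b :: l₂, (L g).y ≤ (L b).y := by
      intro g hg
      rcases List.mem_cons.1 hg with rfl | hg
      · exact le_rfl
      · exact ((List.pairwise_cons.1 (List.pairwise_append.1 hpw).2.1).1 g hg).2.le
    rw [List.isChain_split]
    refine ⟨?_, List.isChain_cons_cons.2 ⟨?_, List.isChain_cons_cons.2 ⟨?_, ?_⟩⟩⟩
    · refine hp1.imp_of_mem_imp fun p q hp hq hpq => hpq.congr ?_ ?_ hL ?_
      · exact ih.subset _ (by rw [List.append_assoc]; simp at hp ⊢; tauto)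
      · exact ih.subset _ (by rw [List.append_assoc]; simp at hq ⊢; tauto)
      · intro z hz
        rw [hLx] at hz
        exact Or.inl ((hm1 q hq).trans_lt (hX1.trans_le (hxpts z hz).1))
    · refine ⟨?_, ?_, ?_, ?_, ?_, ?_, ?_⟩
      · rw [hLx, hL a hao]; exact hX1
      · rw [hLx, hL a hao]; exact hY2.trans_le hb₀a
      · rw [hLx, hL a hao]; exact hX2.le.trans hac.le_right
      · rw [hLx, hL a hao]
      · rw [hLx, hL a hao]
        intro p h1 h2
        rcases hcon a hao p h2 h1 with h3 | h3
        · exact h3.2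
        · exact absurd h3.1 hab
      · rw [hLx, hL a hao]
        intro u hu p hp h1 h2
        rcases List.mem_cons.1 hu with rfl | hu
        · rw [hLx] at hp; exact absurd (hxpts p hp).1 (not_le.2 h1)
        · rw [hL u hu] at hp; exact hac.left u hu p hp (h1.trans hX2) h2
      · rw [hLx, hL a hao]
        intro u hu p hp h1 h2
        rcases List.mem_cons.1 hu with rfl | hu
        · rfl
        · rw [hL u hu] at hp
          have h3 : p.1 < (L c).x := h1.trans_lt hX2
          exact absurd ((hac.left u hu p hp h3 h2.le).symm.trans (hac.below u hu p hp h3.le h2))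
            hac.ne
    · refine ⟨?_, ?_, ?_, ?_, ?_, ?_, ?_⟩
      · rw [hLx, hL b hbo]; exact hX2.trans_le hcb
      · rw [hLx, hL b hbo]; exact hY1
      · rw [hLx, hL b hbo]
      · rw [hLx, hL b hbo]; exact hY2.le.trans hb₀b.le_top
      · rw [hLx, hL b hbo]
        intro p h1 h2
        rcases hcon b hbo p h1 h2 with h3 | h3
        · exact absurd h3.1.symm hab
        · exact h3.2
      · rw [hLx, hL b hbo]
        intro u hu p hp h1 h2
        rcases List.mem_cons.1 hu with rfl | hu
        · rfl
        · rw [hL u hu] at hp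
          have h3 : p.2 < (L b₀).y := h2.trans_lt hY2
          exact absurd ((hb₀b.left u hu p hp h1 h3.le).symm.trans (hb₀b.below u hu p hp h1.le h3))
            hb₀b.ne
      · rw [hLx, hL b hbo]
        intro u hu p hp h1 h2
        rcases List.mem_cons.1 hu with rfl | hu
        · rw [hLx] at hp; exact absurd (hxpts p hp).2 (not_le.2 h2)
        · rw [hL u hu] at hp; exact hb₀b.below u hu p hp h1 (h2.trans hY2)
    · refine hp2.imp_of_mem_imp fun p q hp hq hpq => hpq.congr ?_ ?_ hL ?_
      · exact ih.subset _ (by rw [List.append_assoc]; simp at hp ⊢; tauto)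
      · exact ih.subset _ (by rw [List.append_assoc]; simp at hq ⊢; tauto)
      · intro z hz
        rw [hLx] at hz
        exact Or.inr ((hm2 p hp).trans_lt (hY1.trans_le (hxpts z hz).2))
  · intro u hu
    rcases List.mem_cons.1 hu with rfl | huo
    · intro d hd e he f hud hue hdf p q r h1 h2 h3 h4 h5 h6
      have hfx := hdf.adj hud
      have hone : ∀ y ∈ u :: o, G.Adj u y → ∀ p ∈ (L' u).points, p ∈ (L' y).points →
          p = (X, (L a).y) ∨ p = ((L b).x, Y) := by
        intro y hy huy p hp hq
        rcases List.mem_cons.1 hy with rfl | hy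
        · exact absurd rfl huy.ne
        · rw [hLx] at hp
          rw [hL y hy] at hq
          exact (hcon y hy p hp hq).imp And.right And.right
      rcases hone d hd hud p h1 h2 with rfl | rfl <;> rcases hone e he hue q h3 h4 with rfl | rfl <;>
        rcases hone f hdf.1 hfx r h5 h6 with rfl | rfl <;>
        first | exact CyclicLT.irrefl_left | exact CyclicLT.irrefl_mid | exact CyclicLT.irrefl_ends
    · by_cases hua : u = a
      · subst hua
        have hq2 : ∀ q ∈ (L u).points, q ∈ N.points → q = (X, (L u).y) := by
          intro q h1 h2
          rcases hcon u hao q h2 h1 with h3 | h3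
          · exact h3.2
          · exact absurd h3.1 hab
        rcases List.eq_nil_or_concat l₁ with rfl | ⟨l, z, rfl⟩
        · have h1 : u = v₁ := by simpa using ih.head
          have h2 : a₀ = v₂ := by
            have h3 : k = [] := by cases k <;> simp at hk ⊢
            rw [h3] at hk; simpa using hk.symm
          subst h1 h2
          refine hcyc u hao c hco a₀ hv₂ hxa.symm hac' t1 hna _ _ _ (hstair u c hac) hq2 h.base ?_
          by_cases hca : c = a₀
          · exact Or.inl hca
          · have : (L c).x < (L a₀).x := by
              have h3 : a₀ ∈ c :: (r ++ l₂) := by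
                have := ih.last
                have h4 : a₀ ∈ ([] ++ u :: m ++ b :: l₂).getLast? := this
                have h5 := List.mem_of_getLast? h4
                rw [e0] at h5
                have h6 : u ≠ a₀ := hbase.ne
                rcases List.mem_cons.1 h5 with h5 | h5
                · exact absurd h5.symm h6
                · exact h5
              rcases List.mem_cons.1 h3 with h3 | h3
              · exact absurd h3.symm hca
              · rw [e0] at hpw
                exact ((List.pairwise_cons.1 (List.pairwise_cons.1 hpw).2).1 a₀ h3).1
            right
            refine Or.inr (Or.inr ⟨?_, ?_⟩) <;> dsimp only <;> linarith
        · have h2 : a₀ = z := by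
            have : (v₂ :: (l ++ [z])).getLast? = some a₀ := by
              rw [← List.concat_eq_append, hk]; simp
            rw [← List.cons_append, List.getLast?_concat] at this
            exact (Option.some.inj this).symm
          subst h2
          have hst : IsStair L o a₀ u := by
            have := h.stair
            have e : l.concat a₀ ++ u :: m ++ b :: l₂ = l ++ a₀ :: u :: (m ++ b :: l₂) := by simp
            rw [e, List.isChain_split] at this
            exact (List.isChain_cons_cons.1 this.2).1
          have ha₀ : a₀ ∈ o := hna.1
          refine hcyc u hao c hco a₀ ha₀ hxa.symm hac' t1 hna _ _ _ (hstair u c hac) hq2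
            (hswap _ _ _ (hstair a₀ u hst)) (Or.inr (Or.inl ⟨?_, ?_⟩))
          · dsimp only; linarith
          · have := hst.y_lt; dsimp only; linarith
      · by_cases hub : u = b
        · subst hub
          have hq2 : ∀ q ∈ (L u).points, q ∈ N.points → q = ((L u).x, Y) := by
            intro q h1 h2
            rcases hcon u hbo q h2 h1 with h3 | h3
            · exact absurd h3.1.symm hab
            · exact h3.2
          cases l₂ with
          | nil =>
            have h1 : u = v₂ := by
              have := ih.last
              rw [List.getLast?_append] at this
              simpa using this
            have h2 : b₁ = v₁ := by simp at hk₂; exact hk₂.1.symm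
            subst h1 h2
            refine hcyc u hbo b₁ hv₁ b₀ hb₀o hxb.symm hbase.symm t2 hnb _ _ _
              (hswap _ _ _ h.base) hq2 (hswap _ _ _ (hstair b₀ u hb₀b)) ?_
            by_cases hcb : b₁ = b₀
            · exact Or.inl hcb
            · have : (L b₀).y < (L b₁).y := by
                have h3 : b₁ ∈ l₁ ++ k' ++ [b₀] := by
                  have h5 := List.mem_of_head? ih.head
                  rw [e0'] at h5
                  have h6 : b₁ ≠ u := hbase.ne
                  simp at h5 ⊢
                  tauto
                rcases List.mem_append.1 h3 with h3 | h3
                · rw [e0'] at hpw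
                  exact ((List.pairwise_append.1 hpw).2.2 b₁ h3 b₀ (by simp)).2
                · exact absurd (List.mem_singleton.1 h3) hcb
              right
              refine Or.inr (Or.inl ⟨?_, ?_⟩) <;> dsimp only <;> linarith
          | cons z l =>
            have h2 : b₁ = z := by simp at hk₂; exact hk₂.1.symm
            subst h2
            have hst : IsStair L o u b₁ := by
              have := h.stair
              rw [List.isChain_split] at this
              exact (List.isChain_cons_cons.1 this.2).1
            refine hcyc u hbo b₁ hb₁o b₀ hb₀o hxb.symm hab₁ t2 hnb _ _ _ (hstair u b₁ hst) hq2
              (hswap _ _ _ (hstair b₀ u hb₀b)) (Or.inr (Or.inl ⟨?_, ?_⟩))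
            · have := hst.x_lt; dsimp only; linarith
            · dsimp only; linarith
        · have hux : ¬ G.Adj u x := fun h' => by
            rcases (hadj u huo).1 h'.symm with h' | h'
            · exact hua h'
            · exact hub h'
          have hmem : ∀ y ∈ x :: o, G.Adj u y → y ∈ o := by
            intro y hy huy
            rcases List.mem_cons.1 hy with rfl | hy
            · exact absurd huy hux
            · exact hy
          intro d hd e he f hud hue hdf p q r h1 h2 h3 h4 h5 h6
          have hd' := hmem d hd hud
          have he' := hmem e he hue
          obtain ⟨f', hf'⟩ := R.exists_nextIn (A := {y | y ∈ o}) hud hud hd'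
          rw [hs] at hdf
          have : f = f' := hdf.unique (hf'.insert_of_not_adj hud hux)
          subst this
          rw [hL u huo] at h1 h3 h5
          rw [hL d hd'] at h2
          rw [hL e he'] at h4
          rw [hL f hf'.1] at h6
          exact h.cyclic u huo d hd' e he' f hud hue hf' p q r h1 h2 h3 h4 h5 h6

/-- The L-shapes are added in the order of the construction. -/
theorem Build.exists_isStaircase [Finite V] (hbase : G.Adj v₁ v₂) {o P : List V}
    (h : Build R v₁ v₂ o P) : ∃ L, IsStaircase R v₁ v₂ o P L := by
  induction h with
  | base => exact isStaircase_base R hbase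
  | step o l₁ m l₂ k k' a b x a₀ b₀ hB hx hadj hk hk' hna hnb ih =>
    obtain ⟨L, hL⟩ := ih
    exact hL.step hbase (hB.facts hbase) hx hadj hk hk' hna hnb

/-- The L-representation with the given embedding that results from a construction of the graph. -/
theorem Build.exists_isLRepresentation [Finite V] (hbase : G.Adj v₁ v₂) {o P : List V}
    (h : Build R v₁ v₂ o P) (ho : ∀ y, y ∈ o) :
    ∃ L, IsLRepresentation G L ∧ HasBaseEdge L v₁ v₂ ∧ DefinesEmbedding L R := by
  obtain ⟨L, hL⟩ := h.exists_isStaircase hbase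
  refine ⟨L, ⟨fun x y => hL.disjoint x (ho x) y (ho y), fun x y => hL.touch x (ho x) y (ho y), ?_⟩,
    ⟨fun x => hL.top x (ho x), fun x => hL.right x (ho x)⟩, ?_⟩
  · intro x y z hxy hyz hxz
    ext p
    simp only [Set.mem_inter_iff, Set.mem_empty_iff_false, iff_false, not_and, and_imp]
    exact fun h1 h2 => hL.triple x (ho x) y (ho y) z (ho z) hxy hyz hxz p h1 h2
  · rintro ⟨⟨u, d⟩, hd⟩ ⟨⟨u', e⟩, he⟩ hue p q r hp hq hr
    dsimp only at hue
    subst hue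
    rw [R.rot_mk] at hr
    have : ({y | y ∈ o} : Set V) = Set.univ := by ext y; simp [ho y]
    exact hL.cyclic u' (ho _) d (ho _) e (ho _) (R.nx u' d) hd he (this ▸ nextIn_univ.2 rfl) p q r
      hp.1 hp.2 hq.1 hq.2 hr.1 hr.2

end RotationSystem

/-! ### Contacts of L-shapes -/

/-- Touching of two L-shapes, with the bend of the first one (weakly) to the upper left of the other
one's. -/
def LShape.Touches (K M : LShape) : Prop :=
  K.x ≤ M.x ∧ M.y ≤ K.y ∧ M.x ≤ K.right ∧ K.y ≤ M.top

namespace LShape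

theorem Touches.mem_left {K M : LShape} (h : K.Touches M) : (M.x, K.y) ∈ K.points :=
  Or.inr ⟨rfl, h.1, h.2.2.1⟩

theorem Touches.mem_right {K M : LShape} (h : K.Touches M) : (M.x, K.y) ∈ M.points :=
  Or.inl ⟨rfl, h.2.1, h.2.2.2⟩

theorem vertical_not_disjoint {K M : LShape} (h : Disjoint K.interior M.interior)
    (hx : K.x = M.x) : K.top ≤ M.y ∨ M.top ≤ K.y := by
  by_contra hc
  push Not at hc
  obtain ⟨t, h1, h2⟩ := exists_between (lt_min (max_lt K.y_lt_top hc.1) (max_lt hc.2 M.y_lt_top))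
  rw [max_lt_iff] at h1
  rw [lt_min_iff] at h2
  refine Set.disjoint_left.1 h
    (show (K.x, t) ∈ K.interior from ⟨Or.inl ⟨rfl, h1.1.le, h2.1.le⟩, ?_⟩)
    ⟨Or.inl ⟨hx, h1.2.le, h2.2.le⟩, ?_⟩
  · rintro (h | h) <;> simp only [Set.mem_singleton_iff, Prod.mk.injEq] at h
    · exact h2.1.ne h.2
    · exact h1.1.ne' h.2
  · rintro (h | h) <;> simp only [Set.mem_singleton_iff, Prod.mk.injEq] at h
    · exact h2.2.ne h.2
    · exact h1.2.ne' h.2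

theorem horizontal_not_disjoint {K M : LShape} (h : Disjoint K.interior M.interior)
    (hy : K.y = M.y) : K.right ≤ M.x ∨ M.right ≤ K.x := by
  by_contra hc
  push Not at hc
  obtain ⟨t, h1, h2⟩ :=
    exists_between (lt_min (max_lt K.x_lt_right hc.1) (max_lt hc.2 M.x_lt_right))
  rw [max_lt_iff] at h1
  rw [lt_min_iff] at h2
  refine Set.disjoint_left.1 h
    (show (t, K.y) ∈ K.interior from ⟨Or.inr ⟨rfl, h1.1.le, h2.1.le⟩, ?_⟩)
    ⟨Or.inr ⟨hy, h1.2.le, h2.2.le⟩, ?_⟩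
  · rintro (h | h) <;> simp only [Set.mem_singleton_iff, Prod.mk.injEq] at h
    · exact h1.1.ne' h.1
    · exact h2.1.ne h.1
  · rintro (h | h) <;> simp only [Set.mem_singleton_iff, Prod.mk.injEq] at h
    · exact h1.2.ne' h.1
    · exact h2.2.ne h.1

theorem bend_ne {K M : LShape} (h : Disjoint K.interior M.interior) (hx : K.x = M.x) :
    K.y ≠ M.y := by
  intro hy
  rcases vertical_not_disjoint h hx with h1 | h1
  · exact absurd K.y_lt_top (not_lt.2 (hy ▸ h1))
  · exact absurd M.y_lt_top (not_lt.2 (hy ▸ h1))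

theorem touches_or {K M : LShape} (h : Disjoint K.interior M.interior)
    (hne : (K.points ∩ M.points).Nonempty) : K.Touches M ∨ M.Touches K := by
  obtain ⟨⟨p1, p2⟩, hK, hM⟩ := hne
  simp only [LShape.points, Set.mem_ofPred_eq] at hK hM
  have hK1 := K.x_lt_right
  have hK2 := K.y_lt_top
  have hM1 := M.x_lt_right
  have hM2 := M.y_lt_top
  rcases hK with ⟨h1, h2, h3⟩ | ⟨h1, h2, h3⟩ <;> rcases hM with ⟨h4, h5, h6⟩ | ⟨h4, h5, h6⟩
  · rcases vertical_not_disjoint h (h1.symm.trans h4) with h7 | h7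
    · right; refine ⟨?_, ?_, ?_, ?_⟩ <;> linarith
    · left; refine ⟨?_, ?_, ?_, ?_⟩ <;> linarith
  · right; refine ⟨?_, ?_, ?_, ?_⟩ <;> linarith
  · left; refine ⟨?_, ?_, ?_, ?_⟩ <;> linarith
  · rcases horizontal_not_disjoint h (h1.symm.trans h4) with h7 | h7
    · left; refine ⟨?_, ?_, ?_, ?_⟩ <;> linarith
    · right; refine ⟨?_, ?_, ?_, ?_⟩ <;> linarith

/-- Two touching L-shapes touch in an endpoint of one of them. -/
theorem Touches.eq_or {K M : LShape} (ht : K.Touches M) (h : Disjoint K.interior M.interior) :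
    K.right = M.x ∨ M.top = K.y := by
  by_contra hc
  push Not at hc
  refine Set.disjoint_left.1 h (show (M.x, K.y) ∈ K.interior from ⟨ht.mem_left, ?_⟩)
    ⟨ht.mem_right, ?_⟩
  · rintro (h | h) <;> simp only [Set.mem_singleton_iff, Prod.mk.injEq] at h
    · exact K.y_lt_top.ne h.2
    · exact hc.1 h.1.symm
  · rintro (h | h) <;> simp only [Set.mem_singleton_iff, Prod.mk.injEq] at h
    · exact hc.2 h.2.symm
    · exact M.x_lt_right.ne h.1

end LShape

section Generic

variable {V : Type u}

/-- A family of L-shapes in general position and without crossings: no two bends are on a common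
vertical or horizontal line, and if the bend of `L u` is to the upper left of the bend of `L w`, then
the horizontal leg of `L u` or the vertical leg of `L w` ends where, or before, they meet. -/
structure IsGeneric (L : V → LShape) : Prop where
  x_inj : ∀ u w, (L u).x = (L w).x → u = w
  y_inj : ∀ u w, (L u).y = (L w).y → u = w
  noncross : ∀ u w, (L u).x < (L w).x → (L w).y < (L u).y →
    (L u).right ≤ (L w).x ∨ (L w).top ≤ (L u).y

/-- The graph of the contacts in a family of L-shapes. -/
def contactGraph (L : V → LShape) : SimpleGraph V where
  Adj u w := u ≠ w ∧ ((L u).Touches (L w) ∨ (L w).Touches (L u))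
  symm := ⟨fun _ _ h => ⟨h.1.symm, h.2.symm⟩⟩
  loopless := ⟨fun _ h => h.1 rfl⟩

theorem IsGeneric.noncross' {L : V → LShape} (h : IsGeneric L) {u w : V} (hne : u ≠ w)
    (ht : (L u).Touches (L w)) : (L u).right = (L w).x ∨ (L w).top = (L u).y := by
  have hx : (L u).x < (L w).x := ht.1.lt_of_ne fun h' => hne (h.x_inj _ _ h')
  have hy : (L w).y < (L u).y := ht.2.1.lt_of_ne fun h' => hne (h.y_inj _ _ h').symm
  rcases h.noncross u w hx hy with h1 | h1
  · exact Or.inl (le_antisymm h1 ht.2.2.1)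
  · exact Or.inr (le_antisymm h1 ht.2.2.2)

theorem IsGeneric.isLRepresentation {L : V → LShape} (h : IsGeneric L) :
    IsLRepresentation (contactGraph L) L := by
  -- a common point is the intersection of a vertical leg with a horizontal leg
  have key : ∀ u w, u ≠ w → ∀ p ∈ (L u).points, p ∈ (L w).points →
      ((L u).Touches (L w) ∧ p = ((L w).x, (L u).y)) ∨
      ((L w).Touches (L u) ∧ p = ((L u).x, (L w).y)) := by
    rintro u w huw ⟨p1, p2⟩ (⟨h1, h2, h3⟩ | ⟨h1, h2, h3⟩) (⟨h4, h5, h6⟩ | ⟨h4, h5, h6⟩) <;>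
      dsimp only at *
    · exact absurd (h.x_inj _ _ (h1.symm.trans h4)) huw
    · right; subst h1 h4; exact ⟨⟨h5, h2, h6, h3⟩, rfl⟩
    · left; subst h1 h4; exact ⟨⟨h2, h5, h3, h6⟩, rfl⟩
    · exact absurd (h.y_inj _ _ (h1.symm.trans h4)) huw
  have hdis : ∀ u w, u ≠ w → (L u).Touches (L w) →
      ((L w).x, (L u).y) ∈ (L u).interior → ((L w).x, (L u).y) ∉ (L w).interior := by
    intro u w huw ht hu hw
    rcases h.noncross' huw ht with h1 | h1
    · exact hu.2 (Or.inr (by rw [h1]; rfl))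
    · exact hw.2 (Or.inl (by rw [h1]))
  refine ⟨?_, ?_, ?_⟩
  · intro u w huw
    rw [Set.disjoint_left]
    intro p hu hw
    rcases key u w huw p hu.1 hw.1 with ⟨ht, rfl⟩ | ⟨ht, rfl⟩
    · exact hdis u w huw ht hu hw
    · exact hdis w u huw.symm ht hw hu
  · intro u w huw
    constructor
    · rintro ⟨-, ht | ht⟩
      · exact ⟨_, ht.mem_left, ht.mem_right⟩
      · exact ⟨_, ht.mem_right, ht.mem_left⟩
    · rintro ⟨p, hu, hw⟩
      exact ⟨huw, (key u w huw p hu hw).imp And.left And.left⟩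
  · intro u v w huv hvw huw
    ext p
    simp only [Set.mem_inter_iff, Set.mem_empty_iff_false, iff_false, not_and, and_imp]
    rintro (⟨h1, -, -⟩ | ⟨h1, -, -⟩) (⟨h2, -, -⟩ | ⟨h2, -, -⟩) (⟨h3, -, -⟩ | ⟨h3, -, -⟩)
    · exact huv (h.x_inj _ _ (h1.symm.trans h2))
    · exact huv (h.x_inj _ _ (h1.symm.trans h2))
    · exact huw (h.x_inj _ _ (h1.symm.trans h3))
    · exact hvw (h.y_inj _ _ (h2.symm.trans h3))
    · exact hvw (h.x_inj _ _ (h2.symm.trans h3))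
    · exact huw (h.y_inj _ _ (h1.symm.trans h3))
    · exact huv (h.y_inj _ _ (h1.symm.trans h2))
    · exact huv (h.y_inj _ _ (h1.symm.trans h2))

/-- Ranks with respect to `f`, as real numbers with gaps of more than `1 / 2`. -/
theorem exists_rank [Finite V] {α : Type*} [LinearOrder α] (f : V → α) :
    ∃ g : V → ℝ, (∀ u w, g u < g w ↔ f u < f w) ∧ ∀ u w, g u < g w → g u + 1 / 2 < g w := by
  classical
  have := Fintype.ofFinite V
  let g : V → ℕ := fun v => (Finset.univ.filter fun u => f u < f v).card
  have hle : ∀ u w, f u ≤ f w → g u ≤ g w := fun u w h =>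
    Finset.card_le_card fun z hz => by
      simp only [Finset.mem_filter, Finset.mem_univ, true_and] at hz ⊢
      exact hz.trans_le h
  have hlt : ∀ u w, f u < f w → g u < g w := fun u w h =>
    Finset.card_lt_card <| by
      rw [Finset.ssubset_iff_of_subset]
      · exact ⟨u, by simpa using h, by simp⟩
      · intro z hz
        simp only [Finset.mem_filter, Finset.mem_univ, true_and] at hz ⊢
        exact hz.trans h
  refine ⟨fun v => g v, ?_, ?_⟩
  · intro u w
    rw [Nat.cast_lt]
    exact ⟨fun h => not_le.1 fun h' => absurd (hle w u h') (not_le.2 h), hlt u w⟩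
  · intro u w h
    rw [Nat.cast_lt] at h
    have : (g u : ℝ) + 1 ≤ g w := by exact_mod_cast h
    linarith

/-- The maximum of `a` and of the values of `g` on a set of vertices. -/
theorem exists_max [Finite V] (a : ℝ) (g : V → ℝ) (s : Set V) :
    ∃ m, a ≤ m ∧ (∀ u ∈ s, g u ≤ m) ∧ (m = a ∨ ∃ u ∈ s, m = g u) := by
  obtain ⟨m, hm, hmax⟩ := ((Set.toFinite s).image g |>.insert a).exists_maximal
    (Set.insert_nonempty a _)
  have hmax' : ∀ x ∈ insert a (g '' s), x ≤ m := fun x hx =>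
    not_lt.1 fun h => absurd (hmax hx h.le) (not_le.2 h)
  refine ⟨m, hmax' _ (Or.inl rfl), fun u hu => hmax' _ (Or.inr ⟨u, hu, rfl⟩), ?_⟩
  rcases hm with rfl | ⟨u, hu, rfl⟩
  · exact Or.inl rfl
  · exact Or.inr ⟨u, hu, rfl⟩

/-- The minimum of `a` and of the values of `g` on a set of vertices. -/
theorem exists_min [Finite V] (a : ℝ) (g : V → ℝ) (s : Set V) :
    ∃ m, m ≤ a ∧ (∀ u ∈ s, m ≤ g u) ∧ (m = a ∨ ∃ u ∈ s, m = g u) := by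
  obtain ⟨m, h1, h2, h3⟩ := exists_max (-a) (fun u => -g u) s
  refine ⟨-m, by linarith, fun u hu => by linarith [h2 u hu], ?_⟩
  rcases h3 with h3 | ⟨u, hu, h3⟩
  · exact Or.inl (by linarith)
  · exact Or.inr ⟨u, hu, by linarith⟩

theorem IsLRepresentation.touches_or {G : SimpleGraph V} {L : V → LShape}
    (h : IsLRepresentation G L) {u w : V} (huw : G.Adj u w) :
    (L u).Touches (L w) ∨ (L w).Touches (L u) :=
  LShape.touches_or (h.interior_disjoint u w huw.ne) ((h.touch u w huw.ne).1 huw)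

theorem IsLRepresentation.eq_of_mem {G : SimpleGraph V} {L : V → LShape}
    (h : IsLRepresentation G L) {u v w : V} {p : ℝ × ℝ} (huv : u ≠ v) (huw : u ≠ w)
    (h1 : p ∈ (L u).points) (h2 : p ∈ (L v).points) (h3 : p ∈ (L w).points) : v = w := by
  by_contra hvw
  have : p ∈ (L u).points ∩ (L v).points ∩ (L w).points := ⟨⟨h1, h2⟩, h3⟩
  rw [h.no_triple u v w huv hvw huw] at this
  exact this

/-- An L-representation can be brought into general position without losing a contact: the
coordinates of the bends are replaced by their ranks, where of two bends on a line, the one to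
the upper left counts as further to the left and as higher. -/
theorem IsLRepresentation.exists_isGeneric [Finite V] {G : SimpleGraph V} {L : V → LShape}
    (h : IsLRepresentation G L) : ∃ L' : V → LShape, IsGeneric L' ∧ G ≤ contactGraph L' := by
  obtain ⟨X, hX, hX'⟩ := exists_rank fun v => toLex ((L v).x, -(L v).y)
  obtain ⟨Y, hY, hY'⟩ := exists_rank fun v => toLex ((L v).y, -(L v).x)
  simp only [Prod.Lex.toLex_lt_toLex, neg_lt_neg_iff] at hX hY
  have hXlt : ∀ u w, u ≠ w → (L u).x ≤ (L w).x → (L w).y ≤ (L u).y → X u < X w := by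
    intro u w huw h1 h2
    rw [hX]
    rcases h1.lt_or_eq with h1 | h1
    · exact Or.inl h1
    · exact Or.inr ⟨h1, h2.lt_of_ne (LShape.bend_ne (h.interior_disjoint u w huw) h1).symm⟩
  have hYlt : ∀ u w, u ≠ w → (L u).x ≤ (L w).x → (L w).y ≤ (L u).y → Y w < Y u := by
    intro u w huw h1 h2
    rw [hY]
    rcases h2.lt_or_eq with h2 | h2
    · exact Or.inl h2
    · refine Or.inr ⟨h2, h1.lt_of_ne fun h3 => ?_⟩
      exact LShape.bend_ne (h.interior_disjoint u w huw) h3 h2.symm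
  have hXle : ∀ u w, X u < X w → (L u).x ≤ (L w).x := fun u w h' => by
    rcases (hX u w).1 h' with h1 | h1
    · exact h1.le
    · exact h1.1.le
  have hYle : ∀ u w, Y u < Y w → (L u).y ≤ (L w).y := fun u w h' => by
    rcases (hY u w).1 h' with h1 | h1
    · exact h1.le
    · exact h1.1.le
  have hXinj : ∀ u w, X u = X w → u = w := by
    intro u w huw
    by_contra hne
    have h1 : ¬ X u < X w := huw.not_lt
    have h2 : ¬ X w < X u := huw.not_gt
    rw [hX] at h1 h2
    push Not at h1 h2
    have h3 := le_antisymm h2.1 h1.1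
    exact LShape.bend_ne (h.interior_disjoint u w hne) h3
      (le_antisymm (h1.2 h3) (h2.2 h3.symm))
  have hYinj : ∀ u w, Y u = Y w → u = w := by
    intro u w huw
    by_contra hne
    have h1 : ¬ Y u < Y w := huw.not_lt
    have h2 : ¬ Y w < Y u := huw.not_gt
    rw [hY] at h1 h2
    push Not at h1 h2
    have h3 := le_antisymm h2.1 h1.1
    exact LShape.bend_ne (h.interior_disjoint u w hne)
      (le_antisymm (h1.2 h3) (h2.2 h3.symm)) h3
  -- the horizontal leg of `u` now ends at the last vertical line through a bend to the lower right that
  -- it crossed, or that it reached in a point not above the leg there; vertical legs are treated likewise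
  choose r hr1 hr2 hr3 using fun u => exists_max (X u + 1 / 2) X
    {w | X u < X w ∧ Y w < Y u ∧ ((L w).x < (L u).right ∨
      ((L w).x = (L u).right ∧ (L u).y ≤ (L w).top))}
  choose t ht1 ht2 ht3 using fun w => exists_max (Y w + 1 / 2) Y
    {u | X u < X w ∧ Y w < Y u ∧ ((L u).y < (L w).top ∨
      ((L u).y = (L w).top ∧ (L w).x ≤ (L u).right))}
  have hcross : ∀ u w, X u < X w → Y w < Y u → r u ≤ X w ∨ t w ≤ Y u := by
    intro u w h1 h2
    by_contra hc
    push Not at hc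
    obtain ⟨w₁, ⟨h3, h4, h5⟩, h6⟩ := (hr3 u).resolve_left fun h' => by
      have := hX' u w h1; linarith [hc.1]
    obtain ⟨u₁, ⟨h7, h8, h9⟩, h10⟩ := (ht3 w).resolve_left fun h' => by
      have := hY' w u h2; linarith [hc.2]
    have hw₁ : X w < X w₁ := h6 ▸ hc.1
    have hu₁ : Y u < Y u₁ := h10 ▸ hc.2
    have e1 := hXle _ _ hw₁
    have e2 := hYle _ _ hu₁
    have hne : u ≠ w := by rintro rfl; exact lt_irrefl _ h1
    have ht : (L u).Touches (L w) := by
      refine ⟨hXle _ _ h1, hYle _ _ h2, ?_, ?_⟩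
      · rcases h5 with h5 | h5
        · exact e1.trans h5.le
        · exact e1.trans h5.1.le
      · rcases h9 with h9 | h9
        · exact e2.trans h9.le
        · exact e2.trans h9.1.le
    rcases ht.eq_or (h.interior_disjoint u w hne) with h11 | h11
    · rw [h11] at h5
      have h12 : (L w₁).x = (L w).x ∧ (L u).y ≤ (L w₁).top := by
        rcases h5 with h5 | h5
        · exact absurd e1 (not_le.2 h5)
        · exact h5
      have hne' : u ≠ w₁ := by rintro rfl; exact lt_irrefl _ h3
      refine hw₁.ne (congrArg X (h.eq_of_mem hne hne' ht.mem_left ht.mem_right ?_))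
      exact Or.inl ⟨h12.1.symm, hYle _ _ h4, h12.2⟩
    · rw [h11] at h9
      have h12 : (L u₁).y = (L u).y ∧ (L w).x ≤ (L u₁).right := by
        rcases h9 with h9 | h9
        · exact absurd e2 (not_le.2 h9)
        · exact h9
      have hne' : w ≠ u₁ := by rintro rfl; exact lt_irrefl _ h8
      refine hu₁.ne (congrArg Y (h.eq_of_mem hne.symm hne' ht.mem_right ht.mem_left ?_))
      exact Or.inr ⟨h12.1.symm, hXle _ _ h7, h12.2⟩
  refine ⟨fun v => ⟨X v, Y v, t v, r v, by linarith [ht1 v], by linarith [hr1 v]⟩,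
    ⟨hXinj, hYinj, hcross⟩, ?_⟩
  have main : ∀ u w, u ≠ w → (L u).Touches (L w) →
      X u ≤ X w ∧ Y w ≤ Y u ∧ X w ≤ r u ∧ Y u ≤ t w := by
    intro u w huw ht
    have h1 := hXlt u w huw ht.1 ht.2.1
    have h2 := hYlt u w huw ht.1 ht.2.1
    refine ⟨h1.le, h2.le, hr2 u w ⟨h1, h2, ?_⟩, ht2 w u ⟨h1, h2, ?_⟩⟩
    · rcases ht.2.2.1.lt_or_eq with h3 | h3
      · exact Or.inl h3
      · exact Or.inr ⟨h3, ht.2.2.2⟩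
    · rcases ht.2.2.2.lt_or_eq with h3 | h3
      · exact Or.inl h3
      · exact Or.inr ⟨h3, ht.2.2.1⟩
  intro u w huw
  exact ⟨huw.ne, (h.touches_or huw).imp (main u w huw.ne) (main w u huw.ne.symm)⟩

end Generic

/-! ### Maximal L-graphs -/

section Generic

variable {V : Type u}

/-- A family of L-shapes in general position in which the one of `v₁` begins furthest to the left,
is topmost and stops every vertical leg except the one of `v₂`, which reaches higher;
and the one of `v₂` is rightmost and lowest. -/
structure IsSpread (L : V → LShape) (v₁ v₂ : V) : Prop extends IsGeneric L where
  ne : v₁ ≠ v₂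
  x₁ : ∀ u, u ≠ v₁ → (L v₁).x < (L u).x
  y₁ : ∀ u, u ≠ v₁ → (L u).y < (L v₁).y
  x₂ : ∀ u, u ≠ v₂ → (L u).x < (L v₂).x
  y₂ : ∀ u, u ≠ v₂ → (L v₂).y < (L u).y
  top₂ : (L v₁).y < (L v₂).top
  top_le : ∀ u, u ≠ v₁ → u ≠ v₂ → (L u).top ≤ (L v₁).y

/-- The L-shape with the highest bend becomes the one of `v₁`, and among the others, the one with the
rightmost bend becomes the one of `v₂`. The vertical leg of the former and the horizontal leg of the
latter have no contacts, except possibly with each other, and can be moved out. -/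
theorem IsGeneric.exists_isSpread [Finite V] [Nontrivial V] {L : V → LShape} (h : IsGeneric L) :
    ∃ (L' : V → LShape) (v₁ v₂ : V), IsSpread L' v₁ v₂ ∧ contactGraph L ≤ contactGraph L' := by
  classical
  obtain ⟨v₁, hv₁⟩ := Finite.exists_max fun v => (L v).y
  obtain ⟨v₂, hv₂', hv₂⟩ := (Set.toFinite {v | v ≠ v₁}).exists_maximalFor (fun v => (L v).x)
    _ (exists_ne v₁)
  have hY : ∀ u, u ≠ v₁ → (L u).y < (L v₁).y := fun u hu =>
    (hv₁ u).lt_of_ne fun h' => hu (h.y_inj _ _ h')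
  have hX : ∀ u, u ≠ v₁ → u ≠ v₂ → (L u).x < (L v₂).x := fun u hu hu' =>
    not_le.1 fun h' => hu' (h.x_inj _ _ (le_antisymm (hv₂ hu h') h'))
  obtain ⟨xm, hxm⟩ := Finite.exists_min fun v => (L v).x
  obtain ⟨ym, hym⟩ := Finite.exists_min fun v => (L v).y
  have hne : v₂ ≠ v₁ := hv₂'
  have hA := hxm v₂
  have hB := hym v₁
  let x : V → ℝ := fun v => if v = v₁ then (L xm).x - 1 else (L v).x
  let y : V → ℝ := fun v => if v = v₂ then (L ym).y - 1 else (L v).y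
  let t : V → ℝ := fun v => if v = v₁ ∨ v = v₂ then (L v₁).y + 1 else min (L v).top (L v₁).y
  let r : V → ℝ := fun v => if v = v₁ then (L v₂).x else if v = v₂ then (L v₂).x + 1 else
    min (L v).right (L v₂).x
  have x1 : x v₁ = (L xm).x - 1 := if_pos rfl
  have x2 : ∀ v, v ≠ v₁ → x v = (L v).x := fun v hv => if_neg hv
  have y1 : y v₂ = (L ym).y - 1 := if_pos rfl
  have y2 : ∀ v, v ≠ v₂ → y v = (L v).y := fun v hv => if_neg hv
  have t1 : t v₁ = (L v₁).y + 1 := if_pos (Or.inl rfl)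
  have t2 : t v₂ = (L v₁).y + 1 := if_pos (Or.inr rfl)
  have t3 : ∀ v, v ≠ v₁ → v ≠ v₂ → t v = min (L v).top (L v₁).y := fun v h1 h2 =>
    if_neg (not_or.2 ⟨h1, h2⟩)
  have r1 : r v₁ = (L v₂).x := if_pos rfl
  have r2 : r v₂ = (L v₂).x + 1 := (if_neg hne).trans (if_pos rfl)
  have r3 : ∀ v, v ≠ v₁ → v ≠ v₂ → r v = min (L v).right (L v₂).x := fun v h1 h2 =>
    (if_neg h1).trans (if_neg h2)
  have hyt : ∀ v, y v < t v := by
    intro v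
    by_cases h1 : v = v₁
    · rw [h1, t1, y2 v₁ hne.symm]; linarith
    · by_cases h2 : v = v₂
      · rw [h2, t2, y1]; linarith
      · rw [t3 v h1 h2, y2 v h2]; exact lt_min (L v).y_lt_top (hY v h1)
  have hxr : ∀ v, x v < r v := by
    intro v
    by_cases h1 : v = v₁
    · rw [h1, r1, x1]; linarith
    · by_cases h2 : v = v₂
      · rw [h2, r2, x2 v₂ hne]; linarith
      · rw [r3 v h1 h2, x2 v h1]; exact lt_min (L v).x_lt_right (hX v h1 h2)
  have hx₁ : ∀ u, u ≠ v₁ → x v₁ < x u := fun u hu => by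
    rw [x1, x2 u hu]; linarith [hxm u]
  have hy₂ : ∀ u, u ≠ v₂ → y v₂ < y u := fun u hu => by
    rw [y1, y2 u hu]; linarith [hym u]
  have hy₁ : ∀ u, u ≠ v₁ → y u < y v₁ := fun u hu => by
    by_cases h2 : u = v₂
    · rw [h2]; exact hy₂ v₁ hne.symm
    · rw [y2 u h2, y2 v₁ hne.symm]; exact hY u hu
  have hx₂ : ∀ u, u ≠ v₂ → x u < x v₂ := fun u hu => by
    by_cases h2 : u = v₁
    · rw [h2]; exact hx₁ v₂ hne
    · rw [x2 u h2, x2 v₂ hne]; exact hX u h2 hu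
  refine ⟨fun v => ⟨x v, y v, t v, r v, hyt v, hxr v⟩, v₁, v₂,
    ⟨⟨?_, ?_, ?_⟩, hne.symm, hx₁, hy₁, hx₂, hy₂, ?_, ?_⟩, ?_⟩
  · intro u w huw
    dsimp only at huw
    by_contra hc
    by_cases h1 : u = v₁
    · subst h1; exact (hx₁ w (Ne.symm hc)).ne huw
    · by_cases h2 : w = v₁
      · subst h2; exact (hx₁ u hc).ne' huw
      · rw [x2 u h1, x2 w h2] at huw
        exact hc (h.x_inj _ _ huw)
  · intro u w huw
    dsimp only at huw
    by_contra hc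
    by_cases h1 : u = v₂
    · subst h1; exact (hy₂ w (Ne.symm hc)).ne huw
    · by_cases h2 : w = v₂
      · subst h2; exact (hy₂ u hc).ne' huw
      · rw [y2 u h1, y2 w h2] at huw
        exact hc (h.y_inj _ _ huw)
  · intro u w h1 h2
    dsimp only at *
    have hu₂ : u ≠ v₂ := by
      rintro rfl
      by_cases h3 : w = u
      · subst h3; exact lt_irrefl _ h1
      · exact lt_asymm h1 (hx₂ w h3)
    have hw₁ : w ≠ v₁ := by
      rintro rfl
      by_cases h3 : u = w
      · subst h3; exact lt_irrefl _ h2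
      · exact lt_asymm h2 (hy₁ u h3)
    by_cases hw₂ : w = v₂
    · left
      subst hw₂
      rw [x2 w hw₁]
      by_cases hu₁ : u = v₁
      · subst hu₁; exact r1.le
      · rw [r3 u hu₁ hu₂]; exact min_le_right _ _
    · by_cases hu₁ : u = v₁
      · right; subst hu₁
        rw [t3 w hw₁ hw₂, y2 u hu₂]; exact min_le_right _ _
      · rw [x2 u hu₁, x2 w hw₁] at h1
        rw [y2 u hu₂, y2 w hw₂] at h2
        rw [r3 u hu₁ hu₂, x2 w hw₁, t3 w hw₁ hw₂, y2 u hu₂]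
        exact (h.noncross u w h1 h2).imp (min_le_left _ _).trans (min_le_left _ _).trans
  · dsimp only; rw [t2, y2 v₁ hne.symm]; linarith
  · intro u h1 h2
    dsimp only
    rw [t3 u h1 h2, y2 v₁ hne.symm]; exact min_le_right _ _
  · have main : ∀ u w, u ≠ w → (L u).Touches (L w) → x u ≤ x w ∧ y w ≤ y u ∧ x w ≤ r u ∧ y u ≤ t w := by
      intro u w huw ht
      have hw₁ : w ≠ v₁ := by
        rintro rfl; exact absurd (hY u huw) (not_lt.2 ht.2.1)
      have hu₂ : u ≠ v₂ := by
        rintro rfl; exact absurd (hX w hw₁ huw.symm) (not_lt.2 ht.1)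
      have hxw : (L w).x ≤ (L v₂).x := by
        by_cases h1 : w = v₂
        · rw [h1]
        · exact (hX w hw₁ h1).le
      refine ⟨?_, ?_, ?_, ?_⟩
      · by_cases hu₁ : u = v₁
        · subst hu₁; exact (hx₁ w hw₁).le
        · rw [x2 u hu₁, x2 w hw₁]; exact ht.1
      · by_cases hw₂ : w = v₂
        · subst hw₂; exact (hy₂ u hu₂).le
        · rw [y2 u hu₂, y2 w hw₂]; exact ht.2.1
      · rw [x2 w hw₁]
        by_cases hu₁ : u = v₁
        · subst hu₁; rw [r1]; exact hxw
        · rw [r3 u hu₁ hu₂]; exact le_min ht.2.2.1 hxw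
      · rw [y2 u hu₂]
        by_cases hw₂ : w = v₂
        · subst hw₂; rw [t2]; linarith [hv₁ u]
        · rw [t3 w hw₁ hw₂]; exact le_min ht.2.2.2 (hv₁ u)
    intro u w huw
    exact ⟨huw.1, huw.2.imp (main u w huw.1) (main w u huw.1.symm)⟩

/-- Every end except those of the vertical legs of `v₁` and `v₂` and of the horizontal leg of `v₂`
touches the interior of a leg. -/
structure IsFull (L : V → LShape) (v₁ v₂ : V) : Prop extends IsSpread L v₁ v₂ where
  right_touches : ∀ u, u ≠ v₂ → ∃ w, (L u).x < (L w).x ∧ (L w).y < (L u).y ∧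
    (L u).right = (L w).x ∧ (L u).y < (L w).top
  top_touches : ∀ w, w ≠ v₁ → w ≠ v₂ → ∃ u, (L u).x < (L w).x ∧ (L w).y < (L u).y ∧
    (L w).top = (L u).y ∧ (L w).x < (L u).right

/-- Extending first the horizontal and then the vertical legs until they are stopped. -/
theorem IsSpread.exists_isFull [Finite V] {L : V → LShape} {v₁ v₂ : V} (h : IsSpread L v₁ v₂) :
    ∃ L' : V → LShape, IsFull L' v₁ v₂ ∧ contactGraph L ≤ contactGraph L' := by
  -- an upper bound for all coordinates, where ends that are not stopped are put
  obtain ⟨B, hB⟩ : ∃ B, ∀ v, (L v).top ≤ B ∧ (L v).right ≤ B := by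
    obtain ⟨m, -, h1, -⟩ := exists_max 0 (fun v => (L v).top) Set.univ
    obtain ⟨m', h2, h3, -⟩ := exists_max m (fun v => (L v).right) Set.univ
    exact ⟨m', fun v => ⟨(h1 v trivial).trans h2, h3 v trivial⟩⟩
  choose r hr1 hr2 hr3 using fun u => exists_min B (fun w => (L w).x)
    {w | (L u).x < (L w).x ∧ (L w).y < (L u).y ∧ (L u).y < (L w).top}
  choose t ht1 ht2 ht3 using fun w => exists_min B (fun u => (L u).y)
    {u | (L u).x < (L w).x ∧ (L w).y < (L u).y ∧ (L w).x < r u}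
  have hr : ∀ u, (L u).right ≤ r u := by
    intro u
    rcases hr3 u with h1 | ⟨w, ⟨h1, h2, h3⟩, h4⟩
    · rw [h1]; exact (hB u).2
    · rw [h4]
      exact (h.noncross u w h1 h2).resolve_right (not_le.2 h3)
  have hcross : ∀ u w, (L u).x < (L w).x → (L w).y < (L u).y → r u ≤ (L w).x ∨ (L w).top ≤ (L u).y :=
    fun u w h1 h2 => or_iff_not_imp_right.2 fun h3 => hr2 u w ⟨h1, h2, not_le.1 h3⟩
  have ht : ∀ w, (L w).top ≤ t w := by
    intro w
    rcases ht3 w with h1 | ⟨u, ⟨h1, h2, h3⟩, h4⟩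
    · rw [h1]; exact (hB w).1
    · rw [h4]
      exact (hcross u w h1 h2).resolve_left (not_le.2 h3)
  have hr₁ : ∀ w, w ≠ v₁ → w ≠ v₂ → (L w).x < r v₁ := by
    intro w h1 h2
    rcases hr3 v₁ with h3 | ⟨z, ⟨h3, h4, h5⟩, h6⟩
    · rw [h3]; exact (L w).x_lt_right.trans_le (hB w).2
    · have : z = v₂ := by
        by_contra hz
        exact absurd (h.top_le z (by rintro rfl; exact lt_irrefl _ h3) hz) (not_le.2 h5)
      rw [h6, this]; exact h.x₂ w h2
  have hright : ∀ u, u ≠ v₂ → ∃ w, (L u).x < (L w).x ∧ (L w).y < (L u).y ∧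
      r u = (L w).x ∧ (L u).y < (L w).top := by
    intro u hu
    rcases hr3 u with h1 | ⟨w, ⟨h1, h2, h3⟩, h4⟩
    · have hle : (L u).y ≤ (L v₁).y := by
        by_cases hu₁ : u = v₁
        · rw [hu₁]
        · exact (h.y₁ u hu₁).le
      have := hr2 u v₂ ⟨h.x₂ u hu, h.y₂ u hu, hle.trans_lt h.top₂⟩
      have h2 := (L v₂).x_lt_right
      have h3 := (hB v₂).2
      linarith
    · exact ⟨w, h1, h2, h4, h3⟩
  have htop : ∀ w, w ≠ v₁ → w ≠ v₂ → ∃ u, (L u).x < (L w).x ∧ (L w).y < (L u).y ∧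
      t w = (L u).y ∧ (L w).x < r u := by
    intro w hw₁ hw₂
    rcases ht3 w with h1 | ⟨u, ⟨h1, h2, h3⟩, h4⟩
    · have := ht2 w v₁ ⟨h.x₁ w hw₁, h.y₁ w hw₁, hr₁ w hw₁ hw₂⟩
      have h2 := (L v₁).y_lt_top
      have h3 := (hB v₁).1
      linarith
    · exact ⟨u, h1, h2, h4, h3⟩
  refine ⟨fun v => ⟨(L v).x, (L v).y, t v, r v, (L v).y_lt_top.trans_le (ht v),
    (L v).x_lt_right.trans_le (hr v)⟩, ⟨⟨⟨h.x_inj, h.y_inj, ?_⟩, h.ne, h.x₁, h.y₁, h.x₂, h.y₂,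
      h.top₂.trans_le (ht v₂), ?_⟩, ?_, htop⟩, ?_⟩
  · intro u w h1 h2
    exact or_iff_not_imp_left.2 fun h3 => ht2 w u ⟨h1, h2, not_le.1 h3⟩
  · intro u h1 h2
    exact ht2 u v₁ ⟨h.x₁ u h1, h.y₁ u h1, hr₁ u h1 h2⟩
  · intro u hu
    obtain ⟨w, h1, h2, h3, h4⟩ := hright u hu
    exact ⟨w, h1, h2, h3, h4.trans_le (ht w)⟩
  · have main : ∀ u w, (L u).Touches (L w) → (L u).x ≤ (L w).x ∧ (L w).y ≤ (L u).y ∧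
        (L w).x ≤ r u ∧ (L u).y ≤ t w := fun u w h' =>
      ⟨h'.1, h'.2.1, h'.2.2.1.trans (hr u), h'.2.2.2.trans (ht w)⟩
    intro u w huw
    exact ⟨huw.1, huw.2.imp (main u w) (main w u)⟩

/-- The contacts are in bijection with the ends that touch a leg: there are `n - 1` such ends of horizontal
legs and `n - 2` of vertical ones. -/
theorem IsFull.ncard_edgeSet [Finite V] {L : V → LShape} {v₁ v₂ : V} (h : IsFull L v₁ v₂) :
    (contactGraph L).edgeSet.ncard + 3 = 2 * Nat.card V := by
  classical
  choose r hr1 hr2 hr3 hr4 using h.right_touches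
  choose t ht1 ht2 ht3 ht4 using h.top_touches
  have hrne : ∀ u hu, u ≠ r u hu := fun u hu h' => by
    have := hr1 u hu; rw [← h'] at this; exact lt_irrefl _ this
  have htne : ∀ u hu hu', u ≠ t u hu hu' := fun u hu hu' h' => by
    have := ht1 u hu hu'; rw [← h'] at this; exact lt_irrefl _ this
  -- each end that touches a leg is sent to the edge that it represents
  let f : {u // u ≠ v₂} ⊕ {u // u ≠ v₁ ∧ u ≠ v₂} → Sym2 V :=
    Sum.elim (fun u => s(u.1, r u.1 u.2)) fun w => s(w.1, t w.1 w.2.1 w.2.2)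
  have hinj : Function.Injective f := by
    rintro (⟨u, hu⟩ | ⟨u, hu, hu'⟩) (⟨w, hw⟩ | ⟨w, hw, hw'⟩) he
    · have he : s(u, r u hu) = s(w, r w hw) := he
      rcases Sym2.eq_iff.1 he with ⟨h1, -⟩ | ⟨h1, h2⟩
      · simp only [h1]
      · have h3 := hr1 u hu; have h4 := hr1 w hw
        rw [← h1] at h4; rw [h2] at h3
        exact absurd h3 (lt_asymm h4)
    · exfalso
      have he : s(u, r u hu) = s(w, t w hw hw') := he
      rcases Sym2.eq_iff.1 he with ⟨h1, h2⟩ | ⟨h1, h2⟩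
      · have h3 := hr1 u hu; have h4 := ht1 w hw hw'
        subst h1; rw [h2] at h3
        exact absurd h3 (lt_asymm h4)
      · have h3 := hr3 u hu; have h4 := ht4 w hw hw'
        rw [← h1, ← h2] at h4
        exact h4.ne' h3
    · exfalso
      have he : s(u, t u hu hu') = s(w, r w hw) := he
      rcases Sym2.eq_iff.1 he with ⟨h1, h2⟩ | ⟨h1, h2⟩
      · have h3 := hr1 w hw; have h4 := ht1 u hu hu'
        subst h1; rw [← h2] at h3
        exact absurd h3 (lt_asymm h4)
      · have h3 := hr3 w hw; have h4 := ht4 u hu hu'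
        rw [h2] at h4; rw [← h1] at h3
        exact h4.ne' h3
    · have he : s(u, t u hu hu') = s(w, t w hw hw') := he
      rcases Sym2.eq_iff.1 he with ⟨h1, -⟩ | ⟨h1, h2⟩
      · simp only [h1]
      · have h3 := ht1 u hu hu'; have h4 := ht1 w hw hw'
        rw [← h1] at h4; rw [h2] at h3
        exact absurd h3 (lt_asymm h4)
  have hcon : ∀ u w, u ≠ w → (L u).Touches (L w) → ∃ z, f z = s(u, w) := by
    intro u w huw hT
    have hu₂ : u ≠ v₂ := by
      rintro rfl; exact absurd (h.x₂ w huw.symm) (not_lt.2 hT.1)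
    have hw₁ : w ≠ v₁ := by
      rintro rfl; exact absurd (h.y₁ u huw) (not_lt.2 hT.2.1)
    have hR : (L u).right = (L w).x → ∃ z, f z = s(u, w) := fun h1 =>
      ⟨Sum.inl ⟨u, hu₂⟩, by
        have : r u hu₂ = w := h.x_inj _ _ ((hr3 u hu₂).symm.trans h1)
        simp only [f, Sum.elim_inl, this]⟩
    rcases h.noncross' huw hT with h1 | h1
    · exact hR h1
    · by_cases hw₂ : w = v₂
      · subst hw₂
        refine hR (le_antisymm ?_ hT.2.2.1)
        rw [hr3 u hu₂]
        by_cases h2 : r u hu₂ = w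
        · rw [h2]
        · exact (h.x₂ _ h2).le
      · refine ⟨Sum.inr ⟨w, hw₁, hw₂⟩, ?_⟩
        have : t w hw₁ hw₂ = u := h.y_inj _ _ ((ht3 w hw₁ hw₂).symm.trans h1)
        simp only [f, Sum.elim_inr, this]
        exact Sym2.eq_swap
  have hrange : (contactGraph L).edgeSet = Set.range f := by
    ext e
    induction e with
    | h u w =>
      rw [SimpleGraph.mem_edgeSet]
      constructor
      · rintro ⟨huw, hT | hT⟩
        · exact hcon u w huw hT
        · rw [Sym2.eq_swap]; exact hcon w u huw.symm hT
      · rintro ⟨⟨z, hz⟩ | ⟨z, hz, hz'⟩, he⟩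
        · have : (contactGraph L).Adj z (r z hz) := ⟨hrne z hz, Or.inl ⟨(hr1 z hz).le, (hr2 z hz).le,
            (hr3 z hz).ge, (hr4 z hz).le⟩⟩
          rw [← SimpleGraph.mem_edgeSet] at this ⊢
          rw [← he]; exact this
        · have : (contactGraph L).Adj z (t z hz hz') := ⟨htne z hz hz', Or.inr ⟨(ht1 z hz hz').le,
            (ht2 z hz hz').le, (ht4 z hz hz').le, (ht3 z hz hz').ge⟩⟩
          rw [← SimpleGraph.mem_edgeSet] at this ⊢
          rw [← he]; exact this
  have hc1 : Nat.card {u // u ≠ v₂} + 1 = Nat.card V := by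
    have := Set.ncard_add_ncard_compl {v₂}
    rw [Set.ncard_singleton] at this
    rw [← this, add_comm]; rfl
  have hc2 : Nat.card {u // u ≠ v₁ ∧ u ≠ v₂} + 2 = Nat.card V := by
    have := Set.ncard_add_ncard_compl {v₁, v₂}
    rw [Set.ncard_pair h.ne] at this
    rw [← this, add_comm]
    congr 1
    refine Nat.card_congr (Equiv.subtypeEquivRight fun u => ?_)
    simp
  rw [hrange, ← Nat.card_coe_set_eq, Nat.card_range_of_injective hinj, Nat.card_sum]
  omega

/-- Every L-graph on at least two vertices is contained in one with `2 n - 3` edges. -/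
theorem IsLGraph.exists_le [Finite V] [Nontrivial V] {G : SimpleGraph V} (h : IsLGraph G) :
    ∃ G', G ≤ G' ∧ IsLGraph G' ∧ G'.edgeSet.ncard + 3 = 2 * Nat.card V := by
  obtain ⟨L, hL⟩ := h
  obtain ⟨L₁, h1, h1'⟩ := hL.exists_isGeneric
  obtain ⟨L₂, v₁, v₂, h2, h2'⟩ := h1.exists_isSpread
  obtain ⟨L₃, h3, h3'⟩ := h2.exists_isFull
  exact ⟨_, h1'.trans (h2'.trans h3'), ⟨L₃, h3.isLRepresentation⟩, h3.ncard_edgeSet⟩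

/-- The maximal L-graphs on `n ≥ 2` vertices are the L-graphs with `2 n - 3` edges. -/
theorem isMaximalLGraph_iff [Finite V] [Nontrivial V] {G : SimpleGraph V} :
    IsMaximalLGraph G ↔ IsLGraph G ∧ G.edgeSet.ncard + 3 = 2 * Nat.card V := by
  constructor
  · rintro ⟨h, hmax⟩
    obtain ⟨G', h1, h2, h3⟩ := h.exists_le
    rcases h1.eq_or_lt with rfl | h1
    · exact ⟨h, h3⟩
    · exact absurd h2 (hmax _ h1)
  · rintro ⟨h, hE⟩
    refine ⟨h, fun G' hlt hG' => ?_⟩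
    obtain ⟨G'', h1, -, h3⟩ := hG'.exists_le
    have := Set.ncard_lt_ncard (SimpleGraph.edgeSet_ssubset_edgeSet.2 (hlt.trans_le h1))
      (Set.toFinite _)
    omega

end Generic

/-! ### The edge labeling of an L-representation -/

namespace RotationSystem

variable {V : Type u} {G : SimpleGraph V} {R : RotationSystem G} {v₁ v₂ : V}

/-- The function `κ` gives the index of the block of each element. -/
theorem blocks_of_pairwise {α : Type*} {m : ℕ} (Q : Fin m → α → Prop) (l : List α) (κ : α → Fin m)
    (hκ : l.Pairwise fun b c => κ b ≤ κ c) (hQ : ∀ b ∈ l, Q (κ b) b) :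
    Blocks (List.ofFn Q) l := by
  refine blocks_of_monotone _ l (fun i => if h : i < l.length then κ l[i] else m) 0 ?_
    (fun _ => Nat.zero_le _) ?_
  · intro i j hij
    dsimp only
    split_ifs with h1 h2 h2
    · rcases hij.eq_or_lt with rfl | hij
      · exact le_rfl
      · exact List.pairwise_iff_getElem.1 hκ i j h1 h2 hij
    · exact (κ l[i]).2.le
    · omega
    · exact le_rfl
  · intro i hi
    refine ⟨Q (κ l[i]), ?_, hQ _ (List.getElem_mem hi)⟩
    simp [hi]

/-- An end of the L-shape of `u` touches the L-shape of `w`: the upper end for the colour `0`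
and the right end for the colour `1`. -/
def EndTouches (L : V → LShape) (c : Fin 2) (u w : V) : Prop :=
  if c = 0 then (L w).Touches (L u) ∧ (L u).top = (L w).y
  else (L u).Touches (L w) ∧ (L u).right = (L w).x

/-- The two ends of an L-shape. -/
def endPoint (K : LShape) (c : Fin 2) : ℝ × ℝ :=
  if c = 0 then (K.x, K.top) else (K.right, K.y)

theorem EndTouches.mem_left {L : V → LShape} {c : Fin 2} {u w : V} (h : EndTouches L c u w) :
    endPoint (L u) c ∈ (L u).points := by
  unfold EndTouches at h
  unfold endPoint
  split_ifs at h ⊢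
  · rw [h.2]; exact h.1.mem_right
  · rw [h.2]; exact h.1.mem_left

theorem EndTouches.mem_right {L : V → LShape} {c : Fin 2} {u w : V} (h : EndTouches L c u w) :
    endPoint (L u) c ∈ (L w).points := by
  unfold EndTouches at h
  unfold endPoint
  split_ifs at h ⊢
  · rw [h.2]; exact h.1.mem_left
  · rw [h.2]; exact h.1.mem_right

theorem EndTouches.unique {L : V → LShape} (hL : IsLRepresentation G L) {c : Fin 2} {u w w' : V}
    (h : EndTouches L c u w) (h' : EndTouches L c u w') (hw : u ≠ w) (hw' : u ≠ w') : w = w' :=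
  hL.eq_of_mem hw hw' h.mem_left h.mem_right h'.mem_right

theorem EndTouches.adj {L : V → LShape} (hL : IsLRepresentation G L) {c : Fin 2} {u w : V}
    (h : EndTouches L c u w) (hw : u ≠ w) : G.Adj u w :=
  (hL.touch u w hw).2 ⟨_, h.mem_left, h.mem_right⟩

theorem exists_endTouches {L : V → LShape} (hL : IsLRepresentation G L) {u w : V}
    (h : G.Adj u w) : ∃ c, EndTouches L c u w ∨ EndTouches L c w u := by
  have key : ∀ u w, G.Adj u w → (L u).Touches (L w) →
      ∃ c, EndTouches L c u w ∨ EndTouches L c w u := by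
    intro u w h ht
    rcases ht.eq_or (hL.interior_disjoint u w h.ne) with h1 | h1
    · exact ⟨1, Or.inl ⟨ht, h1⟩⟩
    · exact ⟨0, Or.inr ⟨ht, h1⟩⟩
  rcases hL.touches_or h with ht | ht
  · exact key u w h ht
  · obtain ⟨c, hc⟩ := key w u h.symm ht
    exact ⟨c, hc.symm⟩

/-- Along an L-shape, `p.2 - p.1` decreases from the top end to the right end. -/
theorem sub_le_of_mem {K : LShape} {p : ℝ × ℝ} (hp : p ∈ K.points) :
    K.y - K.right ≤ p.2 - p.1 ∧ p.2 - p.1 ≤ K.top - K.x := by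
  have h1 := K.x_lt_right
  have h2 := K.y_lt_top
  rcases hp with ⟨h3, h4, h5⟩ | ⟨h3, h4, h5⟩ <;> constructor <;> linarith

/-- In an L-representation of a graph with `2 n - 3` edges, the ends of the L-shapes of the vertices
other than `v₁` and `v₂` are in bijection with the edges other than `v₁v₂`; colouring the
edges by the kind of the end gives an edge labeling. -/
theorem _root_.IsLRepresentation.exists_isEdgeLabeling [Finite V] {L : V → LShape}
    (hL : IsLRepresentation G L) (hbase : HasBaseEdge L v₁ v₂) (hR : DefinesEmbedding L R)
    (h₁₂ : G.Adj v₁ v₂) (hE : G.edgeSet.ncard + 3 = 2 * Nat.card V) :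
    ∃ S : Fin 2 → Set G.Dart, IsEdgeLabeling R v₁ v₂ S := by
  classical
  have hT : (L v₁).Touches (L v₂) := by
    refine (hL.touches_or h₁₂).resolve_right fun h => ?_
    exact LShape.bend_ne (hL.interior_disjoint v₁ v₂ h₁₂.ne) (le_antisymm (hbase.2 v₁) h.1)
      (le_antisymm h.2.1 (hbase.1 v₂))
  have hend₁ : ∀ c w, v₁ ≠ w → EndTouches L c v₁ w → w = v₂ := by
    intro c w hw h
    unfold EndTouches at h
    split_ifs at h
    · exact absurd (hbase.1 w) (not_le.2 (h.2 ▸ (L v₁).y_lt_top))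
    · have h1 : (L w).x = (L v₂).x := le_antisymm (hbase.2 w) (h.2 ▸ hT.2.2.1)
      exact hL.eq_of_mem hw h₁₂.ne h.1.mem_left h.1.mem_right (h1 ▸ hT.mem_right)
  have hend₂ : ∀ c w, v₂ ≠ w → EndTouches L c v₂ w → w = v₁ := by
    intro c w hw h
    unfold EndTouches at h
    split_ifs at h
    · have h1 : (L w).y = (L v₁).y := le_antisymm (hbase.1 w) (h.2 ▸ hT.2.2.2)
      exact hL.eq_of_mem hw h₁₂.ne.symm h.1.mem_right h.1.mem_left (h1 ▸ hT.mem_left)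
    · exact absurd (hbase.2 w) (not_le.2 (h.2 ▸ (L v₂).x_lt_right))
  -- the ends of the other vertices represent the other edges
  let Rep : Fin 2 × {x // x ≠ v₁ ∧ x ≠ v₂} → Sym2 V → Prop := fun z e =>
    ∃ w, z.2.1 ≠ w ∧ EndTouches L z.1 z.2.1 w ∧ e = s(z.2.1, w)
  have hRepu : ∀ z e e', Rep z e → Rep z e' → e = e' := by
    rintro z e e' ⟨w, h1, h2, rfl⟩ ⟨w', h3, h4, rfl⟩
    rw [h2.unique hL h4 h1 h3]
  have hcov : ∀ e ∈ G.edgeSet \ {s(v₁, v₂)}, ∃ z, Rep z e := by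
    have key : ∀ u w, G.Adj u w → s(u, w) ≠ s(v₁, v₂) → ∀ c, EndTouches L c u w →
        ∃ z, Rep z s(u, w) := by
      intro u w huw hne c hc
      refine ⟨(c, ⟨u, ?_, ?_⟩), w, huw.ne, hc, rfl⟩
      · rintro rfl
        exact hne (by rw [hend₁ c w huw.ne hc])
      · rintro rfl
        exact hne (by rw [hend₂ c w huw.ne hc, Sym2.eq_swap])
    rintro e ⟨he, hne⟩
    induction e with
    | h u w =>
      obtain ⟨c, hc | hc⟩ := exists_endTouches hL he
      · exact key u w he hne c hc
      · rw [Sym2.eq_swap]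
        exact key w u (G.symm.symm _ _ he) (by rwa [Sym2.eq_swap]) c hc
  have hcov' : ∀ e : (G.edgeSet \ {s(v₁, v₂)} : Set (Sym2 V)), ∃ z, Rep z e := fun e =>
    hcov e e.2
  choose g hg using hcov'
  have hgi : Function.Injective g := fun e e' h =>
    Subtype.ext (hRepu (g e) _ _ (hg e) (h ▸ hg e'))
  have hc1 : Nat.card (G.edgeSet \ {s(v₁, v₂)} : Set (Sym2 V)) + 1 = G.edgeSet.ncard := by
    rw [Nat.card_coe_set_eq]
    exact Set.ncard_sdiff_singleton_add_one h₁₂ (Set.toFinite _)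
  have hc2 : Nat.card {u // u ≠ v₁ ∧ u ≠ v₂} + 2 = Nat.card V := by
    have := Set.ncard_add_ncard_compl {v₁, v₂}
    rw [Set.ncard_pair h₁₂.ne] at this
    rw [← this, add_comm]
    congr 1
    refine Nat.card_congr (Equiv.subtypeEquivRight fun u => ?_)
    simp
  have hgb : Function.Bijective g := by
    refine hgi.bijective_of_nat_card_le ?_
    rw [Nat.card_prod, Nat.card_fin]; omega
  have htot : ∀ z, ∃ e ∈ G.edgeSet \ {s(v₁, v₂)}, Rep z e := fun z => by
    obtain ⟨e, rfl⟩ := hgb.2 z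
    exact ⟨e, e.2, hg e⟩
  have huniq : ∀ e ∈ G.edgeSet \ {s(v₁, v₂)}, ∀ z z', Rep z e → Rep z' e → z = z' := by
    have key : ∀ e (he : e ∈ G.edgeSet \ {s(v₁, v₂)}) z, Rep z e → z = g ⟨e, he⟩ := by
      intro e he z hz
      obtain ⟨e', rfl⟩ := hgb.2 z
      exact congrArg g (Subtype.ext (hRepu _ _ _ (hg e') hz))
    intro e he z z' h h'
    rw [key e he z h, key e he z' h']
  have hend : ∀ x, x ≠ v₁ → x ≠ v₂ → ∀ c, ∃ w, G.Adj x w ∧ EndTouches L c x w := by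
    intro x h1 h2 c
    obtain ⟨-, -, w, h3, h4, -⟩ := htot (c, ⟨x, h1, h2⟩)
    exact ⟨w, h4.adj hL h3, h4⟩
  let S : Fin 2 → Set G.Dart := fun c =>
    {d | d.fst ≠ v₁ ∧ d.fst ≠ v₂ ∧ EndTouches L c d.fst d.snd}
  have hnb : ∀ x y, x ≠ v₁ → x ≠ v₂ → s(x, y) ≠ s(v₁, v₂) := by
    intro x y h1 h2 h3
    rcases Sym2.eq_iff.1 h3 with ⟨h4, -⟩ | ⟨h4, -⟩
    · exact h1 h4
    · exact h2 h4
  refine ⟨S, ⟨⟨?_, ?_⟩, ?_, ?_, ?_, ?_, ?_⟩⟩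
  · rintro c ⟨⟨x, y⟩, hxy⟩ ⟨h1, h2, -⟩
    exact ⟨hxy, hnb x y h1 h2⟩
  · intro e he
    obtain ⟨⟨c, u, hu⟩, w, h1, h2, rfl⟩ := hcov e he
    refine ⟨(c, ⟨(u, w), h2.adj hL h1⟩), ⟨rfl, hu.1, hu.2, h2⟩, ?_⟩
    rintro ⟨c', ⟨⟨u', w'⟩, hd⟩⟩ ⟨h3, h4, h5, h6⟩
    dsimp only at h3 h4 h5 h6
    have h3 : s(u', w') = s(u, w) := h3
    have := huniq _ he (c, ⟨u, hu⟩) (c', ⟨u', h4, h5⟩) ⟨w, h1, h2, rfl⟩ ⟨w', hd.ne, h6, h3.symm⟩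
    rw [Prod.mk.injEq, Subtype.mk.injEq] at this
    obtain ⟨rfl, rfl⟩ := this
    have : w' = w := Sym2.congr_right.1 h3
    subst this
    rfl
  · intro x hx₁ hx₂ c
    obtain ⟨w, hw, h⟩ := hend x hx₁ hx₂ c
    refine ⟨⟨(x, w), hw⟩, ⟨rfl, hx₁, hx₂, h⟩, ?_⟩
    rintro ⟨⟨x', w'⟩, hd⟩ ⟨h1, h2, h3, h4⟩
    dsimp only at h1 h4
    subst h1
    have : w = w' := h.unique hL h4 hw.ne hd.ne
    subst this
    rfl
  · intro x hx₁ hx₂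
    obtain ⟨a, ha, hend_a⟩ := hend x hx₁ hx₂ 0
    refine ⟨⟨(x, a), ha⟩, ⟨hx₁, hx₂, hend_a⟩, rfl, ?_⟩
    obtain ⟨t, ht⟩ := R.exists_isCyc ha
    rw [ht.pattern_iff]
    -- the contact points with the neighbours in each of the four classes
    have hcl : ∀ w, G.Adj x w → ∃ (i : Fin 4) (p : ℝ × ℝ), p ∈ (L x).points ∧ p ∈ (L w).points ∧
        (∃ h : G.Adj x w, (⟨(x, w), h⟩ : G.Dart) ∈
          (![S 0, S 1, incoming (S 0), incoming (S 1)] : Fin 4 → Set G.Dart) i) ∧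
        (![p = ((L x).x, (L x).top), p = ((L x).right, (L x).y), p.2 = (L x).y ∧ (L x).x ≤ p.1,
          p.1 = (L x).x ∧ (L x).y ≤ p.2] : Fin 4 → Prop) i ∧ (w = a ↔ i = 0) := by
      intro w hw
      obtain ⟨⟨c, u, hu⟩, w', h1, h2, h3⟩ := hcov s(x, w) ⟨hw, hnb x w hx₁ hx₂⟩
      dsimp only at h1 h2 h3
      have hwa : ∀ c', EndTouches L c' x w → (c' = 0 → w = a) := by
        rintro c' h rfl
        exact h.unique hL hend_a hw.ne ha.ne
      have hwa' : w = a → ∀ z, Rep z s(x, w) → z = (0, ⟨x, hx₁, hx₂⟩) := by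
        rintro rfl z hz
        exact huniq _ ⟨hw, hnb x w hx₁ hx₂⟩ _ _ hz ⟨w, hw.ne, hend_a, rfl⟩
      rcases Sym2.eq_iff.1 h3 with ⟨rfl, rfl⟩ | ⟨rfl, rfl⟩
      · fin_cases c
        · refine ⟨0, _, h2.mem_left, h2.mem_right, ⟨hw, hx₁, hx₂, h2⟩, rfl, ?_⟩
          exact iff_of_true (hwa 0 h2 rfl) rfl
        · refine ⟨1, _, h2.mem_left, h2.mem_right, ⟨hw, hx₁, hx₂, h2⟩, rfl, ?_⟩
          refine iff_of_false (fun h => ?_) (by decide)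
          have := hwa' h (1, ⟨x, hu⟩) ⟨w, h1, h2, rfl⟩
          simp at this
      · have hne : ∀ c, w = a → Rep (c, ⟨w, hu⟩) s(x, w) → False := fun c h h' => by
          have := hwa' h _ h'
          rw [Prod.mk.injEq, Subtype.mk.injEq] at this
          exact hw.ne this.2.symm
        fin_cases c
        · refine ⟨2, _, h2.mem_right, h2.mem_left, ⟨hw, hu.1, hu.2, h2⟩, ⟨h2.2, h2.1.1⟩, ?_⟩
          exact iff_of_false (fun h => hne 0 h ⟨x, h1, h2, h3⟩) (by decide)
        · refine ⟨3, _, h2.mem_right, h2.mem_left, ⟨hw, hu.1, hu.2, h2⟩, ⟨h2.2, h2.1.2.1⟩, ?_⟩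
          exact iff_of_false (fun h => hne 1 h ⟨x, h1, h2, h3⟩) (by decide)
    choose! κ pt hpx hpw hκ hgeo hκa using hcl
    have hpt : ∀ b c, G.Adj x b → G.Adj x c → (pt b).2 - (pt b).1 = (pt c).2 - (pt c).1 → b = c := by
      intro b c hb hc h
      have := LShape.eq_of_sub_eq (hpx b hb) (hpx c hc) h
      exact hL.eq_of_mem hb.ne hc.ne (hpx b hb) (hpw b hb) (this ▸ hpw c hc)
    have hadj : ∀ b ∈ t, G.Adj x b := fun b hb => (ht.mem_iff b).1 (List.mem_cons_of_mem _ hb)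
    have hchain : t.IsChain fun b c => (pt b).2 - (pt b).1 ≤ (pt c).2 - (pt c).1 := by
      have h1 : t.IsChain fun b c => R.nx x b = c := by
        have := ht.chain
        rw [List.cons_append] at this
        exact (List.isChain_append.1 this.of_cons).1
      refine h1.imp_of_mem_imp fun b c hb hc hbc => ?_
      by_contra hlt
      rw [not_le] at hlt
      have hba : b ≠ a := by
        rintro rfl; exact (List.nodup_cons.1 ht.nodup).1 hb
      have h2 : (pt b).2 - (pt b).1 < (pt a).2 - (pt a).1 := by
        have h3 := hgeo a ha
        rw [(hκa a ha).1 rfl] at h3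
        have h3 : pt a = ((L x).x, (L x).top) := h3
        refine lt_of_le_of_ne ?_ fun h => hba (hpt b a (hadj b hb) ha h)
        rw [h3]
        exact (sub_le_of_mem (hpx b (hadj b hb))).2
      refine hR ⟨(x, b), hadj b hb⟩ ⟨(x, a), ha⟩ rfl (pt b) (pt a) (pt c) ⟨hpx b (hadj b hb),
        hpw b (hadj b hb)⟩ ⟨hpx a ha, hpw a ha⟩ ?_ (Or.inr (Or.inr ⟨hlt, h2⟩))
      rw [R.rot_mk]
      subst hbc
      exact ⟨hpx _ (hadj _ hc), hpw _ (hadj _ hc)⟩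
    have hpair : t.Pairwise fun b c => (pt b).2 - (pt b).1 ≤ (pt c).2 - (pt c).1 := by
      have : IsTrans V fun b c => (pt b).2 - (pt b).1 ≤ (pt c).2 - (pt c).1 :=
        ⟨fun a b c h1 h2 => h1.trans h2⟩
      exact hchain.pairwise
    refine blocks_of_pairwise _ _ κ ?_ fun b hb => hκ b ((ht.mem_iff b).1 hb)
    rw [List.pairwise_cons]
    refine ⟨fun b hb => by rw [(hκa a ha).1 rfl]; exact Fin.zero_le _, ?_⟩
    refine hpair.imp_of_mem fun {b c} hb hc hbc => ?_
    by_contra hlt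
    rw [not_le] at hlt
    have hxb := hadj b hb
    have hxc := hadj c hc
    have hne : ∀ d ∈ t, κ d ≠ 0 := fun d hd h => by
      have := (hκa d (hadj d hd)).2 h
      subst this
      exact (List.nodup_cons.1 ht.nodup).1 hd
    have key : (pt c).2 - (pt c).1 ≤ (pt b).2 - (pt b).1 := by
      have hb0 := hne b hb
      have hc0 := hne c hc
      have gb := hgeo b hxb
      have gc := hgeo c hxc
      have pb := sub_le_of_mem (hpx b hxb)
      generalize κ b = i at hlt hb0 gb
      generalize κ c = j at hlt hc0 gc
      fin_cases j
      · exact absurd rfl hc0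
      · have gc : pt c = ((L x).right, (L x).y) := gc
        rw [gc]; exact pb.1
      · have gc : (pt c).2 = (L x).y ∧ (L x).x ≤ (pt c).1 := gc
        fin_cases i
        · exact absurd rfl hb0
        · exact absurd hlt (by decide)
        · exact absurd hlt (by decide)
        · have gb : (pt b).1 = (L x).x ∧ (L x).y ≤ (pt b).2 := gb
          linarith [gb.1, gb.2, gc.1, gc.2]
      · fin_cases i <;> exact absurd hlt (by decide)
    have := hpt b c hxb hxc (le_antisymm hbc key)
    rw [this] at hlt
    exact lt_irrefl _ hlt
  · rintro ⟨⟨x, y⟩, hxy⟩ h1 rfl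
    dsimp only at *
    have hx₂ : x ≠ v₂ := by rintro rfl; exact h1 Sym2.eq_swap
    refine ⟨hxy.ne, hx₂, ?_⟩
    obtain ⟨⟨c, u, hu⟩, w', h2, h3, h4⟩ := hcov _ ⟨hxy, h1⟩
    dsimp only at h2 h3 h4
    have h4 : s(x, y) = s(u, w') := h4
    rcases Sym2.eq_iff.1 h4 with ⟨rfl, rfl⟩ | ⟨rfl, rfl⟩
    · by_cases hc : c = 0
      · exact hc ▸ h3
      -- otherwise both vertices are topmost, and the upper end of `x` touches nothing
      · exfalso
        obtain ⟨z, -, h5⟩ := hend x hxy.ne hx₂ 0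
        unfold EndTouches at h3
        rw [if_neg hc] at h3
        have h6 := h5.2
        have h7 := (L x).y_lt_top
        have h8 := hbase.1 z
        linarith [h3.1.2.1]
    · exact absurd rfl hu.1
  · rintro ⟨⟨x, y⟩, hxy⟩ h1 rfl
    dsimp only at *
    have hx₁ : x ≠ v₁ := by rintro rfl; exact h1 rfl
    refine ⟨hx₁, hxy.ne, ?_⟩
    obtain ⟨⟨c, u, hu⟩, w', h2, h3, h4⟩ := hcov _ ⟨hxy, h1⟩
    dsimp only at h2 h3 h4
    have h4 : s(x, y) = s(u, w') := h4
    rcases Sym2.eq_iff.1 h4 with ⟨rfl, rfl⟩ | ⟨rfl, rfl⟩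
    · fin_cases c
      · exfalso
        obtain ⟨z, -, h5⟩ := hend x hx₁ hxy.ne 1
        have h6 : (L x).right = (L z).x := h5.2
        have h7 := (L x).x_lt_right
        have h8 := hbase.2 z
        have h9 : (L y).x ≤ (L x).x := h3.1.1
        linarith
      · exact h3
    · exact absurd rfl hu.2
  -- bends move to the lower right along the edges once the red ones are reversed
  · have hNW : ∀ u w, u ≠ w → (L u).Touches (L w) → (L u).x - (L u).y < (L w).x - (L w).y := by
      intro u w huw ht
      rcases ht.1.lt_or_eq with h | h
      · linarith [ht.2.1]
      · have := LShape.bend_ne (hL.interior_disjoint u w huw) h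
        have := ht.2.1.lt_of_ne this.symm
        linarith
    have hstep : ∀ y z, Relation.TransGen (fun y z : V =>
        ∃ d : G.Dart, (d ∈ S 0 ∧ d.fst = z ∧ d.snd = y) ∨ (d ∈ S 1 ∧ d.fst = y ∧ d.snd = z)) y z →
        (L y).x - (L y).y < (L z).x - (L z).y := by
      have key : ∀ y z, (∃ d : G.Dart, (d ∈ S 0 ∧ d.fst = z ∧ d.snd = y) ∨
          (d ∈ S 1 ∧ d.fst = y ∧ d.snd = z)) → (L y).x - (L y).y < (L z).x - (L z).y := by
        rintro y z ⟨⟨⟨a, b⟩, hd⟩, ⟨⟨-, -, h⟩, rfl, rfl⟩ | ⟨⟨-, -, h⟩, rfl, rfl⟩⟩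
        · exact hNW _ _ hd.ne.symm h.1
        · exact hNW _ _ hd.ne h.1
      intro y z h
      induction h with
      | single h => exact key _ _ h
      | tail _ h ih => exact ih.trans (key _ _ h)
    exact fun x hx => lt_irrefl _ (hstep x x hx)

end RotationSystem

/-! ### The number of edges of a constructed graph -/

namespace RotationSystem

variable {V : Type u} {G : SimpleGraph V} {R : RotationSystem G} {v₁ v₂ : V}

/-- The base edge, and two more edges with each further vertex. -/
theorem Build.ncard_edges [Finite V] (hbase : G.Adj v₁ v₂) {o P : List V} (h : Build R v₁ v₂ o P) :
    {e ∈ G.edgeSet | ∀ y ∈ e, y ∈ o}.ncard + 3 = 2 * o.length := by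
  induction h with
  | base =>
    have : {e ∈ G.edgeSet | ∀ y ∈ e, y ∈ [v₂, v₁]} = {s(v₁, v₂)} := by
      ext e
      induction e with
      | h x y =>
        simp only [Set.mem_sep_iff, SimpleGraph.mem_edgeSet, Sym2.mem_iff, forall_eq_or_imp,
          forall_eq, List.mem_cons, List.not_mem_nil, or_false, Set.mem_singleton_iff]
        constructor
        · rintro ⟨h, rfl | rfl, rfl | rfl⟩
          · exact absurd rfl h.ne
          · exact Sym2.eq_swap
          · rfl
          · exact absurd rfl h.ne
        · intro h
          rcases Sym2.eq_iff.1 h with ⟨rfl, rfl⟩ | ⟨rfl, rfl⟩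
          · exact ⟨hbase, by simp⟩
          · exact ⟨hbase.symm, by simp⟩
    rw [this]; simp
  | step o l₁ m l₂ k k' a b x a₀ b₀ hB hx hadj hk hk' hna hnb ih =>
    have hF := hB.facts hbase
    have hao : a ∈ o := hF.subset a (by simp)
    have hbo : b ∈ o := hF.subset b (by simp)
    have hab : a ≠ b := by
      rintro rfl
      have := hF.nodup
      rw [List.nodup_append] at this
      exact this.2.2 a (by simp) a (by simp) rfl
    have hset : {e ∈ G.edgeSet | ∀ y ∈ e, y ∈ x :: o} =
        insert s(x, a) (insert s(x, b) {e ∈ G.edgeSet | ∀ y ∈ e, y ∈ o}) := by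
      ext e
      constructor
      · rintro ⟨he, h⟩
        by_cases hxe : x ∈ e
        · obtain ⟨y, rfl⟩ := hxe
          have hxy : G.Adj x y := he
          rcases List.mem_cons.1 (h y (by simp)) with rfl | hy
          · exact absurd rfl hxy.ne
          · rcases (hadj y hy).1 hxy with rfl | rfl
            · exact Or.inl rfl
            · exact Or.inr (Or.inl rfl)
        · refine Or.inr (Or.inr ⟨he, fun y hy => ?_⟩)
          rcases List.mem_cons.1 (h y hy) with rfl | h
          · exact absurd hy hxe
          · exact h
      · rintro (rfl | rfl | ⟨he, h⟩)
        · exact ⟨(hadj a hao).2 (Or.inl rfl), by simp [hao]⟩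
        · exact ⟨(hadj b hbo).2 (Or.inr rfl), by simp [hbo]⟩
        · exact ⟨he, fun y hy => List.mem_cons_of_mem _ (h y hy)⟩
    have hfin : {e ∈ G.edgeSet | ∀ y ∈ e, y ∈ o}.Finite := Set.toFinite _
    rw [hset, Set.ncard_insert_of_notMem _ (hfin.insert _), Set.ncard_insert_of_notMem _ hfin,
      List.length_cons]
    · omega
    · exact fun h => hx (h.2 x (by simp))
    · rintro (h | h)
      · exact hab (Sym2.congr_right.1 h)
      · exact hx (h.2 x (by simp))

theorem Build.isMaximalLGraph [Finite V] (hbase : G.Adj v₁ v₂) {o P : List V}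
    (h : Build R v₁ v₂ o P) (ho : ∀ y, y ∈ o) : IsMaximalLGraph G := by
  have : Nontrivial V := ⟨v₁, v₂, hbase.ne⟩
  obtain ⟨L, hL, -⟩ := h.exists_isLRepresentation hbase ho
  refine isMaximalLGraph_iff.2 ⟨⟨L, hL⟩, ?_⟩
  have h1 := h.ncard_edges hbase
  have h2 : {e ∈ G.edgeSet | ∀ y ∈ e, y ∈ o} = G.edgeSet := by ext e; simp [ho]
  have h3 : Nat.card V = o.length := by
    classical
    have := Fintype.ofFinite V
    have h4 : o.toFinset = Finset.univ := by ext y; simp [ho y]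
    rw [Nat.card_eq_fintype_card, ← Finset.card_univ, ← h4,
      List.toFinset_card_of_nodup (h.facts hbase).nodup_o]
  rw [h2] at h1
  rw [h1, h3]

end RotationSystem

/-! ### Edge labelings and their faces -/

namespace RotationSystem

variable {V : Type u} {G : SimpleGraph V} {R : RotationSystem G} {v₁ v₂ : V} {red blue : V → V}

/-- An edge labeling, given by the heads `red x` and `blue x` of the two outgoing edges of each inner
vertex `x`. -/
structure Labeling (R : RotationSystem G) (v₁ v₂ : V) (red blue : V → V) : Prop where
  base : G.Adj v₁ v₂
  adj_red : ∀ x, Inner v₁ v₂ x → G.Adj x (red x)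
  adj_blue : ∀ x, Inner v₁ v₂ x → G.Adj x (blue x)
  red_ne : ∀ x, Inner v₁ v₂ x → red x ≠ v₂
  blue_ne : ∀ x, Inner v₁ v₂ x → blue x ≠ v₁
  up_or : ∀ x y, G.Adj x y → Up v₁ v₂ red blue x y ∨ Up v₁ v₂ red blue y x
  exclusive : ∀ x y, Inner v₁ v₂ x → Inner v₁ v₂ y → red x = y → blue y ≠ x
  acyclic : ∀ x, ¬ Relation.TransGen (Up v₁ v₂ red blue) x x
  exists_isCyc : ∀ x, Inner v₁ v₂ x → ∃ kR kB, R.IsCyc x (red x) (blue x :: (kR ++ kB)) ∧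
    (∀ c ∈ kR, Inner v₁ v₂ c ∧ red c = x) ∧ ∀ c ∈ kB, Inner v₁ v₂ c ∧ blue c = x

theorem eq_singleton_of_nodup {α : Type*} {l : List α} {a : α} (hn : l.Nodup) (h : ∀ b ∈ l, b = a)
    (ha : a ∈ l) : l = [a] := by
  cases l with
  | nil => simp at ha
  | cons b l =>
    obtain rfl := h b (by simp)
    cases l with
    | nil => rfl
    | cons c l =>
      obtain rfl := h c (by simp)
      simp at hn

/-- Each edge other than the base edge has exactly one orientation and colour, so that the labeling is
determined by the functions `red` and `blue`. -/
theorem _root_.IsEdgeLabeling.exists_labeling [Finite V] {S : Fin 2 → Set G.Dart}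
    (h : IsEdgeLabeling R v₁ v₂ S) (hbase : G.Adj v₁ v₂) :
    ∃ red blue, Labeling R v₁ v₂ red blue ∧
      (∀ x y (hxy : G.Adj x y), (⟨(x, y), hxy⟩ : G.Dart) ∈ S 0 ↔ Inner v₁ v₂ x ∧ red x = y) ∧
      (∀ x y (hxy : G.Adj x y), (⟨(x, y), hxy⟩ : G.Dart) ∈ S 1 ↔ Inner v₁ v₂ x ∧ blue x = y) := by
  have huniq : ∀ c c' d d', d ∈ S c → d' ∈ S c' → d.edge = d'.edge → c = c' ∧ d = d' := by
    intro c c' d d' hd hd' he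
    have := (h.orientation.2 d.edge (h.orientation.1 c d hd)).unique (y₁ := (c, d)) (y₂ := (c', d'))
      ⟨rfl, hd⟩ ⟨he.symm, hd'⟩
    exact ⟨congrArg Prod.fst this, congrArg Prod.snd this⟩
  have htail : ∀ c, ∀ d ∈ S c, Inner v₁ v₂ d.fst := by
    intro c d hd
    have hne : d.symm.edge ≠ s(v₁, v₂) := by
      rw [SimpleGraph.Dart.edge_symm]; exact (h.orientation.1 c d hd).2
    constructor
    · intro h1
      have := (huniq _ _ _ _ hd (h.at₁ d.symm hne h1) (by simp)).2
      exact d.symm_ne this.symm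
    · intro h1
      have := (huniq _ _ _ _ hd (h.at₂ d.symm hne h1) (by simp)).2
      exact d.symm_ne this.symm
  have hex : ∀ c, ∃ f : V → V, ∀ x y (hxy : G.Adj x y),
      (⟨(x, y), hxy⟩ : G.Dart) ∈ S c ↔ Inner v₁ v₂ x ∧ f x = y := by
    intro c
    have : ∀ x, ∃ z, Inner v₁ v₂ x → ∃ hz : G.Adj x z, (⟨(x, z), hz⟩ : G.Dart) ∈ S c := by
      intro x
      by_cases hx : Inner v₁ v₂ x
      · obtain ⟨⟨⟨x', z⟩, hz⟩, ⟨h1, h2⟩, -⟩ := h.outgoing x hx.1 hx.2 c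
        dsimp only at h1
        subst h1
        exact ⟨z, fun _ => ⟨hz, h2⟩⟩
      · exact ⟨x, fun h => absurd h hx⟩
    choose f hf using this
    refine ⟨f, fun x y hxy => ⟨fun hd => ?_, ?_⟩⟩
    · have hx := htail c _ hd
      obtain ⟨hz, h2⟩ := hf x hx
      have := (h.outgoing x hx.1 hx.2 c).unique ⟨rfl, h2⟩ ⟨rfl, hd⟩
      exact ⟨hx, congrArg (fun d : G.Dart => d.snd) this⟩
    · rintro ⟨hx, rfl⟩
      exact (hf x hx).2
  have hadj : ∀ c x, Inner v₁ v₂ x → ∃ z, ∃ hz : G.Adj x z, (⟨(x, z), hz⟩ : G.Dart) ∈ S c := by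
    intro c x hx
    obtain ⟨⟨⟨x', z⟩, hz⟩, ⟨h1, h2⟩, -⟩ := h.outgoing x hx.1 hx.2 c
    dsimp only at h1
    subst h1
    exact ⟨z, hz, h2⟩
  obtain ⟨red, hred⟩ := hex 0
  obtain ⟨blue, hblue⟩ := hex 1
  have hadj_red : ∀ x, Inner v₁ v₂ x → G.Adj x (red x) := by
    intro x hx
    obtain ⟨z, hz, h1⟩ := hadj 0 x hx
    rw [((hred x z hz).1 h1).2]; exact hz
  have hadj_blue : ∀ x, Inner v₁ v₂ x → G.Adj x (blue x) := by
    intro x hx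
    obtain ⟨z, hz, h1⟩ := hadj 1 x hx
    rw [((hblue x z hz).1 h1).2]; exact hz
  have hnb : ∀ x y, Inner v₁ v₂ x → s(x, y) ≠ s(v₁, v₂) := by
    intro x y hx h3
    rcases Sym2.eq_iff.1 h3 with ⟨h4, -⟩ | ⟨h4, -⟩
    · exact hx.1 h4
    · exact hx.2 h4
  have hred' : ∀ x (hx : Inner v₁ v₂ x), (⟨(x, red x), hadj_red x hx⟩ : G.Dart) ∈ S 0 := fun x hx =>
    (hred _ _ _).2 ⟨hx, rfl⟩
  have hblue' : ∀ x (hx : Inner v₁ v₂ x), (⟨(x, blue x), hadj_blue x hx⟩ : G.Dart) ∈ S 1 :=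
    fun x hx => (hblue _ _ _).2 ⟨hx, rfl⟩
  have h01 : (0 : Fin 2) ≠ 1 := by decide
  have hred_ne : ∀ x, Inner v₁ v₂ x → red x ≠ v₂ := fun x hx hr =>
    h01 (huniq _ _ _ _ (hred' x hx) (h.at₂ _ (hnb _ _ hx) hr) rfl).1
  have hblue_ne : ∀ x, Inner v₁ v₂ x → blue x ≠ v₁ := fun x hx hr =>
    h01 (huniq _ _ _ _ (hblue' x hx) (h.at₁ _ (hnb _ _ hx) hr) rfl).1.symm
  refine ⟨red, blue, ⟨hbase, hadj_red, hadj_blue, hred_ne, hblue_ne, ?_, ?_, ?_, ?_⟩, hred, hblue⟩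
  · intro x y hxy
    by_cases he : s(x, y) = s(v₁, v₂)
    · rcases Sym2.eq_iff.1 he with ⟨rfl, rfl⟩ | ⟨rfl, rfl⟩
      · exact Or.inl (Or.inr (Or.inr ⟨rfl, rfl⟩))
      · exact Or.inr (Or.inr (Or.inr ⟨rfl, rfl⟩))
    · obtain ⟨⟨c, ⟨⟨x', y'⟩, hd⟩⟩, ⟨h1, h2⟩, -⟩ := h.orientation.2 s(x, y) ⟨hxy, he⟩
      have h1 : s(x', y') = s(x, y) := h1
      dsimp only at h2
      fin_cases c
      · have h3 := (hred _ _ _).1 h2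
        rcases Sym2.eq_iff.1 h1 with ⟨rfl, rfl⟩ | ⟨rfl, rfl⟩
        · exact Or.inr (Or.inl h3)
        · exact Or.inl (Or.inl h3)
      · have h3 := (hblue _ _ _).1 h2
        rcases Sym2.eq_iff.1 h1 with ⟨rfl, rfl⟩ | ⟨rfl, rfl⟩
        · exact Or.inl (Or.inr (Or.inl h3))
        · exact Or.inr (Or.inr (Or.inl h3))
  · intro x y hx hy hxy hyx
    refine h01 (huniq _ _ _ _ (hred' x hx) (hblue' y hy) ?_).1
    change s(x, red x) = s(y, blue y)
    rw [hxy, hyx, Sym2.eq_swap]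
  · have hno : ∀ z, ¬ Up v₁ v₂ red blue v₂ z := by
      rintro z (⟨h1, h2⟩ | ⟨h1, -⟩ | ⟨h1, -⟩)
      · exact hred_ne z h1 h2
      · exact h1.2 rfl
      · exact hbase.ne h1.symm
    have key : ∀ x y, Relation.TransGen (Up v₁ v₂ red blue) x y → y = v₂ ∨
        Relation.TransGen (fun y z : V => ∃ d : G.Dart, (d ∈ S 0 ∧ d.fst = z ∧ d.snd = y) ∨
          (d ∈ S 1 ∧ d.fst = y ∧ d.snd = z)) x y := by
      have step : ∀ x y, Up v₁ v₂ red blue x y → y = v₂ ∨ ∃ d : G.Dart,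
          (d ∈ S 0 ∧ d.fst = y ∧ d.snd = x) ∨ (d ∈ S 1 ∧ d.fst = x ∧ d.snd = y) := by
        rintro x y (⟨h1, rfl⟩ | ⟨h1, rfl⟩ | ⟨-, h1⟩)
        · exact Or.inr ⟨_, Or.inl ⟨hred' y h1, rfl, rfl⟩⟩
        · exact Or.inr ⟨_, Or.inr ⟨hblue' x h1, rfl, rfl⟩⟩
        · exact Or.inl h1
      intro x y hxy
      induction hxy with
      | single h1 => exact (step _ _ h1).imp_right .single
      | tail _ h1 ih =>
        rcases ih with rfl | ih
        · exact absurd h1 (hno _)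
        · exact (step _ _ h1).imp_right ih.tail
    intro x hx
    rcases key x x hx with h1 | h1
    · subst h1
      obtain ⟨z, hz, -⟩ := Relation.TransGen.head'_iff.1 hx
      exact hno z hz
    · exact h.acyclic x h1
  · intro x hx
    obtain ⟨⟨⟨x', a⟩, hd⟩, h1, h2, h3⟩ := h.clockwise x hx.1 hx.2
    dsimp only at h2
    subst h2
    obtain rfl : red x' = a := ((hred _ _ _).1 h1).2
    obtain ⟨t, ht⟩ := R.exists_isCyc hd
    rw [ht.pattern_iff] at h3
    obtain ⟨l₀, r₁, e0, hl₀, l₁, r₂, e1, hl₁, l₂, r₃, e2, hl₂, l₃, r₄, e3, hl₃, e4⟩ := h3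
    have e4 : r₄ = [] := e4
    subst e4 e3 e2 e1
    have q0 : ∀ b ∈ l₀, b = red x' := by
      intro b hb
      obtain ⟨hb', hb''⟩ := hl₀ b hb
      exact ((hred _ _ _).1 hb'').2.symm
    have q1 : ∀ b ∈ l₁, b = blue x' := by
      intro b hb
      obtain ⟨hb', hb''⟩ := hl₁ b hb
      exact ((hblue _ _ _).1 hb'').2.symm
    have q2 : ∀ b ∈ l₂, Inner v₁ v₂ b ∧ red b = x' := by
      intro b hb
      obtain ⟨hb', hb''⟩ := hl₂ b hb
      exact (hred b x' hb'.symm).1 hb''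
    have q3 : ∀ b ∈ l₃, Inner v₁ v₂ b ∧ blue b = x' := by
      intro b hb
      obtain ⟨hb', hb''⟩ := hl₃ b hb
      exact (hblue b x' hb'.symm).1 hb''
    -- the classes are disjoint, since no edge has two orientations or colours
    have hx := htail _ _ h1
    have x1 : red x' ≠ blue x' := fun he =>
      h01 (huniq _ _ _ _ (hred' x' hx) (hblue' x' hx) (by
        change s(x', red x') = s(x', blue x'); rw [he])).1
    have x2 : ∀ b, Inner v₁ v₂ b → red b = x' → b ≠ red x' ∧ b ≠ blue x' := by
      intro b hb hbx
      constructor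
      · intro h4
        have := (huniq _ _ _ _ (hred' b hb) (hred' x' hx) (by
          change s(b, red b) = s(x', red x'); rw [hbx, ← h4, Sym2.eq_swap])).2
        have : b = x' := congrArg (fun d : G.Dart => d.fst) this
        subst this
        exact (hadj_red b hb).ne hbx.symm
      · intro h4
        refine h01 (huniq _ _ _ _ (hred' b hb) (hblue' x' hx) (by
          change s(b, red b) = s(x', blue x'); rw [hbx, ← h4, Sym2.eq_swap])).1
    have x3 : ∀ b, Inner v₁ v₂ b → blue b = x' → b ≠ red x' ∧ b ≠ blue x' := by
      intro b hb hbx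
      constructor
      · intro h4
        refine h01 (huniq _ _ _ _ (hred' x' hx) (hblue' b hb) (by
          change s(x', red x') = s(b, blue b); rw [hbx, ← h4, Sym2.eq_swap])).1
      · intro h4
        have := (huniq _ _ _ _ (hblue' b hb) (hblue' x' hx) (by
          change s(b, blue b) = s(x', blue x'); rw [hbx, ← h4, Sym2.eq_swap])).2
        have : b = x' := congrArg (fun d : G.Dart => d.fst) this
        subst this
        exact (hadj_blue b hb).ne hbx.symm
    have m0 : red x' ∈ l₀ := by
      have : red x' ∈ red x' :: t := by simp
      rw [e0] at this
      simp only [List.mem_append, List.append_nil] at this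
      rcases this with h4 | h4 | h4 | h4
      · exact h4
      · exact absurd (q1 _ h4) x1
      · exact absurd rfl (x2 _ (q2 _ h4).1 (q2 _ h4).2).1
      · exact absurd rfl (x3 _ (q3 _ h4).1 (q3 _ h4).2).1
    have m1 : blue x' ∈ l₁ := by
      have : blue x' ∈ red x' :: t := (ht.mem_iff _).2 (hadj_blue x' hx)
      rw [e0] at this
      simp only [List.mem_append, List.append_nil] at this
      rcases this with h4 | h4 | h4 | h4
      · exact absurd (q0 _ h4).symm x1
      · exact h4
      · exact absurd rfl (x2 _ (q2 _ h4).1 (q2 _ h4).2).2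
      · exact absurd rfl (x3 _ (q3 _ h4).1 (q3 _ h4).2).2
    have hnd := ht.nodup
    rw [e0, List.nodup_append, List.nodup_append] at hnd
    have f0 := eq_singleton_of_nodup hnd.1 q0 m0
    have f1 := eq_singleton_of_nodup hnd.2.1.1 q1 m1
    rw [f0, f1] at e0
    refine ⟨l₂, l₃, ?_, q2, q3⟩
    have : t = blue x' :: (l₂ ++ l₃) := by simpa using e0
    rw [← this]; exact ht

end RotationSystem

namespace RotationSystem

variable {V : Type u} {G : SimpleGraph V} {R : RotationSystem G} {v₁ v₂ : V} {red blue : V → V}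

/-- The base edge, and two outgoing edges at each inner vertex. -/
theorem _root_.IsEdgeLabeling.ncard_edgeSet [Finite V] {S : Fin 2 → Set G.Dart}
    (h : IsEdgeLabeling R v₁ v₂ S) (hbase : G.Adj v₁ v₂) :
    G.edgeSet.ncard + 3 = 2 * Nat.card V := by
  obtain ⟨red, blue, -, hred, hblue⟩ := h.exists_labeling hbase
  have h1 := ncard_of_isColoredOrientation h.orientation {v₁, v₂}ᶜ
    (fun x hx c => h.outgoing x (fun h' => hx (Or.inl h')) (fun h' => hx (Or.inr h')) c) (by
      have : ∀ x, Inner v₁ v₂ x → x ∈ ({v₁, v₂} : Set V)ᶜ := by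
        rintro x hx (h1 | h1)
        · exact hx.1 h1
        · exact hx.2 h1
      rintro c ⟨⟨x, y⟩, hd⟩ h2
      fin_cases c
      · exact this x ((hred _ _ _).1 h2).1
      · exact this x ((hblue _ _ _).1 h2).1)
  have h2 : (G.edgeSet \ {s(v₁, v₂)}).ncard + 1 = G.edgeSet.ncard :=
    Set.ncard_sdiff_singleton_add_one hbase (Set.toFinite _)
  have h3 := Set.ncard_add_ncard_compl ({v₁, v₂} : Set V)
  rw [Set.ncard_pair hbase.ne] at h3
  rw [Nat.card_fin] at h1
  omega

/-- The darts from `red x` to `x`, and from `v₁` to `v₂`; there is exactly one on each face. -/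
def IsTurn (v₁ v₂ : V) (red : V → V) (d : G.Dart) : Prop :=
  (Inner v₁ v₂ d.snd ∧ red d.snd = d.fst) ∨ (d.fst = v₁ ∧ d.snd = v₂)

/-- The darts from `x` to `blue x`. -/
def IsBlue (v₁ v₂ : V) (blue : V → V) (d : G.Dart) : Prop :=
  Inner v₁ v₂ d.fst ∧ blue d.fst = d.snd

/-- The darts that go against an `Up` edge. -/
def IsDown (v₁ v₂ : V) (red blue : V → V) (d : G.Dart) : Prop :=
  Up v₁ v₂ red blue d.snd d.fst

namespace Labeling

theorem up_asymm (h : Labeling R v₁ v₂ red blue) {x y : V} (hxy : Up v₁ v₂ red blue x y) :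
    ¬ Up v₁ v₂ red blue y x := fun hyx => h.acyclic x (.tail (.single hxy) hyx)

theorem not_up_right (h : Labeling R v₁ v₂ red blue) (x : V) : ¬ Up v₁ v₂ red blue x v₁ := by
  rintro (⟨h1, -⟩ | ⟨h1, h2⟩ | ⟨-, h1⟩)
  · exact h1.1 rfl
  · exact h.blue_ne x h1 h2
  · exact h.base.ne h1

theorem not_up_left (h : Labeling R v₁ v₂ red blue) (x : V) : ¬ Up v₁ v₂ red blue v₂ x := by
  rintro (⟨h1, h2⟩ | ⟨h1, -⟩ | ⟨h1, -⟩)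
  · exact h.red_ne x h1 h2
  · exact h1.2 rfl
  · exact h.base.ne h1.symm

theorem up_adj (h : Labeling R v₁ v₂ red blue) {x y : V} (hxy : Up v₁ v₂ red blue x y) :
    G.Adj x y := by
  rcases hxy with ⟨h1, rfl⟩ | ⟨h1, rfl⟩ | ⟨rfl, rfl⟩
  · exact (h.adj_red y h1).symm
  · exact h.adj_blue x h1
  · exact h.base

theorem turn_or (h : Labeling R v₁ v₂ red blue) (d : G.Dart) :
    IsTurn v₁ v₂ red d ∨ IsBlue v₁ v₂ blue d ∨ IsDown v₁ v₂ red blue d := by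
  rcases h.up_or _ _ d.adj with (h1 | h1 | h1) | h1
  · exact Or.inl (Or.inl h1)
  · exact Or.inr (Or.inl h1)
  · exact Or.inl (Or.inr h1)
  · exact Or.inr (Or.inr h1)

theorem isTurn_up {d : G.Dart} (hd : IsTurn v₁ v₂ red d) : Up v₁ v₂ red blue d.fst d.snd := by
  rcases hd with h1 | h1
  · exact Or.inl h1
  · exact Or.inr (Or.inr h1)

theorem not_isDown_of_isTurn (h : Labeling R v₁ v₂ red blue) {d : G.Dart}
    (hd : IsTurn v₁ v₂ red d) : ¬ IsDown v₁ v₂ red blue d := h.up_asymm (isTurn_up hd)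

theorem nx_red (h : Labeling R v₁ v₂ red blue) {x : V} (hx : Inner v₁ v₂ x) :
    R.nx x (red x) = blue x := by
  obtain ⟨kR, kB, h1, -⟩ := h.exists_isCyc x hx
  exact (List.isChain_cons_cons.1 h1.chain).1

theorem isDown_of_fst (h : Labeling R v₁ v₂ red blue) {d : G.Dart} (hd : d.fst = v₂) :
    IsDown v₁ v₂ red blue d :=
  (h.up_or _ _ d.adj).resolve_left fun h' => h.not_up_left _ (hd ▸ h')

theorem _root_.List.IsChain.next_mem {α : Type*} {f : α → α} {z : α} : ∀ {a : α} {l : List α},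
    List.IsChain (fun b c => f b = c) (a :: l ++ [z]) → ∀ b ∈ a :: l, f b ∈ l ++ [z] := by
  intro a l
  induction l generalizing a with
  | nil =>
    intro h b hb
    obtain rfl := List.mem_singleton.1 hb
    simpa using h
  | cons c l ih =>
    intro h b hb
    rw [List.cons_append, List.cons_append, List.isChain_cons_cons] at h
    rcases List.mem_cons.1 hb with rfl | hb
    · rw [h.1]; simp
    · exact List.mem_cons_of_mem _ (ih h.2 b hb)

/-- The walk along a face continues downwards after a blue edge: clockwise after an incoming blue edge
comes another one or the outgoing red edge. -/
theorem isDown_facePerm_of_isBlue (h : Labeling R v₁ v₂ red blue) {d : G.Dart}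
    (hd : IsBlue v₁ v₂ blue d) : IsDown v₁ v₂ red blue (R.facePerm d) := by
  obtain ⟨⟨w, g⟩, hwg⟩ := d
  obtain ⟨hw, hg⟩ := hd
  dsimp only at hw hg
  by_cases hg₂ : g = v₂
  · exact h.isDown_of_fst (by rw [facePerm_fst]; exact hg₂)
  · have hgi : Inner v₁ v₂ g := ⟨fun h' => h.blue_ne w hw (hg.trans h'), hg₂⟩
    obtain ⟨kR, kB, h1, h2, h3⟩ := h.exists_isCyc g hgi
    have hup : Up v₁ v₂ red blue w g := Or.inr (Or.inl ⟨hw, hg⟩)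
    have hmem : w ∈ kB := by
      have := (h1.mem_iff w).2 hwg.symm
      simp only [List.mem_cons, List.mem_append] at this
      rcases this with h4 | h4 | h4 | h4
      · exact absurd hg (h.exclusive g w hgi hw h4.symm)
      · exact absurd (Or.inr (Or.inl ⟨hgi, h4.symm⟩)) (h.up_asymm hup)
      · exact absurd (Or.inl (h2 w h4)) (h.up_asymm hup)
      · exact h4
    have hch : List.IsChain (fun b c => R.nx g b = c) (kB ++ [red g]) := by
      have := h1.chain
      have e : red g :: (blue g :: (kR ++ kB)) ++ [red g] =
          (red g :: blue g :: kR) ++ (kB ++ [red g]) := by simp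
      rw [e] at this
      exact (List.isChain_append.1 this).2.1
    rw [facePerm_mk]
    change Up v₁ v₂ red blue (R.nx g w) g
    obtain ⟨b, l, rfl⟩ : ∃ b l, kB = b :: l := by
      cases kB with
      | nil => simp at hmem
      | cons b l => exact ⟨_, _, rfl⟩
    rcases List.mem_append.1 (hch.next_mem w hmem) with h4 | h4
    · exact Or.inr (Or.inl (h3 _ (List.mem_cons_of_mem _ h4)))
    · rw [List.mem_singleton.1 h4]
      exact Or.inl ⟨hgi, rfl⟩

/-- The walk along a face that goes down continues downwards up to a turn. -/
theorem facePerm_of_isDown (h : Labeling R v₁ v₂ red blue) {d : G.Dart}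
    (hd : IsDown v₁ v₂ red blue d) :
    IsDown v₁ v₂ red blue (R.facePerm d) ∨ IsTurn v₁ v₂ red (R.facePerm d) := by
  obtain ⟨⟨c, g⟩, hcg⟩ := d
  have hd : Up v₁ v₂ red blue g c := hd
  rcases h.turn_or (R.facePerm ⟨(c, g), hcg⟩) with h1 | h1 | h1
  · exact Or.inr h1
  · exfalso
    rw [facePerm_mk] at h1
    obtain ⟨hg, h1⟩ := h1
    have h1 : blue g = R.nx g c := h1
    rw [← h.nx_red hg] at h1
    have := R.nx_inj (h.adj_red g hg) hcg.symm h1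
    exact h.up_asymm hd (Or.inl ⟨hg, this⟩)
  · exact Or.inl h1

/-- Around an inner vertex there is exactly one place where an outgoing `Up` edge is
followed by an incoming one. -/
theorem exists_corner (h : Labeling R v₁ v₂ red blue) {g : V} (hg : Inner v₁ v₂ g) :
    ∃ s, Up v₁ v₂ red blue g s ∧ Up v₁ v₂ red blue (R.nx g s) g ∧
      ∀ s', Up v₁ v₂ red blue g s' → Up v₁ v₂ red blue (R.nx g s') g → s' = s := by
  obtain ⟨kR, kB, h1, h2, h3⟩ := h.exists_isCyc g hg
  obtain ⟨k, s, hk⟩ : ∃ k s, blue g :: kR = k ++ [s] :=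
    ⟨_, _, (List.dropLast_append_getLast (l := blue g :: kR) (by simp)).symm⟩
  obtain ⟨p, r, hp⟩ : ∃ p r, kB ++ [red g] = p :: r := by
    cases kB with
    | nil => exact ⟨_, _, rfl⟩
    | cons b l => exact ⟨_, _, rfl⟩
  have hout : ∀ c ∈ blue g :: kR, Up v₁ v₂ red blue g c := by
    intro c hc
    rcases List.mem_cons.1 hc with rfl | hc
    · exact Or.inr (Or.inl ⟨hg, rfl⟩)
    · exact Or.inl (h2 c hc)
  have hin : ∀ c ∈ kB ++ [red g], Up v₁ v₂ red blue c g := by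
    intro c hc
    rcases List.mem_append.1 hc with hc | hc
    · exact Or.inr (Or.inl (h3 c hc))
    · rw [List.mem_singleton.1 hc]; exact Or.inl ⟨hg, rfl⟩
  have hch := h1.chain
  have e : red g :: (blue g :: (kR ++ kB)) ++ [red g] = red g :: (k ++ s :: p :: r) := by
    have : red g :: (blue g :: (kR ++ kB)) ++ [red g] =
        red g :: ((blue g :: kR) ++ (kB ++ [red g])) := by simp
    rw [this, hk, hp]; simp
  rw [e] at hch
  have hch' := hch.of_cons
  rw [List.isChain_split] at hch'
  have hsp : R.nx g s = p := (List.isChain_cons_cons.1 hch'.2).1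
  refine ⟨s, hout s (by rw [hk]; simp), by rw [hsp]; exact hin p (by rw [hp]; simp), ?_⟩
  intro s' hs' hs''
  have hmem : s' ∈ k ++ [s] := by
    rw [← hk]
    have := (h1.mem_iff s').2 (h.up_adj hs')
    simp only [List.mem_cons, List.mem_append] at this ⊢
    rcases this with h4 | h4 | h4 | h4
    · exact absurd (hin s' (by simp [h4])) (h.up_asymm hs')
    · exact Or.inl h4
    · exact Or.inr h4
    · exact absurd (hin s' (by simp [h4])) (h.up_asymm hs')
  rcases List.mem_append.1 hmem with h4 | h4
  · exfalso
    cases k with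
    | nil => simp at h4
    | cons b k =>
      have h5 := hch'.1.next_mem s' h4
      have h6 : R.nx g s' ∈ blue g :: kR := by
        rw [hk]; simp only [List.mem_append, List.mem_cons] at h5 ⊢; tauto
      exact h.up_asymm (hout _ h6) hs''
  · exact List.mem_singleton.1 h4

/-- Otherwise the face would be a closed walk against `Up` edges, which form no cycle. -/
theorem exists_isTurn [Finite V] (h : Labeling R v₁ v₂ red blue) (d : G.Dart) :
    ∃ j, IsTurn v₁ v₂ red (R.facePerm^[j] d) := by
  classical
  by_contra hc
  push Not at hc
  have hdown : ∀ j, IsDown v₁ v₂ red blue (R.facePerm^[j + 1] d) := by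
    intro j
    induction j with
    | zero =>
      rcases h.turn_or d with h1 | h1 | h1
      · exact absurd h1 (hc 0)
      · exact h.isDown_facePerm_of_isBlue h1
      · exact (h.facePerm_of_isDown h1).resolve_right (hc 1)
    | succ j ih =>
      rw [Function.iterate_succ_apply']
      refine (h.facePerm_of_isDown ih).resolve_right ?_
      rw [← Function.iterate_succ_apply' (f := R.facePerm)]
      exact hc _
  have hchain : ∀ j, Relation.TransGen (Up v₁ v₂ red blue) (R.facePerm^[j + 2] d).fst
      (R.facePerm^[1] d).fst := by
    intro j
    have step : ∀ j, Up v₁ v₂ red blue (R.facePerm^[j + 2] d).fst (R.facePerm^[j + 1] d).fst := by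
      intro j
      rw [Function.iterate_succ_apply', facePerm_fst]
      exact hdown j
    induction j with
    | zero => exact .single (step 0)
    | succ j ih => exact .head (step (j + 1)) ih
  obtain ⟨k, hk, hk'⟩ : ∃ k, 0 < k ∧ R.facePerm ^ k = 1 := by
    exact ⟨orderOf R.facePerm, orderOf_pos _, pow_orderOf_eq_one _⟩
  have h1 := hchain (k - 1)
  have h2 : R.facePerm^[k - 1 + 2] d = R.facePerm^[1] d := by
    have : k - 1 + 2 = k + 1 := by omega
    rw [this, Function.iterate_succ_apply', Equiv.Perm.iterate_eq_pow, hk']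
    rfl
  rw [h2] at h1
  exact h.acyclic _ h1

/-- Euler's formula gives as many faces as there are turns, so that every face has only one. -/
theorem isTurn_unique [Finite V] (h : Labeling R v₁ v₂ red blue) (hR : R.IsPlanar)
    (hE : G.edgeSet.ncard + 3 = 2 * Nat.card V) : G.Connected ∧ ∀ d e : G.Dart,
      IsTurn v₁ v₂ red d → IsTurn v₁ v₂ red e → R.facePerm.SameCycle d e → d = e := by
  have : Nonempty V := ⟨v₁⟩
  let F : {d : G.Dart // IsTurn v₁ v₂ red d} → R.Face := fun d => Quotient.mk _ d.1
  have hsurj : Function.Surjective F := by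
    intro f
    induction f using Quotient.ind with
    | _ d =>
      obtain ⟨j, hj⟩ := h.exists_isTurn d
      refine ⟨⟨_, hj⟩, Quotient.sound ?_⟩
      change R.facePerm.SameCycle (R.facePerm^[j] d) _
      rw [Equiv.Perm.iterate_eq_pow]
      exact Equiv.Perm.sameCycle_pow_left.2 (Equiv.Perm.SameCycle.refl _ _)
  have hinj : Function.Injective fun d : {d : G.Dart // IsTurn v₁ v₂ red d} =>
      (⟨d.1.snd, fun h' => by
        rcases d.2 with h1 | h1
        · exact h1.1.1 h'
        · exact h.base.ne (h'.symm.trans h1.2)⟩ : {x // x ≠ v₁}) := by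
    rintro ⟨⟨⟨x, y⟩, hd⟩, h1⟩ ⟨⟨⟨x', y'⟩, hd'⟩, h2⟩ he
    have he : y = y' := congrArg Subtype.val he
    subst he
    have : x = x' := by
      rcases h1 with h1 | h1 <;> rcases h2 with h2 | h2
      · exact h1.2.symm.trans h2.2
      · exact absurd h2.2 h1.1.2
      · exact absurd h1.2 h2.1.2
      · exact h1.1.trans h2.1.symm
    subst this
    rfl
  have hc1 : Nat.card {u // u ≠ v₁} + 1 = Nat.card V := by
    have := Set.ncard_add_ncard_compl {v₁}
    rw [Set.ncard_singleton] at this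
    rw [← this, add_comm]; rfl
  have hT := Nat.card_le_card_of_injective _ hinj
  have hF := Nat.card_le_card_of_surjective _ hsurj
  have hiso : Nat.card {x : V // ∀ y, ¬ G.Adj x y} = 0 := by
    refine card_isolated fun x => ?_
    by_cases h1 : x = v₁
    · exact ⟨v₂, h1 ▸ h.base⟩
    · by_cases h2 : x = v₂
      · exact ⟨v₁, h2 ▸ h.base.symm⟩
      · exact ⟨_, h.adj_red x ⟨h1, h2⟩⟩
  have hC := one_le_card_connectedComponent (G := G)
  have heul := hR
  unfold IsPlanar at heul
  rw [hiso, Nat.card_coe_set_eq] at heul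
  refine ⟨connected_of_card (by omega), ?_⟩
  have hbij := hsurj.bijective_of_nat_card_le (by omega)
  intro d e hd he hde
  have := @hbij.1 ⟨d, hd⟩ ⟨e, he⟩ (Quotient.sound hde)
  exact congrArg Subtype.val this

end Labeling

end RotationSystem

/-! ### The facial paths of an edge labeling -/

/-- The values `p (a + n - 1), …, p (a + 1), p a`. -/
def descList {α : Type*} (p : ℕ → α) (a : ℕ) : ℕ → List α
  | 0 => []
  | n + 1 => p (a + n) :: descList p a n

namespace descList

variable {α : Type*} {p : ℕ → α} {a : ℕ}

theorem succ_eq (n : ℕ) : descList p a (n + 1) = descList p (a + 1) n ++ [p a] := by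
  induction n with
  | zero => rfl
  | succ n ih =>
    rw [descList, ih, descList, List.cons_append]
    congr 2; omega

theorem mem_iff (n : ℕ) (x : α) : x ∈ descList p a n ↔ ∃ j, a ≤ j ∧ j < a + n ∧ p j = x := by
  induction n with
  | zero => simp [descList]; intros; omega
  | succ n ih =>
    rw [descList, List.mem_cons, ih]
    constructor
    · rintro (rfl | ⟨j, h1, h2, h3⟩)
      · exact ⟨_, by omega, by omega, rfl⟩
      · exact ⟨j, h1, by omega, h3⟩
    · rintro ⟨j, h1, h2, h3⟩
      rcases Nat.lt_or_ge j (a + n) with h4 | h4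
      · exact Or.inr ⟨j, h1, h4, h3⟩
      · have : j = a + n := by omega
        exact Or.inl (this ▸ h3.symm)

theorem isChain {r : α → α → Prop} (n : ℕ) (h : ∀ j, a ≤ j → j + 1 < a + n → r (p (j + 1)) (p j)) :
    (descList p a n).IsChain r := by
  induction n with
  | zero => simp [descList]
  | succ n ih =>
    cases n with
    | zero => simp [descList]
    | succ n =>
      rw [descList, descList, List.isChain_cons_cons]
      exact ⟨h (a + n) (by omega) (by omega), ih fun j h1 h2 => h j h1 (by omega)⟩

theorem chain3 {Q : α → α → α → Prop} (n : ℕ)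
    (h : ∀ j, a ≤ j → j + 2 < a + n → Q (p (j + 2)) (p (j + 1)) (p j)) :
    Chain3 Q (descList p a n) := by
  induction n with
  | zero => trivial
  | succ n ih =>
    match n, ih with
    | 0, _ => trivial
    | 1, _ => trivial
    | n + 2, ih => exact ⟨h (a + n) (by omega) (by omega), ih fun j h1 h2 => h j h1 (by omega)⟩

theorem nodup (n : ℕ) (h : ∀ i j, a ≤ i → i < j → j < a + n → p i ≠ p j) :
    (descList p a n).Nodup := by
  induction n with
  | zero => simp [descList]
  | succ n ih =>
    rw [descList, List.nodup_cons, mem_iff]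
    refine ⟨?_, ih fun i j h1 h2 h3 => h i j h1 h2 (by omega)⟩
    rintro ⟨j, h1, h2, h3⟩
    exact h j (a + n) h1 h2 (by omega) h3

theorem exists_append (n j : ℕ) (h1 : a ≤ j) (h2 : j + 1 < a + n) :
    ∃ l r, descList p a n = l ++ p (j + 1) :: p j :: r := by
  induction n with
  | zero => omega
  | succ n ih =>
    rcases Nat.lt_or_ge (j + 1) (a + n) with h3 | h3
    · obtain ⟨l, r, h4⟩ := ih h3
      exact ⟨p (a + n) :: l, r, by rw [descList, h4]; rfl⟩
    · obtain ⟨m, rfl⟩ : ∃ m, n = m + 1 := ⟨n - 1, by omega⟩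
      refine ⟨[], descList p a m, ?_⟩
      rw [descList, descList, List.nil_append]
      have e : a + m = j := by omega
      have e' : a + (m + 1) = j + 1 := by omega
      rw [e, e']

end descList

namespace RotationSystem

variable {V : Type u} {G : SimpleGraph V} {R : RotationSystem G} {v₁ v₂ : V} {red blue : V → V}

/-- The turn of the face with a given apex. -/
def TurnAt (v₁ v₂ : V) (red : V → V) (t : G.Dart) : Option V → Prop
  | none => t.fst = v₁ ∧ t.snd = v₂
  | some w => Inner v₁ v₂ w ∧ t.fst = red w ∧ t.snd = w

/-- The facial path of a face starts at this position after its turn. -/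
def startPos : Option V → ℕ
  | none => 1
  | some _ => 2

/-- The facial paths of an edge labeling: each face is walked along starting with its only turn. The
second statement says that each `Up` edge is on the facial path of the face to its left. -/
theorem Labeling.exists_facialPaths [Finite V] (h : Labeling R v₁ v₂ red blue)
    (huniq : ∀ d e : G.Dart, IsTurn v₁ v₂ red d → IsTurn v₁ v₂ red e →
      R.facePerm.SameCycle d e → d = e) (hconn : G.Connected) :
    ∃ I, FacialPaths R v₁ v₂ red blue I ∧ ∀ p q, Up v₁ v₂ red blue p q →
      ∃ w, Apex v₁ v₂ w ∧ ∃ l r, path v₁ v₂ red blue I w = l ++ p :: q :: r := by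
  classical
  let σ := R.facePerm
  let vert : G.Dart → ℕ → V := fun t j => (σ^[j] t).fst
  let per : G.Dart → ℕ := fun t => Function.minimalPeriod σ t
  let I : Option V → List V := fun w =>
    if hw : ∃ t : G.Dart, TurnAt v₁ v₂ red t w then
      descList (vert hw.choose) (startPos w + 1) (per hw.choose - startPos w - 1)
    else []
  have hTA : ∀ w (t : G.Dart), TurnAt v₁ v₂ red t w → IsTurn v₁ v₂ red t := by
    rintro (_ | w) t ht
    · exact Or.inr ht
    · obtain ⟨h1, h2, rfl⟩ := ht
      exact Or.inl ⟨h1, h2.symm⟩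
  have hTAu : ∀ w (t t' : G.Dart), TurnAt v₁ v₂ red t w → TurnAt v₁ v₂ red t' w → t = t' := by
    rintro (_ | w) t t' ht ht'
    · exact SimpleGraph.Dart.ext _ _ (Prod.ext (ht.1.trans ht'.1.symm) (ht.2.trans ht'.2.symm))
    · exact SimpleGraph.Dart.ext _ _
        (Prod.ext (ht.2.1.trans ht'.2.1.symm) (ht.2.2.trans ht'.2.2.symm))
  have hTAw : ∀ w w' (t : G.Dart), TurnAt v₁ v₂ red t w → TurnAt v₁ v₂ red t w' → w = w' := by
    rintro (_ | w) (_ | w') t ht ht'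
    · rfl
    · exact absurd (ht'.2.2.symm.trans ht.2) ht'.1.2
    · exact absurd (ht.2.2.symm.trans ht'.2) ht.1.2
    · exact congrArg some (ht.2.2.symm.trans ht'.2.2)
  have hTAe : ∀ w, Apex v₁ v₂ w → ∃ t : G.Dart, TurnAt v₁ v₂ red t w := by
    rintro (_ | w) hw
    · exact ⟨⟨(v₁, v₂), h.base⟩, rfl, rfl⟩
    · exact ⟨⟨(red w, w), (h.adj_red w (hw w rfl)).symm⟩, hw w rfl, rfl, rfl⟩
  have hTAa : ∀ t : G.Dart, IsTurn v₁ v₂ red t → ∃ w, Apex v₁ v₂ w ∧ TurnAt v₁ v₂ red t w := by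
    rintro t (ht | ht)
    · exact ⟨some t.snd, by rintro x ⟨⟩; exact ht.1, ht.1, ht.2.symm, rfl⟩
    · exact ⟨none, by rintro x ⟨⟩, ht⟩
  have hI : ∀ w t, TurnAt v₁ v₂ red t w →
      I w = descList (vert t) (startPos w + 1) (per t - startPos w - 1) := by
    intro w t ht
    have hw : ∃ t : G.Dart, TurnAt v₁ v₂ red t w := ⟨t, ht⟩
    change (if hw : _ then _ else _) = _
    rw [dif_pos hw, hTAu w _ t hw.choose_spec ht]
  have hvs : ∀ t j, vert t (j + 1) = (σ^[j] t).snd := by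
    intro t j
    change (σ^[j + 1] t).fst = _
    rw [Function.iterate_succ_apply']
    exact R.facePerm_fst _
  have hper : ∀ t : G.Dart, σ^[per t] t = t := fun t => Function.iterate_minimalPeriod
  have hpos : ∀ t : G.Dart, 0 < per t := fun t => Function.minimalPeriod_pos_of_mem_periodicPts
    (σ.injective.mem_periodicPts t)
  have hsame : ∀ (t : G.Dart) j, σ.SameCycle t (σ^[j] t) := fun t j => by
    rw [Equiv.Perm.iterate_eq_pow]
    exact Equiv.Perm.sameCycle_pow_right.2 (Equiv.Perm.SameCycle.refl _ _)
  have hlt : ∀ (t : G.Dart) j, σ^[j] t = t → 0 < j → per t ≤ j := fun t j h1 h2 =>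
    Function.IsPeriodicPt.minimalPeriod_le h2 h1
  -- after its turn and, for an inner apex, one blue edge, the walk along a face goes down only
  have hdown : ∀ w t, TurnAt v₁ v₂ red t w → startPos w < per t ∧
      ∀ j, startPos w ≤ j → j < per t → IsDown v₁ v₂ red blue (σ^[j] t) := by
    intro w t ht
    have hT := hTA w t ht
    have hfirst : IsDown v₁ v₂ red blue (σ^[startPos w] t) := by
      cases w with
      | none => exact h.isDown_of_fst (by rw [← ht.2]; exact R.facePerm_fst _)
      | some w =>
        change IsDown v₁ v₂ red blue (σ (σ t))
        apply h.isDown_facePerm_of_isBlue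
        obtain ⟨⟨x, y⟩, hd⟩ := t
        obtain ⟨h1, h2, h3⟩ := ht
        dsimp only at h2 h3
        subst h2 h3
        change IsBlue v₁ v₂ blue (R.facePerm _)
        rw [facePerm_mk]
        exact ⟨h1, (h.nx_red h1).symm⟩
    have hsec : startPos w ≠ 0 ∧ ∀ j, 0 < j → j < startPos w →
        ¬ IsTurn v₁ v₂ red (σ^[j] t) := by
      cases w with
      | none => exact ⟨Nat.one_ne_zero, fun j h1 h2 => absurd h2 (by simp only [startPos]; omega)⟩
      | some w =>
        refine ⟨two_ne_zero, fun j h1 h2 h3 => ?_⟩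
        have : j = 1 := by simp only [startPos] at h2; omega
        subst this
        have h4 := huniq _ _ hT h3 (hsame t 1)
        exact R.facePerm_ne t h4.symm
    have hall : ∀ j, startPos w ≤ j → (∀ i, startPos w ≤ i → i ≤ j → σ^[i] t ≠ t) →
        IsDown v₁ v₂ red blue (σ^[j] t) := by
      intro j hj
      induction j, hj using Nat.le_induction with
      | base => exact fun _ => hfirst
      | succ j hj ih =>
        intro hne
        have h1 := ih fun i h2 h3 => hne i h2 (by omega)
        rw [Function.iterate_succ_apply']
        refine (h.facePerm_of_isDown h1).resolve_right fun h4 => ?_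
        have h5 : IsTurn v₁ v₂ red (σ^[j + 1] t) := by
          rw [Function.iterate_succ_apply']; exact h4
        exact hne (j + 1) (by omega) le_rfl (huniq _ _ hT h5 (hsame t _)).symm
    have hstart : startPos w < per t := by
      by_contra hle
      rcases (not_lt.1 hle).lt_or_eq with h1 | h1
      · refine hsec.2 _ (hpos t) h1 ?_
        rw [hper]; exact hT
      · refine h.not_isDown_of_isTurn hT ?_
        rw [← h1, hper] at hfirst; exact hfirst
    refine ⟨hstart, fun j h1 h2 => hall j h1 fun i h3 h4 h5 => ?_⟩
    exact absurd (hlt t i h5 (by omega)) (by omega)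
  have hpath : ∀ w t, TurnAt v₁ v₂ red t w → path v₁ v₂ red blue I w =
      descList (vert t) (startPos w) (per t - startPos w + 1) ∧
      closedPath v₁ v₂ red blue I w =
        descList (vert t) (startPos w - 1) (per t - startPos w + 3) := by
    intro w t ht
    obtain ⟨hm, -⟩ := hdown w t ht
    have e1 : path v₁ v₂ red blue I w =
        vert t (per t) :: I w ++ [vert t (startPos w)] := by
      have h1 : vert t (per t) = t.fst := by change (σ^[per t] t).fst = _; rw [hper]
      cases w with
      | none =>
        have h2 : vert t (startPos (none : Option V)) = t.snd := hvs t 0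
        rw [h1, h2, ht.1, ht.2]; rfl
      | some w =>
        have h2 : vert t (startPos (some w)) = blue w := by
          have : vert t (startPos (some w)) = (σ^[1] t).snd := hvs t 1
          rw [this]
          obtain ⟨⟨x, y⟩, hd⟩ := t
          obtain ⟨h4, h2, h3⟩ := ht
          dsimp only at h2 h3
          subst h2 h3
          change (R.facePerm _).snd = _
          rw [facePerm_mk]
          exact h.nx_red h4
        rw [h1, h2, ht.2.1]; rfl
    have e2 : path v₁ v₂ red blue I w =
        descList (vert t) (startPos w) (per t - startPos w + 1) := by
      rw [e1, hI w t ht, descList]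
      obtain ⟨n, hn⟩ : ∃ n, per t - startPos w = n + 1 := ⟨per t - startPos w - 1, by omega⟩
      have : startPos w + (per t - startPos w) = per t := by omega
      rw [this, hn, descList.succ_eq]
      rfl
    refine ⟨e2, ?_⟩
    have h0 : startPos w ≠ 0 := by
      cases w with
      | none => exact Nat.one_ne_zero
      | some w => exact two_ne_zero
    have h4 : closedPath v₁ v₂ red blue I w =
        vert t (per t + 1) :: path v₁ v₂ red blue I w ++ [vert t (startPos w - 1)] := by
      have h1 : vert t (per t + 1) = t.snd := by rw [hvs, hper]
      cases w with
      | none =>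
        have h2 : vert t (startPos (none : Option V) - 1) = t.fst := rfl
        rw [h1, h2, ht.1, ht.2]; rfl
      | some w =>
        have h2 : vert t (startPos (some w) - 1) = t.snd := hvs t 0
        rw [h1, h2, ht.2.2]; rfl
    have h5 : startPos w = startPos w - 1 + 1 := by omega
    have h6 : per t + 1 = startPos w - 1 + (per t - startPos w + 2) := by omega
    have e3 : descList (vert t) (startPos w - 1) (per t - startPos w + 3) = vert t (per t + 1) ::
        (descList (vert t) (startPos w) (per t - startPos w + 1) ++ [vert t (startPos w - 1)]) := by
      rw [show per t - startPos w + 3 = (per t - startPos w + 2) + 1 by omega, descList,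
        ← h6, show per t - startPos w + 2 = (per t - startPos w + 1) + 1 by omega,
        descList.succ_eq, ← h5]
    rw [h4, e2, e3]
    rfl
  have hup : ∀ w t, TurnAt v₁ v₂ red t w → ∀ j, startPos w ≤ j → j < per t →
      Up v₁ v₂ red blue (vert t (j + 1)) (vert t j) := by
    intro w t ht j h1 h2
    rw [hvs]
    exact (hdown w t ht).2 j h1 h2
  have hfst : ∀ t j, R.nx (vert t (j + 1)) (vert t j) = vert t (j + 2) := by
    intro t j
    have h1 := hvs t (j + 1)
    rw [h1, hvs t j]
    change R.nx _ (σ^[j] t).fst = (σ^[j + 1] t).snd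
    rw [Function.iterate_succ_apply']
    generalize σ^[j] t = d
    obtain ⟨⟨x, y⟩, hd⟩ := d
    change _ = (R.facePerm _).snd
    rw [facePerm_mk]
  have hmemI : ∀ w t, TurnAt v₁ v₂ red t w → ∀ g, g ∈ I w ↔
      ∃ j, startPos w ≤ j ∧ j + 1 < per t ∧ vert t (j + 1) = g := by
    intro w t ht g
    have hm := (hdown w t ht).1
    rw [hI w t ht, descList.mem_iff]
    constructor
    · rintro ⟨j, h1, h2, h3⟩
      obtain ⟨i, rfl⟩ : ∃ i, j = i + 1 := ⟨j - 1, by omega⟩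
      exact ⟨i, by omega, by omega, h3⟩
    · rintro ⟨j, h1, h2, h3⟩
      exact ⟨j + 1, by omega, by omega, h3⟩
  have hinner : ∀ w t, TurnAt v₁ v₂ red t w → ∀ j, startPos w ≤ j → j + 1 < per t →
      Inner v₁ v₂ (vert t (j + 1)) := by
    intro w t ht j h1 h2
    constructor
    · intro h3
      exact h.not_up_right _ (h3 ▸ hup w t ht (j + 1) (by omega) h2)
    · intro h3
      exact h.not_up_left _ (h3 ▸ hup w t ht j h1 (by omega))
  -- the walk passes an inner vertex only at its corner
  have hcorner : ∀ w t, TurnAt v₁ v₂ red t w → ∀ w' t', TurnAt v₁ v₂ red t' w' →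
      ∀ j j', startPos w ≤ j → j + 1 < per t → startPos w' ≤ j' → j' + 1 < per t' →
      vert t (j + 1) = vert t' (j' + 1) → σ^[j] t = σ^[j'] t' := by
    intro w t ht w' t' ht' j j' h1 h2 h3 h4 h5
    obtain ⟨s, -, -, hs⟩ := h.exists_corner (hinner w t ht j h1 h2)
    have e1 := hs (vert t j) (hup w t ht j h1 (by omega))
      (by rw [hfst]; exact hup w t ht (j + 1) (by omega) h2)
    have e2 := hs (vert t' j') (h5 ▸ hup w' t' ht' j' h3 (by omega))
      (by rw [h5, hfst]; exact hup w' t' ht' (j' + 1) (by omega) h4)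
    refine SimpleGraph.Dart.ext _ _ (Prod.ext (e1.trans e2.symm) ?_)
    rw [← hvs, ← hvs]; exact h5
  -- every dart is on a face
  have hface : ∀ d, ∃ w t j, Apex v₁ v₂ w ∧ TurnAt v₁ v₂ red t w ∧ j < per t ∧ σ^[j] t = d := by
    intro d
    obtain ⟨i, hi⟩ := h.exists_isTurn d
    obtain ⟨w, hw, ht⟩ := hTAa _ hi
    have h1 : σ.SameCycle (σ^[i] d) d := (hsame d i).symm
    obtain ⟨k, hk⟩ := h1.exists_nat_pow_eq
    refine ⟨w, _, k % per (σ^[i] d), hw, ht, Nat.mod_lt _ (hpos _), ?_⟩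
    rw [Function.iterate_mod_minimalPeriod_eq, Equiv.Perm.iterate_eq_pow]
    exact hk
  have hfaceDown : ∀ d, IsDown v₁ v₂ red blue d → ∃ w t j, Apex v₁ v₂ w ∧ TurnAt v₁ v₂ red t w ∧
      startPos w ≤ j ∧ j < per t ∧ σ^[j] t = d := by
    intro d hd
    obtain ⟨w, t, j, hw, ht, hj, rfl⟩ := hface d
    refine ⟨w, t, j, hw, ht, ?_, hj, rfl⟩
    by_contra hlt'
    rw [not_le] at hlt'
    rcases Nat.eq_zero_or_pos j with h1 | h1
    · subst h1
      exact h.not_isDown_of_isTurn (hTA w t ht) hd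
    · cases w with
      | none => simp only [startPos] at hlt'; omega
      | some w =>
        have : j = 1 := by simp only [startPos] at hlt'; omega
        subst this
        obtain ⟨⟨x, y⟩, hd'⟩ := t
        obtain ⟨h1, h2, h3⟩ := ht
        dsimp only at h2 h3
        subst h2 h3
        have hd : IsDown v₁ v₂ red blue (R.facePerm _) := hd
        rw [facePerm_mk] at hd
        have hd : Up v₁ v₂ red blue (R.nx y (red y)) y := hd
        rw [h.nx_red h1] at hd
        exact h.up_asymm (Or.inr (Or.inl ⟨h1, rfl⟩)) hd
  refine ⟨I, ⟨h.base, h.adj_red, h.adj_blue, fun x hx => h.nx_red hx, ?_, ?_, ?_, ?_, ?_, ?_, ?_⟩, ?_⟩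
  · intro w hw
    obtain ⟨t, ht⟩ := hTAe w hw
    rw [(hpath w t ht).1]
    exact descList.isChain _ fun j h1 h2 => hup w t ht j h1 (by omega)
  · intro w hw
    obtain ⟨t, ht⟩ := hTAe w hw
    rw [(hpath w t ht).2]
    exact descList.chain3 _ fun j h1 h2 => hfst t j
  · intro w hw g hg
    obtain ⟨t, ht⟩ := hTAe w hw
    obtain ⟨j, h1, h2, rfl⟩ := (hmemI w t ht g).1 hg
    exact hinner w t ht j h1 h2
  · intro g hg
    obtain ⟨s, hs1, hs2, -⟩ := h.exists_corner hg
    obtain ⟨w, t, j, hw, ht, h1, h2, h3⟩ := hfaceDown ⟨(s, g), (h.up_adj hs1).symm⟩ hs1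
    have hv : vert t (j + 1) = g := by rw [hvs, h3]
    refine ⟨w, hw, (hmemI w t ht g).2 ⟨j, h1, ?_, hv⟩⟩
    -- the next dart goes down as well, so that it is not the turn
    by_contra hlt'
    have h4 : j + 1 = per t := by omega
    have h5 : σ (σ^[j] t) = t := by
      have : σ^[j + 1] t = σ (σ^[j] t) := Function.iterate_succ_apply' ..
      rw [← this, h4, hper]
    rw [h3] at h5
    refine h.not_isDown_of_isTurn (hTA w t ht) ?_
    rw [← h5]
    change IsDown v₁ v₂ red blue (R.facePerm _)
    rw [facePerm_mk]
    exact hs2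
  · intro w w' hw hw' g hg hg'
    obtain ⟨t, ht⟩ := hTAe w hw
    obtain ⟨t', ht'⟩ := hTAe w' hw'
    obtain ⟨j, h1, h2, h3⟩ := (hmemI w t ht g).1 hg
    obtain ⟨j', h4, h5, h6⟩ := (hmemI w' t' ht' g).1 hg'
    have h7 := hcorner w t ht w' t' ht' j j' h1 h2 h4 h5 (h3.trans h6.symm)
    have h8 : σ.SameCycle t t' := (hsame t j).trans (h7 ▸ (hsame t' j').symm)
    have := huniq _ _ (hTA w t ht) (hTA w' t' ht') h8
    subst this
    exact hTAw w w' t ht ht'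
  · intro w hw
    obtain ⟨t, ht⟩ := hTAe w hw
    have hm := (hdown w t ht).1
    rw [hI w t ht]
    refine descList.nodup _ fun i j h1 h2 h3 h4 => ?_
    obtain ⟨i', rfl⟩ : ∃ i', i = i' + 1 := ⟨i - 1, by omega⟩
    obtain ⟨j', rfl⟩ : ∃ j', j = j' + 1 := ⟨j - 1, by omega⟩
    have h5 := hcorner w t ht w t ht i' j' (by omega) (by omega) (by omega) (by omega) h4
    have h6 : σ^[i' + (j' - i')] t = σ^[i'] t := by
      rw [show i' + (j' - i') = j' by omega]; exact h5.symm
    rw [Function.iterate_add_apply] at h6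
    have h7 := hlt t (j' - i') (σ.injective.iterate i' h6) (by omega)
    omega
  · intro Y hY hYadj _
    by_contra hne
    obtain ⟨y, hy⟩ := Set.nonempty_iff_ne_empty.2 hne
    have : ∀ z, G.Reachable y z → z ∈ Y := by
      rintro z ⟨p⟩
      induction p with
      | nil => exact hy
      | cons hadj p ih => exact ih (hYadj _ hy _ hadj)
    exact (hY v₁ (this v₁ (hconn.preconnected y v₁))).1 rfl
  · intro p q hpq
    obtain ⟨w, t, j, hw, ht, h1, h2, h3⟩ := hfaceDown ⟨(q, p), (h.up_adj hpq).symm⟩ hpq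
    refine ⟨w, hw, ?_⟩
    rw [(hpath w t ht).1]
    obtain ⟨l, r, h4⟩ := descList.exists_append (p := vert t) (a := startPos w)
      (per t - startPos w + 1) j h1 (by omega)
    refine ⟨l, r, ?_⟩
    rw [h4, hvs, h3]
    have : vert t j = q := by change (σ^[j] t).fst = q; rw [h3]
    rw [this]

end RotationSystem

/-! ### Schnyder realizers and their facial paths -/

namespace RotationSystem

variable {V : Type u} {G : SimpleGraph V} {R : RotationSystem G} {v₁ v₂ : V}

/-- The first element of `A` after `a` in the clockwise list of neighbours. -/
theorem nextIn_of_isChain {A : Set V} {x b : V} : ∀ {a : V} {l : List V},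
    List.IsChain (fun b c => R.nx x b = c) (a :: (l ++ [b])) → (∀ c ∈ l, c ∉ A) → b ∈ A →
    R.NextIn A x a b := by
  intro a l
  induction l generalizing a with
  | nil => exact fun h _ hb => nextIn_of_nx (List.isChain_cons_cons.1 h).1 hb
  | cons c l ih =>
    intro h hl hb
    rw [List.cons_append, List.isChain_cons_cons] at h
    obtain ⟨h1, k, hk, h2, h3⟩ := ih h.2 (fun c' hc => hl c' (by simp [hc])) hb
    refine ⟨h1, k + 1, by omega, by rw [Function.iterate_succ_apply, h.1, h2], ?_⟩
    intro j hj hj'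
    obtain ⟨i, rfl⟩ : ∃ i, j = i + 1 := ⟨j - 1, by omega⟩
    rw [Function.iterate_succ_apply, h.1]
    rcases Nat.eq_zero_or_pos i with rfl | hi
    · exact hl c (by simp)
    · exact h3 i hi (by omega)

/-- The lists of neighbours around the inner vertices in a Schnyder realizer: `red x`, `blue x` and
`green x` are the heads of the outgoing edges of `x`, and `I x`, `kR x` and `kB x` list the
tails of the incoming green, red and blue edges. -/
structure RealizerLists (H : SimpleGraph (Option V)) (RH : RotationSystem H) (v₁ v₂ : V)
    (red blue : V → V) (green : V → Option V) (I kR kB : V → List V) : Prop where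
  isCyc : ∀ x, Inner v₁ v₂ x → RH.IsCyc (some x) (some (red x))
    ((I x).map some ++ some (blue x) :: ((kR x).map some ++ green x :: (kB x).map some))
  mem_I : ∀ x, Inner v₁ v₂ x → ∀ c, c ∈ I x ↔ Inner v₁ v₂ c ∧ green c = some x
  mem_kB : ∀ x, Inner v₁ v₂ x → ∀ c, c ∈ kB x ↔ Inner v₁ v₂ c ∧ blue c = x
  red_ne : ∀ x, Inner v₁ v₂ x → red x ≠ v₂
  blue_ne : ∀ x, Inner v₁ v₂ x → blue x ≠ v₁
  green_ne₁ : ∀ x, Inner v₁ v₂ x → green x ≠ some v₁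
  green_ne₂ : ∀ x, Inner v₁ v₂ x → green x ≠ some v₂
  adj_cases : ∀ x y, H.Adj (some x) (some y) → Up v₁ v₂ red blue x y ∨ Up v₁ v₂ red blue y x ∨
    (Inner v₁ v₂ x ∧ green x = some y) ∨ (Inner v₁ v₂ y ∧ green y = some x)
  adj_none : ∀ x, H.Adj (some x) none → x = v₁ ∨ x = v₂ ∨ (Inner v₁ v₂ x ∧ green x = none)
  exclusive : ∀ x y, Inner v₁ v₂ x → green x = some y →
    ¬ Up v₁ v₂ red blue x y ∧ ¬ Up v₁ v₂ red blue y x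

theorem exists_map_some {l : List (Option V)} {p : V → Prop}
    (h : ∀ c ∈ l, ∃ y, c = some y ∧ p y) : ∃ l' : List V, l = l'.map some ∧ ∀ y ∈ l', p y := by
  induction l with
  | nil => exact ⟨[], rfl, by simp⟩
  | cons a l ih =>
    obtain ⟨l', rfl, h'⟩ := ih fun c hc => h c (List.mem_cons_of_mem _ hc)
    obtain ⟨y, rfl, hy⟩ := h a (by simp)
    refine ⟨y :: l', rfl, ?_⟩
    intro z hz
    rcases List.mem_cons.1 hz with rfl | hz
    · exact hy
    · exact h' z hz

/-- The local rule cuts the clockwise list of neighbours of an inner vertex at its three outgoing edges. -/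
theorem _root_.IsSchnyderRealizer.exists_lists [Finite V] {H : SimpleGraph (Option V)}
    {RH : RotationSystem H} {S : Fin 3 → Set H.Dart}
    (h : IsSchnyderRealizer RH (some v₁) (some v₂) none S) :
    ∃ red blue green I kR kB, RealizerLists H RH v₁ v₂ red blue green I kR kB ∧
      (∀ d ∈ S 2, ∃ x, Inner v₁ v₂ x ∧ d.fst = some x ∧ d.snd = green x) ∧
      ∀ x, Inner v₁ v₂ x → ∀ hx : H.Adj (some x) (green x),
        (⟨(some x, green x), hx⟩ : H.Dart) ∈ S 2 := by
  have huniq : ∀ c c' d d', d ∈ S c → d' ∈ S c' → d.edge = d'.edge → c = c' ∧ d = d' := by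
    intro c c' d d' hd hd' he
    have := (h.orientation.2 d.edge (h.orientation.1 c d hd)).unique (y₁ := (c, d)) (y₂ := (c', d'))
      ⟨rfl, hd⟩ ⟨he.symm, hd'⟩
    exact ⟨congrArg Prod.fst this, congrArg Prod.snd this⟩
  have htail : ∀ c, ∀ d ∈ S c, ∃ x, d.fst = some x ∧ Inner v₁ v₂ x := by
    intro c d hd
    have hin : d.symm.edge ∈ innerEdges H (some v₁) (some v₂) none := by
      rw [SimpleGraph.Dart.edge_symm]; exact h.orientation.1 c d hd
    have hno : ∀ c', d.symm ∉ S c' := fun c' h' => d.symm_ne (huniq _ _ _ _ hd h' (by simp)).2.symm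
    rcases hf : d.fst with _ | x
    · exact absurd (h.atₙ d.symm hin hf) (hno 2)
    · refine ⟨x, rfl, ?_, ?_⟩
      · rintro rfl; exact hno 0 (h.at₁ d.symm hin hf)
      · rintro rfl; exact hno 1 (h.at₂ d.symm hin hf)
  have hin : ∀ x z, Inner v₁ v₂ x → H.Adj (some x) z →
      s(some x, z) ∈ innerEdges H (some v₁) (some v₂) none := by
    intro x z hx hz
    refine ⟨hz, ?_⟩
    rintro (h1 | h1 | h1) <;> rcases Sym2.eq_iff.1 h1 with ⟨h2, -⟩ | ⟨h2, -⟩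
    · exact hx.1 (Option.some.inj h2)
    · exact hx.2 (Option.some.inj h2)
    · exact hx.2 (Option.some.inj h2)
    · cases h2
    · cases h2
    · exact hx.1 (Option.some.inj h2)
  have hout : ∀ c x, ∃ z, Inner v₁ v₂ x → ∃ hz : H.Adj (some x) z,
      (⟨(some x, z), hz⟩ : H.Dart) ∈ S c := by
    intro c x
    by_cases hx : Inner v₁ v₂ x
    · obtain ⟨⟨⟨x', z⟩, hz⟩, ⟨h1, h2⟩, -⟩ := h.outgoing (some x) (by simpa using hx.1)
        (by simpa using hx.2) (by simp) c
      dsimp only at h1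
      subst h1
      exact ⟨z, fun _ => ⟨hz, h2⟩⟩
    · exact ⟨none, fun h => absurd h hx⟩
  choose hd hhd hmem using hout
  have hiff : ∀ c x z (hz : H.Adj (some x) z), (⟨(some x, z), hz⟩ : H.Dart) ∈ S c ↔
      Inner v₁ v₂ x ∧ hd c x = z := by
    intro c x z hz
    constructor
    · intro h1
      obtain ⟨x', h2, hx⟩ := htail c _ h1
      obtain rfl := Option.some.inj h2
      have := (h.outgoing (some x) (by simpa using hx.1)
        (by simpa using hx.2) (by simp) c).unique ⟨rfl, hmem c x hx⟩ ⟨rfl, h1⟩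
      exact ⟨hx, congrArg (fun d : H.Dart => d.snd) this⟩
    · rintro ⟨hx, rfl⟩; exact hmem c x hx
  -- the colour of an edge is determined by its head if that is an outer vertex
  have hhead : ∀ c c' x z, Inner v₁ v₂ x → hd c x = z → (∀ d : H.Dart,
      d.edge ∈ innerEdges H (some v₁) (some v₂) none → d.snd = z → d ∈ S c') → c = c' := by
    intro c c' x z hx hz hat
    exact (huniq _ _ _ _ (hmem c x hx) (hat ⟨(some x, hd c x), hhd c x hx⟩ (hin x _ hx (hhd c x hx)) hz) rfl).1
  have hred : ∀ x, ∃ y, Inner v₁ v₂ x → hd 0 x = some y := by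
    intro x
    by_cases hx : Inner v₁ v₂ x
    · rcases hz : hd 0 x with _ | y
      · exact absurd (hhead 0 2 x none hx hz h.atₙ) (by decide)
      · exact ⟨y, fun _ => rfl⟩
    · exact ⟨x, fun h => absurd h hx⟩
  have hblue : ∀ x, ∃ y, Inner v₁ v₂ x → hd 1 x = some y := by
    intro x
    by_cases hx : Inner v₁ v₂ x
    · rcases hz : hd 1 x with _ | y
      · exact absurd (hhead 1 2 x none hx hz h.atₙ) (by decide)
      · exact ⟨y, fun _ => rfl⟩
    · exact ⟨x, fun h => absurd h hx⟩
  choose red hred using hred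
  choose blue hblue using hblue
  let green : V → Option V := hd 2
  -- the six classes of darts around a vertex are disjoint
  let P : Fin 6 → Set H.Dart := ![S 0, incoming (S 2), S 1, incoming (S 0), S 2, incoming (S 1)]
  have hP : ∀ i j d, d ∈ P i → d ∈ P j → i = j := by
    let col : Fin 6 → Fin 3 := ![0, 2, 1, 0, 2, 1]
    have hcl : ∀ i d, d ∈ P i → (i.val % 2 = 0 ∧ d ∈ S (col i)) ∨
        (i.val % 2 = 1 ∧ d.symm ∈ S (col i)) := by
      intro i d hd
      fin_cases i
      · exact Or.inl ⟨rfl, hd⟩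
      · exact Or.inr ⟨rfl, hd⟩
      · exact Or.inl ⟨rfl, hd⟩
      · exact Or.inr ⟨rfl, hd⟩
      · exact Or.inl ⟨rfl, hd⟩
      · exact Or.inr ⟨rfl, hd⟩
    have hcol : ∀ i j : Fin 6, i.val % 2 = j.val % 2 → col i = col j → i = j := by decide
    intro i j d hi hj
    rcases hcl i d hi with ⟨h1, h2⟩ | ⟨h1, h2⟩ <;> rcases hcl j d hj with ⟨h3, h4⟩ | ⟨h3, h4⟩
    · exact hcol i j (h1.trans h3.symm) (huniq _ _ _ _ h2 h4 rfl).1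
    · exact absurd (huniq _ _ _ _ h2 h4 (by simp)).2.symm d.symm_ne
    · exact absurd (huniq _ _ _ _ h2 h4 (by simp)).2 d.symm_ne
    · exact hcol i j (h1.trans h3.symm) (huniq _ _ _ _ h2 h4 rfl).1
  have hincoming : ∀ c x z, (∃ hz : H.Adj (some x) z, (⟨(some x, z), hz⟩ : H.Dart) ∈ incoming (S c)) →
      ∃ y, z = some y ∧ Inner v₁ v₂ y ∧ hd c y = some x := by
    rintro c x z ⟨hz, h1⟩
    obtain ⟨y, h2, hy⟩ := htail c _ h1
    have h2 : z = some y := h2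
    subst h2
    exact ⟨y, rfl, (hiff c y _ hz.symm).1 h1⟩
  have hlists : ∀ x, ∃ I kR kB : List V, Inner v₁ v₂ x → RH.IsCyc (some x) (some (red x))
      (I.map some ++ some (blue x) :: (kR.map some ++ green x :: kB.map some)) ∧
      (∀ c, c ∈ I ↔ Inner v₁ v₂ c ∧ green c = some x) ∧
      ∀ c, c ∈ kB ↔ Inner v₁ v₂ c ∧ blue c = x := by
    intro x
    by_cases hx : Inner v₁ v₂ x
    swap
    · exact ⟨[], [], [], fun h => absurd h hx⟩
    obtain ⟨⟨⟨x', a⟩, hda⟩, h1, h2, h3⟩ := h.clockwise (some x) (by simpa using hx.1)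
      (by simpa using hx.2) (by simp)
    dsimp only at h2
    subst h2
    obtain rfl : some (red x) = a := (hred x hx).symm.trans ((hiff _ _ _ _).1 h1).2
    obtain ⟨t, ht⟩ := RH.exists_isCyc hda
    rw [ht.pattern_iff] at h3
    obtain ⟨l₀, r₁, e0, hl₀, l₁, r₂, e1, hl₁, l₂, r₃, e2, hl₂, l₃, r₄, e3, hl₃, l₄, r₅, e4, hl₄, l₅,
      r₆, e5, hl₅, e6⟩ := h3
    have e6 : r₆ = [] := e6
    subst e6 e5 e4 e3 e2 e1
    have hl : ∀ z (hz : H.Adj (some x) z), ∀ i, (⟨(some x, z), hz⟩ : H.Dart) ∈ P i →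
        z ∈ (![l₀, l₁, l₂, l₃, l₄, l₅] : Fin 6 → List (Option V)) i := by
      intro z hz i hi
      have hmemz : z ∈ l₀ ++ (l₁ ++ (l₂ ++ (l₃ ++ (l₄ ++ (l₅ ++ []))))) := by
        rw [← e0]; exact (ht.mem_iff z).2 hz
      simp only [List.mem_append, List.not_mem_nil, or_false] at hmemz
      rcases hmemz with h4 | h4 | h4 | h4 | h4 | h4
      · obtain ⟨h5, h6⟩ := hl₀ z h4; obtain rfl := hP i 0 _ hi h6; exact h4
      · obtain ⟨h5, h6⟩ := hl₁ z h4; obtain rfl := hP i 1 _ hi h6; exact h4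
      · obtain ⟨h5, h6⟩ := hl₂ z h4; obtain rfl := hP i 2 _ hi h6; exact h4
      · obtain ⟨h5, h6⟩ := hl₃ z h4; obtain rfl := hP i 3 _ hi h6; exact h4
      · obtain ⟨h5, h6⟩ := hl₄ z h4; obtain rfl := hP i 4 _ hi h6; exact h4
      · obtain ⟨h5, h6⟩ := hl₅ z h4; obtain rfl := hP i 5 _ hi h6; exact h4
    have hnd := ht.nodup
    rw [e0] at hnd
    simp only [List.nodup_append, List.append_nil] at hnd
    have q : ∀ c b, (∃ hb : H.Adj (some x) b, (⟨(some x, b), hb⟩ : H.Dart) ∈ S c) → b = hd c x := by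
      rintro c b ⟨hb, h4⟩
      exact ((hiff c x b hb).1 h4).2.symm
    have f0 : l₀ = [some (red x)] := eq_singleton_of_nodup hnd.1
      (fun b hb => (q 0 b (hl₀ b hb)).trans (hred x hx)) (hl _ hda 0 h1)
    have f2 : l₂ = [some (blue x)] := by
      rw [← hblue x hx]
      exact eq_singleton_of_nodup hnd.2.1.2.1.1 (fun b hb => q 1 b (hl₂ b hb))
        (hl _ (hhd 1 x hx) 2 (hmem 1 x hx))
    have f4 : l₄ = [green x] := eq_singleton_of_nodup hnd.2.1.2.1.2.1.2.1.1
      (fun b hb => q 2 b (hl₄ b hb)) (hl _ (hhd 2 x hx) 4 (hmem 2 x hx))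
    obtain ⟨I, rfl, hI⟩ := exists_map_some fun b hb => hincoming 2 x b (hl₁ b hb)
    obtain ⟨kR, rfl, hkR⟩ := exists_map_some fun b hb => hincoming 0 x b (hl₃ b hb)
    obtain ⟨kB, rfl, hkB⟩ := exists_map_some fun b hb => hincoming 1 x b (hl₅ b hb)
    rw [f0, f2, f4] at e0
    have hback : ∀ k c, Inner v₁ v₂ c → hd k c = some x → ∃ hz : H.Adj (some x) (some c),
        (⟨(some x, some c), hz⟩ : H.Dart) ∈ incoming (S k) := by
      intro k c hc h4
      have hz : H.Adj (some c) (some x) := h4 ▸ hhd k c hc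
      exact ⟨hz.symm, (hiff k c _ hz).2 ⟨hc, h4⟩⟩
    refine ⟨I, kR, kB, fun _ => ⟨?_, fun c => ⟨hI c, fun ⟨hc, h4⟩ => ?_⟩,
      fun c => ⟨fun hc => ?_, fun ⟨hc, h4⟩ => ?_⟩⟩⟩
    · have : t = I.map some ++ some (blue x) :: (kR.map some ++ green x :: kB.map some) := by
        simpa using e0
      rw [← this]; exact ht
    · obtain ⟨hz, h5⟩ := hback 2 c hc h4
      simpa using hl _ hz 1 h5
    · obtain ⟨h4, h5⟩ := hkB c hc
      exact ⟨h4, Option.some.inj ((hblue c h4).symm.trans h5)⟩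
    · obtain ⟨hz, h5⟩ := hback 1 c hc ((hblue c hc).trans (congrArg some h4))
      simpa using hl _ hz 5 h5
  choose I kR kB hlists using hlists
  have hcolour : ∀ u z (huz : H.Adj u z), s(u, z) ∈ innerEdges H (some v₁) (some v₂) none →
      ∃ c x, Inner v₁ v₂ x ∧ ((some x = u ∧ hd c x = z) ∨ (some x = z ∧ hd c x = u)) := by
    intro u z huz he
    obtain ⟨⟨c, ⟨⟨u', z'⟩, hd'⟩⟩, ⟨h1, h2⟩, -⟩ := h.orientation.2 _ he
    dsimp only at h2
    obtain ⟨x, h3, hx⟩ := htail c _ h2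
    have h3 : u' = some x := h3
    subst h3
    have h4 := (hiff c x z' hd').1 h2
    have h1 : s(some x, z') = s(u, z) := h1
    rcases Sym2.eq_iff.1 h1 with ⟨rfl, rfl⟩ | ⟨rfl, rfl⟩
    · exact ⟨c, x, hx, Or.inl ⟨rfl, h4.2⟩⟩
    · exact ⟨c, x, hx, Or.inr ⟨rfl, h4.2⟩⟩
  refine ⟨red, blue, green, I, kR, kB, ⟨fun x hx => (hlists x hx).1, fun x hx => (hlists x hx).2.1,
    fun x hx => (hlists x hx).2.2, ?_, ?_, ?_, ?_, ?_, ?_, ?_⟩,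
    ?_, ?_⟩
  · rintro x hx h1
    exact absurd (hhead 0 1 x (some v₂) hx (h1 ▸ hred x hx) h.at₂) (by decide)
  · rintro x hx h1
    exact absurd (hhead 1 0 x (some v₁) hx (h1 ▸ hblue x hx) h.at₁) (by decide)
  · rintro x hx h1
    exact absurd (hhead 2 0 x (some v₁) hx h1 h.at₁) (by decide)
  · rintro x hx h1
    exact absurd (hhead 2 1 x (some v₂) hx h1 h.at₂) (by decide)
  · intro x y hxy
    by_cases he : s(some x, some y) ∈ innerEdges H (some v₁) (some v₂) none
    · obtain ⟨c, z, hz, ⟨h1, h2⟩ | ⟨h1, h2⟩⟩ := hcolour _ _ hxy he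
      · obtain rfl := Option.some.inj h1
        fin_cases c
        · exact Or.inr (Or.inl (Or.inl ⟨hz, Option.some.inj ((hred z hz).symm.trans h2)⟩))
        · exact Or.inl (Or.inr (Or.inl ⟨hz, Option.some.inj ((hblue z hz).symm.trans h2)⟩))
        · exact Or.inr (Or.inr (Or.inl ⟨hz, h2⟩))
      · obtain rfl := Option.some.inj h1
        fin_cases c
        · exact Or.inl (Or.inl ⟨hz, Option.some.inj ((hred z hz).symm.trans h2)⟩)
        · exact Or.inr (Or.inl (Or.inr (Or.inl ⟨hz, Option.some.inj ((hblue z hz).symm.trans h2)⟩)))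
        · exact Or.inr (Or.inr (Or.inr ⟨hz, h2⟩))
    · have : s(some x, some y) ∈ ({s(some v₁, some v₂), s(some v₂, none), s(none, some v₁)} :
          Set (Sym2 (Option V))) := by
        by_contra h'; exact he ⟨hxy, h'⟩
      rcases this with h1 | h1 | h1 <;> rcases Sym2.eq_iff.1 h1 with ⟨h2, h3⟩ | ⟨h2, h3⟩
      · exact Or.inl (Or.inr (Or.inr ⟨Option.some.inj h2, Option.some.inj h3⟩))
      · exact Or.inr (Or.inl (Or.inr (Or.inr ⟨Option.some.inj h3, Option.some.inj h2⟩)))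
      · cases h3
      · cases h2
      · cases h2
      · cases h3
  · intro x hx0
    by_cases hx : Inner v₁ v₂ x
    · obtain ⟨c, z, hz, ⟨h1, h2⟩ | ⟨h1, h2⟩⟩ := hcolour _ _ hx0 (hin x _ hx hx0)
      · obtain rfl := Option.some.inj h1
        obtain rfl := hhead c 2 z none hz h2 h.atₙ
        exact Or.inr (Or.inr ⟨hz, h2⟩)
      · cases h1
    · unfold Inner at hx
      tauto
  · intro x y hx hxy
    have hg : H.Adj (some x) (some y) := hxy ▸ hhd 2 x hx
    have hgm : (⟨(some x, some y), hg⟩ : H.Dart) ∈ S 2 := (hiff 2 x _ hg).2 ⟨hx, hxy⟩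
    constructor
    · rintro (⟨h1, h2⟩ | ⟨h1, h2⟩ | ⟨rfl, rfl⟩)
      · have := (hiff 0 y _ hg.symm).2 ⟨h1, (hred y h1).trans (congrArg some h2)⟩
        exact absurd (huniq _ _ _ _ hgm this Sym2.eq_swap).1 (by decide)
      · have := (hiff 1 x _ hg).2 ⟨h1, (hblue x h1).trans (congrArg some h2)⟩
        exact absurd (huniq _ _ _ _ hgm this rfl).1 (by decide)
      · exact hx.1 rfl
    · rintro (⟨h1, h2⟩ | ⟨h1, h2⟩ | ⟨rfl, rfl⟩)
      · have := (hiff 0 x _ hg).2 ⟨h1, (hred x h1).trans (congrArg some h2)⟩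
        exact absurd (huniq _ _ _ _ hgm this rfl).1 (by decide)
      · have := (hiff 1 y _ hg.symm).2 ⟨h1, (hblue y h1).trans (congrArg some h2)⟩
        exact absurd (huniq _ _ _ _ hgm this Sym2.eq_swap).1 (by decide)
      · exact hx.2 rfl
  · rintro ⟨⟨u, z⟩, hd'⟩ h1
    obtain ⟨x, h2, hx⟩ := htail 2 _ h1
    have h2 : u = some x := h2
    subst h2
    exact ⟨x, hx, rfl, ((hiff 2 x z hd').1 h1).2.symm⟩
  · intro x hx _
    exact hmem 2 x hx

end RotationSystem

namespace RotationSystem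

variable {V : Type u} {G : SimpleGraph V} {R : RotationSystem G} {v₁ v₂ : V}

/-- An embedding of a graph on `V` that is inherited from one of a graph on `Option V`. -/
theorem isInherited_some_iff {H : SimpleGraph (Option V)} {RH : RotationSystem H} {f : G →g H}
    (hf : ∀ x, f x = some x) : R.IsInherited f RH ↔ ∀ x a, G.Adj x a →
      RH.NextIn {c | ∃ y, c = some y ∧ G.Adj x y} (some x) (some a) (some (R.nx x a)) := by
  have hmap : ∀ x a (h : G.Adj x a) (h' : H.Adj (some x) (some a)),
      f.mapDart ⟨(x, a), h⟩ = ⟨(some x, some a), h'⟩ := by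
    intro x a h h'
    exact SimpleGraph.Dart.ext _ _ (Prod.ext (hf x) (hf a))
  have hadj : ∀ x a, G.Adj x a → H.Adj (some x) (some a) := by
    intro x a h
    have := f.map_rel h
    rwa [hf, hf] at this
  have hset : ∀ x, {c | ∃ h : H.Adj (some x) c, (⟨(some x, c), h⟩ : H.Dart) ∈
      Set.range f.mapDart} = {c | ∃ y, c = some y ∧ G.Adj x y} := by
    intro x
    ext c
    constructor
    · rintro ⟨h, ⟨⟨x', y⟩, hd⟩, he⟩
      rw [hmap x' y hd (hadj _ _ hd)] at he
      have he := congrArg SimpleGraph.Dart.toProd he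
      simp only [Prod.mk.injEq, Option.some.injEq] at he
      obtain ⟨rfl, rfl⟩ := he
      exact ⟨y, rfl, hd⟩
    · rintro ⟨y, rfl, h⟩
      exact ⟨hadj _ _ h, ⟨(x, y), h⟩, hmap x y h _⟩
  have key : ∀ x a (h : G.Adj x a), RH.IsFirstClockwise (Set.range f.mapDart)
      (f.mapDart ⟨(x, a), h⟩) (f.mapDart (R.rot ⟨(x, a), h⟩)) ↔
      RH.NextIn {c | ∃ y, c = some y ∧ G.Adj x y} (some x) (some a) (some (R.nx x a)) := by
    intro x a h
    rw [R.rot_mk h, hmap x a h (hadj _ _ h), hmap x _ (R.adj_nx h) (hadj _ _ (R.adj_nx h)),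
      isFirstClockwise_iff, hset]
  constructor
  · intro h x a hxa
    exact (key x a hxa).1 (h ⟨(x, a), hxa⟩)
  · rintro h ⟨⟨x, a⟩, hxa⟩
    exact (key x a hxa).2 (h x a hxa)

/-- A relation holds around a closed path `c, a, I, b, e` if it holds at `a`, at `b` and inside `I`. -/
theorem chain3_closed {α : Type*} {K : α → α → Prop} {Q : α → α → α → Prop} {c b e : α} :
    ∀ {a : α} {I : List α}, List.IsChain K (a :: (I ++ [b])) → (∀ s, K a s → Q c a s) →
      (∀ p, K p b → Q p b e) → (∀ p g s, g ∈ I → K p g → K g s → Q p g s) →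
      Chain3 Q (c :: a :: (I ++ [b] ++ [e])) := by
  intro a I
  induction I generalizing a c with
  | nil =>
    intro h h1 h2 _
    have h := (List.isChain_cons_cons.1 h).1
    exact ⟨h1 _ h, h2 _ h, trivial⟩
  | cons g I ih =>
    intro h h1 h2 h3
    rw [List.cons_append, List.isChain_cons_cons] at h
    exact ⟨h1 _ h.1, ih h.2 (fun s hs => h3 a g s (by simp) h.1 hs) h2
      fun p g' s hg' => h3 p g' s (by simp [hg'])⟩

/-- In a triangulation, the triangle to the left of the edge from `u` to `w`. -/
theorem nx_of_triangle (R : RotationSystem G)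
    (htri : ∀ d, R.facePerm (R.facePerm (R.facePerm d)) = d) {u w a : V} (h : G.Adj u w)
    (ha : R.nx w u = a) : R.nx a w = u ∧ R.nx u a = w := by
  have hwa : G.Adj w a := ha ▸ R.adj_nx h.symm
  have h1 : R.facePerm ⟨(u, w), h⟩ = ⟨(w, a), hwa⟩ := by
    rw [facePerm_mk]; exact SimpleGraph.Dart.ext _ _ (Prod.ext rfl ha)
  have h2 := htri ⟨(u, w), h⟩
  rw [h1, facePerm_mk, facePerm_mk] at h2
  have h2 := congrArg SimpleGraph.Dart.toProd h2
  simp only [Prod.mk.injEq] at h2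
  obtain ⟨h3, h4⟩ := h2
  rw [h3] at h4
  exact ⟨h3, h4⟩

/-- The clockwise list of the neighbours of the third outer vertex. -/
theorem RealizerLists.exists_outer [Finite V] {H : SimpleGraph (Option V)} {RH : RotationSystem H}
    {red blue : V → V} {green : V → Option V} {I kR kB : V → List V}
    (h : RealizerLists H RH v₁ v₂ red blue green I kR kB) (h₁ : H.Adj none (some v₁))
    (h₂ : H.Adj none (some v₂)) (h₁₂ : v₁ ≠ v₂) (hnx : RH.nx none (some v₂) = some v₁) :
    ∃ J : List V, RH.IsCyc none (some v₁) (J.map some ++ [some v₂]) ∧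
      ∀ g, g ∈ J ↔ Inner v₁ v₂ g ∧ green g = none := by
  obtain ⟨t, ht⟩ := RH.exists_isCyc h₁
  have hv₂ : some v₂ ∈ t := by
    rcases List.mem_cons.1 ((ht.mem_iff _).2 h₂) with h3 | h3
    · exact absurd (Option.some.inj h3).symm h₁₂
    · exact h3
  obtain ⟨t', z, rfl⟩ : ∃ t' z, t = t' ++ [z] := by
    rcases List.eq_nil_or_concat t with rfl | ⟨t', z, rfl⟩
    · simp at hv₂
    · exact ⟨t', z, by simp⟩
  have hz : RH.nx none z = some v₁ := by
    have := ht.chain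
    rw [← List.cons_append, List.append_assoc] at this
    exact (List.isChain_cons_cons.1 (List.isChain_append.1 this).2.1).1
  obtain rfl : z = some v₂ := RH.nx_inj ((ht.mem_iff z).1 (by simp)) h₂ (hz.trans hnx.symm)
  have hnd := ht.nodup
  have hp : ∀ c ∈ t', ∃ y, c = some y ∧ (Inner v₁ v₂ y ∧ green y = none) := by
    intro c hc
    have hadj := (ht.mem_iff c).1 (by simp [hc])
    have hc1 : c ≠ some v₁ := by
      rintro rfl
      exact (List.nodup_cons.1 hnd).1 (by simp [hc])
    have hc2 : c ≠ some v₂ := by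
      rintro rfl
      exact (List.disjoint_of_nodup_append (List.nodup_cons.1 hnd).2) hc (by simp)
    rcases c with _ | y
    · exact absurd hadj (H.irrefl)
    · rcases h.adj_none y hadj.symm with rfl | rfl | h3
      · exact absurd rfl hc1
      · exact absurd rfl hc2
      · exact ⟨y, rfl, h3⟩
  obtain ⟨J, rfl, hJ⟩ := exists_map_some hp
  refine ⟨J, ht, fun g => ⟨hJ g, ?_⟩⟩
  rintro ⟨hg, hg'⟩
  have hadj : H.Adj (some g) (green g) := ((h.isCyc g hg).mem_iff _).1 (by simp)
  rw [hg'] at hadj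
  have := (ht.mem_iff (some g)).2 hadj.symm
  simpa [hg.1, hg.2] using this

/-- A graph with three outgoing edges at each vertex that is not on the outer triangle has as many
edges as a triangulation. -/
theorem card_edges_of_orientation [Finite V] {S : Fin 3 → Set G.Dart} {v₃ : V} (h₁₂ : G.Adj v₁ v₂)
    (h₂₃ : G.Adj v₂ v₃) (h₃₁ : G.Adj v₃ v₁)
    (horient : IsColoredOrientation (innerEdges G v₁ v₂ v₃) S)
    (hout : ∀ x, x ≠ v₁ → x ≠ v₂ → x ≠ v₃ → ∀ c, ∃! d : G.Dart, d.fst = x ∧ d ∈ S c)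
    (htail : ∀ c, ∀ d ∈ S c, d.fst ≠ v₁ ∧ d.fst ≠ v₂ ∧ d.fst ≠ v₃) :
    Nat.card G.edgeSet + 6 = 3 * Nat.card V := by
  have hE := ncard_of_isColoredOrientation horient ({v₁, v₂, v₃}ᶜ)
    (fun x hx c => hout x (fun h3 => hx (by simp [h3])) (fun h3 => hx (by simp [h3]))
      (fun h3 => hx (by simp [h3])) c) (by
    rintro c d hd (h3 | h3 | h3)
    · exact (htail c d hd).1 h3
    · exact (htail c d hd).2.1 h3
    · exact (htail c d hd).2.2 h3)
  have h3 : ({v₁, v₂, v₃} : Set V).ncard = 3 := by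
    rw [Set.ncard_eq_three]
    exact ⟨_, _, _, h₁₂.ne, h₃₁.ne', h₂₃.ne, rfl⟩
  have h4 : ({s(v₁, v₂), s(v₂, v₃), s(v₃, v₁)} : Set (Sym2 V)).ncard = 3 := by
    rw [Set.ncard_eq_three]
    refine ⟨_, _, _, ?_, ?_, ?_, rfl⟩ <;>
      simp [h₁₂.ne, h₂₃.ne, h₃₁.ne, h₁₂.ne', h₃₁.ne']
  have h5 : ({s(v₁, v₂), s(v₂, v₃), s(v₃, v₁)} : Set (Sym2 V)) ⊆ G.edgeSet := by
    rintro e (rfl | rfl | rfl)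
    · exact h₁₂
    · exact h₂₃
    · exact h₃₁
  have h6 := Set.ncard_sdiff_add_ncard_of_subset h5
  have h7 := Set.ncard_compl_add_ncard ({v₁, v₂, v₃} : Set V)
  have hE : (G.edgeSet \ {s(v₁, v₂), s(v₂, v₃), s(v₃, v₁)}).ncard =
    ({v₁, v₂, v₃}ᶜ : Set V).ncard * Nat.card (Fin 3) := hE
  rw [Nat.card_fin] at hE
  rw [Nat.card_coe_set_eq]
  omega

theorem exists_two_neighbours {v₃ : V} (h₁₂ : G.Adj v₁ v₂) (h₂₃ : G.Adj v₂ v₃) (h₃₁ : G.Adj v₃ v₁)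
    {S : Fin 3 → Set G.Dart} (horient : IsColoredOrientation (innerEdges G v₁ v₂ v₃) S)
    (hout : ∀ x, x ≠ v₁ → x ≠ v₂ → x ≠ v₃ → ∀ c, ∃! d : G.Dart, d.fst = x ∧ d ∈ S c) (x : V) :
    ∃ a b, a ≠ b ∧ G.Adj x a ∧ G.Adj x b := by
  by_cases hx₁ : x = v₁
  · subst hx₁
    exact ⟨_, _, h₂₃.ne, h₁₂, h₃₁.symm⟩
  by_cases hx₂ : x = v₂
  · subst hx₂
    exact ⟨_, _, h₃₁.ne', h₁₂.symm, h₂₃⟩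
  by_cases hx₃ : x = v₃
  · subst hx₃
    exact ⟨_, _, h₁₂.ne, h₃₁, h₂₃.symm⟩
  obtain ⟨⟨⟨a, b⟩, hd⟩, ⟨h1, h2⟩, -⟩ := hout x hx₁ hx₂ hx₃ 0
  obtain ⟨⟨⟨a', b'⟩, hd'⟩, ⟨h1', h2'⟩, -⟩ := hout x hx₁ hx₂ hx₃ 1
  dsimp only at h1 h1'
  subst h1' h1
  refine ⟨b, b', ?_, hd, hd'⟩
  rintro rfl
  have := (horient.2 s(a, b) (horient.1 0 _ h2)).unique (y₁ := (0, ⟨(a, b), hd⟩))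
    (y₂ := (1, ⟨(a, b), hd⟩)) ⟨rfl, h2⟩ ⟨rfl, h2'⟩
  exact absurd (congrArg Prod.fst this) (by simp)

/-- The graph of a Schnyder realizer is connected and all its faces are triangles. -/
theorem _root_.IsSchnyderRealizer.triangulation [Finite V] {v₃ : V} {S : Fin 3 → Set G.Dart}
    (h : IsSchnyderRealizer R v₁ v₂ v₃ S) :
    G.Connected ∧ ∀ d, R.facePerm (R.facePerm (R.facePerm d)) = d := by
  obtain ⟨h₁₂, h₂₃, h₃₁, -⟩ := h.outer
  have := Nonempty.intro v₁
  refine (card_edges_le R h.planar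
    (exists_two_neighbours h₁₂ h₂₃ h₃₁ h.orientation h.outgoing)).2 ?_
  have huniq : ∀ c c' d, d ∈ S c → d.symm ∉ S c' := by
    intro c c' d hd hd'
    have := (h.orientation.2 d.edge (h.orientation.1 c d hd)).unique (y₁ := (c, d))
      (y₂ := (c', d.symm)) ⟨rfl, hd⟩ ⟨by simp, hd'⟩
    exact d.symm_ne (congrArg Prod.snd this).symm
  refine (card_edges_of_orientation h₁₂ h₂₃ h₃₁ h.orientation h.outgoing fun c d hd => ?_).ge
  have hin : d.symm.edge ∈ innerEdges G v₁ v₂ v₃ := by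
    rw [SimpleGraph.Dart.edge_symm]; exact h.orientation.1 c d hd
  exact ⟨fun h3 => huniq _ _ _ hd (h.at₁ d.symm hin h3),
    fun h3 => huniq _ _ _ hd (h.at₂ d.symm hin h3), fun h3 => huniq _ _ _ hd (h.atₙ d.symm hin h3)⟩

end RotationSystem

namespace RotationSystem

variable {V : Type u} {G : SimpleGraph V} {R : RotationSystem G} {v₁ v₂ : V}

/-- The incoming green edges at `w` together with `red w` and `blue w` list the facial path of `w` in the
graph without the green edges: as all faces of `H` are triangles, consecutive ones are adjacent. -/
theorem FacialPaths.of_realizerLists {H : SimpleGraph (Option V)} {RH : RotationSystem H}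
    {red blue : V → V} {green : V → Option V} {J : List V} {I kR kB : V → List V}
    (hl : RealizerLists H RH v₁ v₂ red blue green I kR kB)
    (hJ : RH.IsCyc none (some v₁) (J.map some ++ [some v₂]))
    (hJ' : ∀ g, g ∈ J ↔ Inner v₁ v₂ g ∧ green g = none) (hne : v₁ ≠ v₂)
    (hconn : H.Connected) (htri : ∀ d, RH.facePerm (RH.facePerm (RH.facePerm d)) = d)
    (hG : ∀ x y, G.Adj x y ↔ H.Adj (some x) (some y) ∧
      (Up v₁ v₂ red blue x y ∨ Up v₁ v₂ red blue y x))
    (hbase : G.Adj v₁ v₂) (hb1 : RH.nx (some v₁) none = some v₂)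
    (hb2 : RH.nx (some v₂) (some v₁) = none)
    (hR : ∀ x a, G.Adj x a →
      RH.NextIn {c | ∃ y, c = some y ∧ G.Adj x y} (some x) (some a) (some (R.nx x a))) :
    FacialPaths R v₁ v₂ red blue (fun w => w.elim J I) := by
  have hnx : ∀ x a b, G.Adj x a →
      RH.NextIn {c | ∃ y, c = some y ∧ G.Adj x y} (some x) (some a) (some b) → R.nx x a = b :=
    fun x a b ha h => Option.some.inj ((hR x a ha).unique h)
  have hnx' : ∀ x a b, G.Adj x a → G.Adj x b → RH.nx (some x) (some a) = some b → R.nx x a = b :=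
    fun x a b ha hb h => hnx x a b ha (nextIn_of_nx h ⟨b, rfl, hb⟩)
  have hgreen : ∀ x, Inner v₁ v₂ x → H.Adj (some x) (green x) := fun x hx =>
    ((hl.isCyc x hx).mem_iff _).1 (by simp)
  have hgreen' : ∀ x, Inner v₁ v₂ x → ∀ y, green x = some y → Inner v₁ v₂ y := by
    intro x hx y hy
    exact ⟨fun h => hl.green_ne₁ x hx (h ▸ hy), fun h => hl.green_ne₂ x hx (h ▸ hy)⟩
  have hngreen : ∀ x y, Inner v₁ v₂ x → green x = some y → ¬ G.Adj x y := by
    intro x y hx hy h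
    rcases ((hG x y).1 h).2 with h1 | h1
    · exact (hl.exclusive x y hx hy).1 h1
    · exact (hl.exclusive x y hx hy).2 h1
  have hred : ∀ x, Inner v₁ v₂ x → G.Adj x (red x) := fun x hx =>
    (hG _ _).2 ⟨((hl.isCyc x hx).mem_iff _).1 (by simp), Or.inr (Or.inl ⟨hx, rfl⟩)⟩
  have hblue : ∀ x, Inner v₁ v₂ x → G.Adj x (blue x) := fun x hx =>
    (hG _ _).2 ⟨((hl.isCyc x hx).mem_iff _).1 (by simp), Or.inl (Or.inr (Or.inl ⟨hx, rfl⟩))⟩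
  have hUp : ∀ x y, Up v₁ v₂ red blue x y → G.Adj x y := by
    rintro x y (⟨h1, rfl⟩ | ⟨h1, rfl⟩ | ⟨rfl, rfl⟩)
    · exact (hred y h1).symm
    · exact hblue x h1
    · exact hbase
  have hmemI : ∀ w, Apex v₁ v₂ w → ∀ g, g ∈ (w.elim J I : List V) ↔
      Inner v₁ v₂ g ∧ green g = w := by
    rintro (_ | w) hw g
    · exact hJ' g
    · exact hl.mem_I w (hw w rfl) g
  -- consecutive vertices of the path of `w` are consecutive around `w`
  have hwchain : ∀ w, Apex v₁ v₂ w → List.IsChain (fun b c => RH.nx w (some b) = some c)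
      (path v₁ v₂ red blue (fun w => w.elim J I) w) ∧
      ∀ b ∈ path v₁ v₂ red blue (fun w => w.elim J I) w, H.Adj w (some b) := by
    rintro (_ | w) hw
    · constructor
      · have h1 := hJ.chain
        have h2 : List.IsChain (fun b c => RH.nx none b = c)
            ((path v₁ v₂ red blue (fun w => w.elim J I) none).map some) := by
          have h3 := List.IsChain.left_of_append h1
          simpa [path] using h3
        exact (List.isChain_map _).1 h2
      · intro b hb
        refine (hJ.mem_iff _).1 ?_
        simpa [path] using hb
    · have hc := hl.isCyc w (hw w rfl)
      constructor
      · have h1 := hc.chain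
        have h2 : List.IsChain (fun b c => RH.nx (some w) b = c)
            ((path v₁ v₂ red blue (fun w => w.elim J I) (some w)).map some) := by
          have h3 : some (red w) :: ((I w).map some ++ some (blue w) :: ((kR w).map some ++
              green w :: (kB w).map some)) ++ [some (red w)] =
              (path v₁ v₂ red blue (fun w => w.elim J I) (some w)).map some ++
                ((kR w).map some ++ green w :: (kB w).map some ++ [some (red w)]) := by
            simp [path]
          rw [h3] at h1
          exact h1.left_of_append
        exact (List.isChain_map _).1 h2
      · intro b hb
        refine (hc.mem_iff _).1 ?_
        simp only [path, Option.elim_some, List.mem_cons, List.mem_append, List.not_mem_nil,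
          or_false] at hb
        rcases hb with (rfl | hb) | rfl
        · simp
        · simp [hb]
        · simp
  have hK : ∀ w, Apex v₁ v₂ w → List.IsChain (fun p q => RH.nx (some q) w = some p ∧
      RH.nx (some p) (some q) = w ∧ Up v₁ v₂ red blue p q)
      (path v₁ v₂ red blue (fun w => w.elim J I) w) := by
    intro w hw
    obtain ⟨h1, h2⟩ := hwchain w hw
    obtain ⟨a, I', hpath, hI'⟩ : ∃ a I', path v₁ v₂ red blue (fun w => w.elim J I) w = a :: I' ∧
        ∀ q ∈ I', Inner v₁ v₂ q ∧ (green q = w ∨ ∃ w', w = some w' ∧ w' ∈ kB q) ∨ q = v₂ := by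
      rcases w with _ | w
      · refine ⟨v₁, J ++ [v₂], rfl, fun q hq => ?_⟩
        rcases List.mem_append.1 hq with hq | hq
        · have := (hJ' q).1 hq
          exact Or.inl ⟨this.1, Or.inl this.2⟩
        · exact Or.inr (List.mem_singleton.1 hq)
      · refine ⟨red w, I w ++ [blue w], rfl, fun q hq => ?_⟩
        rcases List.mem_append.1 hq with hq | hq
        · have := (hl.mem_I w (hw w rfl) q).1 hq
          exact Or.inl ⟨this.1, Or.inl this.2⟩
        · obtain rfl := List.mem_singleton.1 hq
          by_cases hq₂ : blue w = v₂
          · exact Or.inr hq₂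
          · have hin : Inner v₁ v₂ (blue w) := ⟨hl.blue_ne w (hw w rfl), hq₂⟩
            exact Or.inl ⟨hin, Or.inr ⟨w, rfl, (hl.mem_kB _ hin w).2 ⟨hw w rfl, rfl⟩⟩⟩
    rw [hpath] at h1 h2 ⊢
    have h3 : List.IsChain (fun p q => RH.nx w (some p) = some q ∧ H.Adj w (some p) ∧ q ∈ I')
        (a :: I') := by
      have h4 : List.IsChain (fun p q => p ∈ a :: I' ∧ q ∈ I') (a :: I') := by
        rw [List.isChain_iff_getElem]
        intro i hi
        refine ⟨List.getElem_mem _, ?_⟩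
        rw [List.getElem_cons_succ]
        exact List.getElem_mem _
      rw [List.isChain_iff_getElem] at h1 h4 ⊢
      exact fun i hi => ⟨h1 i hi, h2 _ (h4 i hi).1, (h4 i hi).2⟩
    refine h3.imp ?_
    rintro p q ⟨h4, h5, h6⟩
    obtain ⟨h7, h8⟩ := RH.nx_of_triangle htri h5.symm h4
    refine ⟨h7, h8, ?_⟩
    have h9 : H.Adj w (some q) := h4 ▸ RH.adj_nx h5
    rcases hI' q h6 with ⟨hq, h10⟩ | rfl
    · have hc := hl.isCyc q hq
      have hch : List.IsChain (fun b c => RH.nx (some q) b = c)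
          (green q :: (kB q).map some ++ [some (red q)]) := by
        have h11 := hc.chain
        have h12 : some (red q) :: ((I q).map some ++ some (blue q) :: ((kR q).map some ++
            green q :: (kB q).map some)) ++ [some (red q)] =
            (some (red q) :: ((I q).map some ++ some (blue q) :: (kR q).map some)) ++
              (green q :: (kB q).map some ++ [some (red q)]) := by simp
        rw [h12] at h11
        exact h11.right_of_append
      have hwm : w ∈ green q :: (kB q).map some := by
        rcases h10 with rfl | ⟨w', rfl, h10⟩
        · simp
        · simp [h10]
      have := hch.next_mem w hwm
      rw [h7] at this
      rcases List.mem_append.1 this with h11 | h11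
      · obtain ⟨p', h12, h13⟩ := List.mem_map.1 h11
        obtain rfl := Option.some.inj h13
        exact Or.inr (Or.inl ((hl.mem_kB q hq _).1 h12))
      · obtain rfl := Option.some.inj (List.mem_singleton.1 h11)
        exact Or.inl ⟨hq, rfl⟩
    · have h10 : H.Adj (some p) (some q) := (h7 ▸ RH.adj_nx h9.symm).symm
      rcases hl.adj_cases p q h10 with h11 | (⟨h11, h12⟩ | ⟨h11, -⟩ | ⟨h11, -⟩) | ⟨h11, h12⟩ | ⟨h11, -⟩
      · exact h11
      · exact absurd h12 (hl.red_ne p h11)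
      · exact absurd rfl h11.2
      · exact absurd h11.symm hne
      · exact absurd h12 (hl.green_ne₂ p h11)
      · exact absurd rfl h11.2
  have hup : ∀ w, Apex v₁ v₂ w → List.IsChain (Up v₁ v₂ red blue)
      (path v₁ v₂ red blue (fun w => w.elim J I) w) :=
    fun w hw => (hK w hw).imp fun _ _ h => h.2.2
  have hmid : ∀ w, Apex v₁ v₂ w → ∀ p g s, Inner v₁ v₂ g → green g = w →
      (RH.nx (some g) w = some p ∧ RH.nx (some p) (some g) = w ∧ Up v₁ v₂ red blue p g) →
      (RH.nx (some s) w = some g ∧ RH.nx (some g) (some s) = w ∧ Up v₁ v₂ red blue g s) →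
      R.nx g s = p := by
    rintro w hw p g s hg rfl ⟨h1, h2, h3⟩ ⟨h4, h5, h6⟩
    refine hnx g s p (hUp _ _ h6) (nextIn_of_isChain (l := [green g]) ?_ ?_
      ⟨p, rfl, (hUp _ _ h3).symm⟩)
    · exact List.isChain_cons_cons.2 ⟨h5, List.isChain_cons_cons.2 ⟨h1, List.isChain_singleton _⟩⟩
    · intro c hc
      rw [List.mem_singleton] at hc
      rintro ⟨y, h7, h8⟩
      exact hngreen g y hg (hc.symm.trans h7) h8
  refine ⟨hbase, hred, hblue, ?_, hup, ?_, ?_, ?_, ?_, ?_, ?_⟩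
  · intro x hx
    refine hnx _ _ _ (hred x hx) (nextIn_of_isChain (l := (I x).map some) ?_ ?_
      ⟨_, rfl, hblue x hx⟩)
    · have h1 := (hwchain (some x) (fun y hy => Option.some.inj hy ▸ hx)).1
      have h2 := (List.isChain_map (R := fun b c => RH.nx (some x) b = c) some).2 h1
      simpa [path] using h2
    · intro c hc
      obtain ⟨g, hg, rfl⟩ := List.mem_map.1 hc
      rintro ⟨y, h1, h2⟩
      obtain rfl := Option.some.inj h1
      obtain ⟨h3, h4⟩ := (hl.mem_I x hx _).1 hg
      exact hngreen _ _ h3 h4 h2.symm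
  · rintro (_ | w) hw
    · have h1 := hK none hw
      refine chain3_closed (c := v₂) (b := v₂) (e := v₁) h1 ?_ ?_ ?_
      · rintro s ⟨h2, h3, h4⟩
        refine hnx v₁ s v₂ (hUp _ _ h4) (nextIn_of_isChain (l := [none]) ?_ ?_ ⟨v₂, rfl, hbase⟩)
        · exact List.isChain_cons_cons.2
            ⟨h3, List.isChain_cons_cons.2 ⟨hb1, List.isChain_singleton _⟩⟩
        · intro c hc
          rw [List.mem_singleton] at hc
          rintro ⟨y, h7, -⟩
          cases hc.symm.trans h7
      · rintro p ⟨h2, h3, h4⟩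
        refine hnx v₂ v₁ p hbase.symm (nextIn_of_isChain (l := [none]) ?_ ?_
          ⟨p, rfl, (hUp _ _ h4).symm⟩)
        · exact List.isChain_cons_cons.2
            ⟨hb2, List.isChain_cons_cons.2 ⟨h2, List.isChain_singleton _⟩⟩
        · intro c hc
          rw [List.mem_singleton] at hc
          rintro ⟨y, h7, -⟩
          cases hc.symm.trans h7
      · intro p g s hg
        have := (hJ' g).1 hg
        exact hmid none hw p g s this.1 this.2
    · have h1 := hK (some w) hw
      have hw' := hw w rfl
      refine chain3_closed (c := w) (b := blue w) (e := w) h1 ?_ ?_ ?_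
      · rintro s ⟨h2, h3, h4⟩
        exact hnx' _ _ _ (hUp _ _ h4) (hred w hw').symm h3
      · rintro p ⟨h2, h3, h4⟩
        exact hnx' _ _ _ (hblue w hw').symm (hUp _ _ h4).symm h2
      · intro p g s hg
        have := (hl.mem_I w hw' g).1 hg
        exact hmid (some w) hw p g s this.1 this.2
  · intro w hw g hg
    exact ((hmemI w hw g).1 hg).1
  · intro g hg
    have hw : Apex v₁ v₂ (green g) := fun x hx => hgreen' g hg x hx
    exact ⟨green g, hw, (hmemI _ hw g).2 ⟨hg, rfl⟩⟩
  · intro w w' hw hw' g hg hg'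
    exact ((hmemI w hw g).1 hg).2.symm.trans ((hmemI w' hw' g).1 hg').2
  · rintro (_ | w) hw
    · have := (List.nodup_cons.1 hJ.nodup).2
      exact (List.Nodup.of_append_left this).of_map
    · have := (List.nodup_cons.1 (hl.isCyc w (hw w rfl)).nodup).2
      exact (List.Nodup.of_append_left this).of_map
  · intro Y hin hadj happ
    by_contra hY
    obtain ⟨z, hz⟩ := Set.nonempty_iff_ne_empty.2 hY
    have hstep : ∀ u u', H.Adj u u' → (∃ y ∈ Y, u = some y) → ∃ y ∈ Y, u' = some y := by
      rintro u u' huu ⟨y, hy, rfl⟩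
      have hy' := hin y hy
      rcases u' with _ | y'
      · exfalso
        rcases hl.adj_none y huu with rfl | rfl | ⟨-, h1⟩
        · exact hy'.1 rfl
        · exact hy'.2 rfl
        · have h2 := (hup none (by rintro x ⟨⟩)).imp fun _ _ h => hUp _ _ h
          have h3 := List.IsChain.induction (· ∉ Y) _ h2
            (fun {x y} hxy hx hy => hx (hadj y hy x hxy.symm))
            (fun hne => fun h => (hin _ h).1 rfl) y (by
              have := (hJ' y).2 ⟨hy', h1⟩
              simp [path, this])
          exact h3 hy
      · rcases hl.adj_cases y y' huu with h1 | h1 | ⟨-, h1⟩ | ⟨h1, h2⟩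
        · exact ⟨y', hadj y hy y' (hUp _ _ h1), rfl⟩
        · exact ⟨y', hadj y hy y' (hUp _ _ h1).symm, rfl⟩
        · have h3 := hgreen' y hy' y' h1
          exact ⟨y', (happ y' h3 y ((hl.mem_I y' h3 y).2 ⟨hy', h1⟩)).1 hy, rfl⟩
        · exact ⟨y', (happ y hy' y' ((hl.mem_I y hy' y').2 ⟨h1, h2⟩)).2 hy, rfl⟩
    obtain ⟨W⟩ := hconn.preconnected (some z) (some v₁)
    have : ∀ a b (W : H.Walk a b), (∃ y ∈ Y, a = some y) → ∃ y ∈ Y, b = some y := by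
      intro a b W
      induction W with
      | nil => exact id
      | cons h _ ih => exact fun h' => ih (hstep _ _ h h')
    obtain ⟨y, hy, h1⟩ := this _ _ W ⟨z, hz, rfl⟩
    obtain rfl := Option.some.inj h1
    exact (hin _ hy).1 rfl

theorem _root_.IsSchnyderMinusGreen.exists_facialPaths [Finite V]
    (h : IsSchnyderMinusGreen R v₁ v₂) : ∃ red blue I, FacialPaths R v₁ v₂ red blue I := by
  obtain ⟨H, RH, S, hS, hG, f, hf, hR⟩ := h
  obtain ⟨red, blue, green, I, kR, kB, hl, hS2, hS2'⟩ := hS.exists_lists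
  obtain ⟨hconn, htri⟩ := hS.triangulation
  obtain ⟨h₁₂, h₂ₙ, hₙ₁, hφ₁, hφ₂, hφ₃⟩ := hS.outer
  have hne : v₁ ≠ v₂ := fun he => h₁₂.ne (congrArg some he)
  have hnext : ∀ {a b c : Option V} (hab : H.Adj a b) (hbc : H.Adj b c),
      RH.facePerm ⟨(a, b), hab⟩ = ⟨(b, c), hbc⟩ → RH.nx b a = c := by
    intro a b c hab hbc h
    rw [facePerm_mk] at h
    exact congrArg (fun d : H.Dart => d.snd) h
  obtain ⟨J, hJ, hJ'⟩ := hl.exists_outer hₙ₁ h₂ₙ.symm hne (hnext _ _ hφ₂)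
  have hG' : ∀ x y, G.Adj x y ↔ H.Adj (some x) (some y) ∧
      (Up v₁ v₂ red blue x y ∨ Up v₁ v₂ red blue y x) := by
    intro x y
    rw [hG]
    refine and_congr_right fun hxy => ⟨fun h1 => ?_, fun h1 d hd he => ?_⟩
    · rcases hl.adj_cases x y hxy with h2 | h2 | ⟨h2, h3⟩ | ⟨h2, h3⟩
      · exact Or.inl h2
      · exact Or.inr h2
      · have hadj : H.Adj (some x) (green x) := h3 ▸ hxy
        exact absurd (by rw [← h3]; rfl) (h1 _ (hS2' x h2 hadj))
      · have hadj : H.Adj (some y) (green y) := h3 ▸ hxy.symm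
        exact absurd (by rw [← h3]; exact Sym2.eq_swap) (h1 _ (hS2' y h2 hadj))
    · obtain ⟨z, hz, h2, h3⟩ := hS2 d hd
      have h4 : d.edge = s(some z, green z) := by
        rw [← h2, ← h3]; rfl
      rw [h4] at he
      rcases Sym2.eq_iff.1 he with ⟨h5, h6⟩ | ⟨h5, h6⟩
      · obtain rfl := Option.some.inj h5
        rcases h1 with h1 | h1
        · exact (hl.exclusive _ _ hz h6).1 h1
        · exact (hl.exclusive _ _ hz h6).2 h1
      · obtain rfl := Option.some.inj h5
        rcases h1 with h1 | h1
        · exact (hl.exclusive _ _ hz h6).2 h1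
        · exact (hl.exclusive _ _ hz h6).1 h1
  exact ⟨red, blue, _, FacialPaths.of_realizerLists hl hJ hJ' hne hconn htri hG'
    ((hG' _ _).2 ⟨h₁₂, Or.inl (Or.inr (Or.inr ⟨rfl, rfl⟩))⟩) (hnext _ _ hφ₃) (hnext _ _ hφ₁)
    ((isInherited_some_iff hf).1 hR)⟩

end RotationSystem

/-! ### The Schnyder realizer of an edge labeling -/

section Lists

variable {α β : Type*}

/-- If the list `l` of iterates of `f` is left at `s`, then `s` is its last element. -/
theorem List.IsChain.exists_eq_append {f : α → α} {s : α} : ∀ {l r : List α}, r ≠ [] →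
    List.IsChain (fun b c => f b = c) (l ++ r) → s ∈ l → f s ∉ l →
    ∃ l' r', l = l' ++ [s] ∧ r = f s :: r'
  | [], _, _, _, hs, _ => by simp at hs
  | [b], [], hr, _, _, _ => absurd rfl hr
  | [b], c :: r, _, h, hs, _ => by
    obtain rfl := List.mem_singleton.1 hs
    exact ⟨[], r, rfl, by rw [(List.isChain_cons_cons.1 h).1]⟩
  | b :: c :: l, r, hr, h, hs, hfs => by
    have h : List.IsChain (fun b c => f b = c) (b :: c :: (l ++ r)) := h
    rw [List.isChain_cons_cons] at h
    rcases List.mem_cons.1 hs with rfl | hs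
    · exact absurd (by simp [h.1]) hfs
    · obtain ⟨l', r', h1, h2⟩ := List.IsChain.exists_eq_append (l := c :: l) hr h.2 hs
        (fun h' => hfs (List.mem_cons_of_mem _ h'))
      exact ⟨b :: l', r', by rw [h1]; rfl, h2⟩

theorem List.IsChain.forall_next {r : α → α → Prop} {f : α → α} {z : α} : ∀ {l : List α},
    List.IsChain (fun b c => f b = c) (l ++ [z]) → List.IsChain r (l ++ [z]) →
    ∀ b ∈ l, r b (f b)
  | [], _, _, b, hb => by simp at hb
  | [a], h, h', b, hb => by
    obtain rfl := List.mem_singleton.1 hb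
    rw [(List.isChain_cons_cons.1 h).1]
    exact (List.isChain_cons_cons.1 h').1
  | a :: c :: l, h, h', b, hb => by
    have h := List.isChain_cons_cons.1 (show List.IsChain _ (a :: c :: (l ++ [z])) from h)
    have h' := List.isChain_cons_cons.1 (show List.IsChain _ (a :: c :: (l ++ [z])) from h')
    rcases List.mem_cons.1 hb with rfl | hb
    · rw [h.1]; exact h'.1
    · exact List.IsChain.forall_next (l := c :: l) h.2 h'.2 b hb

theorem List.IsChain.exists_prev {r : α → α → Prop} {c : α} : ∀ {a : α} {l : List α},
    List.IsChain r (a :: l) → c ∈ l → ∃ b ∈ a :: l, r b c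
  | _, [], _, hc => by simp at hc
  | a, b :: l, h, hc => by
    rw [List.isChain_cons_cons] at h
    rcases List.mem_cons.1 hc with rfl | hc
    · exact ⟨a, by simp, h.1⟩
    · obtain ⟨b', hb', h'⟩ := h.2.exists_prev hc
      exact ⟨b', List.mem_cons_of_mem _ hb', h'⟩

theorem List.mem_of_cons_append_eq {a b g : α} {I l r : List α}
    (h : a :: (I ++ [b]) = l ++ g :: r) (hl : l ≠ []) (hr : r ≠ []) : g ∈ I := by
  obtain ⟨a', l, rfl⟩ := List.exists_cons_of_ne_nil hl
  obtain ⟨r, b', rfl⟩ : ∃ r' b', r = r' ++ [b'] :=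
    ⟨_, _, (List.dropLast_append_getLast hr).symm⟩
  have h1 : I ++ [b] = (l ++ g :: r) ++ [b'] := by
    simpa using (List.cons.inj h).2
  rw [(List.append_inj' h1 rfl).1]
  simp

end Lists

namespace RotationSystem

variable {V : Type u} {G : SimpleGraph V} {R : RotationSystem G} {v₁ v₂ : V}

/-- A rotation system with prescribed clockwise lists of neighbours. -/
theorem exists_rotationSystem [Finite V] (p : V → V → List V → Prop)
    (h : ∀ u, ∃ a t, p u a t ∧ (a :: t).Nodup ∧ ∀ b, b ∈ a :: t ↔ G.Adj u b) :
    ∃ R : RotationSystem G, ∀ u, ∃ a t, p u a t ∧ R.IsCyc u a t := by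
  classical
  choose a t hp hn hm using h
  let σ : V → Equiv.Perm V := fun u => (a u :: t u).formPerm
  have hadj : ∀ u b, G.Adj u b → G.Adj u (σ u b) := by
    intro u b hb
    rw [← hm] at hb ⊢
    exact List.formPerm_apply_mem_of_mem hb
  have htr : ∀ u b c, G.Adj u b → G.Adj u c → ∃ k, (σ u)^[k] b = c := by
    intro u b c hb hc
    obtain ⟨k, -, -, hk⟩ := ((List.Nodup.isCycleOn_formPerm (hn u)).2 ((hm u b).2 hb)
      ((hm u c).2 hc)).exists_pow_eq''
    exact ⟨k, by rw [← hk, Equiv.Perm.iterate_eq_pow]⟩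
  refine ⟨ofNx (fun u => σ u) hadj (fun u b c _ _ h => (σ u).injective h) htr, fun u =>
    ⟨a u, t u, hp u, hn u, hm u, ?_⟩⟩
  rw [List.isChain_iff_getElem]
  intro i hi
  have hi' : i < (a u :: t u).length := by simp at hi ⊢; omega
  have h1 : (a u :: t u ++ [a u])[i] = (a u :: t u)[i] := List.getElem_append_left hi'
  have h2 : G.Adj u (a u :: t u)[i] := (hm u _).1 (List.getElem_mem _)
  rw [h1, nx_ofNx _ _ _ _ h2]
  refine (List.formPerm_apply_getElem _ (hn u) i hi').trans ?_
  rcases Nat.lt_or_ge (i + 1) (a u :: t u).length with h3 | h3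
  · rw [List.getElem_append_left h3]
    congr 1
    exact Nat.mod_eq_of_lt h3
  · have h4 : i + 1 = (a u :: t u).length := by omega
    simp only [h4, Nat.mod_self]
    simp

theorem isChain_nextIn {A : Set V} {x : V} {l : List V} (h : List.IsChain (fun b c => R.nx x b = c) l)
    (hl : ∀ c ∈ l, c ∈ A) : List.IsChain (R.NextIn A x) l := by
  induction l with
  | nil => exact List.isChain_nil
  | cons a l ih =>
    cases l with
    | nil => exact List.isChain_singleton _
    | cons b l =>
      rw [List.isChain_cons_cons] at h ⊢
      exact ⟨nextIn_of_nx h.1 (hl b (by simp)), ih h.2 fun c hc => hl c (List.mem_cons_of_mem _ hc)⟩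

/-- One neighbour that is not in `A` may be skipped. -/
theorem isChain_nextIn_append {A : Set V} {x g b : V} {r : List V} (hg : g ∉ A) :
    ∀ {a : V} {l : List V},
    List.IsChain (fun b c => R.nx x b = c) (a :: (l ++ g :: b :: r)) → (∀ c ∈ a :: l, c ∈ A) →
    (∀ c ∈ b :: r, c ∈ A) → List.IsChain (R.NextIn A x) (a :: (l ++ b :: r)) := by
  intro a l
  induction l generalizing a with
  | nil =>
    intro h _ hr
    have h1 := List.isChain_cons_cons.1 h
    have h2 := List.isChain_cons_cons.1 h1.2
    exact List.isChain_cons_cons.2 ⟨nextIn_of_isChain (l := [g])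
      (List.isChain_cons_cons.2 ⟨h1.1, List.isChain_cons_cons.2 ⟨h2.1, List.isChain_singleton _⟩⟩)
      (by simpa using hg) (hr b (by simp)), isChain_nextIn h2.2 hr⟩
  | cons c l ih =>
    intro h hl hr
    rw [List.cons_append, List.isChain_cons_cons] at h ⊢
    exact ⟨nextIn_of_nx h.1 (hl c (by simp)), ih h.2 (fun c' hc' => hl c' (by simp [hc'])) hr⟩

end RotationSystem

namespace RotationSystem

variable {V : Type u} {G : SimpleGraph V} {R : RotationSystem G} {v₁ v₂ : V} {red blue : V → V}

/-- `kR x` and `kB x` list the tails of the incoming red and blue edges of `x` in clockwise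
order. -/
structure Kids (R : RotationSystem G) (v₁ v₂ : V) (red blue : V → V) (kR kB : V → List V) :
    Prop where
  isCyc : ∀ x, Inner v₁ v₂ x → R.IsCyc x (red x) (blue x :: (kR x ++ kB x))
  isCyc₁ : R.IsCyc v₁ v₂ (kR v₁)
  isCyc₂ : R.IsCyc v₂ v₁ (kB v₂)
  mem_kR : ∀ x, x ≠ v₂ → ∀ c, c ∈ kR x ↔ Inner v₁ v₂ c ∧ red c = x
  mem_kB : ∀ x, x ≠ v₁ → ∀ c, c ∈ kB x ↔ Inner v₁ v₂ c ∧ blue c = x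

theorem Labeling.exists_kids [Finite V] (h : Labeling R v₁ v₂ red blue) :
    ∃ kR kB, Kids R v₁ v₂ red blue kR kB := by
  obtain ⟨k₁, hk₁⟩ := R.exists_isCyc h.base
  obtain ⟨k₂, hk₂⟩ := R.exists_isCyc h.base.symm
  have hne : v₁ ≠ v₂ := h.base.ne
  have hex : ∀ x, ∃ kR kB : List V, (x = v₁ → kR = k₁) ∧ (x = v₂ → kB = k₂) ∧ (Inner v₁ v₂ x →
      R.IsCyc x (red x) (blue x :: (kR ++ kB)) ∧ (∀ c ∈ kR, Inner v₁ v₂ c ∧ red c = x) ∧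
      ∀ c ∈ kB, Inner v₁ v₂ c ∧ blue c = x) := by
    intro x
    by_cases hx : Inner v₁ v₂ x
    · obtain ⟨kR, kB, h1⟩ := h.exists_isCyc x hx
      exact ⟨kR, kB, fun h2 => absurd h2 hx.1, fun h2 => absurd h2 hx.2, fun _ => h1⟩
    · exact ⟨k₁, k₂, fun _ => rfl, fun _ => rfl, fun h1 => absurd h1 hx⟩
  choose kR kB h1 h2 h3 using hex
  have hrb : ∀ c, Inner v₁ v₂ c → red c ≠ blue c := fun c hc he =>
    (List.nodup_cons.1 (h3 c hc).1.nodup).1 (by simp [he])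
  refine ⟨kR, kB, fun x hx => (h3 x hx).1, by rw [h1 _ rfl]; exact hk₁,
    by rw [h2 _ rfl]; exact hk₂, ?_, ?_⟩
  · intro x hx c
    by_cases hx₁ : x = v₁
    · subst hx₁
      rw [h1 x rfl]
      constructor
      · intro hc
        have hadj : G.Adj x c := (hk₁.mem_iff c).1 (List.mem_cons_of_mem _ hc)
        rcases h.up_or x c hadj with (h4 | ⟨h4, -⟩ | ⟨-, rfl⟩) | h4
        · exact h4
        · exact absurd rfl h4.1
        · exact absurd hc (List.nodup_cons.1 hk₁.nodup).1
        · exact absurd h4 (h.not_up_right c)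
      · rintro ⟨hc, rfl⟩
        rcases List.mem_cons.1 ((hk₁.mem_iff c).2 (h.adj_red c hc).symm) with h4 | h4
        · exact absurd h4 hc.2
        · exact h4
    · have hin : Inner v₁ v₂ x := ⟨hx₁, hx⟩
      refine ⟨(h3 x hin).2.1 c, ?_⟩
      rintro ⟨hc, rfl⟩
      have := ((h3 _ hin).1.mem_iff c).2 (h.adj_red c hc).symm
      simp only [List.mem_cons, List.mem_append] at this
      rcases this with h4 | h4 | h4 | h4
      · exact absurd (Or.inl ⟨hin, h4.symm⟩) (h.up_asymm (Or.inl ⟨hc, rfl⟩))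
      · exact absurd h4.symm (h.exclusive c _ hc hin rfl)
      · exact h4
      · exact absurd ((h3 _ hin).2.2 c h4).2.symm (hrb c hc)
  · intro x hx c
    by_cases hx₁ : x = v₂
    · subst hx₁
      rw [h2 x rfl]
      constructor
      · intro hc
        have hadj : G.Adj x c := (hk₂.mem_iff c).1 (List.mem_cons_of_mem _ hc)
        rcases h.up_or x c hadj with h4 | (⟨h4, -⟩ | h4 | ⟨rfl, -⟩)
        · exact absurd h4 (h.not_up_left c)
        · exact absurd rfl h4.2
        · exact h4
        · exact absurd hc (List.nodup_cons.1 hk₂.nodup).1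
      · rintro ⟨hc, rfl⟩
        rcases List.mem_cons.1 ((hk₂.mem_iff c).2 (h.adj_blue c hc).symm) with h4 | h4
        · exact absurd h4 hc.1
        · exact h4
    · have hin : Inner v₁ v₂ x := ⟨hx, hx₁⟩
      refine ⟨(h3 x hin).2.2 c, ?_⟩
      rintro ⟨hc, rfl⟩
      have := ((h3 _ hin).1.mem_iff c).2 (h.adj_blue c hc).symm
      simp only [List.mem_cons, List.mem_append] at this
      rcases this with h4 | h4 | h4 | h4
      · exact absurd rfl (h.exclusive _ c hin hc h4.symm)
      · exact absurd (Or.inr (Or.inl ⟨hin, h4.symm⟩)) (h.up_asymm (Or.inr (Or.inl ⟨hc, rfl⟩)))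
      · exact absurd ((h3 _ hin).2.1 c h4).2 (hrb c hc)
      · exact h4

/-- `γ g` is the apex of the facial path that passes through `g`; the values `t` increase from `g`
to `γ g` and from the ends of the facial path of `g` to `g`. -/
structure Greens (G : SimpleGraph V) (v₁ v₂ : V) (red blue : V → V) (I : Option V → List V)
    (γ : V → Option V) (t : V → ℕ) : Prop where
  apex : ∀ g, Inner v₁ v₂ g → Apex v₁ v₂ (γ g)
  mem_iff : ∀ w, Apex v₁ v₂ w → ∀ g, g ∈ I w ↔ Inner v₁ v₂ g ∧ γ g = w
  lt : ∀ g w, Inner v₁ v₂ g → γ g = some w → t g < t w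
  red_lt : ∀ g, Inner v₁ v₂ g → t (red g) < t g
  blue_lt : ∀ g, Inner v₁ v₂ g → t (blue g) < t g
  not_adj : ∀ g w, Inner v₁ v₂ g → γ g = some w → ¬ G.Adj g w
  nodup : ∀ w, Apex v₁ v₂ w → (path v₁ v₂ red blue I w).Nodup

/-- A green edge from `g` to its apex `w` is not parallel to an edge of `G`: it is not parallel to the red
or blue edge of `g`, since the time decreases along those and increases from `g` to `w`, nor to that
of `w`, since the coordinate increases along the facial path of `w`. -/
theorem FacialPaths.exists_greens [Finite V] {I : Option V → List V}
    (h : FacialPaths R v₁ v₂ red blue I)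
    (hup : ∀ x y, G.Adj x y → Up v₁ v₂ red blue x y ∨ Up v₁ v₂ red blue y x) :
    ∃ γ t, Greens G v₁ v₂ red blue I γ t := by
  obtain ⟨t, x, ht, hx⟩ := h.exists_time
  have hγ : ∀ g, ∃ w, Inner v₁ v₂ g → Apex v₁ v₂ w ∧ g ∈ I w := by
    intro g
    by_cases hg : Inner v₁ v₂ g
    · obtain ⟨w, h1⟩ := h.exists_apex g hg
      exact ⟨w, fun _ => h1⟩
    · exact ⟨none, fun h1 => absurd h1 hg⟩
  choose γ hγ using hγ
  have hmem : ∀ w, Apex v₁ v₂ w → ∀ g, g ∈ I w ↔ Inner v₁ v₂ g ∧ γ g = w := by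
    intro w hw g
    constructor
    · intro hg
      have hin := h.inner w hw g hg
      exact ⟨hin, h.unique _ _ (hγ g hin).1 hw g (hγ g hin).2 hg⟩
    · rintro ⟨hg, rfl⟩
      exact (hγ g hg).2
  have hnodup : ∀ w, Apex v₁ v₂ w → (path v₁ v₂ red blue I w).Nodup := by
    intro w hw
    have h1 : List.IsChain (fun p q => x p < x q) (path v₁ v₂ red blue I w) :=
      (h.up w hw).imp hx
    have h2 : ((path v₁ v₂ red blue I w).map x).Pairwise (· < ·) :=
      ((List.isChain_map (R := (· < ·)) x).2 h1).pairwise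
    exact List.Nodup.of_map x (h2.imp fun h => ne_of_lt h)
  have hlt : ∀ g w, Inner v₁ v₂ g → γ g = some w → t g < t w := by
    intro g w hg hw
    have hw' : Apex v₁ v₂ (some w) := hw ▸ (hγ g hg).1
    exact ht w (hw' w rfl) g (by simp [path, (hmem _ hw' g).2 ⟨hg, hw⟩])
  have hred : ∀ g, Inner v₁ v₂ g → t (red g) < t g := fun g hg => ht g hg _ (by simp [path])
  have hblue : ∀ g, Inner v₁ v₂ g → t (blue g) < t g := fun g hg => ht g hg _ (by simp [path])
  refine ⟨γ, t, fun g hg => (hγ g hg).1, hmem, hlt, hred, hblue, ?_, hnodup⟩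
  intro g w hg hw hadj
  have hw' : Apex v₁ v₂ (some w) := hw ▸ (hγ g hg).1
  have hw'' := hw' w rfl
  have h1 := hlt g w hg hw
  have hmemg := (hmem _ hw' g).2 ⟨hg, hw⟩
  have hnd := hnodup _ hw'
  have hnd1 : g ≠ red w := by
    rintro rfl
    exact (List.nodup_cons.1 hnd).1 (by simp [hmemg])
  have hnd2 : g ≠ blue w := by
    rintro rfl
    exact List.disjoint_of_nodup_append (l₁ := red w :: I (some w)) hnd
      (List.mem_cons_of_mem _ hmemg) (List.mem_singleton_self _)
  rcases hup g w hadj with (⟨h2, h3⟩ | ⟨h2, h3⟩ | ⟨h2, h3⟩) | (⟨h2, h3⟩ | ⟨h2, h3⟩ | ⟨h2, h3⟩)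
  · exact hnd1 h3.symm
  · have := hblue g hg
    rw [h3] at this
    omega
  · exact hg.1 h2
  · have := hred g hg
    rw [h3] at this
    omega
  · exact hnd2 h3.symm
  · exact hg.2 h3

/-- The graph `G` with a new vertex `none`, which is joined to `v₁` and `v₂`, and with the green edges
from `x` to `γ x`. -/
def addGreen (G : SimpleGraph V) (v₁ v₂ : V) (γ : V → Option V) : SimpleGraph (Option V) :=
  SimpleGraph.fromRel fun a b => (∃ x y, a = some x ∧ b = some y ∧ G.Adj x y) ∨
    (∃ x, Inner v₁ v₂ x ∧ a = some x ∧ b = γ x) ∨ (b = none ∧ (a = some v₁ ∨ a = some v₂))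

variable {I : Option V → List V} {γ : V → Option V} {t : V → ℕ} {kR kB : V → List V}

theorem Greens.adj_some_some (hg : Greens G v₁ v₂ red blue I γ t) (x y : V) :
    (addGreen G v₁ v₂ γ).Adj (some x) (some y) ↔
      G.Adj x y ∨ (Inner v₁ v₂ x ∧ γ x = some y) ∨ (Inner v₁ v₂ y ∧ γ y = some x) := by
  rw [addGreen, SimpleGraph.fromRel_adj]
  constructor
  · rintro ⟨-, (⟨x', y', h1, h2, h3⟩ | ⟨x', h1, h2, h3⟩ | ⟨h1, -⟩) |
      (⟨x', y', h1, h2, h3⟩ | ⟨x', h1, h2, h3⟩ | ⟨h1, -⟩)⟩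
    · obtain rfl := Option.some.inj h1
      obtain rfl := Option.some.inj h2
      exact Or.inl h3
    · obtain rfl := Option.some.inj h2
      exact Or.inr (Or.inl ⟨h1, h3.symm⟩)
    · cases h1
    · obtain rfl := Option.some.inj h1
      obtain rfl := Option.some.inj h2
      exact Or.inl h3.symm
    · obtain rfl := Option.some.inj h2
      exact Or.inr (Or.inr ⟨h1, h3.symm⟩)
    · cases h1
  · have hne : ∀ x y, Inner v₁ v₂ x → γ x = some y → x ≠ y := by
      rintro x y hx hxy rfl
      exact (hg.lt x x hx hxy).ne rfl
    rintro (h | ⟨h, h'⟩ | ⟨h, h'⟩)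
    · exact ⟨fun he => h.ne (Option.some.inj he), Or.inl (Or.inl ⟨x, y, rfl, rfl, h⟩)⟩
    · exact ⟨fun he => hne x y h h' (Option.some.inj he), Or.inl (Or.inr (Or.inl ⟨x, h, rfl, h'.symm⟩))⟩
    · exact ⟨fun he => hne y x h h' (Option.some.inj he).symm,
        Or.inr (Or.inr (Or.inl ⟨y, h, rfl, h'.symm⟩))⟩

theorem addGreen_adj_none (x : V) : (addGreen G v₁ v₂ γ).Adj (some x) none ↔
    x = v₁ ∨ x = v₂ ∨ (Inner v₁ v₂ x ∧ γ x = none) := by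
  rw [addGreen, SimpleGraph.fromRel_adj]
  constructor
  · rintro ⟨-, (⟨x', y', h1, h2, h3⟩ | ⟨x', h1, h2, h3⟩ | ⟨-, h1 | h1⟩) |
      (⟨x', y', h1, h2, h3⟩ | ⟨x', h1, h2, h3⟩ | ⟨h1, -⟩)⟩
    · cases h2
    · obtain rfl := Option.some.inj h2
      exact Or.inr (Or.inr ⟨h1, h3.symm⟩)
    · exact Or.inl (Option.some.inj h1)
    · exact Or.inr (Or.inl (Option.some.inj h1))
    · cases h1
    · cases h2
    · cases h1
  · rintro (rfl | rfl | ⟨h, h'⟩)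
    · exact ⟨by simp, Or.inl (Or.inr (Or.inr ⟨rfl, Or.inl rfl⟩))⟩
    · exact ⟨by simp, Or.inl (Or.inr (Or.inr ⟨rfl, Or.inr rfl⟩))⟩
    · exact ⟨by simp, Or.inl (Or.inr (Or.inl ⟨x, h, rfl, h'.symm⟩))⟩

/-- The clockwise lists of neighbours in the completed graph: the incoming green edges are
inserted between the two outgoing edges, and the outgoing green edge between the incoming red
and blue ones. -/
structure Completion {H : SimpleGraph (Option V)} (RH : RotationSystem H) (v₁ v₂ : V)
    (red blue : V → V) (I : Option V → List V) (γ : V → Option V) (kR kB : V → List V) : Prop where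
  isCyc : ∀ x, Inner v₁ v₂ x → RH.IsCyc (some x) (some (red x))
    ((I (some x)).map some ++ some (blue x) :: ((kR x).map some ++ γ x :: (kB x).map some))
  isCyc₁ : RH.IsCyc (some v₁) (some v₂) ((kR v₁).map some ++ [none])
  isCyc₂ : RH.IsCyc (some v₂) (some v₁) (none :: (kB v₂).map some)
  isCycₙ : RH.IsCyc none (some v₁) ((I none).map some ++ [some v₂])

theorem nodup_map_some {l : List V} : (l.map some).Nodup ↔ l.Nodup :=
  List.nodup_map_iff (Option.some_injective V)

/-- The prescribed lists contain each neighbour in the completed graph exactly once, so that they are the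
clockwise lists of a rotation system. -/
theorem Kids.exists_completion [Finite V] (hk : Kids R v₁ v₂ red blue kR kB)
    (hg : Greens G v₁ v₂ red blue I γ t) (hne : v₁ ≠ v₂) :
    ∃ RH : RotationSystem (addGreen G v₁ v₂ γ), Completion RH v₁ v₂ red blue I γ kR kB := by
  have hnone : Apex v₁ v₂ none := by rintro x ⟨⟩
  have hγ₁ : ∀ y, Inner v₁ v₂ y → γ y ≠ some v₁ := fun y hy h => (hg.apex y hy v₁ h).1 rfl
  have hγ₂ : ∀ y, Inner v₁ v₂ y → γ y ≠ some v₂ := fun y hy h => (hg.apex y hy v₂ h).2 rfl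
  obtain ⟨RH, hRH⟩ := exists_rotationSystem (G := addGreen G v₁ v₂ γ) (fun u a l =>
    (∀ x, u = some x → Inner v₁ v₂ x → a = some (red x) ∧ l = (I (some x)).map some ++
      some (blue x) :: ((kR x).map some ++ γ x :: (kB x).map some)) ∧
    (u = some v₁ → a = some v₂ ∧ l = (kR v₁).map some ++ [none]) ∧
    (u = some v₂ → a = some v₁ ∧ l = none :: (kB v₂).map some) ∧
    (u = none → a = some v₁ ∧ l = (I none).map some ++ [some v₂])) (by
      rintro (_ | x)
      · refine ⟨_, _, ⟨by rintro x ⟨⟩, by rintro ⟨⟩, by rintro ⟨⟩, fun _ => ⟨rfl, rfl⟩⟩, ?_, ?_⟩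
        · have := nodup_map_some.2 (hg.nodup none hnone)
          rw [path, List.cons_append, List.map_cons, List.map_append] at this
          exact this
        · rintro (_ | y)
          · simp
          · rw [SimpleGraph.adj_comm, addGreen_adj_none, ← hg.mem_iff none hnone]
            simp only [List.mem_cons, List.mem_append, List.mem_map, Option.some.injEq,
              List.not_mem_nil, or_false, exists_eq_right]
            tauto
      · by_cases hx₁ : x = v₁
        · subst hx₁
          refine ⟨_, _, ⟨fun y hy hy' => absurd (Option.some.inj hy).symm hy'.1,
            fun _ => ⟨rfl, rfl⟩, fun h => absurd (Option.some.inj h) hne, by rintro ⟨⟩⟩, ?_, ?_⟩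
          · have := nodup_map_some.2 hk.isCyc₁.nodup
            rw [← List.cons_append, List.nodup_append]
            exact ⟨this, List.nodup_singleton _, by simp⟩
          · rintro (_ | y)
            · simp [addGreen_adj_none]
            · rw [hg.adj_some_some, ← hk.isCyc₁.mem_iff]
              have h1 : ¬ Inner x v₂ x := fun h => h.1 rfl
              have h2 : ¬ (Inner x v₂ y ∧ γ y = some x) := fun h => hγ₁ y h.1 h.2
              simp [h1, h2]
        · by_cases hx₂ : x = v₂
          · subst hx₂
            refine ⟨_, _, ⟨fun y hy hy' => absurd (Option.some.inj hy).symm hy'.2,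
              fun h => absurd (Option.some.inj h).symm hne, fun _ => ⟨rfl, rfl⟩, by rintro ⟨⟩⟩, ?_, ?_⟩
            · have := nodup_map_some.2 hk.isCyc₂.nodup
              rw [List.map_cons, List.nodup_cons] at this
              simp only [List.nodup_cons, List.mem_cons, not_or]
              exact ⟨⟨by simp, this.1⟩, by simp, this.2⟩
            · rintro (_ | y)
              · simp [addGreen_adj_none]
              · rw [hg.adj_some_some, ← hk.isCyc₂.mem_iff]
                have h1 : ¬ Inner v₁ x x := fun h => h.2 rfl
                have h2 : ¬ (Inner v₁ x y ∧ γ y = some x) := fun h => hγ₂ y h.1 h.2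
                simp [h1, h2]
          · have hx : Inner v₁ v₂ x := ⟨hx₁, hx₂⟩
            have hax : Apex v₁ v₂ (some x) := fun y hy => Option.some.inj hy ▸ hx
            have hc := hk.isCyc x hx
            refine ⟨some (red x), (I (some x)).map some ++ some (blue x) :: ((kR x).map some ++
              γ x :: (kB x).map some), ⟨fun y hy _ => ?_, fun h => absurd (Option.some.inj h) hx₁,
              fun h => absurd (Option.some.inj h) hx₂, by rintro ⟨⟩⟩, ?_, ?_⟩
            · obtain rfl := Option.some.inj hy
              exact ⟨rfl, rfl⟩
            · have hperm : (some (red x) :: ((I (some x)).map some ++ some (blue x) ::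
                  ((kR x).map some ++ γ x :: (kB x).map some))).Perm
                  (γ x :: ((I (some x)).map some ++
                    (red x :: blue x :: (kR x ++ kB x)).map some)) := by
                classical
                rw [List.perm_iff_count]
                intro b
                simp only [List.map_cons, List.map_append, List.count_append, List.count_cons]
                omega
              rw [hperm.nodup_iff, List.nodup_cons, List.nodup_append]
              refine ⟨?_, ?_, nodup_map_some.2 hc.nodup, ?_⟩
              · rw [List.mem_append]
                rintro (h1 | h1) <;> obtain ⟨y, h2, h3⟩ := List.mem_map.1 h1
                · have h4 := (hg.mem_iff _ hax y).1 h2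
                  have h5 := hg.lt y x h4.1 h4.2
                  have h6 := hg.lt x y hx h3.symm
                  omega
                · exact hg.not_adj x y hx h3.symm ((hc.mem_iff y).1 h2)
              · have := (List.nodup_cons.1 (hg.nodup _ hax)).2
                exact nodup_map_some.2 (List.Nodup.of_append_left this)
              · intro a ha b hb hab
                obtain ⟨y, h2, rfl⟩ := List.mem_map.1 ha
                obtain ⟨z, h3, rfl⟩ := List.mem_map.1 hb
                obtain rfl := Option.some.inj hab
                have h4 := (hg.mem_iff _ hax y).1 h2
                exact hg.not_adj y x h4.1 h4.2 ((hc.mem_iff y).1 h3).symm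
            · rintro (_ | y)
              · rw [addGreen_adj_none]
                simp [hx₁, hx₂, hx, eq_comm]
              · rw [hg.adj_some_some, ← hg.mem_iff _ hax, ← hc.mem_iff]
                simp only [List.mem_cons, List.mem_append, List.mem_map, Option.some.injEq,
                  exists_eq_right, hx, true_and, eq_comm (a := γ x)]
                tauto)
  refine ⟨RH, fun x hx => ?_, ?_, ?_, ?_⟩
  · obtain ⟨a, l, h1, h2⟩ := hRH (some x)
    obtain ⟨rfl, rfl⟩ := h1.1 x rfl hx
    exact h2
  · obtain ⟨a, l, h1, h2⟩ := hRH (some v₁)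
    obtain ⟨rfl, rfl⟩ := h1.2.1 rfl
    exact h2
  · obtain ⟨a, l, h1, h2⟩ := hRH (some v₂)
    obtain ⟨rfl, rfl⟩ := h1.2.2.1 rfl
    exact h2
  · obtain ⟨a, l, h1, h2⟩ := hRH none
    obtain ⟨rfl, rfl⟩ := h1.2.2.2 rfl
    exact h2

end RotationSystem

namespace RotationSystem

variable {V : Type u} {G : SimpleGraph V} {R : RotationSystem G} {v₁ v₂ : V} {red blue : V → V}
  {I : Option V → List V} {γ : V → Option V} {t : V → ℕ} {kR kB : V → List V}
  {H : SimpleGraph (Option V)} {RH : RotationSystem H}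

/-- The chain around an inner vertex that starts with the outgoing blue edge. -/
theorem Completion.isChain (hC : Completion RH v₁ v₂ red blue I γ kR kB) {q : V}
    (hq : Inner v₁ v₂ q) : List.IsChain (fun b c => RH.nx (some q) b = c)
      ((blue q :: kR q).map some ++ γ q :: (kB q ++ [red q]).map some) := by
  have h := (hC.isCyc q hq).chain
  have h1 : some (red q) :: ((I (some q)).map some ++ some (blue q) :: ((kR q).map some ++
      γ q :: (kB q).map some)) ++ [some (red q)] = (some (red q) :: (I (some q)).map some) ++
      ((blue q :: kR q).map some ++ γ q :: (kB q ++ [red q]).map some) := by simp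
  rw [h1] at h
  exact h.right_of_append

theorem Completion.isChain₁ (hC : Completion RH v₁ v₂ red blue I γ kR kB) :
    List.IsChain (fun b c => RH.nx (some v₁) b = c)
      ((v₂ :: kR v₁).map some ++ none :: [v₂].map some) := by
  simpa using hC.isCyc₁.chain

theorem Completion.isChain₂ (hC : Completion RH v₁ v₂ red blue I γ kR kB) :
    List.IsChain (fun b c => RH.nx (some v₂) b = c)
      (some v₁ :: none :: (kB v₂ ++ [v₁]).map some) := by
  simpa using hC.isCyc₂.chain

theorem Kids.isChain (hk : Kids R v₁ v₂ red blue kR kB) {q : V} (hq : Inner v₁ v₂ q) :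
    List.IsChain (fun b c => R.nx q b = c) ((blue q :: kR q) ++ (kB q ++ [red q])) := by
  have h := (hk.isCyc q hq).chain
  rw [List.cons_append] at h
  simpa using h.of_cons

/-- Between the incoming red and blue edges at `q` is the green edge of `q`. -/
theorem Completion.nx_green (hC : Completion RH v₁ v₂ red blue I γ kR kB)
    (hk : Kids R v₁ v₂ red blue kR kB) (h : Labeling R v₁ v₂ red blue) {q p s : V}
    (hq : Inner v₁ v₂ q) (hpq : Up v₁ v₂ red blue p q) (hqs : Up v₁ v₂ red blue q s)
    (hnx : R.nx q s = p) :
    RH.nx (some q) (some s) = γ q ∧ RH.nx (some q) (γ q) = some p := by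
  have hmem : ∀ s, s ∈ blue q :: kR q ↔ Up v₁ v₂ red blue q s := by
    intro s
    rw [List.mem_cons, hk.mem_kR q hq.2]
    constructor
    · rintro (rfl | h1)
      · exact Or.inr (Or.inl ⟨hq, rfl⟩)
      · exact Or.inl h1
    · rintro (h1 | ⟨-, h1⟩ | ⟨h1, -⟩)
      · exact Or.inr h1
      · exact Or.inl h1.symm
      · exact absurd h1 hq.1
  obtain ⟨l, r, h1, h2⟩ := (hk.isChain hq).exists_eq_append (by simp) ((hmem s).2 hqs)
    (by rw [hnx, hmem]; exact h.up_asymm hpq)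
  have h3 := hC.isChain hq
  rw [h1, h2, hnx, List.map_append, List.append_assoc] at h3
  have h4 := h3.right_of_append
  simp only [List.map_cons, List.map_nil, List.cons_append, List.nil_append,
    List.isChain_cons_cons] at h4
  exact ⟨h4.1, h4.2.1⟩

/-- No green edge is inserted directly after an incoming blue edge. -/
theorem Completion.nx_of_mem_kB (hC : Completion RH v₁ v₂ red blue I γ kR kB)
    (hk : Kids R v₁ v₂ red blue kR kB) {q w : V} (hq : q ≠ v₁) (hw : w ∈ kB q) :
    RH.nx (some q) (some w) = some (R.nx q w) := by
  obtain ⟨f, h1, h2⟩ : ∃ f, List.IsChain (fun b c => R.nx q b = c) (kB q ++ [f]) ∧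
      List.IsChain (fun b c => RH.nx (some q) b = c) ((kB q ++ [f]).map some) := by
    by_cases hq₂ : q = v₂
    · subst hq₂
      refine ⟨v₁, ?_, hC.isChain₂.of_cons.of_cons⟩
      have h := hk.isCyc₂.chain
      rw [List.cons_append] at h
      exact h.of_cons
    · have hin : Inner v₁ v₂ q := ⟨hq, hq₂⟩
      exact ⟨red q, (hk.isChain hin).right_of_append, (hC.isChain hin).right_of_append.of_cons⟩
  exact h1.forall_next ((List.isChain_map some).1 h2) w hw

/-- No green edge is inserted directly before an incoming red edge. -/
theorem Completion.nx_of_mem_kR (hC : Completion RH v₁ v₂ red blue I γ kR kB)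
    (hk : Kids R v₁ v₂ red blue kR kB) {p q w : V} (hp : p ≠ v₂) (hw : w ∈ kR p)
    (hpq : G.Adj p q) (hnx : R.nx p q = w) : RH.nx (some p) (some q) = some w := by
  obtain ⟨f, h0, h1, h2⟩ : ∃ f, (∀ b ∈ f :: kR p, G.Adj p b) ∧
      List.IsChain (fun b c => R.nx p b = c) (f :: kR p) ∧
      List.IsChain (fun b c => RH.nx (some p) b = c) ((f :: kR p).map some) := by
    by_cases hp₁ : p = v₁
    · subst hp₁
      exact ⟨v₂, fun b hb => (hk.isCyc₁.mem_iff b).1 hb, hk.isCyc₁.chain.left_of_append,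
        hC.isChain₁.left_of_append⟩
    · have hin : Inner v₁ v₂ p := ⟨hp₁, hp⟩
      refine ⟨blue p, fun b hb => ((hk.isCyc p hin).mem_iff b).1 ?_,
        (hk.isChain hin).left_of_append, (hC.isChain hin).left_of_append⟩
      rcases List.mem_cons.1 hb with rfl | hb
      · simp
      · simp [hb]
  have h3 : List.IsChain (fun b c => R.nx p b = c ∧ RH.nx (some p) (some b) = some c)
      (f :: kR p) := by
    have h2 := (List.isChain_map some).1 h2
    rw [List.isChain_iff_getElem] at h1 h2 ⊢
    exact fun i hi => ⟨h1 i hi, h2 i hi⟩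
  obtain ⟨b, hb, h4, h5⟩ := h3.exists_prev hw
  obtain rfl := R.nx_inj hpq (h0 b hb) (hnx.trans h4.symm)
  exact h5

/-- The triangles of the completed graph. -/
theorem Completion.triangle (hC : Completion RH v₁ v₂ red blue I γ kR kB)
    (hk : Kids R v₁ v₂ red blue kR kB) (h : Labeling R v₁ v₂ red blue)
    (hg : Greens G v₁ v₂ red blue I γ t) (hF : FacialPaths R v₁ v₂ red blue I) {w : Option V}
    (hw : Apex v₁ v₂ w) {p q : V} {l r : List V}
    (hpath : path v₁ v₂ red blue I w = l ++ p :: q :: r) :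
    RH.nx w (some p) = some q ∧ RH.nx (some q) w = some p ∧ RH.nx (some p) (some q) = w := by
  have hup := hF.up w hw
  have hcor := hF.corner w hw
  obtain ⟨lo, hi, c, e, hp1, hp2⟩ : ∃ lo hi c e, path v₁ v₂ red blue I w = lo :: (I w ++ [hi]) ∧
      closedPath v₁ v₂ red blue I w = c :: path v₁ v₂ red blue I w ++ [e] := by
    rcases w with _ | w
    · exact ⟨_, _, _, _, rfl, rfl⟩
    · exact ⟨_, _, _, _, rfl, rfl⟩
  rw [hp2, hpath] at hcor
  have hup0 := hup
  rw [hpath] at hup0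
  have hup1 := hup0.right_of_append
  have hupq := (List.isChain_cons_cons.1 hup1).1
  refine ⟨?_, ?_, ?_⟩
  · have h1 : List.IsChain (fun b c => RH.nx w b = c) ((path v₁ v₂ red blue I w).map some) := by
      rcases w with _ | w
      · have h2 := hC.isCycₙ.chain.left_of_append
        simpa [path] using h2
      · have h2 := (hC.isCyc w (hw w rfl)).chain
        have h3 : some (red w) :: ((I (some w)).map some ++ some (blue w) :: ((kR w).map some ++
            γ w :: (kB w).map some)) ++ [some (red w)] =
            (path v₁ v₂ red blue I (some w)).map some ++
              ((kR w).map some ++ γ w :: ((kB w).map some ++ [some (red w)])) := by simp [path]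
        rw [h3] at h2
        exact h2.left_of_append
    rw [hpath] at h1
    simp only [List.map_append, List.map_cons] at h1
    exact (List.isChain_cons_cons.1 h1.right_of_append).1
  · rcases r with _ | ⟨s, r⟩
    · have hq : q = hi := by
        have h1 : (lo :: I w) ++ [hi] = (l ++ [p]) ++ [q] := by
          rw [List.cons_append, ← hp1, hpath]; simp
        exact (List.singleton_inj.1 (List.append_inj' h1 rfl).2).symm
      have h1 : R.nx q e = p := by
        refine Chain3.triple (Q := fun p g s => R.nx g s = p) (l := c :: l) (r := []) ?_
        simpa using hcor
      rcases w with _ | w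
      · obtain rfl : e = v₁ := by
          have h2 : (v₂ :: path v₁ v₂ red blue I none) ++ [v₁] = (c :: path v₁ v₂ red blue I none) ++
            [e] := hp2
          exact (List.singleton_inj.1 (List.append_inj' h2 rfl).2).symm
        obtain rfl : hi = v₂ := by
          have h2 : (e :: I none) ++ [v₂] = (lo :: I none) ++ [hi] := hp1
          exact (List.singleton_inj.1 (List.append_inj' h2 rfl).2).symm
        subst hq
        have h3 := hC.isChain₂
        have h4 := hk.isCyc₂.chain
        rw [List.cons_append] at h4
        rcases hkB : kB q with _ | ⟨b, k⟩
        · rw [hkB] at h3 h4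
          have h5 := (List.isChain_cons_cons.1 h4).1
          have h6 := (List.isChain_cons_cons.1 (List.isChain_cons_cons.1 h3).2).1
          rw [h6, ← h1, h5]
        · rw [hkB] at h3 h4
          have h5 := (List.isChain_cons_cons.1 h4).1
          have h6 := (List.isChain_cons_cons.1 (List.isChain_cons_cons.1 h3).2).1
          rw [h6, ← h1, h5]
      · obtain rfl : e = w := by
          have h2 : (w :: path v₁ v₂ red blue I (some w)) ++ [w] =
            (c :: path v₁ v₂ red blue I (some w)) ++ [e] := hp2
          exact (List.singleton_inj.1 (List.append_inj' h2 rfl).2).symm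
        obtain rfl : hi = blue e := by
          have h2 : (red e :: I (some e)) ++ [blue e] = (lo :: I (some e)) ++ [hi] := hp1
          exact (List.singleton_inj.1 (List.append_inj' h2 rfl).2).symm
        subst hq
        have hb := h.blue_ne e (hw e rfl)
        rw [hC.nx_of_mem_kB hk hb ((hk.mem_kB _ hb e).2 ⟨hw e rfl, rfl⟩), h1]
    · have hqI : q ∈ I w := List.mem_of_cons_append_eq (l := l ++ [p]) (r := s :: r)
        (by rw [← hp1, hpath]; simp) (by simp) (by simp)
      obtain ⟨hq, rfl⟩ := (hg.mem_iff w hw q).1 hqI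
      have h1 : R.nx q s = p := by
        refine Chain3.triple (Q := fun p g s => R.nx g s = p) (l := c :: l) (r := r ++ [e]) ?_
        simpa using hcor
      have hqs := (List.isChain_cons_cons.1 (List.isChain_cons_cons.1 hup1).2).1
      exact (hC.nx_green hk h hq hupq hqs h1).2
  · rcases List.eq_nil_or_concat l with rfl | ⟨l, o, rfl⟩
    · obtain rfl : lo = p := by
        have h1 := hp1.symm.trans hpath
        exact (List.cons.inj h1).1
      have h1 : R.nx lo q = c := by
        refine Chain3.triple (Q := fun p g s => R.nx g s = p) (l := []) (r := r ++ [e]) ?_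
        simpa using hcor
      rcases w with _ | w
      · obtain rfl : c = v₂ := (List.cons.inj hp2).1.symm
        obtain rfl : lo = v₁ := (List.cons.inj hp1).1.symm
        have h3 := hC.isChain₁
        have h4 := hk.isCyc₁.chain
        obtain ⟨k, z, hkz⟩ : ∃ k z, c :: kR lo = k ++ [z] :=
          ⟨_, _, (List.dropLast_append_getLast (List.cons_ne_nil _ _)).symm⟩
        have hz : G.Adj lo z := (hk.isCyc₁.mem_iff z).1 (by rw [hkz]; simp)
        rw [hkz, List.append_assoc] at h4
        rw [hkz, List.map_append, List.append_assoc] at h3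
        have h5 := (List.isChain_cons_cons.1 h4.right_of_append).1
        have h6 := (List.isChain_cons_cons.1 h3.right_of_append).1
        obtain rfl := R.nx_inj (h.up_adj hupq) hz (h1.trans h5.symm)
        exact h6
      · obtain rfl : c = w := (List.cons.inj hp2).1.symm
        obtain rfl : lo = red c := (List.cons.inj hp1).1.symm
        have hr := h.red_ne c (hw c rfl)
        exact hC.nx_of_mem_kR hk hr ((hk.mem_kR _ hr c).2 ⟨hw c rfl, rfl⟩) (h.up_adj hupq) h1
    · have hpI : p ∈ I w := List.mem_of_cons_append_eq (l := l ++ [o]) (r := q :: r)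
        (by rw [← hp1, hpath]; simp) (by simp) (by simp)
      obtain ⟨hp, rfl⟩ := (hg.mem_iff w hw p).1 hpI
      have h1 : R.nx p q = o := by
        refine Chain3.triple (Q := fun p g s => R.nx g s = p) (l := c :: l) (r := r ++ [e]) ?_
        simpa using hcor
      have hop : Up v₁ v₂ red blue o p := by
        have : List.IsChain (Up v₁ v₂ red blue) (l ++ (o :: p :: q :: r)) := by simpa using hup0
        exact (List.isChain_cons_cons.1 this.right_of_append).1
      exact (hC.nx_green hk h hp hop hupq h1).1

end RotationSystem

namespace RotationSystem

variable {V : Type u} {G : SimpleGraph V} {R : RotationSystem G} {v₁ v₂ : V} {red blue : V → V}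
  {I : Option V → List V} {γ : V → Option V} {t : V → ℕ} {kR kB : V → List V}
  {RH : RotationSystem (addGreen G v₁ v₂ γ)}

theorem facePerm_pow_three_of_nx {R : RotationSystem G} {a b c : V} (hab : G.Adj a b)
    (h1 : R.nx b a = c) (h2 : R.nx c b = a) (h3 : R.nx a c = b) :
    R.facePerm (R.facePerm (R.facePerm ⟨(a, b), hab⟩)) = ⟨(a, b), hab⟩ := by
  subst h1
  rw [facePerm_mk, facePerm_mk, facePerm_mk]
  exact SimpleGraph.Dart.ext _ _ (Prod.ext h2
    (show R.nx (R.nx (R.nx b a) b) (R.nx b a) = b by rw [h2]; exact h3))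

theorem _root_.List.exists_next_of_mem {α : Type*} {a b g : α} {l : List α} (h : g ∈ a :: l) :
    ∃ l' q r, a :: (l ++ [b]) = l' ++ g :: q :: r := by
  obtain ⟨l', r, h1⟩ := List.append_of_mem h
  obtain ⟨q, r', h2⟩ : ∃ q r', r ++ [b] = q :: r' := List.exists_cons_of_ne_nil (by simp)
  exact ⟨l', q, r', by rw [← List.cons_append, h1, List.append_assoc, List.cons_append, h2]⟩

theorem _root_.List.exists_prev_of_mem {α : Type*} {a b g : α} {l : List α} (h : g ∈ l ++ [b]) :
    ∃ l' p r, a :: (l ++ [b]) = l' ++ p :: g :: r := by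
  obtain ⟨l', r, h1⟩ := List.append_of_mem h
  obtain ⟨l'', p, h2⟩ : ∃ l'' p, a :: l' = l'' ++ [p] :=
    ⟨_, _, (List.dropLast_append_getLast (List.cons_ne_nil _ _)).symm⟩
  exact ⟨l'', p, r, by rw [h1, ← List.cons_append, h2]; simp⟩

/-- The three edges of the outer triangle. -/
theorem Completion.outer (hC : Completion RH v₁ v₂ red blue I γ kR kB) :
    RH.nx (some v₁) none = some v₂ ∧ RH.nx (some v₂) (some v₁) = none ∧
      RH.nx none (some v₂) = some v₁ := by
  refine ⟨?_, ?_, ?_⟩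
  · exact (List.isChain_cons_cons.1 hC.isChain₁.right_of_append).1
  · exact (List.isChain_cons_cons.1 hC.isChain₂).1
  · have h := hC.isCycₙ.chain
    have h1 : some v₁ :: ((I none).map some ++ [some v₂]) ++ [some v₁] =
        (some v₁ :: (I none).map some) ++ [some v₂, some v₁] := by simp
    rw [h1] at h
    exact (List.isChain_cons_cons.1 h.right_of_append).1

/-- All faces of the completed graph are triangles. -/
theorem Completion.facePerm_pow_three (hC : Completion RH v₁ v₂ red blue I γ kR kB)
    (hk : Kids R v₁ v₂ red blue kR kB) (h : Labeling R v₁ v₂ red blue)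
    (hg : Greens G v₁ v₂ red blue I γ t) (hF : FacialPaths R v₁ v₂ red blue I)
    (hcover : ∀ p q, Up v₁ v₂ red blue p q → ∃ w, Apex v₁ v₂ w ∧
      ∃ l r, path v₁ v₂ red blue I w = l ++ p :: q :: r) (d : (addGreen G v₁ v₂ γ).Dart) :
    RH.facePerm (RH.facePerm (RH.facePerm d)) = d := by
  obtain ⟨h1, h2, h3⟩ := hC.outer
  have hnone : Apex v₁ v₂ none := by rintro x ⟨⟩
  have hlo : ∀ w, Apex v₁ v₂ w → ∀ p l q r, path v₁ v₂ red blue I w = l ++ p :: q :: r →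
      ∃ c, RH.nx w (some p) = c ∧ RH.nx c w = some p ∧ RH.nx (some p) c = w := by
    intro w hw p l q r hp
    obtain ⟨h4, h5, h6⟩ := hC.triangle hk h hg hF hw hp
    exact ⟨_, h4, h5, h6⟩
  have hhi : ∀ w, Apex v₁ v₂ w → ∀ q l p r, path v₁ v₂ red blue I w = l ++ p :: q :: r →
      ∃ c, RH.nx (some q) w = c ∧ RH.nx c (some q) = w ∧ RH.nx w c = some q := by
    intro w hw p l q r hp
    obtain ⟨h4, h5, h6⟩ := hC.triangle hk h hg hF hw hp
    exact ⟨_, h5, h6, h4⟩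
  have hsome : ∀ x, Inner v₁ v₂ x → Apex v₁ v₂ (some x) := fun x hx y hy =>
    Option.some.inj hy ▸ hx
  have hmid : ∀ g, Inner v₁ v₂ g → g ∈ I (γ g) := fun g hg' =>
    (hg.mem_iff _ (hg.apex g hg') g).2 ⟨hg', rfl⟩
  have hpath : ∀ w, ∃ lo hi, path v₁ v₂ red blue I w = lo :: (I w ++ [hi]) := by
    rintro (_ | w)
    · exact ⟨_, _, rfl⟩
    · exact ⟨_, _, rfl⟩
  suffices ∃ c, RH.nx d.snd d.fst = c ∧ RH.nx c d.snd = d.fst ∧ RH.nx d.fst c = d.snd by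
    obtain ⟨c, h4, h5, h6⟩ := this
    exact facePerm_pow_three_of_nx d.adj h4 h5 h6
  -- the edge of `g` to its apex
  have htoApex : ∀ g, Inner v₁ v₂ g → ∃ c, RH.nx (γ g) (some g) = c ∧
      RH.nx c (γ g) = some g ∧ RH.nx (some g) c = γ g := by
    intro g hg'
    obtain ⟨lo, hi, hp⟩ := hpath (γ g)
    obtain ⟨l, q, r, h4⟩ := List.exists_next_of_mem (a := lo) (b := hi)
      (List.mem_cons_of_mem _ (hmid g hg'))
    exact hlo _ (hg.apex g hg') g l q r (hp.trans h4)
  have hofApex : ∀ g, Inner v₁ v₂ g → ∃ c, RH.nx (some g) (γ g) = c ∧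
      RH.nx c (some g) = γ g ∧ RH.nx (γ g) c = some g := by
    intro g hg'
    obtain ⟨lo, hi, hp⟩ := hpath (γ g)
    obtain ⟨l, q, r, h4⟩ := List.exists_prev_of_mem (a := lo) (b := hi)
      (List.mem_append_left _ (hmid g hg'))
    exact hhi _ (hg.apex g hg') g l q r (hp.trans h4)
  obtain ⟨⟨a, b⟩, hd⟩ := d
  dsimp only
  rcases a with _ | x <;> rcases b with _ | y
  · exact absurd hd ((addGreen G v₁ v₂ γ).irrefl)
  · rcases (addGreen_adj_none y).1 hd.symm with rfl | rfl | ⟨hy, h4⟩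
    · exact ⟨_, h1, h2, h3⟩
    · obtain ⟨l, p, r, h4⟩ := List.exists_prev_of_mem (a := v₁) (b := y) (g := y) (l := I none)
        (by simp)
      exact hhi none hnone y l p r h4
    · rw [← h4]; exact hofApex y hy
  · rcases (addGreen_adj_none x).1 hd with rfl | rfl | ⟨hx, h4⟩
    · obtain ⟨l, q, r, h4⟩ := List.exists_next_of_mem (a := x) (b := v₂) (g := x) (l := I none)
        (by simp)
      exact hlo none hnone x l q r h4
    · exact ⟨_, h3, h1, h2⟩
    · rw [← h4]; exact htoApex x hx
  · rcases (hg.adj_some_some x y).1 hd with h4 | ⟨hx, h4⟩ | ⟨hy, h4⟩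
    · rcases h.up_or x y h4 with (⟨h5, rfl⟩ | ⟨h5, rfl⟩ | ⟨rfl, rfl⟩) | h5
      · obtain ⟨l, q, r, h6⟩ := List.exists_next_of_mem (a := red y) (b := blue y) (g := red y)
          (l := I (some y)) (by simp)
        exact hlo _ (hsome y h5) _ l q r h6
      · obtain ⟨l, p, r, h6⟩ := List.exists_prev_of_mem (a := red x) (b := blue x) (g := blue x)
          (l := I (some x)) (by simp)
        exact hhi _ (hsome x h5) _ l p r h6
      · exact ⟨_, h2, h3, h1⟩
      · obtain ⟨w, hw, l, r, h6⟩ := hcover y x h5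
        obtain ⟨h7, h8, h9⟩ := hC.triangle hk h hg hF hw h6
        exact ⟨w, h9, h7, h8⟩
    · rw [← h4]; exact htoApex x hx
    · rw [← h4]; exact hofApex y hy

theorem addGreen_connected (hg : Greens G v₁ v₂ red blue I γ t) (hconn : G.Connected) :
    (addGreen G v₁ v₂ γ).Connected := by
  have hsome : ∀ x, (addGreen G v₁ v₂ γ).Reachable (some v₁) (some x) := by
    intro x
    let f : G →g addGreen G v₁ v₂ γ := ⟨some, fun {a b} hab => (hg.adj_some_some a b).2 (Or.inl hab)⟩
    exact (hconn.preconnected v₁ x).map f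
  have hall : ∀ a, (addGreen G v₁ v₂ γ).Reachable (some v₁) a := by
    rintro (_ | x)
    · exact ((addGreen_adj_none v₁).2 (Or.inl rfl)).reachable
    · exact hsome x
  have : Nonempty (Option V) := ⟨none⟩
  exact SimpleGraph.Connected.mk fun a b => (hall a).symm.trans (hall b)

theorem IsCyc.nextIn_some {H : SimpleGraph (Option V)} {RH : RotationSystem H} {x a : V}
    {l : List V} (h : R.IsCyc x a l) {A : Set (Option V)}
    (h' : List.IsChain (RH.NextIn A (some x)) ((a :: l ++ [a]).map some)) {b : V} (hb : G.Adj x b) :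
    RH.NextIn A (some x) (some b) (some (R.nx x b)) :=
  h.chain.forall_next ((List.isChain_map some).1 h') b ((h.mem_iff b).2 hb)

/-- The embedding of `G` is inherited from that of the completed graph. -/
theorem Completion.nextIn (hC : Completion RH v₁ v₂ red blue I γ kR kB)
    (hk : Kids R v₁ v₂ red blue kR kB) (hg : Greens G v₁ v₂ red blue I γ t) {x b : V}
    (hb : G.Adj x b) : RH.NextIn {c | ∃ y, c = some y ∧ G.Adj x y} (some x) (some b)
      (some (R.nx x b)) := by
  have hmap : ∀ l : List V, (∀ c ∈ l, G.Adj x c) →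
      ∀ c ∈ l.map some, c ∈ {c | ∃ y, c = some y ∧ G.Adj x y} := by
    intro l hl c hc
    obtain ⟨y, hy, rfl⟩ := List.mem_map.1 hc
    exact ⟨y, rfl, hl y hy⟩
  have hnone : (none : Option V) ∉ {c | ∃ y, c = some y ∧ G.Adj x y} := by
    rintro ⟨y, h1, -⟩
    cases h1
  by_cases hx₁ : x = v₁
  · subst hx₁
    have hadj := hk.isCyc₁.mem_iff
    refine hk.isCyc₁.nextIn_some ?_ hb
    rw [List.map_append]
    exact isChain_nextIn_append hnone hC.isChain₁ (hmap (v₂ :: kR x) fun c hc => (hadj c).1 hc)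
      (hmap [v₂] fun c hc => (hadj c).1 (by simp [List.mem_singleton.1 hc]))
  by_cases hx₂ : x = v₂
  · subst hx₂
    have hadj := hk.isCyc₂.mem_iff
    refine hk.isCyc₂.nextIn_some ?_ hb
    obtain ⟨b', r, h1⟩ : ∃ b' r, kB x ++ [v₁] = b' :: r := List.exists_cons_of_ne_nil (by simp)
    have h2 := hC.isChain₂
    have h3 : ∀ c ∈ b' :: r, G.Adj x c := by
      rw [← h1]
      intro c hc
      refine (hadj c).1 ?_
      simp only [List.mem_append, List.mem_singleton] at hc
      rcases hc with hc | hc <;> simp [hc]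
    rw [h1] at h2
    rw [List.cons_append, h1]
    exact isChain_nextIn_append (l := []) hnone h2 (hmap [v₁] fun c hc => (hadj c).1
      (by simp [List.mem_singleton.1 hc])) (hmap (b' :: r) h3)
  · have hx : Inner v₁ v₂ x := ⟨hx₁, hx₂⟩
    have hax : Apex v₁ v₂ (some x) := fun y hy => Option.some.inj hy ▸ hx
    have hc := hk.isCyc x hx
    have hadj := hc.mem_iff
    refine hc.nextIn_some ?_ hb
    have h0 : (red x :: blue x :: (kR x ++ kB x) ++ [red x]).map some =
        some (red x) :: ((blue x :: kR x).map some ++ (kB x ++ [red x]).map some) := by simp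
    rw [h0, List.map_cons, List.cons_append, List.isChain_cons_cons]
    constructor
    · refine nextIn_of_isChain (l := (I (some x)).map some) ?_ ?_ ⟨_, rfl, (hadj _).1 (by simp)⟩
      · have h1 := (hC.isCyc x hx).chain
        have h2 : some (red x) :: ((I (some x)).map some ++ some (blue x) :: ((kR x).map some ++
            γ x :: (kB x).map some)) ++ [some (red x)] =
            (some (red x) :: ((I (some x)).map some ++ [some (blue x)])) ++ ((kR x).map some ++
            γ x :: (kB x).map some ++ [some (red x)]) := by simp
        rw [h2] at h1
        exact h1.left_of_append
      · intro c hc'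
        obtain ⟨g, hg', rfl⟩ := List.mem_map.1 hc'
        rintro ⟨y, h1, h2⟩
        obtain rfl := Option.some.inj h1
        have h3 := (hg.mem_iff _ hax _).1 hg'
        exact hg.not_adj _ _ h3.1 h3.2 h2.symm
    · obtain ⟨b', r, h1⟩ : ∃ b' r, kB x ++ [red x] = b' :: r :=
        List.exists_cons_of_ne_nil (by simp)
      have h2 := hC.isChain hx
      have h3 : ∀ c ∈ b' :: r, G.Adj x c := by
        rw [← h1]
        intro c hc
        refine (hadj c).1 ?_
        simp only [List.mem_append, List.mem_singleton] at hc
        rcases hc with hc | hc <;> simp [hc]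
      rw [h1] at h2 ⊢
      refine isChain_nextIn_append (g := γ x) ?_ h2 (hmap (blue x :: kR x) fun c hc => ?_)
        (hmap (b' :: r) h3)
      · rintro ⟨y, h4, h5⟩
        exact hg.not_adj x y hx h4 h5
      · refine (hadj c).1 ?_
        rcases List.mem_cons.1 hc with hc | hc <;> simp [hc]

end RotationSystem

namespace RotationSystem

variable {V : Type u} {G : SimpleGraph V} {R : RotationSystem G} {v₁ v₂ : V} {red blue : V → V}
  {I : Option V → List V} {γ : V → Option V} {t : V → ℕ} {kR kB : V → List V}

/-- The heads of the outgoing edges of the three colours at an inner vertex. -/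
def outHead (red blue : V → V) (γ : V → Option V) : Fin 3 → V → Option V :=
  ![fun x => some (red x), fun x => some (blue x), γ]

/-- The directed edges of the three colours in the completed graph. -/
def greenColoring (H : SimpleGraph (Option V)) (v₁ v₂ : V) (red blue : V → V) (γ : V → Option V)
    (c : Fin 3) : Set H.Dart :=
  {d | ∃ x, Inner v₁ v₂ x ∧ d.fst = some x ∧ d.snd = outHead red blue γ c x}

/-- The local rule is that of the prescribed lists, and the completed graph is maximally planar since it
is a connected triangulation with `3 n - 6` edges. -/
theorem Completion.isSchnyderRealizer [Finite V] {RH : RotationSystem (addGreen G v₁ v₂ γ)}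
    (hC : Completion RH v₁ v₂ red blue I γ kR kB)
    (hk : Kids R v₁ v₂ red blue kR kB) (h : Labeling R v₁ v₂ red blue)
    (hg : Greens G v₁ v₂ red blue I γ t) (hF : FacialPaths R v₁ v₂ red blue I)
    (hcover : ∀ p q, Up v₁ v₂ red blue p q → ∃ w, Apex v₁ v₂ w ∧
      ∃ l r, path v₁ v₂ red blue I w = l ++ p :: q :: r) (hconn : G.Connected) :
    IsSchnyderRealizer RH (some v₁) (some v₂) none
      (greenColoring (addGreen G v₁ v₂ γ) v₁ v₂ red blue γ) := by
  obtain ⟨hn1, hn2, hn3⟩ := hC.outer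
  have h₁₂ : (addGreen G v₁ v₂ γ).Adj (some v₁) (some v₂) :=
    (hg.adj_some_some _ _).2 (Or.inl h.base)
  have h₂ₙ : (addGreen G v₁ v₂ γ).Adj (some v₂) none := (addGreen_adj_none _).2 (Or.inr (Or.inl rfl))
  have h₁ₙ : (addGreen G v₁ v₂ γ).Adj (some v₁) none := (addGreen_adj_none _).2 (Or.inl rfl)
  have hadj : ∀ c x, Inner v₁ v₂ x → (addGreen G v₁ v₂ γ).Adj (some x) (outHead red blue γ c x) := by
    intro c x hx
    rw [← (hC.isCyc x hx).mem_iff]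
    fin_cases c <;> simp [outHead]
  have hinj : ∀ c c' x, Inner v₁ v₂ x → outHead red blue γ c x = outHead red blue γ c' x →
      c = c' := by
    intro c c' x hx
    have hnd := (hC.isCyc x hx).nodup
    have hrb : red x ≠ blue x := fun he => (List.nodup_cons.1 hnd).1 (by simp [he])
    have hrg : some (red x) ≠ γ x := fun he => (List.nodup_cons.1 hnd).1 (by simp [he])
    have hbg : some (blue x) ≠ γ x := fun he =>
      (List.nodup_cons.1 (List.Nodup.of_append_right (List.nodup_cons.1 hnd).2)).1 (by simp [he])
    fin_cases c <;> fin_cases c' <;>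
      simp [outHead, hrb, hrg, hbg, hrb.symm, hrg.symm, hbg.symm]
  -- red and blue edges decrease `t`, green edges increase it
  have htime : ∀ c x y, Inner v₁ v₂ x → outHead red blue γ c x = some y →
      (G.Adj x y ∧ t y < t x) ∨ (¬ G.Adj x y ∧ t x < t y) := by
    intro c x y hx hxy
    fin_cases c
    · obtain rfl := Option.some.inj hxy
      exact Or.inl ⟨h.adj_red x hx, hg.red_lt x hx⟩
    · obtain rfl := Option.some.inj hxy
      exact Or.inl ⟨h.adj_blue x hx, hg.blue_lt x hx⟩
    · exact Or.inr ⟨hg.not_adj x y hx hxy, hg.lt x y hx hxy⟩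
  have hanti : ∀ c c' x y, Inner v₁ v₂ x → Inner v₁ v₂ y → outHead red blue γ c x = some y →
      outHead red blue γ c' y ≠ some x := by
    intro c c' x y hx hy hxy hyx
    rcases htime c x y hx hxy with h1 | h1 <;> rcases htime c' y x hy hyx with h2 | h2
    · omega
    · exact h2.1 h1.1.symm
    · exact h1.1 h2.1.symm
    · omega
  have hinner : ∀ x z, Inner v₁ v₂ x → (addGreen G v₁ v₂ γ).Adj (some x) z →
      s(some x, z) ∈ innerEdges (addGreen G v₁ v₂ γ) (some v₁) (some v₂) none := by
    intro x z hx hz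
    refine ⟨hz, ?_⟩
    rintro (h1 | h1 | h1) <;> rcases Sym2.eq_iff.1 h1 with ⟨h2, -⟩ | ⟨h2, -⟩
    · exact hx.1 (Option.some.inj h2)
    · exact hx.2 (Option.some.inj h2)
    · exact hx.2 (Option.some.inj h2)
    · cases h2
    · cases h2
    · exact hx.1 (Option.some.inj h2)
  have hcol : ∀ a b, (addGreen G v₁ v₂ γ).Adj a b →
      s(a, b) ∈ innerEdges (addGreen G v₁ v₂ γ) (some v₁) (some v₂) none →
      ∃ c x, Inner v₁ v₂ x ∧ ((a = some x ∧ b = outHead red blue γ c x) ∨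
        (b = some x ∧ a = outHead red blue γ c x)) := by
    rintro (_ | x) (_ | y) hab ⟨-, hin⟩
    · exact absurd hab ((addGreen G v₁ v₂ γ).irrefl)
    · rcases (addGreen_adj_none y).1 hab.symm with rfl | rfl | ⟨hy, h1⟩
      · exact absurd (by simp) hin
      · exact absurd (by simp) hin
      · exact ⟨2, y, hy, Or.inr ⟨rfl, h1.symm⟩⟩
    · rcases (addGreen_adj_none x).1 hab with rfl | rfl | ⟨hx, h1⟩
      · exact absurd (by simp) hin
      · exact absurd (by simp) hin
      · exact ⟨2, x, hx, Or.inl ⟨rfl, h1.symm⟩⟩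
    · rcases (hg.adj_some_some x y).1 hab with h1 | ⟨hx, h1⟩ | ⟨hy, h1⟩
      · rcases h.up_or x y h1 with (⟨h2, rfl⟩ | ⟨h2, rfl⟩ | ⟨rfl, rfl⟩) |
          (⟨h2, rfl⟩ | ⟨h2, rfl⟩ | ⟨rfl, rfl⟩)
        · exact ⟨0, y, h2, Or.inr ⟨rfl, rfl⟩⟩
        · exact ⟨1, x, h2, Or.inl ⟨rfl, rfl⟩⟩
        · exact absurd (by simp) hin
        · exact ⟨0, x, h2, Or.inl ⟨rfl, rfl⟩⟩
        · exact ⟨1, y, h2, Or.inr ⟨rfl, rfl⟩⟩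
        · exact absurd (by simp) hin
      · exact ⟨2, x, hx, Or.inl ⟨rfl, h1.symm⟩⟩
      · exact ⟨2, y, hy, Or.inr ⟨rfl, h1.symm⟩⟩
  have horient : IsColoredOrientation
      (innerEdges (addGreen G v₁ v₂ γ) (some v₁) (some v₂) none)
      (greenColoring (addGreen G v₁ v₂ γ) v₁ v₂ red blue γ) := by
    constructor
    · rintro c ⟨⟨a, b⟩, hd⟩ ⟨x, hx, h1, -⟩
      have h1 : a = some x := h1
      subst h1
      exact hinner x b hx hd
    · intro e he
      induction e using Sym2.ind with
      | _ a b =>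
        have hab : (addGreen G v₁ v₂ γ).Adj a b := he.1
        obtain ⟨c, x, hx, h1⟩ := hcol a b hab he
        refine ⟨(c, ⟨(some x, outHead red blue γ c x), hadj c x hx⟩), ⟨?_, x, hx, rfl, rfl⟩, ?_⟩
        · rcases h1 with ⟨rfl, rfl⟩ | ⟨rfl, rfl⟩
          · rfl
          · exact Sym2.eq_swap
        · rintro ⟨c', ⟨⟨a', b'⟩, hd⟩⟩ ⟨h2, y, hy, h3, h4⟩
          obtain rfl : a' = some y := h3
          obtain rfl : b' = outHead red blue γ c' y := h4
          have h2 : s(some y, outHead red blue γ c' y) = s(some x, outHead red blue γ c x) := by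
            refine Eq.trans h2 ?_
            rcases h1 with ⟨rfl, rfl⟩ | ⟨rfl, rfl⟩
            · rfl
            · exact Sym2.eq_swap
          rcases Sym2.eq_iff.1 h2 with ⟨h5, h6⟩ | ⟨h5, h6⟩
          · obtain rfl := Option.some.inj h5
            obtain rfl := hinj c' c _ hx h6
            rfl
          · exact absurd h5.symm (hanti c' c y x hy hx h6)
  have hout : ∀ x, x ≠ some v₁ → x ≠ some v₂ → x ≠ none → ∀ c,
      ∃! d : (addGreen G v₁ v₂ γ).Dart, d.fst = x ∧
        d ∈ greenColoring (addGreen G v₁ v₂ γ) v₁ v₂ red blue γ c := by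
    rintro (_ | x) hx₁ hx₂ hx₃ c
    · exact absurd rfl hx₃
    · have hx : Inner v₁ v₂ x := ⟨fun he => hx₁ (congrArg some he), fun he => hx₂ (congrArg some he)⟩
      refine ⟨⟨(some x, outHead red blue γ c x), hadj c x hx⟩, ⟨rfl, x, hx, rfl, rfl⟩, ?_⟩
      rintro d ⟨h1, y, hy, h2, h3⟩
      obtain rfl := Option.some.inj (h1.symm.trans h2)
      exact SimpleGraph.Dart.ext _ _ (Prod.ext h1 h3)
  have hne₁ : ∀ {x}, Inner v₁ v₂ x → some x ≠ some v₁ := fun hx he => hx.1 (Option.some.inj he)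
  have hne₂ : ∀ {x}, Inner v₁ v₂ x → some x ≠ some v₂ := fun hx he => hx.2 (Option.some.inj he)
  have hcard := card_edges_of_orientation h₁₂ h₂ₙ h₁ₙ.symm horient hout (by
    rintro c d ⟨x, hx, h1, -⟩
    rw [h1]
    exact ⟨hne₁ hx, hne₂ hx, by simp⟩)
  have hdeg := exists_two_neighbours h₁₂ h₂ₙ h₁ₙ.symm horient hout
  have hplanar := isPlanar_of_triangles RH (addGreen_connected hg hconn) hdeg
    (hC.facePerm_pow_three hk h hg hF hcover) hcard
  have hhead : ∀ c (d : (addGreen G v₁ v₂ γ).Dart) z,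
      d.edge ∈ innerEdges (addGreen G v₁ v₂ γ) (some v₁) (some v₂) none → d.snd = z →
      (∀ x, z = some x → ¬ Inner v₁ v₂ x) →
      (∀ c' x, Inner v₁ v₂ x → outHead red blue γ c' x = z → c' = c) →
      d ∈ greenColoring (addGreen G v₁ v₂ γ) v₁ v₂ red blue γ c := by
    rintro c ⟨⟨a, b⟩, hd⟩ z hin hz hz' hc
    have hz : b = z := hz
    subst hz
    obtain ⟨c', x, hx, ⟨rfl, rfl⟩ | ⟨rfl, rfl⟩⟩ := hcol a b hd hin
    · obtain rfl := hc c' x hx rfl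
      exact ⟨x, hx, rfl, rfl⟩
    · exact absurd hx (hz' x rfl)
  have hγ₁ : ∀ y, Inner v₁ v₂ y → γ y ≠ some v₁ := fun y hy h => (hg.apex y hy v₁ h).1 rfl
  have hγ₂ : ∀ y, Inner v₁ v₂ y → γ y ≠ some v₂ := fun y hy h => (hg.apex y hy v₂ h).2 rfl
  refine ⟨isMaximallyPlanar_of_card RH hplanar hdeg hcard, hplanar,
    ⟨h₁₂, h₂ₙ, h₁ₙ.symm, ?_, ?_, ?_⟩, horient, hout, ?_, ?_, ?_, ?_⟩
  · rw [facePerm_mk]; exact SimpleGraph.Dart.ext _ _ (Prod.ext rfl hn2)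
  · rw [facePerm_mk]; exact SimpleGraph.Dart.ext _ _ (Prod.ext rfl hn3)
  · rw [facePerm_mk]; exact SimpleGraph.Dart.ext _ _ (Prod.ext rfl hn1)
  · rintro (_ | x) hx₁ hx₂ hx₃
    · exact absurd rfl hx₃
    · have hx : Inner v₁ v₂ x := ⟨fun he => hx₁ (congrArg some he), fun he => hx₂ (congrArg some he)⟩
      have hax : Apex v₁ v₂ (some x) := fun y hy => Option.some.inj hy ▸ hx
      have hcyc := hC.isCyc x hx
      have hin : ∀ c y, Inner v₁ v₂ y → outHead red blue γ c y = some x →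
          ∃ hy : (addGreen G v₁ v₂ γ).Adj (some x) (some y),
            (⟨(some x, some y), hy⟩ : (addGreen G v₁ v₂ γ).Dart) ∈
              incoming (greenColoring (addGreen G v₁ v₂ γ) v₁ v₂ red blue γ c) := by
        intro c y hy h1
        exact ⟨(h1 ▸ hadj c y hy).symm, y, hy, rfl, h1.symm⟩
      refine ⟨⟨(some x, some (red x)), hadj 0 x hx⟩, ⟨x, hx, rfl, rfl⟩, rfl, ?_⟩
      refine (hcyc.pattern_iff (m := 5) (hadj 0 x hx) _).2 ?_
      refine ⟨[some (red x)], _, rfl, ?_, (I (some x)).map some, _, rfl, ?_, [some (blue x)], _, rfl,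
        ?_, (kR x).map some, _, rfl, ?_, [γ x], _, rfl, ?_, (kB x).map some, [], by simp, ?_, rfl⟩
      · intro z hz
        obtain rfl := List.mem_singleton.1 hz
        exact ⟨hadj 0 x hx, x, hx, rfl, rfl⟩
      · intro z hz
        obtain ⟨y, hy, rfl⟩ := List.mem_map.1 hz
        have h1 := (hg.mem_iff _ hax y).1 hy
        exact hin 2 y h1.1 h1.2
      · intro z hz
        obtain rfl := List.mem_singleton.1 hz
        exact ⟨hadj 1 x hx, x, hx, rfl, rfl⟩
      · intro z hz
        obtain ⟨y, hy, rfl⟩ := List.mem_map.1 hz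
        have h1 := (hk.mem_kR x hx.2 y).1 hy
        exact hin 0 y h1.1 (congrArg some h1.2)
      · intro z hz
        obtain rfl := List.mem_singleton.1 hz
        exact ⟨hadj 2 x hx, x, hx, rfl, rfl⟩
      · intro z hz
        obtain ⟨y, hy, rfl⟩ := List.mem_map.1 hz
        have h1 := (hk.mem_kB x hx.1 y).1 hy
        exact hin 1 y h1.1 (congrArg some h1.2)
  · intro d hd hz
    refine hhead 0 d _ hd hz (fun x hx hx' => hne₁ hx' hx.symm) ?_
    intro c x hx h1
    fin_cases c
    · rfl
    · exact absurd (Option.some.inj h1) (h.blue_ne x hx)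
    · exact absurd h1 (hγ₁ x hx)
  · intro d hd hz
    refine hhead 1 d _ hd hz (fun x hx hx' => hne₂ hx' hx.symm) ?_
    intro c x hx h1
    fin_cases c
    · exact absurd (Option.some.inj h1) (h.red_ne x hx)
    · rfl
    · exact absurd h1 (hγ₂ x hx)
  · intro d hd hz
    refine hhead 2 d _ hd hz (by rintro x ⟨⟩) ?_
    intro c x hx h1
    fin_cases c
    · cases h1
    · cases h1
    · rfl

theorem _root_.IsEdgeLabeling.isSchnyderMinusGreen [Finite V] {S : Fin 2 → Set G.Dart}
    (hS : IsEdgeLabeling R v₁ v₂ S) (hR : R.IsPlanar) (hbase : G.Adj v₁ v₂) :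
    IsSchnyderMinusGreen R v₁ v₂ := by
  obtain ⟨red, blue, h, -, -⟩ := hS.exists_labeling hbase
  obtain ⟨hconn, huniq⟩ := h.isTurn_unique hR (hS.ncard_edgeSet hbase)
  obtain ⟨I, hF, hcover⟩ := h.exists_facialPaths huniq hconn
  obtain ⟨γ, t, hg⟩ := hF.exists_greens h.up_or
  obtain ⟨kR, kB, hk⟩ := h.exists_kids
  obtain ⟨RH, hC⟩ := hk.exists_completion hg hbase.ne
  refine ⟨addGreen G v₁ v₂ γ, RH, _, hC.isSchnyderRealizer hk h hg hF hcover hconn, ?_,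
    ⟨some, fun {a b} hab => (hg.adj_some_some a b).2 (Or.inl hab)⟩, fun x => rfl,
    (isInherited_some_iff fun x => rfl).2 fun x a hxa => hC.nextIn hk hg hxa⟩
  intro x y
  rw [hg.adj_some_some]
  constructor
  · intro hxy
    refine ⟨Or.inl hxy, ?_⟩
    rintro ⟨⟨a, b⟩, hd⟩ ⟨z, hz, h1, h2⟩ he
    have h1 : a = some z := h1
    have h2 : b = γ z := h2
    have he : s(a, b) = s(some x, some y) := he
    rw [h1, h2] at he
    rcases Sym2.eq_iff.1 he with ⟨h3, h4⟩ | ⟨h3, h4⟩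
    · obtain rfl := Option.some.inj h3
      exact hg.not_adj _ _ hz h4 hxy
    · obtain rfl := Option.some.inj h3
      exact hg.not_adj _ _ hz h4 hxy.symm
  · rintro ⟨h1 | ⟨h1, h2⟩ | ⟨h1, h2⟩, h3⟩
    · exact h1
    · exact absurd rfl (h3 ⟨(some x, some y), (hg.adj_some_some x y).2 (Or.inr (Or.inl ⟨h1, h2⟩))⟩
        ⟨x, h1, rfl, h2.symm⟩)
    · exact absurd Sym2.eq_swap
        (h3 ⟨(some y, some x), (hg.adj_some_some y x).2 (Or.inr (Or.inl ⟨h1, h2⟩))⟩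
        ⟨y, h1, rfl, h2.symm⟩)

end RotationSystem

theorem mainTheorem2 {V : Type u} [Finite V] (G : SimpleGraph V) (R : RotationSystem G)
    (hR : R.IsPlanar) (v₁ v₂ : V) (h₁₂ : G.Adj v₁ v₂) :
    List.TFAE [
      IsMaximalLGraph G ∧ ∃ L : V → LShape,
        IsLRepresentation G L ∧ HasBaseEdge L v₁ v₂ ∧ DefinesEmbedding L R,
      IsSchnyderMinusGreen R v₁ v₂,
      ∃ S : Fin 2 → Set G.Dart, IsEdgeLabeling R v₁ v₂ S,
      ∃ ord : V ≃ Fin (Nat.card V), IsTwoCanonicalOrder R v₁ v₂ ord] := by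
  have : Nontrivial V := ⟨v₁, v₂, h₁₂.ne⟩
  tfae_have 1 → 3 := by
    rintro ⟨hmax, L, hL, hbase, hemb⟩
    exact hL.exists_isEdgeLabeling hbase hemb h₁₂ (isMaximalLGraph_iff.1 hmax).2
  tfae_have 3 → 2 := by
    rintro ⟨S, hS⟩
    exact hS.isSchnyderMinusGreen hR h₁₂
  tfae_have 2 → 4 := by
    intro h
    obtain ⟨red, blue, I, hF⟩ := h.exists_facialPaths
    obtain ⟨o, P, hB, ho⟩ := hF.exists_build
    exact hB.exists_isTwoCanonicalOrder h₁₂ ho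
  tfae_have 4 → 1 := by
    rintro ⟨ord, h⟩
    obtain ⟨o, P, hB, ho⟩ := RotationSystem.Build.of_isTwoCanonicalOrder h₁₂ h
    exact ⟨hB.isMaximalLGraph h₁₂ ho, hB.exists_isLRepresentation h₁₂ ho⟩
  tfae_finish
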